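/- Let $r\ge 0$ be an integer, $\tau_0\in\mathbb R$, $\rho_0=e^{-\tau_0}>0$, and put $p(t;x,y)=\frac{1}{\sqrt{\pi t}}e^{-(y-x)^2/t}$. For $n\ge r$ consider $n$ non-intersecting Brownian motions $x_1(t)<\dots<x_n(t)$ on $\mathbb R$, $0<t<1$, with transition density $p$, all starting from $0$ at time $0$, the $r$ right paths being forced to end at $a=\rho_0\sqrt{n/2}$ and the $n-r$ other paths at $0$ at time $1$. That is, the law $\mathbb P_{Br}^{(0,a)}$ of $(x_1(t),\dots,x_n(t))$ on $\{x_1<\dots<x_n\}$ is the limit, as $\gamma\to(0,\dots,0)$ and $\delta\to(0,\dots,0,a,\dots,a)$ ($r$ entries $a$) with $\gamma_1<\dots<\gamma_n$, $\delta_1<\dots<\delta_n$, of the probability measures with density $$\frac1{Z_n(\gamma,\delta)}\det\big(p(t;\gamma_i,x_j)\big)_{i,j\le n}\det\big(p(1-t;x_i,\delta_j)\big)_{i,j\le n}\quad\text{on }\{x_1<\dots<x_n\}.$$ Let $C$ be a contour from $\infty e^{5i\pi/6}$ to $\infty e^{i\pi/6}$ such that $-i\tau$ lies above it, and define $$A_r^{\pm}(u;\tau)=\int_C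 e^{\frac13 ia^3+iau}(\mp ia-\tau)^{\pm r}\frac{da}{2\pi},\qquad A(u)=A_0^\pm(u;\tau),$$ $$K^{(0)}(u,v)=\int_0^\infty A(w+u)A(w+v)\,dw,\qquad K^{(r)}_\tau(u,v)=\int_0^\infty A_r^-(w+u;\tau)A_r^+(w+v;\tau)\,dw,$$ and let $\det(I-K)_E=\sum_{k\ge0}\frac{(-1)^k}{k!}\int_{E^k}\det\big(K(u_i,u_j)\big)_{i,j\le k}\,du$ denote the Fredholm determinant. Then the following hold. 1. The limit law above exists and is unique for all $n\ge r$ and $0<t<1$ (the convergence holds on every Borel set). 2. For every $0<t<1$, the mean empirical measures $\mathbb E\,\frac1n\sum_{j}\delta_{x_j(t)/\sqrt n}$ converge weakly, as $n\to\infty$, to a probability measure with support $[-\sqrt{2t(1-t)},\sqrt{2t(1-t)}]$; thus for large $n$ the support of the mean density of particles is bounded to the right by the curve $\mathcal C:\ y=\sqrt{2nt(1-t)}$. For $n\ge1$, among all $0<t<1$, the tangent line to $\mathcal C$ at time $t$ passes through the point $y=\rho_0\sqrt{n/2}$ at time $1$ exactly when $t=t_0$, and the point of tangency is $$(y_0,t_0)=\Big(\frac{\rho_0\sqrt{2n}}{1+\rho_0^2},\frac1{1+\rho_0^2}\Big),\qquad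 t_0=\frac1{1+e^{-2\tau_0}}.$$ 3. Let $\sigma,\tau\in\mathbb R$ (so that $t=(1+e^{-2\sigma})^{-1}$ is an arbitrary time in $(0,1)$, with $t<t_0$ if and only if $\sigma<\tau_0$), and let $E\subset\mathbb R$ be a Borel set that is bounded below. If $\sigma\le\tau_0$, then $$\lim_{n\to\infty}\mathbb P_{Br}^{(0,\rho_0\sqrt{n/2})}\left(\text{all } x_i\Big(\frac1{1+e^{-2(\sigma+\tau n^{-1/3})}}\Big)\in\frac{\sqrt{2n}+\frac{E^c}{\sqrt2\,n^{1/6}}}{2\cosh(\sigma+\tau n^{-1/3})}\right)=\begin{cases}\det\big(I-K^{(0)}\big)_E,&\sigma<\tau_0\ (\text{i.e. }0<t<t_0),\\[2pt]\det\big(I-K^{(r)}_\tau\big)_E,&\sigma=\tau_0\ (\text{i.e. }t=t_0),\end{cases}$$ where the Fredholm series on the right converge absolutely. The limit for $\sigma<\tau_0$ is $\mathbb P(\mathcal A(\tau)\cap E=\emptyset)$ for the Airy process $\mathcal A$ and does not depend on $\tau$ and $r$; the limit for $\sigma=\tau_0$ is, by definition, $\mathbb P(\mathcal A^{(r)}(\tau)\cap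 E=\emptyset)$ for the $r$-Airy process $\mathcal A^{(r)}$. 4. These Fredholm determinants are genuine probability distributions: $x\mapsto\det(I-K^{(0)})_{(x,\infty)}$ and, for each $\tau\in\mathbb R$, $x\mapsto\det(I-K^{(r)}_\tau)_{(x,\infty)}$ are distribution functions of probability measures on $\mathbb R$ (and the Fredholm series converge absolutely). -/

import Mathlib

open MeasureTheory Filter Topology

/-! ### Non-intersecting Brownian bridges -/

/-- The Brownian transition density `p(t; x, y) = (π t)^{-1/2} exp (-(y - x)² / t)`. -/
noncomputable def brownianKernel (t x y : ℝ) : ℝ :=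
  1 / Real.sqrt (Real.pi * t) * Real.exp (-(y - x) ^ 2 / t)

/-- The Weyl chamber `x₁ < x₂ < ⋯ < xₙ` of ordered configurations. -/
def weylChamber (n : ℕ) : Set (Fin n → ℝ) := {x | StrictMono x}

/-- The unnormalized joint density at time `t ∈ (0, 1)` of the positions of `n` Brownian particles
that start at `γ₁ < ⋯ < γₙ` at time `0`, arrive at `δ₁ < ⋯ < δₙ` at time `1` and do not intersect
in between: the product of the non-intersecting transition densities
`det p(t; γᵢ, xⱼ)` and `det p(1 - t; xᵢ, δⱼ)`. -/
noncomputable def bridgeDensity {n : ℕ} (t : ℝ) (γ δ x : Fin n → ℝ) : ℝ :=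
  (Matrix.of fun i j => brownianKernel t (γ i) (x j)).det *
    (Matrix.of fun i j => brownianKernel (1 - t) (x i) (δ j)).det

/-- The corresponding unnormalized measure, carried by the Weyl chamber. -/
noncomputable def bridgeMeasure {n : ℕ} (t : ℝ) (γ δ : Fin n → ℝ) : Measure (Fin n → ℝ) :=
  (volume.restrict (weylChamber n)).withDensity fun x => ENNReal.ofReal (bridgeDensity t γ δ x)

/-- The law at time `t` of the ordered positions of `n` non-intersecting Brownian bridges
from `γ` to `δ` (distinct starting points, distinct end points). -/
noncomputable def bridgeLaw {n : ℕ} (t : ℝ) (γ δ : Fin n → ℝ) : Measure (Fin n → ℝ) :=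
  (bridgeMeasure t γ δ Set.univ)⁻¹ • bridgeMeasure t γ δ

/-- The end points: the `n - r` left paths return to `0`, the `r` right paths end at `a`. -/
def outlierTarget (n r : ℕ) (a : ℝ) : Fin n → ℝ := fun j => if (j : ℕ) + r < n then 0 else a

/-- The confluent limit: the starting points tend to `0` and the end points tend to the
prescribed targets, both inside the Weyl chamber. -/
def confluentLimit (n r : ℕ) (a : ℝ) : Filter ((Fin n → ℝ) × (Fin n → ℝ)) :=
  𝓝[weylChamber n] 0 ×ˢ 𝓝[weylChamber n] (outlierTarget n r a)

/-- `μ` is the law at time `t` of the ordered positions `x₁(t) < ⋯ < xₙ(t)` of `n` non-intersecting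
Brownian motions that all start from `0` at time `0`, the `r` right paths ending at `a` and the
other `n - r` paths ending at `0` at time `1`. -/
structure IsOutlierBridgeLaw (n r : ℕ) (a t : ℝ) (μ : Measure (Fin n → ℝ)) : Prop where
  isProbabilityMeasure : IsProbabilityMeasure μ
  tendsto : ∀ S : Set (Fin n → ℝ), MeasurableSet S →
    Tendsto (fun q : (Fin n → ℝ) × (Fin n → ℝ) => bridgeLaw t q.1 q.2 S)
      (confluentLimit n r a) (𝓝 (μ S))

/-- The edge curve `y = √(2 n t (1 - t))`. -/
noncomputable def edgeCurve (n : ℕ) (t : ℝ) : ℝ := Real.sqrt (2 * n * t * (1 - t))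

/-- The clock change `σ ↦ t = 1 / (1 + e^{-2σ})`, a bijection of `ℝ` onto `(0, 1)`. -/
noncomputable def clock (σ : ℝ) : ℝ := 1 / (1 + Real.exp (-2 * σ))

/-- The set `(√(2n) + F / (√2 n^{1/6})) / (2 cosh s)`. -/
noncomputable def edgeWindow (n : ℕ) (s : ℝ) (F : Set ℝ) : Set ℝ :=
  (fun ξ : ℝ => (Real.sqrt (2 * n) + ξ / (Real.sqrt 2 * (n : ℝ) ^ (1 / 6 : ℝ))) /
    (2 * Real.cosh s)) '' F

/-! ### The Airy kernel and the `r`-Airy kernels -/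

/-- The integral of `f` along the contour that comes in from `∞ e^{5iπ/6}` along a ray to the vertex
`-i(τ + 1)` and goes out along a ray to `∞ e^{iπ/6}`; the point `-iτ` lies above it. -/
noncomputable def airyContourIntegral (τ : ℝ) (f : ℂ → ℂ) : ℂ :=
  (∫ s in Set.Ioi (0 : ℝ),
      f (-(Complex.I * (τ + 1)) + s * Complex.exp (Complex.I * Real.pi / 6)) *
        Complex.exp (Complex.I * Real.pi / 6)) -
    ∫ s in Set.Ioi (0 : ℝ),
      f (-(Complex.I * (τ + 1)) + s * Complex.exp (5 * Complex.I * Real.pi / 6)) *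
        Complex.exp (5 * Complex.I * Real.pi / 6)

/-- `A_r^+(u; τ) = ∫_C e^{i a³/3 + i a u} (-i a - τ)^r da / 2π`. -/
noncomputable def airyPlus (r : ℕ) (τ u : ℝ) : ℂ :=
  airyContourIntegral τ (fun a =>
    Complex.exp (Complex.I * a ^ 3 / 3 + Complex.I * a * u) * (-(Complex.I * a) - τ) ^ r) /
      (2 * Real.pi)

/-- `A_r^-(u; τ) = ∫_C e^{i a³/3 + i a u} (i a - τ)^{-r} da / 2π`. -/
noncomputable def airyMinus (r : ℕ) (τ u : ℝ) : ℂ :=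
  airyContourIntegral τ (fun a =>
    Complex.exp (Complex.I * a ^ 3 / 3 + Complex.I * a * u) * ((Complex.I * a - τ) ^ r)⁻¹) /
      (2 * Real.pi)

/-- The Airy function `A(u) = ∫_C e^{i a³/3 + i a u} da / 2π`. -/
noncomputable def airyFun (u : ℝ) : ℂ :=
  airyContourIntegral 0 (fun a => Complex.exp (Complex.I * a ^ 3 / 3 + Complex.I * a * u)) /
    (2 * Real.pi)

/-- The Airy kernel `K^{(0)}(u, v) = ∫₀^∞ A(w + u) A(w + v) dw`. -/
noncomputable def airyKernel (u v : ℝ) : ℂ :=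
  ∫ w in Set.Ioi (0 : ℝ), airyFun (w + u) * airyFun (w + v)

/-- The `r`-Airy kernel `K^{(r)}_τ(u, v) = ∫₀^∞ A_r^-(w + u; τ) A_r^+(w + v; τ) dw`. -/
noncomputable def rAiryKernel (r : ℕ) (τ u v : ℝ) : ℂ :=
  ∫ w in Set.Ioi (0 : ℝ), airyMinus r τ (w + u) * airyPlus r τ (w + v)

/-- `d` is the Fredholm determinant `det (I - K)_E`, that is, all the terms of the Fredholm series
`∑ₖ (-1)ᵏ / k! ∫_{Eᵏ} det (K(uᵢ, uⱼ))_{i,j ≤ k} du` converge absolutely and its sum is `d`. -/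
structure HasFredholmDet (K : ℝ → ℝ → ℂ) (E : Set ℝ) (d : ℂ) : Prop where
  integrableOn : ∀ k : ℕ, IntegrableOn
    (fun u : Fin k → ℝ => (Matrix.of fun i j => K (u i) (u j)).det) (Set.univ.pi fun _ => E)
  hasSum : HasSum (fun k : ℕ => (-1 : ℂ) ^ k / (k.factorial : ℂ) *
    ∫ u in Set.univ.pi (fun _ : Fin k => E), (Matrix.of fun i j => K (u i) (u j)).det) d

open Complex (I norm_real ofReal_re norm_exp norm_I exp_ne_zero re_ofReal_mul re_le_norm real_smul
  norm_exp_ofReal_mul_I I_sq I_mul_I continuous_re)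
open Real (exp_add norm_eq_abs exp_pos exp_le_exp norm_of_nonneg exp_nat_mul sq_sqrt pi_pos
  add_one_le_exp sqrt_nonneg sqrt_pos abs_exp two_pi_pos continuous_exp)
open Finset (sum_congr mem_univ mul_sum prod_congr sum_le_sum prod_mul_distrib prod_const prod_pos
  sum_range_succ sum_neg_distrib prod_le_prod)
open Matrix (of of_apply vandermonde det_mul_column det_vandermonde det_mul det_mul_row)
open Polynomial (eval_C eval_mul eval_X eval_pow eval_add)
open Function (Injective comp_def comp_apply)
open Metric (ball mem_ball sphere)
open Set (Ioi Icc univ indicator_of_notMem indicator_of_mem Ioo Ici Ioc Iic indicator_nonneg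
  Ioo_subset_Icc_self)
open scoped Real Complex

variable {n : ℕ}

/-! Completing squares in the two transition determinants shows that, up to a constant, the bridge
density at time `t` is a product of two determinants `det (exp (b j * x i))` and a Gaussian weight.
Dividing each by the Vandermonde determinant of its parameters leaves `confluentDet`, which is
continuous and positive even when parameters coincide. The Vandermonde factors only affect the
normalization, so the confluent limit is the value of a continuous family of laws `ensembleLaw`.
After scaling by `√(t (1 - t))` the parameters ("sources") at clock time `s` are `n - r` zeros and
`r` copies of `√(2n) e^{s - τ₀}`.

This is a biorthogonal ensemble: `exp (b j x - b j² / 4)` is dual to a Gaussian times the transform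
of a Lagrange basis polynomial. Andréief's identity makes `E ∏ (1 + f (x i))` an `n × n`
determinant, hence gap probabilities finite-rank Fredholm determinants. Let P be the polynomial with
roots at the sources. The kernel equals `∫₀^∞ Φ(x + l) Ψ(y + l) dl`, where Φ is a sum of residues of
`e^{wx - w²/4} / P(w)` and Ψ is a vertical line integral of `P(w) e^{w²/4 - wy}`
(`sum_leftFun_mul_rightFun`). The limit kernels have the same form, so only Φ and Ψ need
asymptotics.

At `x = N = √(2n)` the exponent `wx - w²/4 - n log w` has a double critical point at `w = N`. With
`w = N (1 + ε ω)` and `n ε³ = 1` it becomes `-ω³/3`. The outliers sit at `ω = (e^{s - τ₀} - 1) / ε`.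
If `σ < τ₀` they lie well inside the circle around the bulk sources and leave no trace. If `σ = τ₀`
they converge to `τ`, stay outside that circle, and contribute the factors `(ω - τ)^{∓r}` and a
residue circle. Uniform bounds on the contours, together with Hadamard's inequality, carry the
pointwise limits over to the Fredholm series (`tendsto_gap_of_parts`, `tendsto_gap_critical`,
`tendsto_gap_subcritical`).

For the limits to be distribution functions, the only serious point is that they vanish at `-∞`. For
the Hermite ensemble (no outliers) positivity gives P(gap) ≤ exp(-mean number of particles), and the
diagonal of the Airy kernel stays bounded below to the left, so the Airy limit decays exponentially.
Outliers are handled by an interlacing coupling: removing a source lowers the largest particle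
(`ensembleLaw_max_le_succ`).

The mean empirical measure comes from an exact contour formula for `E ∑ e^{ξ x j}`. On the scale
`√n` its limit does not see the finitely many outliers and is the characteristic function of a
semicircle law. -/

/-- No particle lies in the window `α + γ E`. -/
abbrev gapEvent (α γ : ℝ) (E : Set ℝ) : Set (Fin n → ℝ) :=
  {x | ∀ j, x j ∈ (fun ξ : ℝ => α + γ * ξ) '' Eᶜ}

/-! ### Integrating determinants row by row -/

/-- Row `i` depends on the variable `u i` alone, so each term of the Leibniz expansion is a product
of functions of separate variables and Fubini applies. -/
theorem det_integral_eq {𝕜 α : Type*} [RCLike 𝕜] {mα : MeasurableSpace α} {n : ℕ} (μ : Measure α)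
    [SigmaFinite μ] (f : Fin n → Fin n → α → 𝕜) (hf : ∀ i j, Integrable (f i j) μ) :
    Integrable (fun u : Fin n → α => (of fun i j => f i j (u i)).det) (Measure.pi fun _ => μ) ∧
      ∫ u, (of fun i j => f i j (u i)).det ∂(Measure.pi fun _ : Fin n => μ) =
        (of fun i j => ∫ x, f i j x ∂μ).det := by
  have h1 : ∀ σ : Equiv.Perm (Fin n),
      Integrable (fun u : Fin n → α => ∏ i, f (σ i) i (u (σ i))) (Measure.pi fun _ => μ) ∧
      ∫ u, ∏ i, f (σ i) i (u (σ i)) ∂(Measure.pi fun _ : Fin n => μ) = ∏ i, ∫ x, f (σ i) i x ∂μ := by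
    intro σ
    have e : ∀ u : Fin n → α, ∏ i, f (σ i) i (u (σ i)) = ∏ i, f i (σ.symm i) (u i) := fun u => by
      rw [← Equiv.prod_comp σ (fun i => f i (σ.symm i) (u i))]; simp
    have e' : ∏ i, ∫ x, f (σ i) i x ∂μ = ∏ i, ∫ x, f i (σ.symm i) x ∂μ := by
      rw [← Equiv.prod_comp σ (fun i => ∫ x, f i (σ.symm i) x ∂μ)]; simp
    simp_rw [e, e']
    exact ⟨Integrable.fintype_prod (f := fun i => f i (σ.symm i)) fun i => hf _ _,
      integral_fintype_prod_eq_prod (fun i => f i (σ.symm i))⟩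
  have h2 : ∀ σ : Equiv.Perm (Fin n), Integrable (fun u : Fin n → α =>
      ((Equiv.Perm.sign σ : ℤ) : 𝕜) * ∏ i, f (σ i) i (u (σ i))) (Measure.pi fun _ => μ) :=
    fun σ => (h1 σ).1.const_mul _
  simp only [Matrix.det_apply', of_apply]
  constructor
  · exact integrable_finsetSum _ fun σ _ => h2 σ
  · rw [integral_finsetSum _ fun σ _ => h2 σ]
    refine sum_congr rfl fun σ _ => ?_
    rw [← (h1 σ).2, integral_const_mul]

/-! ### Determinants of exponentials with coalescing parameters -/

/-- The point of the interlacing box of `x` with relative coordinates `u`. -/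
def interlace (x : Fin (n + 1) → ℝ) (u : Fin n → ℝ) : Fin n → ℝ :=
  fun i => x i.castSucc + u i * (x i.succ - x i.castSucc)

/-- The quotient of `det (exp (b j * x i))` by the Vandermonde determinant of `b`, extended to all
`b` through an integral over interlacing configurations. -/
noncomputable def confluentDet : (n : ℕ) → (Fin n → ℝ) → (Fin n → ℝ) → ℝ
  | 0, _, _ => 1
  | n + 1, b, x => (∏ i : Fin n, (x i.succ - x i.castSucc)) *
      ∫ u in Icc (0 : Fin n → ℝ) 1, confluentDet n (fun i => b i.castSucc) (interlace x u) *
        rexp (b (Fin.last n) * (∑ i, x i - ∑ i, interlace x u i))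

theorem continuous_interlace : Continuous fun p : (Fin (n + 1) → ℝ) × (Fin n → ℝ) => interlace p.1 p.2 := by
  unfold interlace
  fun_prop

theorem continuous_confluentDet (n : ℕ) : Continuous fun p : (Fin n → ℝ) × (Fin n → ℝ) => confluentDet n p.1 p.2 := by
  induction n with
  | zero => exact continuous_const
  | succ n ih =>
    simp only [confluentDet]
    refine Continuous.mul (by fun_prop) ?_
    refine continuous_parametric_integral_of_continuous
      (f := fun (p : (Fin (n + 1) → ℝ) × (Fin (n + 1) → ℝ)) (u : Fin n → ℝ) =>
        confluentDet n (fun i => p.1 i.castSucc) (interlace p.2 u) *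
        rexp (p.1 (Fin.last n) * (∑ i, p.2 i - ∑ i, interlace p.2 u i))) ?_ isCompact_Icc
    have h1 : Continuous fun q : ((Fin (n + 1) → ℝ) × (Fin (n + 1) → ℝ)) × (Fin n → ℝ) =>
        interlace q.1.2 q.2 := continuous_interlace.comp (by fun_prop : Continuous fun
        q : ((Fin (n + 1) → ℝ) × (Fin (n + 1) → ℝ)) × (Fin n → ℝ) => (q.1.2, q.2))
    have h2 : Continuous fun q : ((Fin (n + 1) → ℝ) × (Fin (n + 1) → ℝ)) × (Fin n → ℝ) =>
        ((fun i : Fin n => q.1.1 i.castSucc), interlace q.1.2 q.2) := by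
      refine Continuous.prodMk (by fun_prop) h1
    have h3 := ih.comp h2
    have h4 : ∀ i, Continuous fun q : ((Fin (n + 1) → ℝ) × (Fin (n + 1) → ℝ)) × (Fin n → ℝ) =>
        interlace q.1.2 q.2 i := fun i => (continuous_apply i).comp h1
    refine h3.mul (continuous_exp.comp ?_)
    refine Continuous.mul (by fun_prop) (Continuous.sub (by fun_prop) ?_)
    exact continuous_finsetSum _ fun i _ => h4 i

theorem continuous_confluentDet_right (b : Fin n → ℝ) : Continuous (confluentDet n b) :=
  (continuous_confluentDet n).comp (by fun_prop : Continuous fun x : Fin n → ℝ => (b, x))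

theorem continuous_confluentDet_left (x : Fin n → ℝ) : Continuous fun b => confluentDet n b x :=
  (continuous_confluentDet n).comp (by fun_prop : Continuous fun b : Fin n → ℝ => (b, x))

theorem continuous_confluentDet_integrand (b x : Fin (n + 1) → ℝ) :
    Continuous fun u : Fin n → ℝ => confluentDet n (fun i => b i.castSucc) (interlace x u) *
        rexp (b (Fin.last n) * (∑ i, x i - ∑ i, interlace x u i)) := by
  have h1 : Continuous fun u : Fin n → ℝ => interlace x u :=
    continuous_interlace.comp (by fun_prop : Continuous fun u : Fin n → ℝ => (x, u))
  have h4 : ∀ i, Continuous fun u : Fin n → ℝ => interlace x u i := fun i => (continuous_apply i).comp h1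
  refine ((continuous_confluentDet_right _).comp h1).mul (continuous_exp.comp ?_)
  exact continuous_const.mul (continuous_const.sub (continuous_finsetSum _ fun i _ => h4 i))

theorem norm_interlace_le (x : Fin (n + 1) → ℝ) {u : Fin n → ℝ}
    (hu : u ∈ Icc (0 : Fin n → ℝ) 1) : ‖interlace x u‖ ≤ ‖x‖ := by
  refine (pi_norm_le_iff_of_nonneg (norm_nonneg _)).2 fun i => ?_
  have h0 : 0 ≤ u i := hu.1 i
  have h1 : u i ≤ 1 := hu.2 i
  have ha := norm_le_pi_norm x i.castSucc
  have hb := norm_le_pi_norm x i.succ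
  rw [norm_eq_abs, abs_le] at *
  unfold interlace
  constructor <;> nlinarith

/-- Growth at most exponential in `‖x‖`, uniformly for bounded `b`, is what a Gaussian weight can
absorb; this feeds the dominated convergence in the parameters. -/
theorem exists_confluentDet_bound (n : ℕ) : ∃ C : ℝ, 0 ≤ C ∧ ∀ b x : Fin n → ℝ,
    |confluentDet n b x| ≤ rexp (C * (1 + ‖b‖) * ‖x‖) := by
  induction n with
  | zero => exact ⟨0, le_rfl, fun b x => by simp [confluentDet]⟩
  | succ n ih =>
    obtain ⟨C, hC, h⟩ := ih
    refine ⟨2 * n + C + (2 * n + 1), by positivity, fun b x => ?_⟩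
    have hx := norm_nonneg x
    have hb := norm_nonneg b
    have hprod : |∏ i : Fin n, (x i.succ - x i.castSucc)| ≤ rexp (2 * n * ‖x‖) := by
      rw [Finset.abs_prod]
      calc _ ≤ ∏ i : Fin n, rexp (2 * ‖x‖) := by
            refine prod_le_prod (fun _ _ => abs_nonneg _) fun i _ => ?_
            have h1 := norm_le_pi_norm x i.succ
            have h2 := norm_le_pi_norm x i.castSucc
            rw [norm_eq_abs] at h1 h2
            have := abs_sub (x i.succ) (x i.castSucc)
            have := add_one_le_exp (2 * ‖x‖)
            linarith
        _ = _ := by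
            rw [prod_const, ← exp_nat_mul]; simp; ring_nf
    have hint : |∫ u in Icc (0 : Fin n → ℝ) 1, confluentDet n (fun i => b i.castSucc) (interlace x u) *
        rexp (b (Fin.last n) * (∑ i, x i - ∑ i, interlace x u i))| ≤
        rexp (C * (1 + ‖b‖) * ‖x‖ + ‖b‖ * ((2 * n + 1) * ‖x‖)) := by
      have := norm_setIntegral_le_of_norm_le_const (μ := volume) (s := Icc (0 : Fin n → ℝ) 1)
        (f := fun u => confluentDet n (fun i => b i.castSucc) (interlace x u) *
        rexp (b (Fin.last n) * (∑ i, x i - ∑ i, interlace x u i)))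
        (C := rexp (C * (1 + ‖b‖) * ‖x‖ + ‖b‖ * ((2 * n + 1) * ‖x‖)))
        isCompact_Icc.measure_lt_top ?_
      · have hv : volume.real (Icc (0 : Fin n → ℝ) 1) = 1 := by
          simp [Measure.real, Real.volume_Icc_pi]
        rw [hv, mul_one] at this
        exact this
      · intro u hu
        rw [norm_mul, exp_add]
        have hnx := norm_interlace_le x hu
        have hnb : ‖fun i : Fin n => b i.castSucc‖ ≤ ‖b‖ :=
          (pi_norm_le_iff_of_nonneg hb).2 fun i => norm_le_pi_norm b i.castSucc
        refine mul_le_mul ?_ ?_ (norm_nonneg _) (exp_pos _).le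
        · refine (h _ _).trans (exp_le_exp.2 ?_)
          gcongr
        · rw [norm_eq_abs, abs_exp, exp_le_exp]
          refine (le_abs_self _).trans ?_
          rw [abs_mul]
          refine mul_le_mul (norm_le_pi_norm b _) ?_ (abs_nonneg _) hb
          have e1 : |∑ i, x i| ≤ (n + 1) * ‖x‖ := by
            refine (Finset.abs_sum_le_sum_abs _ _).trans ?_
            refine (sum_le_sum fun i _ => norm_le_pi_norm x i).trans ?_
            simp
          have e2 : |∑ i, interlace x u i| ≤ n * ‖x‖ := by
            refine (Finset.abs_sum_le_sum_abs _ _).trans ?_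
            refine (sum_le_sum fun i _ => (norm_le_pi_norm (interlace x u) i).trans hnx).trans ?_
            simp
          have := abs_sub (∑ i, x i) (∑ i, interlace x u i)
          linarith
    rw [confluentDet, abs_mul]
    refine (mul_le_mul hprod hint (abs_nonneg _) (exp_pos _).le).trans ?_
    rw [← exp_add, exp_le_exp]
    have h3 : 0 ≤ ‖x‖ * n := by positivity
    have h4 : 0 ≤ ‖b‖ * (‖x‖ * n) := by positivity
    have h5 : 0 ≤ ‖b‖ * ‖x‖ := by positivity
    nlinarith

theorem interlace_mem_Icc {x : Fin (n + 1) → ℝ} (hx : Monotone x) {u : Fin n → ℝ}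
    (hu : u ∈ Icc (0 : Fin n → ℝ) 1) (i : Fin n) :
    interlace x u i ∈ Icc (x i.castSucc) (x i.succ) := by
  have h0 : 0 ≤ u i := hu.1 i
  have h1 : u i ≤ 1 := hu.2 i
  have h : x i.castSucc ≤ x i.succ := hx i.castSucc_lt_succ.le
  unfold interlace
  constructor <;> nlinarith

theorem monotone_interlace {x : Fin (n + 1) → ℝ} (hx : Monotone x) {u : Fin n → ℝ}
    (hu : u ∈ Icc (0 : Fin n → ℝ) 1) : Monotone (interlace x u) := by
  intro i j hij
  rcases hij.eq_or_lt with rfl | hij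
  · exact le_rfl
  · exact (interlace_mem_Icc hx hu i).2.trans
      ((hx (Fin.succ_le_castSucc_iff.2 hij)).trans (interlace_mem_Icc hx hu j).1)

theorem strictMono_interlace {x : Fin (n + 1) → ℝ} (hx : StrictMono x) {u : Fin n → ℝ}
    (hu : ∀ i, u i ∈ Ioo (0 : ℝ) 1) : StrictMono (interlace x u) := by
  have key : ∀ i, interlace x u i ∈ Ioo (x i.castSucc) (x i.succ) := by
    intro i
    have h := hx i.castSucc_lt_succ
    have := hu i
    unfold interlace
    constructor <;> nlinarith [this.1, this.2]
  intro i j hij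
  exact (key i).2.trans_le ((hx.monotone (Fin.succ_le_castSucc_iff.2 hij)).trans (key j).1.le)

theorem confluentDet_nonneg (b : Fin n → ℝ) {x : Fin n → ℝ} (hx : Monotone x) : 0 ≤ confluentDet n b x := by
  induction n with
  | zero => simp [confluentDet]
  | succ n ih =>
    rw [confluentDet]
    refine mul_nonneg (Finset.prod_nonneg fun i _ => sub_nonneg.2 (hx i.castSucc_lt_succ.le)) ?_
    refine setIntegral_nonneg measurableSet_Icc fun u hu => ?_
    exact mul_nonneg (ih _ (monotone_interlace hx hu)) (exp_pos _).le

/-- No condition on `b` is needed. Positivity at coinciding parameters keeps the normalizing mass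
away from zero in the confluent limit. -/
theorem confluentDet_pos (b : Fin n → ℝ) {x : Fin n → ℝ} (hx : StrictMono x) : 0 < confluentDet n b x := by
  induction n with
  | zero => simp [confluentDet]
  | succ n ih =>
    rw [confluentDet]
    refine mul_pos (prod_pos fun i _ => sub_pos.2 (hx i.castSucc_lt_succ)) ?_
    have hc := continuous_confluentDet_integrand b x
    rw [setIntegral_pos_iff_support_of_nonneg_ae]
    · have hsub : univ.pi (fun _ : Fin n => Ioo (0 : ℝ) 1) ⊆
          Function.support (fun u : Fin n → ℝ =>
            confluentDet n (fun i => b i.castSucc) (interlace x u) *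
            rexp (b (Fin.last n) * (∑ i, x i - ∑ i, interlace x u i))) ∩ Icc 0 1 := by
        intro u hu
        have hu' : ∀ i, u i ∈ Ioo (0 : ℝ) 1 := fun i => hu i trivial
        refine ⟨?_, fun i => (hu' i).1.le, fun i => (hu' i).2.le⟩
        exact (mul_pos (ih _ (strictMono_interlace hx hu')) (exp_pos _)).ne'
      refine lt_of_lt_of_le ?_ (measure_mono hsub)
      simp [Real.volume_pi_Ioo]
    · refine (ae_restrict_iff' measurableSet_Icc).2 (.of_forall fun u hu => ?_)
      exact mul_nonneg (confluentDet_nonneg _ (monotone_interlace hx.monotone hu)) (exp_pos _).le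
    · exact hc.continuousOn.integrableOn_compact isCompact_Icc

theorem confluentDet_smul (a : ℝ) (b x : Fin n → ℝ) :
    confluentDet n b (a • x) = a ^ (∑ i ∈ Finset.range n, i) * confluentDet n (a • b) x := by
  induction n with
  | zero => simp [confluentDet]
  | succ n ih =>
    have hl : ∀ u, interlace (a • x) u = a • interlace x u := fun u => by ext i; simp [interlace]; ring
    simp only [confluentDet, hl]
    have e1 : ∏ i : Fin n, ((a • x) i.succ - (a • x) i.castSucc) =
        a ^ n * ∏ i : Fin n, (x i.succ - x i.castSucc) := by
      simp [← mul_sub, prod_mul_distrib]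
    have e2 : ∀ u, confluentDet n (fun i => b i.castSucc) (a • interlace x u) *
        rexp (b (Fin.last n) * (∑ i, (a • x) i - ∑ i, (a • interlace x u) i)) =
        a ^ (∑ i ∈ Finset.range n, i) * (confluentDet n (fun i => (a • b) i.castSucc) (interlace x u) *
          rexp ((a • b) (Fin.last n) * (∑ i, x i - ∑ i, interlace x u i))) := fun u => by
      rw [ih]
      simp only [Pi.smul_apply, smul_eq_mul, ← mul_sum]
      rw [← mul_assoc]
      congr 2
      ring
    simp_rw [e1, e2]
    rw [integral_const_mul, sum_range_succ, pow_add]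
    ring

theorem det_vandermonde_succ {R : Type*} [CommRing R] {n : ℕ} (b : Fin (n + 1) → R) : (vandermonde b).det =
      (vandermonde fun i : Fin n => b i.castSucc).det * ∏ i : Fin n, (b (Fin.last n) - b i.castSucc) := by
  rw [det_vandermonde, det_vandermonde, Fin.prod_univ_castSucc, ← prod_mul_distrib]
  have hlast : ∏ j ∈ Finset.Ioi (Fin.last n), (b j - b (Fin.last n)) = 1 := by
    rw [Finset.Ioi_eq_empty.2 (fun j _ => Fin.le_last j)]; simp
  rw [hlast, mul_one]
  refine prod_congr rfl fun i _ => ?_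
  have : Finset.Ioi i.castSucc = insert (Fin.last n) ((Finset.Ioi i).map Fin.castSuccEmb) := by
    ext j
    refine Fin.lastCases ?_ (fun j => ?_) j
    · simp [Fin.castSucc_lt_last]
    · simp [Fin.le_last]
  rw [this, Finset.prod_insert (by simp), Finset.prod_map, mul_comm]
  rfl

/-- Induction on `n`. Differences of consecutive rows are integrals over the gaps of `x`, and each
such integral releases a factor `b j - β`, where `β` is the last parameter. These factors are the
new ones in the Vandermonde determinant of `b`; what remains is the recursion for `confluentDet`. -/
theorem det_exp_mul_eq (b x : Fin n → ℝ) : (of fun i j => rexp (b j * x i)).det =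
      (vandermonde b).det * confluentDet n b x := by
  induction n with
  | zero => simp [confluentDet]
  | succ n ih =>
    set β := b (Fin.last n) with hβ
    have s1 : (of fun i j => rexp (b j * x i)).det =
        rexp (β * ∑ i, x i) * (of fun i j => rexp ((b j - β) * x i)).det := by
      rw [mul_sum, Real.exp_sum, ← det_mul_column]
      congr 1
      ext i j
      simp only [of_apply, ← exp_add]
      congr 1; ring
    -- With `exp (β x i)` factored out the last column is constant, so subtracting consecutive rows
    -- leaves it a single nonzero entry, the top one.
    have s2 : (of fun i j => rexp ((b j - β) * x i)).det =
        (of fun i j : Fin (n + 1) => (Fin.cons (rexp ((b j - β) * x 0))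
          (fun i : Fin n => rexp ((b j - β) * x i.succ) - rexp ((b j - β) * x i.castSucc)) :
            Fin (n + 1) → ℝ) i).det := by
      refine Matrix.det_eq_of_forall_row_eq_smul_add_pred (fun _ => 1) ?_ ?_
      · intro j; simp
      · intro i j; simp
    have s3 : (of fun i j : Fin (n + 1) => (Fin.cons (rexp ((b j - β) * x 0))
          (fun i : Fin n => rexp ((b j - β) * x i.succ) - rexp ((b j - β) * x i.castSucc)) :
            Fin (n + 1) → ℝ) i).det = (-1) ^ n * (of fun i j : Fin n =>
              rexp ((b j.castSucc - β) * x i.succ) - rexp ((b j.castSucc - β) * x i.castSucc)).det := by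
      rw [Matrix.det_succ_column _ (Fin.last n), Fin.sum_univ_succ, Finset.sum_eq_zero]
      · simp [hβ, Matrix.submatrix]
      · intro i _
        simp [hβ]
    have s4 : ∀ i j : Fin n, rexp ((b j.castSucc - β) * x i.succ) -
        rexp ((b j.castSucc - β) * x i.castSucc) = ∫ v in Icc (0 : ℝ) 1,
          (x i.succ - x i.castSucc) * ((b j.castSucc - β) *
            rexp ((b j.castSucc - β) * (x i.castSucc + v * (x i.succ - x i.castSucc)))) := by
      intro i j
      rw [integral_Icc_eq_integral_Ioc, ← intervalIntegral.integral_of_le zero_le_one]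
      have := intervalIntegral.integral_eq_sub_of_hasDerivAt (a := 0) (b := 1)
        (f := fun v : ℝ => rexp ((b j.castSucc - β) * (x i.castSucc + v * (x i.succ - x i.castSucc))))
        (f' := fun v => (x i.succ - x i.castSucc) * ((b j.castSucc - β) *
            rexp ((b j.castSucc - β) * (x i.castSucc + v * (x i.succ - x i.castSucc))))) ?_ ?_
      · rw [this]; ring_nf
      · intro v _
        have h := ((((hasDerivAt_id v).mul_const (x i.succ - x i.castSucc)).const_add
          (x i.castSucc)).const_mul (b j.castSucc - β)).exp
        exact h.congr_deriv (by simp only [id]; ring)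
      · exact Continuous.intervalIntegrable (by fun_prop) _ _
    have s5 := (det_integral_eq (n := n) (volume.restrict (Icc (0 : ℝ) 1))
      (fun i j v => (x i.succ - x i.castSucc) * ((b j.castSucc - β) *
            rexp ((b j.castSucc - β) * (x i.castSucc + v * (x i.succ - x i.castSucc)))))
      (fun i j => (Continuous.continuousOn (by fun_prop)).integrableOn_compact isCompact_Icc)).2
    have s6 : ∀ u : Fin n → ℝ, (of fun i j : Fin n => (x i.succ - x i.castSucc) * ((b j.castSucc - β) *
            rexp ((b j.castSucc - β) * (x i.castSucc + u i * (x i.succ - x i.castSucc))))).det =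
          (∏ i : Fin n, (x i.succ - x i.castSucc)) * ((∏ j : Fin n, (b j.castSucc - β)) *
          ((vandermonde fun i : Fin n => b i.castSucc).det *
          (confluentDet n (fun i => b i.castSucc) (interlace x u) * rexp (- (β * ∑ i, interlace x u i))))) := by
      intro u
      rw [mul_sum, ← sum_neg_distrib, Real.exp_sum, ← mul_assoc (Matrix.det _), ← ih,
        mul_comm (Matrix.det _), ← det_mul_column, ← det_mul_row, ← det_mul_column]
      congr 1
      ext i j
      simp only [of_apply, ← exp_add, interlace]
      ring_nf
    rw [s1, s2, s3]
    simp_rw [s4]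
    rw [← s5]
    simp_rw [s6]
    rw [integral_const_mul, integral_const_mul, integral_const_mul, ← Measure.restrict_pi_pi,
      Set.pi_univ_Icc, confluentDet, det_vandermonde_succ]
    have e7 : ∀ u, confluentDet n (fun i => b i.castSucc) (interlace x u) *
        rexp (b (Fin.last n) * (∑ i, x i - ∑ i, interlace x u i)) =
        rexp (β * ∑ i, x i) * (confluentDet n (fun i => b i.castSucc) (interlace x u) *
            rexp (- (β * ∑ i, interlace x u i))) := fun u => by
      rw [mul_sub, sub_eq_add_neg, exp_add, ← hβ]; ring
    simp_rw [e7]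
    rw [integral_const_mul]
    -- The sign from expanding along the last column turns the factors `b j - β` into `β - b j`.
    have e8 : (-1 : ℝ) ^ n * ∏ j : Fin n, (b j.castSucc - β) = ∏ j : Fin n, (β - b j.castSucc) := by
      have : ∏ j : Fin n, (β - b j.castSucc) = ∏ j : Fin n, (-1) * (b j.castSucc - β) :=
        prod_congr rfl fun j _ => by ring
      rw [this, prod_mul_distrib]; simp
    rw [← hβ, ← e8, volume_pi]
    have h01 : Icc (fun _ : Fin n => (0:ℝ)) (fun _ => 1) = Icc 0 1 := rfl
    rw [h01]
    ring

/-- For `b = h · (0, 1, …, n - 1)` the exponential matrix is a Vandermonde matrix in `exp (h x i)`.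
Dividing by the powers of `h` and letting `h → 0` replaces `exp (h x j) - exp (h x i)` by `x j - x
i`. -/
theorem confluentDet_zero_mul (x : Fin n → ℝ) :
    (vandermonde fun i : Fin n => ((i : ℕ) : ℝ)).det * confluentDet n 0 x = (vandermonde x).det := by
  have key : ∀ h : ℝ, h ≠ 0 → (vandermonde fun i : Fin n => ((i : ℕ) : ℝ)).det *
      confluentDet n (fun i => h * (i : ℕ)) x =
      ∏ i : Fin n, ∏ j ∈ Finset.Ioi i, (rexp (h * x j) - rexp (h * x i)) / h := by
    intro h hh
    have h1 : (of fun i j : Fin n => rexp (h * (j : ℕ) * x i)).det = (vandermonde fun i => rexp (h * x i)).det := by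
      congr 1
      ext i j
      rw [of_apply, Matrix.vandermonde_apply, ← exp_nat_mul]
      congr 1; ring
    rw [det_exp_mul_eq (fun j : Fin n => h * (j : ℕ)) x, det_vandermonde, det_vandermonde] at h1
    rw [det_vandermonde]
    simp_rw [Finset.prod_div_distrib]
    rw [← h1]
    simp_rw [← mul_sub, prod_mul_distrib]
    have : ∏ i : Fin n, ∏ j ∈ Finset.Ioi i, h ≠ 0 :=
      Finset.prod_ne_zero_iff.2 fun i _ => Finset.prod_ne_zero_iff.2 fun _ _ => hh
    field_simp
  have t1 : Tendsto (fun h : ℝ => (vandermonde fun i : Fin n => ((i : ℕ) : ℝ)).det *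
      confluentDet n (fun i => h * (i : ℕ)) x) (𝓝[≠] 0)
      (𝓝 ((vandermonde fun i : Fin n => ((i : ℕ) : ℝ)).det * confluentDet n 0 x)) := by
    have hc : Continuous fun h : ℝ => (vandermonde fun i : Fin n => ((i : ℕ) : ℝ)).det *
        confluentDet n (fun i => h * (i : ℕ)) x := continuous_const.mul
      ((continuous_confluentDet_left x).comp (by fun_prop : Continuous fun h : ℝ => fun i : Fin n =>
        h * ((i : ℕ) : ℝ)))
    have := (hc.tendsto 0).mono_left (nhdsWithin_le_nhds (s := {0}ᶜ))
    simp only [zero_mul] at this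
    exact this
  have t2 : Tendsto (fun h : ℝ => ∏ i : Fin n, ∏ j ∈ Finset.Ioi i, (rexp (h * x j) - rexp (h * x i)) / h) (𝓝[≠] 0)
      (𝓝 (∏ i : Fin n, ∏ j ∈ Finset.Ioi i, (x j - x i))) := by
    refine tendsto_finsetProd _ fun i _ => tendsto_finsetProd _ fun j _ => ?_
    have hd : HasDerivAt (fun h : ℝ => rexp (h * x j) - rexp (h * x i)) (x j - x i) 0 := by
      have := (((hasDerivAt_id (0 : ℝ)).mul_const (x j)).exp).sub (((hasDerivAt_id (0 : ℝ)).mul_const (x i)).exp)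
      exact this.congr_deriv (by simp)
    refine (hasDerivAt_iff_tendsto_slope.1 hd).congr fun h => ?_
    simp [slope_def_field]
  rw [det_vandermonde x]
  refine tendsto_nhds_unique (t1.congr' ?_) t2
  filter_upwards [self_mem_nhdsWithin] with h hh using key h hh

/-! ### The Weyl chamber and the ensemble with sources -/

theorem det_vandermonde_pos {b : Fin n → ℝ} (hb : StrictMono b) : 0 < (vandermonde b).det := by
  rw [det_vandermonde]
  exact prod_pos fun i _ => prod_pos fun j hj => sub_pos.2 (hb (Finset.mem_Ioi.1 hj))

theorem isOpen_weylChamber (n : ℕ) : IsOpen (weylChamber n) := by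
  have : weylChamber n = ⋂ i : Fin n, ⋂ j : Fin n, {x | i < j → x i < x j} := by
    ext x
    simp only [weylChamber, Set.mem_ofPred_eq, Set.mem_iInter]
    exact ⟨fun h i j hij => h hij, fun h i j hij => h i j hij⟩
  rw [this]
  refine isOpen_iInter_of_finite fun i => isOpen_iInter_of_finite fun j => ?_
  by_cases hij : i < j
  · simp only [hij, forall_const]
    exact isOpen_lt (continuous_apply i) (continuous_apply j)
  · simp [hij]

theorem measurableSet_weylChamber (n : ℕ) : MeasurableSet (weylChamber n) := (isOpen_weylChamber n).measurableSet

theorem natCast_mem_weylChamber (n : ℕ) : (fun i : Fin n => ((i : ℕ) : ℝ)) ∈ weylChamber n :=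
  fun i j hij => by simpa using hij

/-- The unnormalized density of the ensemble with parameters `c`, `b` and variance scale `s`. -/
noncomputable def ensembleDensity (s : ℝ) (c b x : Fin n → ℝ) : ℝ :=
  confluentDet n c x * confluentDet n b x * rexp (-(∑ i, x i ^ 2) / s)

noncomputable def ensembleMeasure (s : ℝ) (c b : Fin n → ℝ) : Measure (Fin n → ℝ) :=
  (volume.restrict (weylChamber n)).withDensity fun x => ENNReal.ofReal (ensembleDensity s c b x)

noncomputable def ensembleLaw (s : ℝ) (c b : Fin n → ℝ) : Measure (Fin n → ℝ) :=
  (ensembleMeasure s c b univ)⁻¹ • ensembleMeasure s c b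

noncomputable def ensembleMass (s : ℝ) (c b : Fin n → ℝ) : ℝ := ∫ x in weylChamber n, ensembleDensity s c b x

theorem continuous_ensembleDensity (s : ℝ) (c b : Fin n → ℝ) : Continuous (ensembleDensity s c b) := by
  unfold ensembleDensity
  exact ((continuous_confluentDet_right c).mul (continuous_confluentDet_right b)).mul (by fun_prop)

theorem continuous_ensembleDensity_param (s : ℝ) (x : Fin n → ℝ) :
    Continuous fun p : (Fin n → ℝ) × (Fin n → ℝ) => ensembleDensity s p.1 p.2 x := by
  unfold ensembleDensity
  exact (((continuous_confluentDet_left x).comp continuous_fst).mul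
    ((continuous_confluentDet_left x).comp continuous_snd)).mul continuous_const

theorem ensembleDensity_nonneg (s : ℝ) (c b : Fin n → ℝ) {x : Fin n → ℝ}
    (hx : x ∈ weylChamber n) : 0 ≤ ensembleDensity s c b x :=
  mul_nonneg (mul_nonneg (confluentDet_nonneg _ (StrictMono.monotone hx))
    (confluentDet_nonneg _ (StrictMono.monotone hx))) (exp_pos _).le

theorem ensembleDensity_pos (s : ℝ) (c b : Fin n → ℝ) {x : Fin n → ℝ}
    (hx : x ∈ weylChamber n) : 0 < ensembleDensity s c b x :=
  mul_pos (mul_pos (confluentDet_pos _ hx) (confluentDet_pos _ hx)) (exp_pos _)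

theorem integrable_exp_abs_sub_sq {s : ℝ} (hs : 0 < s) (A : ℝ) :
    Integrable fun x : ℝ => rexp (A * |x| - x ^ 2 / s) := by
  have h := (integrable_exp_neg_mul_sq (b := 1 / (2 * s)) (by positivity)).const_mul (rexp (A ^ 2 * s / 2))
  refine h.mono' (by fun_prop) (.of_forall fun x => ?_)
  rw [norm_eq_abs, abs_exp, ← exp_add, exp_le_exp]
  have h1 : 0 ≤ (A * s - |x|) ^ 2 / (2 * s) := by positivity
  have h2 : (A * s - |x|) ^ 2 / (2 * s) = A ^ 2 * s / 2 - A * |x| + x ^ 2 / (2 * s) := by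
    rw [sub_sq, sq_abs]; field_simp
  have h3 : x ^ 2 / s = x ^ 2 / (2 * s) + x ^ 2 / (2 * s) := by field_simp; ring
  have h4 : -(1 / (2 * s)) * x ^ 2 = - (x ^ 2 / (2 * s)) := by ring
  linarith

/-- One integrable majorant serves all parameters in a ball. It is a product over coordinates, so
its integrability is one-dimensional. -/
theorem exists_ensembleDensity_bound (n : ℕ) {s : ℝ} (hs : 0 < s) (R : ℝ) :
    ∃ g : (Fin n → ℝ) → ℝ, Integrable g ∧ ∀ c b x, ‖c‖ ≤ R → ‖b‖ ≤ R →
      |ensembleDensity s c b x| ≤ g x := by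
  obtain ⟨C, hC, h⟩ := exists_confluentDet_bound n
  refine ⟨fun x => ∏ i, rexp (2 * C * (1 + R) * |x i| - x i ^ 2 / s), ?_, ?_⟩
  · exact Integrable.fintype_prod (f := fun _ : Fin n => fun x : ℝ =>
      rexp (2 * C * (1 + R) * |x| - x ^ 2 / s)) fun _ => integrable_exp_abs_sub_sq hs _
  · intro c b x hc hb
    have hR : 0 ≤ R := (norm_nonneg c).trans hc
    beta_reduce
    rw [← Real.exp_sum, Finset.sum_sub_distrib, ← mul_sum, ← Finset.sum_div, ensembleDensity,
      abs_mul, abs_mul, abs_exp]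
    have hx : ‖x‖ ≤ ∑ i, |x i| := (pi_norm_le_iff_of_nonneg (Finset.sum_nonneg fun _ _ => abs_nonneg _)).2 fun i =>
        Finset.single_le_sum (f := fun i => |x i|) (fun _ _ => abs_nonneg _) (mem_univ i)
    have h1 : ∀ d : Fin n → ℝ, ‖d‖ ≤ R →
        |confluentDet n d x| ≤ rexp (C * (1 + R) * ∑ i, |x i|) := fun d hd =>
      (h d x).trans (exp_le_exp.2 (by gcongr))
    refine (mul_le_mul_of_nonneg_right (mul_le_mul (h1 c hc) (h1 b hb) (abs_nonneg _)
      (exp_pos _).le) (exp_pos _).le).trans_eq ?_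
    rw [← exp_add, ← exp_add]
    congr 1; ring

theorem integrable_ensembleDensity {s : ℝ} (hs : 0 < s) (c b : Fin n → ℝ) : Integrable (ensembleDensity s c b) := by
  obtain ⟨g, hg, h⟩ := exists_ensembleDensity_bound n hs (max ‖c‖ ‖b‖)
  exact hg.mono' (continuous_ensembleDensity s c b).aestronglyMeasurable
    (.of_forall fun x => h c b x (le_max_left _ _) (le_max_right _ _))

theorem ensembleMass_pos {s : ℝ} (hs : 0 < s) (c b : Fin n → ℝ) : 0 < ensembleMass s c b := by
  rw [ensembleMass, setIntegral_pos_iff_support_of_nonneg_ae]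
  · have : weylChamber n ⊆ Function.support (ensembleDensity s c b) ∩ weylChamber n :=
      fun x hx => ⟨(ensembleDensity_pos s c b hx).ne', hx⟩
    exact ((isOpen_weylChamber n).measure_pos _ ⟨_, natCast_mem_weylChamber n⟩).trans_le (measure_mono this)
  · exact (ae_restrict_iff' (measurableSet_weylChamber n)).2 (.of_forall fun x hx => ensembleDensity_nonneg s c b hx)
  · exact (integrable_ensembleDensity hs c b).integrableOn

theorem ensembleMeasure_apply {s : ℝ} (hs : 0 < s) (c b : Fin n → ℝ) {S : Set (Fin n → ℝ)} (hS : MeasurableSet S) :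
    ensembleMeasure s c b S = ENNReal.ofReal (∫ x in weylChamber n, S.indicator 1 x * ensembleDensity s c b x) := by
  rw [ensembleMeasure, withDensity_apply _ hS, ← ofReal_integral_eq_lintegral_ofReal]
  · congr 1
    rw [← integral_indicator hS]
    refine integral_congr_ae (.of_forall fun x => ?_)
    by_cases hx : x ∈ S <;> simp [hx]
  · exact ((integrable_ensembleDensity hs c b).integrableOn).integrable.mono_measure Measure.restrict_le_self
  · refine ae_restrict_of_ae ((ae_restrict_iff' (measurableSet_weylChamber n)).2
      (.of_forall fun x hx => ensembleDensity_nonneg s c b hx))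

theorem ensembleMeasure_univ {s : ℝ} (hs : 0 < s) (c b : Fin n → ℝ) :
    ensembleMeasure s c b univ = ENNReal.ofReal (ensembleMass s c b) := by
  rw [ensembleMeasure_apply hs c b MeasurableSet.univ]
  simp [ensembleMass]

theorem isProbabilityMeasure_ensembleLaw {s : ℝ} (hs : 0 < s) (c b : Fin n → ℝ) :
    IsProbabilityMeasure (ensembleLaw s c b) := by
  constructor
  rw [ensembleLaw, Measure.smul_apply, smul_eq_mul]
  refine ENNReal.inv_mul_cancel ?_ ?_ <;> rw [ensembleMeasure_univ hs]
  · simpa using ensembleMass_pos hs c b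
  · exact ENNReal.ofReal_ne_top

theorem integral_ensembleLaw {𝕜 : Type*} [RCLike 𝕜] {n : ℕ} {s : ℝ} (hs : 0 < s) (c b : Fin n → ℝ)
    (F : (Fin n → ℝ) → 𝕜) :
    ∫ x, F x ∂ensembleLaw s c b =
      (∫ x in weylChamber n, F x * (ensembleDensity s c b x : 𝕜)) / (ensembleMass s c b : 𝕜) := by
  rw [ensembleLaw, integral_smul_measure, ensembleMeasure_univ hs, ensembleMeasure,
    integral_withDensity_eq_integral_toReal_smul]
  · rw [ENNReal.toReal_inv, ENNReal.toReal_ofReal (ensembleMass_pos hs c b).le, div_eq_inv_mul,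
      RCLike.real_smul_eq_coe_mul, RCLike.ofReal_inv]
    congr 1
    refine setIntegral_congr_fun (measurableSet_weylChamber n) fun x hx => ?_
    rw [ENNReal.toReal_ofReal (ensembleDensity_nonneg s c b hx), RCLike.real_smul_eq_coe_mul, mul_comm]
  · exact (continuous_ensembleDensity s c b).measurable.ennreal_ofReal
  · exact .of_forall fun x => ENNReal.ofReal_lt_top

theorem continuous_integral_ensembleDensity {𝕜 : Type*} [RCLike 𝕜] {n : ℕ} {s : ℝ} (hs : 0 < s)
    {F : (Fin n → ℝ) → 𝕜} (hF : Measurable F) {M : ℝ} (hM : ∀ x, ‖F x‖ ≤ M) :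
    Continuous fun p : (Fin n → ℝ) × (Fin n → ℝ) =>
      ∫ x in weylChamber n, F x * (ensembleDensity s p.1 p.2 x : 𝕜) := by
  refine continuous_iff_continuousAt.2 fun p₀ => ?_
  obtain ⟨g, hg, h⟩ := exists_ensembleDensity_bound n hs (‖p₀‖ + 1)
  refine tendsto_integral_filter_of_dominated_convergence (fun x => M * g x) ?_ ?_ ?_ ?_
  · refine .of_forall fun p => ?_
    exact (hF.mul (RCLike.measurable_ofReal.comp
      (continuous_ensembleDensity s p.1 p.2).measurable)).aestronglyMeasurable
  · have : ∀ᶠ p in 𝓝 p₀, ‖p‖ < ‖p₀‖ + 1 := continuous_norm.continuousAt.eventually_lt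
      continuousAt_const (by simp)
    filter_upwards [this] with p hp
    refine .of_forall fun x => ?_
    rw [norm_mul, RCLike.norm_ofReal]
    exact mul_le_mul (hM x) (h _ _ _ ((norm_fst_le p).trans hp.le) ((norm_snd_le p).trans hp.le))
      (abs_nonneg _) ((norm_nonneg _).trans (hM x))
  · exact (hg.const_mul M).integrableOn
  · refine .of_forall fun x => ?_
    exact (continuous_const.mul (RCLike.continuous_ofReal.comp (continuous_ensembleDensity_param s x))).continuousAt

theorem continuous_ensembleMass {s : ℝ} (hs : 0 < s) :
    Continuous fun p : (Fin n → ℝ) × (Fin n → ℝ) => ensembleMass s p.1 p.2 := by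
  have := continuous_integral_ensembleDensity (𝕜 := ℝ) (n := n) hs (F := fun _ => 1)
    measurable_const (M := 1) (by simp)
  simpa [ensembleMass] using this

theorem continuous_integral_ensembleLaw {𝕜 : Type*} [RCLike 𝕜] {n : ℕ} {s : ℝ} (hs : 0 < s)
    {F : (Fin n → ℝ) → 𝕜} (hF : Measurable F) {M : ℝ} (hM : ∀ x, ‖F x‖ ≤ M) :
    Continuous fun p : (Fin n → ℝ) × (Fin n → ℝ) => ∫ x, F x ∂ensembleLaw s p.1 p.2 := by
  simp_rw [integral_ensembleLaw hs]
  refine (continuous_integral_ensembleDensity hs hF hM).div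
    (RCLike.continuous_ofReal.comp (continuous_ensembleMass hs)) fun p => ?_
  simpa using (ensembleMass_pos hs p.1 p.2).ne'

/-- Dominated convergence for the mass and for the integral over `S`, together with positivity of
the mass. Coinciding parameters are included, so this contains the confluent limit. -/
theorem continuous_ensembleLaw_apply {s : ℝ} (hs : 0 < s) {S : Set (Fin n → ℝ)} (hS : MeasurableSet S) :
    Continuous fun p : (Fin n → ℝ) × (Fin n → ℝ) => ensembleLaw s p.1 p.2 S := by
  have h := continuous_integral_ensembleLaw (𝕜 := ℝ) hs (F := S.indicator 1)
    (measurable_one.indicator hS) (M := 1) (fun x => by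
      by_cases hx : x ∈ S <;> simp [hx])
  have e : ∀ p : (Fin n → ℝ) × (Fin n → ℝ), ensembleLaw s p.1 p.2 S =
      ENNReal.ofReal (∫ x, S.indicator 1 x ∂ensembleLaw s p.1 p.2) := fun p => by
    have := isProbabilityMeasure_ensembleLaw hs p.1 p.2
    rw [integral_indicator_one hS, ofReal_measureReal]
  simp_rw [e]
  exact ENNReal.continuous_ofReal.comp h

/-! ### Brownian bridges as an ensemble; the confluent limit -/

/-- Expanding `-(d j - x i)² / a` splits each determinant into row factors, column factors and `det
(exp (2 d j x i / a))`. The two Gaussians in `x` combine because `1/t + 1/(1-t) = 1/(t(1-t))`. The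
constant `κ` contains the Vandermonde determinants of the end points, which degenerate in the
confluent limit, but it cancels in the normalized law. -/
theorem exists_bridgeDensity_eq {t : ℝ} (ht : t ∈ Ioo (0 : ℝ) 1) {γ δ : Fin n → ℝ}
    (hγ : γ ∈ weylChamber n) (hδ : δ ∈ weylChamber n) : ∃ κ : ℝ, 0 < κ ∧ ∀ x, bridgeDensity t γ δ x =
        κ * ensembleDensity (t * (1 - t)) ((2 / t) • γ) ((2 / (1 - t)) • δ) x := by
  have ht0 : 0 < t := ht.1
  have ht1 : 0 < 1 - t := sub_pos.2 ht.2
  have hpos : ∀ {a : ℝ} {d : Fin n → ℝ}, 0 < a → d ∈ weylChamber n → 0 < (vandermonde ((2 / a) • d)).det := by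
    intro a d ha hd
    refine det_vandermonde_pos fun i j hij => ?_
    have := hd hij
    simp only [Pi.smul_apply, smul_eq_mul]
    gcongr
  have key : ∀ (a : ℝ) (d x : Fin n → ℝ), 0 < a → (of fun i j => brownianKernel a (x i) (d j)).det =
      ((∏ _i : Fin n, 1 / √(π * a)) * (∏ j, rexp (- d j ^ 2 / a)) * (vandermonde ((2 / a) • d)).det) *
        (confluentDet n ((2 / a) • d) x * rexp (-(∑ i, x i ^ 2) / a)) := by
    intro a d x ha
    have : rexp (-(∑ i, x i ^ 2) / a) = ∏ i, rexp (- x i ^ 2 / a) := by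
      rw [← Real.exp_sum, ← sum_neg_distrib, Finset.sum_div]
    rw [this]
    have e := det_exp_mul_eq ((2 / a) • d) x
    calc _ = (∏ _i : Fin n, 1 / √(π * a)) * ((∏ j, rexp (- d j ^ 2 / a)) *
          ((∏ i, rexp (- x i ^ 2 / a)) * (of fun i j => rexp (((2 / a) • d) j * x i)).det)) := by
          rw [← det_mul_column, ← det_mul_row, ← det_mul_column]
          congr 1
          ext i j
          simp only [of_apply, brownianKernel, Pi.smul_apply, smul_eq_mul]
          rw [← exp_add, ← exp_add]
          congr 2
          field_simp
          ring
      _ = _ := by rw [e]; ring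
  have hsymm : ∀ a u v, brownianKernel a u v = brownianKernel a v u := fun a u v => by
    unfold brownianKernel; rw [← neg_sub u v, neg_sq]
  refine ⟨((∏ _i : Fin n, 1 / √(π * t)) * (∏ j, rexp (- γ j ^ 2 / t)) * (vandermonde ((2 / t) • γ)).det) *
      ((∏ _i : Fin n, 1 / √(π * (1 - t))) * (∏ j, rexp (- δ j ^ 2 / (1 - t))) *
        (vandermonde ((2 / (1 - t)) • δ)).det), ?_, fun x => ?_⟩
  · have := hpos ht0 hγ
    have := hpos ht1 hδ
    have : 0 < π := pi_pos
    have h4 : ∀ d : Fin n → ℝ, ∀ a, 0 < ∏ j, rexp (- d j ^ 2 / a) := fun d a =>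
      prod_pos fun _ _ => exp_pos _
    have := h4 γ t
    have := h4 δ (1 - t)
    have h5 : ∀ a : ℝ, 0 < a → 0 < ∏ _i : Fin n, 1 / √(π * a) := fun a ha =>
      prod_pos fun _ _ => by positivity
    have := h5 t ht0
    have := h5 _ ht1
    positivity
  · rw [bridgeDensity, key (1 - t) δ x ht1]
    have e1 : (of fun i j => brownianKernel t (γ i) (x j)).det =
        (of fun i j => brownianKernel t (x i) (γ j)).det := by
      rw [← Matrix.det_transpose]
      congr 1
      ext i j
      simp only [Matrix.transpose_apply, of_apply]
      exact hsymm _ _ _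
    rw [e1, key t γ x ht0, ensembleDensity]
    have e2 : rexp (-(∑ i, x i ^ 2) / (t * (1 - t))) =
        rexp (-(∑ i, x i ^ 2) / t) * rexp (-(∑ i, x i ^ 2) / (1 - t)) := by
      rw [← exp_add]; congr 1; field_simp; ring
    rw [e2]
    ring

theorem bridgeLaw_eq {t : ℝ} (ht : t ∈ Ioo (0 : ℝ) 1) {γ δ : Fin n → ℝ}
    (hγ : γ ∈ weylChamber n) (hδ : δ ∈ weylChamber n) :
    bridgeLaw t γ δ = ensembleLaw (t * (1 - t)) ((2 / t) • γ) ((2 / (1 - t)) • δ) := by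
  obtain ⟨κ, hκ, h⟩ := exists_bridgeDensity_eq ht hγ hδ
  have hm : bridgeMeasure t γ δ = ENNReal.ofReal κ •
      ensembleMeasure (t * (1 - t)) ((2 / t) • γ) ((2 / (1 - t)) • δ) := by
    rw [bridgeMeasure, ensembleMeasure, ← withDensity_smul]
    · congr 1
      ext x
      rw [h, ENNReal.ofReal_mul hκ.le]; rfl
    · exact (continuous_ensembleDensity _ _ _).measurable.ennreal_ofReal
  have h0 : ENNReal.ofReal κ ≠ 0 := by simpa using hκ
  rw [bridgeLaw, ensembleLaw, hm, Measure.smul_apply, smul_eq_mul, smul_smul,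
    ENNReal.mul_inv (Or.inl h0) (Or.inl ENNReal.ofReal_ne_top), mul_right_comm,
    ENNReal.inv_mul_cancel h0 ENNReal.ofReal_ne_top, one_mul]

/-- Needed for uniqueness of limits. For `0 ≤ a` the target is weakly increasing, hence a limit of
strictly increasing configurations. -/
theorem neBot_confluentLimit {n r : ℕ} {a : ℝ} (ha : 0 ≤ a) : (confluentLimit n r a).NeBot := by
  have key : ∀ d : Fin n → ℝ, Monotone d → (𝓝[weylChamber n] d).NeBot := by
    intro d hd
    rw [← mem_closure_iff_nhdsWithin_neBot]
    have ht : Tendsto (fun h : ℝ => d + h • fun i : Fin n => ((i : ℕ) : ℝ)) (𝓝[>] 0) (𝓝 d) := by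
      have hc : Continuous fun h : ℝ => d + h • fun i : Fin n => ((i : ℕ) : ℝ) := by fun_prop
      simpa using (hc.tendsto 0).mono_left nhdsWithin_le_nhds
    refine mem_closure_of_tendsto ht ?_
    filter_upwards [self_mem_nhdsWithin] with h hh i j hij
    have h1 := hd hij.le
    have h2 : ((i : ℕ) : ℝ) < (j : ℕ) := mod_cast hij
    have h3 : 0 < h := hh
    simp only [Pi.add_apply, Pi.smul_apply, smul_eq_mul]
    nlinarith
  have h1 := key 0 monotone_const
  have h2 := key (outlierTarget n r a) (by
    intro i j hij
    have : (i : ℕ) ≤ j := hij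
    unfold outlierTarget
    split_ifs
    · exact le_rfl
    · exact ha
    · omega
    · exact le_rfl)
  exact h1.prod h2

theorem confluentLimit_le_nhds (n r : ℕ) (a : ℝ) :
    confluentLimit n r a ≤ 𝓝 ((0 : Fin n → ℝ), outlierTarget n r a) := by
  rw [nhds_prod_eq, confluentLimit]
  exact Filter.prod_mono nhdsWithin_le_nhds nhdsWithin_le_nhds

theorem eventually_mem_weylChamber (n r : ℕ) (a : ℝ) :
    ∀ᶠ q in confluentLimit n r a, q.1 ∈ weylChamber n ∧ q.2 ∈ weylChamber n := by
  rw [confluentLimit]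
  exact (tendsto_fst.eventually self_mem_nhdsWithin).and (tendsto_snd.eventually self_mem_nhdsWithin)

theorem tendsto_bridgeLaw (n r : ℕ) (a : ℝ) {t : ℝ} (ht : t ∈ Ioo (0 : ℝ) 1)
    {S : Set (Fin n → ℝ)} (hS : MeasurableSet S) :
    Tendsto (fun q : (Fin n → ℝ) × (Fin n → ℝ) => bridgeLaw t q.1 q.2 S) (confluentLimit n r a)
      (𝓝 (ensembleLaw (t * (1 - t)) ((2 / t) • 0) ((2 / (1 - t)) • outlierTarget n r a) S)) := by
  have hs : 0 < t * (1 - t) := mul_pos ht.1 (sub_pos.2 ht.2)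
  have hc := continuous_ensembleLaw_apply hs hS
  have hg : Continuous fun q : (Fin n → ℝ) × (Fin n → ℝ) => ((2 / t) • q.1, (2 / (1 - t)) • q.2) := by fun_prop
  have h := ((hc.comp hg).tendsto ((0 : Fin n → ℝ), outlierTarget n r a)).mono_left (confluentLimit_le_nhds n r a)
  refine h.congr' ?_
  filter_upwards [eventually_mem_weylChamber n r a] with q hq
  rw [bridgeLaw_eq ht hq.1 hq.2]
  rfl

theorem isOutlierBridgeLaw_ensembleLaw (n r : ℕ) (a : ℝ) {t : ℝ} (ht : t ∈ Ioo (0 : ℝ) 1) : IsOutlierBridgeLaw n r a t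
      (ensembleLaw (t * (1 - t)) 0 ((2 / (1 - t)) • outlierTarget n r a)) where
  isProbabilityMeasure := isProbabilityMeasure_ensembleLaw (mul_pos ht.1 (sub_pos.2 ht.2)) _ _
  tendsto S hS := by
    have h := tendsto_bridgeLaw n r a ht hS
    rwa [smul_zero] at h

theorem IsOutlierBridgeLaw.eq {n r : ℕ} {a t : ℝ} (ha : 0 ≤ a) {μ ν : Measure (Fin n → ℝ)}
    (hμ : IsOutlierBridgeLaw n r a t μ) (hν : IsOutlierBridgeLaw n r a t ν) : μ = ν := by
  have := neBot_confluentLimit (n := n) (r := r) ha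
  exact Measure.ext fun S hS => tendsto_nhds_unique (hμ.tendsto S hS) (hν.tendsto S hS)

/-! ### The clock change and the tangent to the edge curve -/

theorem clock_pos (σ : ℝ) : 0 < clock σ := by unfold clock; positivity

theorem clock_lt_one (σ : ℝ) : clock σ < 1 := by
  unfold clock
  have := exp_pos (-2 * σ)
  rw [div_lt_one (by positivity)]; linarith

theorem clock_eq_of_exp {τ₀ ρ₀ : ℝ} (hρ₀ : ρ₀ = rexp (-τ₀)) : clock τ₀ = 1 / (1 + ρ₀ ^ 2) := by
  rw [clock, hρ₀, ← exp_nat_mul]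
  congr 3; push_cast; ring

/-- With `q² = 2nt(1-t)` the height at time `1` of the tangent at time `t` collapses to `n(1-t)/q`.
Comparing squares of nonnegative numbers leaves `1 - t = ρ₀² t`. -/
theorem edgeCurve_tangent {ρ₀ : ℝ} (hρ₀ : 0 < ρ₀) {n : ℕ} (hn : 1 ≤ n) {t : ℝ}
    (ht : t ∈ Ioo (0 : ℝ) 1) : ∃ m : ℝ, HasDerivAt (edgeCurve n) m t ∧
      (edgeCurve n t + m * (1 - t) = ρ₀ * √(n / 2) ↔ t = 1 / (1 + ρ₀ ^ 2)) := by
  have hn' : (0 : ℝ) < n := mod_cast hn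
  have ht0 : 0 < t := ht.1
  have ht1 : 0 < 1 - t := sub_pos.2 ht.2
  have hpos : 0 < 2 * n * t * (1 - t) := by positivity
  have hd : HasDerivAt (fun t : ℝ => 2 * n * t * (1 - t)) (2 * n * (1 - 2 * t)) t := by
    have := ((hasDerivAt_id t).const_mul (2 * (n : ℝ))).mul ((hasDerivAt_id t).const_sub 1)
    exact this.congr_deriv (by simp only [id]; ring)
  refine ⟨_, hd.sqrt hpos.ne', ?_⟩
  rw [edgeCurve]
  have hq := sqrt_pos.2 hpos
  have hsq := sq_sqrt hpos.le
  set q := √(2 * n * t * (1 - t)) with hqdef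
  have hL : q + 2 * n * (1 - 2 * t) / (2 * q) * (1 - t) = n * (1 - t) / q := by
    field_simp
    rw [hsq]; ring
  rw [hL]
  have hR : 0 ≤ ρ₀ * √(n / 2) := by positivity
  have hL0 : 0 ≤ n * (1 - t) / q := by positivity
  rw [← sq_eq_sq₀ hL0 hR, div_pow, mul_pow ρ₀, sq_sqrt (by positivity : (0:ℝ) ≤ n / 2), hsq, eq_div_iff (by positivity),
    div_eq_iff (by positivity)]
  constructor
  · intro h
    have h2 : (n : ℝ) ^ 2 * (1 - t) * (1 - t - ρ₀ ^ 2 * t) = 0 := by linarith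
    have h3 : (n : ℝ) ^ 2 * (1 - t) ≠ 0 := by positivity
    have := (mul_eq_zero.1 h2).resolve_left h3
    linarith
  · intro h
    have : 1 - t = ρ₀ ^ 2 * t := by linarith
    rw [this]; ring

theorem edgeCurve_clock {ρ₀ : ℝ} (hρ₀ : 0 < ρ₀) (n : ℕ) :
    edgeCurve n (1 / (1 + ρ₀ ^ 2)) = ρ₀ * √(2 * n) / (1 + ρ₀ ^ 2) := by
  rw [edgeCurve, show 2 * (n : ℝ) * (1 / (1 + ρ₀ ^ 2)) * (1 - 1 / (1 + ρ₀ ^ 2)) =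
    (ρ₀ / (1 + ρ₀ ^ 2)) ^ 2 * (2 * n) by field_simp; ring, Real.sqrt_mul (by positivity),
    Real.sqrt_sq (by positivity)]
  ring

/-! ### Reduction to unit variance -/

theorem ensembleDensity_smul {s : ℝ} (hs : 0 < s) (c b x : Fin n → ℝ) :
    ensembleDensity s c b (√s • x) = √s ^ (2 * ∑ i ∈ Finset.range n, i) * ensembleDensity 1 (√s • c) (√s • b) x := by
  have h : (∑ i, (√s • x) i ^ 2) / s = (∑ i, x i ^ 2) / 1 := by
    simp_rw [Pi.smul_apply, smul_eq_mul, mul_pow, sq_sqrt hs.le, ← mul_sum]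
    field_simp
  rw [ensembleDensity, ensembleDensity, confluentDet_smul, confluentDet_smul, neg_div, neg_div, h, two_mul, pow_add]
  ring

open Pointwise in
theorem smul_weylChamber {a : ℝ} (ha : 0 < a) : a • weylChamber n = weylChamber n := by
  ext x
  rw [Set.mem_smul_set_iff_inv_smul_mem₀ ha.ne']
  simp only [weylChamber, Set.mem_ofPred_eq]
  have ha' := inv_pos.2 ha
  constructor
  · intro h i j hij
    have := h hij
    simp only [Pi.smul_apply, smul_eq_mul] at this
    exact lt_of_mul_lt_mul_left this ha'.le
  · intro h i j hij
    simp only [Pi.smul_apply, smul_eq_mul]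
    exact mul_lt_mul_of_pos_left (h hij) ha'

open Pointwise in
-- One constant `κ` works for every `F`, so comparison with `F = 1` removes it from normalized
-- integrals.
theorem setIntegral_weylChamber_smul {𝕜 : Type*} [RCLike 𝕜] {n : ℕ} {s : ℝ} (hs : 0 < s)
    (c b : Fin n → ℝ) : ∃ κ : ℝ, 0 < κ ∧ ∀ F : (Fin n → ℝ) → 𝕜,
    ∫ x in weylChamber n, F x * (ensembleDensity s c b x : 𝕜) = (κ : 𝕜) * ∫ x in weylChamber n, F (√s • x) *
        (ensembleDensity 1 (√s • c) (√s • b) x : 𝕜) := by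
  have ha : 0 < √s := sqrt_pos.2 hs
  refine ⟨√s ^ n * √s ^ (2 * ∑ i ∈ Finset.range n, i), by positivity, fun F => ?_⟩
  have h := Measure.setIntegral_comp_smul_of_pos (μ := (volume : Measure (Fin n → ℝ)))
    (fun x => F x * (ensembleDensity s c b x : 𝕜)) (weylChamber n) ha
  rw [smul_weylChamber ha, Module.finrank_fin_fun] at h
  simp_rw [ensembleDensity_smul hs, RCLike.ofReal_mul] at h
  have e : ∀ x, F (√s • x) * (((√s ^ (2 * ∑ i ∈ Finset.range n, i) : ℝ) : 𝕜) *
      (ensembleDensity 1 (√s • c) (√s • b) x : 𝕜)) =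
      ((√s ^ (2 * ∑ i ∈ Finset.range n, i) : ℝ) : 𝕜) * (F (√s • x) *
      (ensembleDensity 1 (√s • c) (√s • b) x : 𝕜)) := fun x => by ring
  simp_rw [e] at h
  rw [integral_const_mul, eq_inv_smul_iff₀ (by positivity), RCLike.real_smul_eq_coe_mul] at h
  rw [← h, RCLike.ofReal_mul, mul_assoc]

theorem integral_ensembleLaw_scale {𝕜 : Type*} [RCLike 𝕜] {n : ℕ} {s : ℝ} (hs : 0 < s)
    (c b : Fin n → ℝ) (F : (Fin n → ℝ) → 𝕜) :
    ∫ x, F x ∂ensembleLaw s c b = ∫ x, F (√s • x) ∂ensembleLaw 1 (√s • c) (√s • b) := by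
  obtain ⟨κ, hκ, h⟩ := setIntegral_weylChamber_smul (𝕜 := 𝕜) hs c b
  rw [integral_ensembleLaw hs, integral_ensembleLaw one_pos, h]
  have h1 := h (fun _ => 1)
  simp only [one_mul] at h1
  have e : ∀ (s : ℝ) (c b : Fin n → ℝ), ∫ x in weylChamber n, (ensembleDensity s c b x : 𝕜) =
      (ensembleMass s c b : 𝕜) := fun s c b => integral_ofReal
  rw [e, e] at h1
  rw [h1, mul_div_mul_left _ _ (by simpa using hκ.ne')]

theorem ensembleLaw_real_scale {s : ℝ} (hs : 0 < s) (c b : Fin n → ℝ)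
    {S : Set (Fin n → ℝ)} (hS : MeasurableSet S) : (ensembleLaw s c b).real S =
      (ensembleLaw 1 (√s • c) (√s • b)).real {x | √s • x ∈ S} := by
  have h := integral_ensembleLaw_scale (𝕜 := ℝ) hs c b (S.indicator 1)
  have hS' : MeasurableSet {x : Fin n → ℝ | √s • x ∈ S} := (measurable_const_smul (√s)) hS
  rw [integral_indicator_one hS] at h
  rw [h, ← integral_indicator_one hS']
  rfl

/-! ### Andréief's identity -/

/-- The permuted chambers are disjoint and cover all configurations with distinct coordinates; the
rest lies in finitely many hyperplanes. -/
theorem sum_integral_weylChamber_perm {E : Type*} [NormedAddCommGroup E] [NormedSpace ℝ E] {n : ℕ}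
    {Q : (Fin n → ℝ) → E} (hQ : Integrable Q) :
    ∑ σ : Equiv.Perm (Fin n), ∫ x in weylChamber n, Q (x ∘ σ) = ∫ x, Q x := by
  set A : Equiv.Perm (Fin n) → Set (Fin n → ℝ) := fun σ => {y | y ∘ σ.symm ∈ weylChamber n} with hA
  have hmp : ∀ σ : Equiv.Perm (Fin n), ∃ e : (Fin n → ℝ) ≃ᵐ (Fin n → ℝ),
      MeasurePreserving e volume volume ∧ ∀ x, e x = x ∘ σ := by
    intro σ
    refine ⟨MeasurableEquiv.piCongrLeft (fun _ => ℝ) σ.symm,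
      volume_measurePreserving_piCongrLeft (fun _ => ℝ) σ.symm, fun x => ?_⟩
    ext i
    have := MeasurableEquiv.piCongrLeft_apply_apply (β := fun _ : Fin n => ℝ) σ.symm x (σ i)
    simpa using this
  have hmeas : ∀ σ, MeasurableSet (A σ) := fun σ => by
    obtain ⟨e, -, he⟩ := hmp σ.symm
    have : A σ = e ⁻¹' weylChamber n := by ext y; simp [hA, he]
    rw [this]
    exact e.measurable (measurableSet_weylChamber n)
  have h1 : ∀ σ : Equiv.Perm (Fin n), ∫ x in weylChamber n, Q (x ∘ σ) = ∫ x in A σ, Q x := by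
    intro σ
    obtain ⟨e, hmpe, he⟩ := hmp σ
    have := hmpe.setIntegral_preimage_emb e.measurableEmbedding Q (A σ)
    rw [← this]
    have hpre : e ⁻¹' (A σ) = weylChamber n := by
      ext x
      simp only [hA, Set.mem_preimage, Set.mem_ofPred_eq, he]
      rw [Function.comp_assoc]
      simp
    rw [hpre]
    simp_rw [he]
  simp_rw [h1]
  have hdisj : Pairwise (Function.onFun Disjoint A) := by
    intro σ τ hst
    refine Set.disjoint_left.2 fun y hy1 hy2 => hst ?_
    have hy1' : StrictMono (y ∘ σ.symm) := hy1
    have hy2' : StrictMono (y ∘ τ.symm) := hy2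
    have : y ∘ σ.symm = y ∘ τ.symm := Tuple.unique_monotone hy1'.monotone hy2'.monotone
    have hinj : Injective y := by
      intro a b hab
      have : (y ∘ σ.symm) (σ a) = (y ∘ σ.symm) (σ b) := by simpa using hab
      exact σ.injective (hy1'.injective this)
    have h2 : σ.symm = τ.symm := by
      ext i
      exact congrArg _ (hinj (congrFun this i))
    have := congrArg Equiv.symm h2
    simpa using this
  have hae : ∀ᵐ x : Fin n → ℝ, x ∈ ⋃ σ, A σ := by
    have hne : ∀ i j : Fin n, i ≠ j → ∀ᵐ x : Fin n → ℝ, x i ≠ x j := by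
      intro i j hij
      let p : Fin n → (Fin n → ℝ) →ₗ[ℝ] ℝ := fun k => LinearMap.proj k
      have hlt : LinearMap.ker (p i - p j) ≠ ⊤ := by
        intro h
        have : Pi.single i (1 : ℝ) ∈ LinearMap.ker (p i - p j) := h ▸ Submodule.mem_top
        rw [LinearMap.mem_ker] at this
        simp [p, hij.symm] at this
      have := Measure.addHaar_submodule (volume : Measure (Fin n → ℝ)) _ hlt
      refine measure_mono_null ?_ this
      intro x hx
      simp only [Set.mem_compl_iff, Set.mem_ofPred_eq, ne_eq, not_not] at hx
      simp [p, LinearMap.mem_ker, hx]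
    have : ∀ᵐ x : Fin n → ℝ, ∀ i j, i ≠ j → x i ≠ x j := by
      refine ae_all_iff.2 fun i => ae_all_iff.2 fun j => ?_
      by_cases hij : i = j
      · simp [hij]
      · filter_upwards [hne i j hij] with x hx _ using hx
    filter_upwards [this] with x hx
    have hinj : Injective x := fun i j h => by
      by_contra hij
      exact hx i j hij h
    refine Set.mem_iUnion.2 ⟨(Tuple.sort x).symm, ?_⟩
    exact (Tuple.monotone_sort x).strictMono_of_injective (hinj.comp (Equiv.injective _))
  rw [← integral_iUnion_fintype hmeas hdisj fun _ => hQ.integrableOn, Measure.restrict_eq_self_of_ae_mem hae]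

/-- Andréief's identity on the Weyl chamber. -/
theorem integral_det_mul_det (f g : Fin n → ℝ → ℂ) (h : ∀ i j, Integrable fun x => f i x * g j x) :
    ∫ x in weylChamber n, (of fun i j => f j (x i)).det * (of fun i j => g j (x i)).det =
      (of fun i j => ∫ x, f i x * g j x).det := by
  -- The determinant of `f i (x i) * g j (x i)` is `∏ f i (x i)` times `det g`, and its integral
  -- over the whole space is the right-hand side. Folding it onto the chamber antisymmetrizes the
  -- product into `det f`.
  have hQ := det_integral_eq (n := n) volume (fun i j x => f i x * g j x) h
  have e1 : ∀ x : Fin n → ℝ, (of fun i j => f i (x i) * g j (x i)).det =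
      (∏ i, f i (x i)) * (of fun i j => g j (x i)).det := fun x => by
    rw [← det_mul_column]; rfl
  simp_rw [e1] at hQ
  rw [← hQ.2, ← volume_pi, ← sum_integral_weylChamber_perm hQ.1]
  have e2 : ∀ (σ : Equiv.Perm (Fin n)) (x : Fin n → ℝ), (of fun i j => g j ((x ∘ σ) i)).det =
        ((Equiv.Perm.sign σ : ℤ) : ℂ) * (of fun i j => g j (x i)).det := fun σ x => by
    rw [← Matrix.det_permute]; rfl
  have hint : ∀ σ : Equiv.Perm (Fin n), IntegrableOn (fun x : Fin n → ℝ =>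
      (∏ i, f i ((x ∘ σ) i)) * (of fun i j => g j ((x ∘ σ) i)).det) (weylChamber n) := by
    intro σ
    have hmp := volume_measurePreserving_piCongrLeft (fun _ : Fin n => ℝ) σ.symm
    have h3 := (hmp.integrable_comp_emb (MeasurableEquiv.measurableEmbedding _)).2 hQ.1
    refine (h3.congr (.of_forall fun x => ?_)).integrableOn
    have : (MeasurableEquiv.piCongrLeft (fun _ : Fin n => ℝ) σ.symm) x = x ∘ σ := by
      ext i
      have := MeasurableEquiv.piCongrLeft_apply_apply (β := fun _ : Fin n => ℝ) σ.symm x (σ i)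
      simpa using this
    simp only [comp_apply, this]
  rw [← integral_finsetSum _ fun σ _ => hint σ]
  refine integral_congr_ae (.of_forall fun x => ?_)
  beta_reduce
  rw [Matrix.det_apply', Finset.sum_mul]
  simp_rw [e2]
  rw [← Equiv.sum_comp (Equiv.inv (Equiv.Perm (Fin n)))]
  rw [← Equiv.sum_comp (Equiv.inv (Equiv.Perm (Fin n)))]
  refine sum_congr rfl fun σ _ => ?_
  simp only [of_apply, comp_apply, Equiv.inv_apply, inv_inv]
  ring

/-! ### The Gaussian transform of polynomials and biorthogonal functions -/

/-- The polynomials `h k` with `h k * exp (-y²) = (-d/dy)^k (exp (-y²) / √π)`. -/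
noncomputable def gaussPoly : ℕ → Polynomial ℂ
  | 0 => Polynomial.C ((1 / √π : ℝ) : ℂ)
  | k + 1 => Polynomial.C 2 * Polynomial.X * gaussPoly k - Polynomial.derivative (gaussPoly k)

theorem natDegree_gaussPoly_le (k : ℕ) : (gaussPoly k).natDegree ≤ k := by
  induction k with
  | zero => simp [gaussPoly]
  | succ k ih =>
    rw [gaussPoly]
    refine (Polynomial.natDegree_sub_le _ _).trans (max_le ?_ ?_)
    · refine Polynomial.natDegree_mul_le.trans ?_
      have : (Polynomial.C (2 : ℂ) * Polynomial.X).natDegree ≤ 1 := 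
        (Polynomial.natDegree_C_mul_le _ _).trans Polynomial.natDegree_X_le
      omega
    · exact (Polynomial.natDegree_derivative_le _).trans (by omega)

/-- The linear extension of `X ^ k ↦ h k`, designed so that the two-sided Laplace transform of the
result times `exp (-y²)` is `q(w) exp (w²/4)`. -/
noncomputable def gaussTransform (q : Polynomial ℂ) : Polynomial ℂ := q.sum fun k a => Polynomial.C a * gaussPoly k

theorem gaussTransform_add (p q : Polynomial ℂ) : gaussTransform (p + q) = gaussTransform p + gaussTransform q :=
  Polynomial.sum_add_index _ _ _ (by simp) (by intros; simp [add_mul])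

theorem gaussTransform_monomial (k : ℕ) (a : ℂ) :
    gaussTransform (Polynomial.C a * Polynomial.X ^ k) = Polynomial.C a * gaussPoly k := by
  rw [gaussTransform, Polynomial.C_mul_X_pow_eq_monomial, Polynomial.sum_monomial_index]
  simp

theorem natDegree_gaussTransform_le (q : Polynomial ℂ) : (gaussTransform q).natDegree ≤ q.natDegree := by
  rw [gaussTransform, Polynomial.sum_def]
  refine Polynomial.natDegree_sum_le_of_forall_le _ _ fun k hk => ?_
  refine (Polynomial.natDegree_C_mul_le _ _).trans ((natDegree_gaussPoly_le k).trans ?_)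
  exact Polynomial.le_natDegree_of_mem_supp k hk

theorem exists_norm_eval_le (q : Polynomial ℂ) (m : ℂ) : ∃ C A : ℝ, 0 ≤ C ∧ 0 ≤ A ∧
    ∀ (c : ℝ) (v : ℝ), ‖q.eval (c + v * m)‖ ≤ C * rexp (A * (|c| + |v|)) := by
  induction q using Polynomial.induction_on' with
  | add p q hp hq =>
    obtain ⟨C, A, hC, hA, h⟩ := hp
    obtain ⟨C', A', hC', hA', h'⟩ := hq
    refine ⟨C + C', A + A', by positivity, by positivity, fun c v => ?_⟩
    rw [eval_add, add_mul]
    refine (norm_add_le _ _).trans (add_le_add ((h c v).trans ?_) ((h' c v).trans ?_)) <;>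
    · gcongr; simp [hA, hA']
  | monomial k a =>
    refine ⟨‖a‖, k * (1 + ‖m‖), by positivity, by positivity, fun c v => ?_⟩
    rw [Polynomial.eval_monomial, norm_mul, norm_pow, mul_assoc (k : ℝ), exp_nat_mul]
    gcongr
    have h1 : ‖(c : ℂ) + v * m‖ ≤ |c| + |v| * ‖m‖ := by
      refine (norm_add_le _ _).trans ?_
      simp
    have h2 : |c| + |v| * ‖m‖ ≤ (1 + ‖m‖) * (|c| + |v|) := by
      nlinarith [abs_nonneg c, abs_nonneg v, norm_nonneg m, mul_nonneg (norm_nonneg m) (abs_nonneg c)]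
    linarith [add_one_le_exp ((1 + ‖m‖) * (|c| + |v|))]

theorem integrable_poly_gauss_exp (q : Polynomial ℂ) (w : ℂ) :
    Integrable fun y : ℝ => q.eval (y : ℂ) * cexp (-(y : ℂ) ^ 2) * cexp (w * y) := by
  obtain ⟨C, A, hC, hA, h⟩ := exists_norm_eval_le q 1
  refine ((integrable_exp_abs_sub_sq one_pos (A + ‖w‖)).const_mul C).mono'
    (Continuous.aestronglyMeasurable (by fun_prop)) (.of_forall fun y => ?_)
  have h0 := h 0 y
  simp only [Complex.ofReal_zero, zero_add, mul_one, abs_zero] at h0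
  rw [norm_mul, norm_mul, norm_exp, norm_exp]
  have e1 : (-(y : ℂ) ^ 2).re = - y ^ 2 := by rw [← Complex.ofReal_pow, ← Complex.ofReal_neg, ofReal_re]
  have e2 : (w * y).re ≤ ‖w‖ * |y| := by
    refine (re_le_norm _).trans ?_
    simp
  rw [e1]
  calc _ ≤ C * rexp (A * |y|) * rexp (- y ^ 2) * rexp (‖w‖ * |y|) := by gcongr
    _ = _ := by
      rw [mul_assoc, mul_assoc, ← exp_add, ← exp_add]
      congr 2; ring

theorem hasDerivAt_poly_gauss (q : Polynomial ℂ) (y : ℝ) :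
    HasDerivAt (fun y : ℝ => q.eval (y : ℂ) * cexp (-(y : ℂ) ^ 2))
      (-((Polynomial.C 2 * Polynomial.X * q - Polynomial.derivative q).eval (y : ℂ) * cexp (-(y : ℂ) ^ 2))) y := by
  have h1 : HasDerivAt (fun z : ℂ => q.eval z * cexp (-z ^ 2))
      (-((Polynomial.C 2 * Polynomial.X * q - Polynomial.derivative q).eval (y : ℂ) *
        cexp (-(y : ℂ) ^ 2))) (y : ℂ) := by
    have := (q.hasDerivAt (y : ℂ)).mul (((hasDerivAt_id (y : ℂ)).pow 2).neg.cexp)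
    refine this.congr_deriv ?_
    simp
    ring
  exact h1.comp_ofReal

/-- Each step in `k` is one integration by parts, which moves a derivative onto `exp (w y)` and
produces a factor `w`; the case `k = 0` is the Gaussian integral. -/
theorem integral_gaussPoly_exp (k : ℕ) (w : ℂ) :
    ∫ y : ℝ, (gaussPoly k).eval (y : ℂ) * cexp (-(y : ℂ) ^ 2) * cexp (w * y) = w ^ k * cexp (w ^ 2 / 4) := by
  induction k with
  | zero =>
    simp only [gaussPoly, eval_C, mul_assoc, integral_const_mul, ← Complex.exp_add]
    have h := integral_cexp_quadratic (b := -1) (by simp) w 0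
    have e : ∀ y : ℝ, -(y : ℂ) ^ 2 + w * y = -1 * (y : ℂ) ^ 2 + w * y + 0 := fun y => by ring
    simp_rw [e]
    rw [h]
    have h2 : ((π : ℂ) / - -1) ^ (1 / 2 : ℂ) = ((√π : ℝ) : ℂ) := by
      rw [neg_neg, div_one, Real.sqrt_eq_rpow, Complex.ofReal_cpow pi_pos.le]
      norm_num
    rw [h2, ← mul_assoc, ← Complex.ofReal_mul, one_div_mul_cancel (sqrt_pos.2 pi_pos).ne']
    simp
    ring_nf
  | succ k ih =>
    have hv : ∀ y : ℝ, HasDerivAt (fun y : ℝ => cexp (w * y)) (w * cexp (w * y)) y := by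
      intro y
      have : HasDerivAt (fun z : ℂ => cexp (w * z)) (w * cexp (w * y)) (y : ℂ) := by
        refine (((hasDerivAt_id (y : ℂ)).const_mul w).cexp).congr_deriv ?_
        simp; ring
      exact this.comp_ofReal
    have h := integral_mul_deriv_eq_deriv_mul_of_integrable
      (u := fun y : ℝ => (gaussPoly k).eval (y : ℂ) * cexp (-(y : ℂ) ^ 2))
      (v := fun y : ℝ => cexp (w * y)) (fun y _ => hasDerivAt_poly_gauss _ y) (fun y _ => hv y) ?_ ?_ ?_
    · have e1 : ∀ y : ℝ, (gaussPoly k).eval (y : ℂ) * cexp (-(y : ℂ) ^ 2) *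
          (w * cexp (w * y)) = w * ((gaussPoly k).eval (y : ℂ) * cexp (-(y : ℂ) ^ 2) *
          cexp (w * y)) := fun y => by ring
      simp_rw [e1, neg_mul] at h
      rw [integral_const_mul, ih, integral_neg, neg_neg] at h
      rw [gaussPoly, ← h]; ring
    · have := (integrable_poly_gauss_exp (gaussPoly k) w).const_mul w
      refine this.congr (.of_forall fun y => ?_)
      simp only [Pi.mul_apply]; ring
    · have := (integrable_poly_gauss_exp (gaussPoly (k + 1)) w).neg
      refine this.congr (.of_forall fun y => ?_)
      simp only [Pi.mul_apply, Pi.neg_apply, gaussPoly]; ring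
    · exact integrable_poly_gauss_exp _ w

theorem integral_gaussTransform_exp (q : Polynomial ℂ) (w : ℂ) :
    ∫ y : ℝ, (gaussTransform q).eval (y : ℂ) * cexp (-(y : ℂ) ^ 2) * cexp (w * y) = q.eval w * cexp (w ^ 2 / 4) := by
  induction q using Polynomial.induction_on' with
  | add p q hp hq =>
    simp only [gaussTransform_add, eval_add, add_mul]
    rw [integral_add (integrable_poly_gauss_exp _ w) (integrable_poly_gauss_exp _ w), hp, hq]
  | monomial k a =>
    rw [← Polynomial.C_mul_X_pow_eq_monomial, gaussTransform_monomial]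
    simp only [eval_mul, eval_C, mul_assoc, integral_const_mul, eval_pow, eval_X]
    rw [← integral_gaussPoly_exp]
    simp only [mul_assoc]

/-- The Lagrange basis polynomial of the nodes `b`. -/
noncomputable def nodeBasis (b : Fin n → ℝ) (j : Fin n) : Polynomial ℂ :=
  Lagrange.basis Finset.univ (fun i => (b i : ℂ)) j

/-- The constant `exp (-b j² / 4)` compensates the factor `exp (w² / 4)` in the Laplace transform of
`rightFun`, so that the two families are exactly dual. -/
noncomputable def leftFun (b : Fin n → ℝ) (j : Fin n) (x : ℝ) : ℂ := cexp (b j * x - b j ^ 2 / 4)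

noncomputable def rightFun (b : Fin n → ℝ) (j : Fin n) (y : ℝ) : ℂ :=
  (gaussTransform (nodeBasis b j)).eval (y : ℂ) * cexp (-(y : ℂ) ^ 2)

theorem continuous_leftFun (b : Fin n → ℝ) (j : Fin n) : Continuous (leftFun b j) := by unfold leftFun; fun_prop

theorem leftFun_mul_rightFun (b : Fin n → ℝ) (i j : Fin n) (x : ℝ) :
    leftFun b i x * rightFun b j x = cexp (-(b i : ℂ) ^ 2 / 4) *
      ((gaussTransform (nodeBasis b j)).eval (x : ℂ) * cexp (-(x : ℂ) ^ 2) * cexp (b i * x)) := by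
  rw [leftFun, rightFun, sub_eq_add_neg, Complex.exp_add, neg_div]; ring

theorem integrable_leftFun_mul_rightFun (b : Fin n → ℝ) (i j : Fin n) :
    Integrable fun x => leftFun b i x * rightFun b j x := by
  simp_rw [leftFun_mul_rightFun]
  exact (integrable_poly_gauss_exp _ _).const_mul _

theorem nodeBasis_eval {b : Fin n → ℝ} (hb : Injective b) (i j : Fin n) :
    (nodeBasis b j).eval (b i : ℂ) = if i = j then 1 else 0 := by
  have hinj : Set.InjOn (fun i => (b i : ℂ)) (Finset.univ : Finset (Fin n)) :=
    fun i _ j _ h => hb (Complex.ofReal_injective h)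
  split_ifs with h
  · subst h
    exact Lagrange.eval_basis_self hinj (mem_univ _)
  · exact Lagrange.eval_basis_of_ne (v := fun i => (b i : ℂ)) (Ne.symm h) (mem_univ _)

/-- Pairing with `exp (b i x)` evaluates the Lagrange basis polynomial at the node `b i`. -/
theorem integral_leftFun_mul_rightFun {b : Fin n → ℝ} (hb : Injective b)
    (i j : Fin n) : ∫ x, leftFun b i x * rightFun b j x = if i = j then 1 else 0 := by
  simp_rw [leftFun_mul_rightFun]
  rw [integral_const_mul, integral_gaussTransform_exp, nodeBasis_eval hb, mul_left_comm, ← Complex.exp_add]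
  simp [neg_div]

theorem natDegree_nodeBasis_lt {b : Fin n → ℝ} (hb : Injective b) (j : Fin n) : (nodeBasis b j).natDegree < n := by
  have hinj : Set.InjOn (fun i => (b i : ℂ)) (Finset.univ : Finset (Fin n)) :=
    fun i _ j _ h => hb (Complex.ofReal_injective h)
  rw [nodeBasis, Lagrange.natDegree_basis hinj (mem_univ _)]
  have := j.pos
  simp; omega

/-- The transforms have degree below `n`, so their matrix is a Vandermonde matrix times a matrix of
coefficients. The constant need not be computed, or even known to be nonzero: normalization
determines it later. -/
theorem exists_det_rightFun_eq {b : Fin n → ℝ} (hb : Injective b) :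
    ∃ κ : ℂ, ∀ x : Fin n → ℝ, (of fun i j => rightFun b j (x i)).det =
      κ * (((vandermonde x).det * rexp (-∑ i, x i ^ 2) : ℝ) : ℂ) := by
  refine ⟨(of fun i j : Fin n => (gaussTransform (nodeBasis b j)).coeff i).det, fun x => ?_⟩
  have h1 : (of fun i j => rightFun b j (x i)).det = (∏ i, cexp (-(x i : ℂ) ^ 2)) *
        (of fun i j => (gaussTransform (nodeBasis b j)).eval (x i : ℂ)).det := by
    rw [← det_mul_column]
    congr 1
    ext i j
    simp only [of_apply, rightFun]; ring
  have h2 : (of fun i j => (gaussTransform (nodeBasis b j)).eval (x i : ℂ)) = (vandermonde fun i => (x i : ℂ)) *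
        (of fun i j : Fin n => (gaussTransform (nodeBasis b j)).coeff i) := by
    ext i j
    rw [of_apply, Matrix.mul_apply, Polynomial.eval_eq_sum_range'
      ((natDegree_gaussTransform_le _).trans_lt (natDegree_nodeBasis_lt hb j)), Finset.sum_range]
    refine sum_congr rfl fun k _ => ?_
    simp [Matrix.vandermonde_apply, mul_comm]
  rw [h1, h2, det_mul, ← Complex.exp_sum, det_vandermonde, det_vandermonde]
  push_cast
  rw [sum_neg_distrib]
  ring

theorem exists_det_leftFun_eq (b : Fin n → ℝ) : ∃ κ : ℂ, ∀ x : Fin n → ℝ, (of fun i j => leftFun b j (x i)).det =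
      κ * (confluentDet n b x : ℂ) := by
  refine ⟨(∏ j, cexp (-(b j : ℂ) ^ 2 / 4)) * ((vandermonde b).det : ℂ), fun x => ?_⟩
  rw [mul_assoc, ← Complex.ofReal_mul, ← det_exp_mul_eq]
  have : (((of fun i j => rexp (b j * x i)).det : ℝ) : ℂ) = (of fun i j => cexp (b j * x i)).det := by
    have := (Complex.ofRealHom).map_det (of fun i j => rexp (b j * x i))
    rw [Complex.ofRealHom_eq_coe] at this
    rw [this]
    congr 1
    ext i j
    simp
  rw [this, ← det_mul_row]
  congr 1
  ext i j
  simp only [of_apply, leftFun, ← Complex.exp_add]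
  congr 1; ring

theorem exists_det_mul_det_eq_density {b : Fin n → ℝ} (hb : Injective b) :
    ∃ κ : ℂ, ∀ x : Fin n → ℝ, (of fun i j => leftFun b j (x i)).det *
      (of fun i j => rightFun b j (x i)).det = κ * (ensembleDensity 1 0 b x : ℂ) := by
  obtain ⟨κ₁, h₁⟩ := exists_det_leftFun_eq b
  obtain ⟨κ₂, h₂⟩ := exists_det_rightFun_eq hb
  refine ⟨κ₁ * κ₂ * ((vandermonde fun i : Fin n => ((i : ℕ) : ℝ)).det : ℂ), fun x => ?_⟩
  rw [h₁, h₂, ← confluentDet_zero_mul, ensembleDensity]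
  push_cast
  simp only [div_one]
  ring

/-- Andréief gives the unnormalized expectation up to an unknown constant `κ`. For `g = 1` the
determinant is `det 1 = 1` by biorthogonality, so `κ` is the inverse of the mass. -/
theorem integral_prod_ensembleLaw {b : Fin n → ℝ} (hb : Injective b) {g : ℝ → ℂ}
    (hg : Measurable g) {M : ℝ} (hM : ∀ x, ‖g x‖ ≤ M) :
    ∫ x, ∏ i, g (x i) ∂ensembleLaw 1 0 b = (of fun i j => ∫ x, g x * (leftFun b i x * rightFun b j x)).det := by
  obtain ⟨κ, hκ⟩ := exists_det_mul_det_eq_density hb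
  have key : ∀ g : ℝ → ℂ, Measurable g → ∀ M : ℝ, (∀ x, ‖g x‖ ≤ M) →
      (of fun i j => ∫ x, g x * (leftFun b i x * rightFun b j x)).det =
      κ * ∫ x in weylChamber n, (∏ i, g (x i)) * (ensembleDensity 1 0 b x : ℂ) := by
    intro g hg M hM
    have h := integral_det_mul_det (fun i x => g x * leftFun b i x) (rightFun b) (fun i j => by
      have := (integrable_leftFun_mul_rightFun b i j).bdd_mul hg.aestronglyMeasurable (Eventually.of_forall hM)
      simpa only [mul_assoc] using this)
    simp only [mul_assoc] at h
    rw [← h, ← integral_const_mul]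
    refine integral_congr_ae (.of_forall fun x => ?_)
    beta_reduce
    have e := det_mul_column (fun i => g (x i)) (of fun i j => leftFun b j (x i))
    simp only [of_apply] at e
    rw [e, mul_assoc, hκ]
    ring
  have h1 := key (fun _ => 1) measurable_const 1 (by simp)
  have hI : (of fun i j => ∫ x, (1 : ℂ) * (leftFun b i x * rightFun b j x)) = 1 := by
    ext i j
    simp only [one_mul, of_apply, integral_leftFun_mul_rightFun hb, Matrix.one_apply]
  rw [hI, Matrix.det_one] at h1
  simp only [Finset.prod_const_one, one_mul] at h1
  have hm : ∫ x in weylChamber n, (ensembleDensity 1 0 b x : ℂ) = (ensembleMass 1 0 b : ℂ) := integral_ofReal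
  rw [hm] at h1
  have hm0 : (ensembleMass 1 0 b : ℂ) ≠ 0 := mod_cast (ensembleMass_pos one_pos 0 b).ne'
  have h2 : ∫ x, ∏ i, g (x i) ∂ensembleLaw 1 0 b = (∫ x in weylChamber n, (∏ i, g (x i)) *
    (ensembleDensity 1 0 b x : ℂ)) / (ensembleMass 1 0 b : ℂ) := integral_ensembleLaw one_pos 0 b _
  rw [key g hg M hM, h2, div_eq_iff hm0]
  linear_combination (∫ x in weylChamber n, (∏ i, g (x i)) * (ensembleDensity 1 0 b x : ℂ)) * h1

/-! ### Linear statistics and finite-rank Fredholm expansions -/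

noncomputable def statMatrix (b : Fin n → ℝ) (f : ℝ → ℂ) : Matrix (Fin n) (Fin n) ℂ :=
  of fun i j => ∫ x, f x * (leftFun b i x * rightFun b j x)

theorem integral_prod_one_add {b : Fin n → ℝ} (hb : Injective b) {f : ℝ → ℂ}
    (hf : Measurable f) {M : ℝ} (hM : ∀ x, ‖f x‖ ≤ M) :
    ∫ x, ∏ i, (1 + f (x i)) ∂ensembleLaw 1 0 b = (1 + statMatrix b f).det := by
  have h := integral_prod_ensembleLaw hb (g := fun x => 1 + f x) (measurable_const.add hf) (M := 1 + M)
    (fun x => (norm_add_le _ _).trans (by simpa using hM x))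
  rw [h]
  congr 1
  ext i j
  simp only [of_apply, Matrix.add_apply, statMatrix, add_mul, one_mul]
  rw [integral_add (integrable_leftFun_mul_rightFun b i j)
    ((integrable_leftFun_mul_rightFun b i j).bdd_mul hf.aestronglyMeasurable
        (Eventually.of_forall hM)), integral_leftFun_mul_rightFun hb, Matrix.one_apply]

theorem hasDerivAt_det_one_add_smul (M : Matrix (Fin n) (Fin n) ℂ) :
    HasDerivAt (fun z : ℂ => (1 + z • M).det) M.trace 0 := by
  rw [funext fun z : ℂ => Matrix.det_one_add_smul z M]
  have h := ((hasDerivAt_id (0 : ℂ)).const_mul M.trace).const_add 1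
  have h2 : HasDerivAt (fun z : ℂ => Polynomial.eval z
      (1 + (Polynomial.X : Polynomial ℂ) • M.map Polynomial.C).det.divX.divX * z ^ 2) 0 0 := by
    have := (Polynomial.hasDerivAt (1 + (Polynomial.X : Polynomial ℂ) •
      M.map Polynomial.C).det.divX.divX (0 : ℂ)).mul (hasDerivAt_pow 2 (0 : ℂ))
    exact this.congr_deriv (by simp)
  exact (h.add h2).congr_deriv (by simp)

/-- Differentiation of both sides at `z = 0`: the product gives the sum, the determinant gives the
trace. Stated for a general measure, since it is also applied with a symmetrized matrix. -/
theorem integral_sum_eq_of_prod {μ : Measure (Fin n → ℝ)} [IsProbabilityMeasure μ] {f : ℝ → ℂ}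
    (hf : Measurable f) {M : ℝ} (hM : ∀ x, ‖f x‖ ≤ M) {G : Matrix (Fin n) (Fin n) ℂ}
    (h : ∀ z : ℂ, ∫ x, ∏ i, (1 + z * f (x i)) ∂μ = (1 + z • G).det) :
    ∫ x, ∑ i, f (x i) ∂μ = G.trace := by
  have hM0 : 0 ≤ M := (norm_nonneg _).trans (hM 0)
  have hmeas : ∀ i : Fin n, Measurable fun x : Fin n → ℝ => f (x i) := fun i =>
    hf.comp (measurable_pi_apply i)
  have h1 : HasDerivAt (fun z : ℂ => ∫ x, ∏ i, (1 + z * f (x i)) ∂μ)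
      (∫ x, (∑ i, (∏ j ∈ Finset.univ.erase i, (1 + 0 * f (x j))) * f (x i)) ∂μ) 0 := by
    have hb1 : ∀ z ∈ ball (0 : ℂ) 1, ∀ x, ‖1 + z * f x‖ ≤ 1 + M := by
      intro z hz x
      refine (norm_add_le _ _).trans ?_
      rw [norm_one, norm_mul]
      have : ‖z‖ ≤ 1 := by simpa using (mem_ball_zero_iff.1 hz).le
      nlinarith [hM x, norm_nonneg (f x), norm_nonneg z]
    refine (hasDerivAt_integral_of_dominated_loc_of_deriv_le (s := ball (0 : ℂ) 1)
      (F := fun z (x : Fin n → ℝ) => ∏ i, (1 + z * f (x i)))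
      (F' := fun z (x : Fin n → ℝ) => ∑ i, (∏ j ∈ Finset.univ.erase i, (1 + z * f (x j))) * f (x i))
      (bound := fun _ => ∑ i : Fin n, (1 + M) ^ (Finset.univ.erase i).card * M)
      (Metric.ball_mem_nhds 0 one_pos) ?_ ?_ ?_ ?_ ?_ ?_).2
    · refine .of_forall fun z => Measurable.aestronglyMeasurable ?_
      exact Finset.measurable_prod _ fun i _ => measurable_const.add ((hmeas i).const_mul z)
    · simp
    · refine Measurable.aestronglyMeasurable ?_
      exact Finset.measurable_sum _ fun i _ => (Finset.measurable_prod _ fun j _ =>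
        measurable_const.add ((hmeas j).const_mul 0)).mul (hmeas i)
    · refine .of_forall fun x z hz => ?_
      refine (norm_sum_le _ _).trans (sum_le_sum fun i _ => ?_)
      rw [norm_mul, norm_prod, ← prod_const]
      exact mul_le_mul (prod_le_prod (fun _ _ => norm_nonneg _) fun j _ => hb1 z hz _) (hM _)
        (norm_nonneg _) (Finset.prod_nonneg fun _ _ => by positivity)
    · exact integrable_const _
    · refine .of_forall fun x z _ => ?_
      have := HasDerivAt.fun_finsetProd (u := Finset.univ) (f := fun (i : Fin n) (z : ℂ) => 1 + z * f (x i))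
        (f' := fun i => f (x i)) (x := z) (fun i _ => by
          simpa using ((hasDerivAt_id z).mul_const (f (x i))).const_add 1)
      simpa [smul_eq_mul] using this
  have h2 : HasDerivAt (fun z : ℂ => ∫ x, ∏ i, (1 + z * f (x i)) ∂μ) G.trace 0 := by
    simp_rw [h]
    exact hasDerivAt_det_one_add_smul G
  have := h1.unique h2
  simpa using this

theorem integral_sum_ensembleLaw {b : Fin n → ℝ} (hb : Injective b) {f : ℝ → ℂ}
    (hf : Measurable f) {M : ℝ} (hM : ∀ x, ‖f x‖ ≤ M) :
    ∫ x, ∑ i, f (x i) ∂ensembleLaw 1 0 b = ∑ i, ∫ x, f x * (leftFun b i x * rightFun b i x) := by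
  have := isProbabilityMeasure_ensembleLaw one_pos 0 b
  rw [integral_sum_eq_of_prod hf hM (G := statMatrix b f) fun z => ?_]
  · rfl
  · have h := integral_prod_one_add hb (f := fun x => z * f x) (hf.const_mul z) (M := ‖z‖ * M)
      (fun x => by rw [norm_mul]; exact mul_le_mul_of_nonneg_left (hM x) (norm_nonneg _))
    rw [h]
    congr 2
    ext i j
    simp only [statMatrix, of_apply, Matrix.smul_apply, smul_eq_mul, mul_assoc]
    rw [integral_const_mul]

/-- A map that is not injective repeats a row and contributes zero. Each `k`-subset is the image of
`k!` injective maps, and reordering rows and columns together does not change a principal minor. -/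
theorem sum_det_submatrix_eq {n k : ℕ} (M : Matrix (Fin n) (Fin n) ℂ) : ∑ f : Fin k → Fin n, (M.submatrix f f).det =
      (k.factorial : ℂ) * ∑ s ∈ Finset.powersetCard k (Finset.univ : Finset (Fin n)),
        (M.submatrix (Subtype.val : s → Fin n) Subtype.val).det := by
  have h0 : ∑ f : Fin k → Fin n, (M.submatrix f f).det =
      ∑ f : Fin k → Fin n with Injective f, (M.submatrix f f).det := by
    rw [Finset.sum_filter]
    refine sum_congr rfl fun f _ => ?_
    split_ifs with h
    · rfl
    · simp only [Injective, not_forall] at h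
      obtain ⟨a, b, hab, hne⟩ := h
      exact Matrix.det_zero_of_row_eq hne (by ext j; simp [hab])
  rw [h0, mul_sum, ← Finset.sum_fiberwise_of_maps_to (g := fun f => Finset.univ.image f)
    (t := Finset.powersetCard k (Finset.univ : Finset (Fin n)))]
  · refine sum_congr rfl fun s hs => ?_
    have hcard : s.card = k := (Finset.mem_powersetCard.1 hs).2
    set e := s.orderIsoOfFin hcard with he
    have hterm : ∀ σ : Equiv.Perm (Fin k), (M.submatrix (fun i => (e (σ i) : Fin n))
        (fun i => (e (σ i) : Fin n))).det = (M.submatrix (Subtype.val : s → Fin n) Subtype.val).det := by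
      intro σ
      have := Matrix.det_submatrix_equiv_self (σ.trans e.toEquiv) (M.submatrix (Subtype.val : s → Fin n) Subtype.val)
      rw [← this]
      rfl
    have hsum : ∑ σ : Equiv.Perm (Fin k), (M.submatrix (fun i => (e (σ i) : Fin n))
        (fun i => (e (σ i) : Fin n))).det =
        (k.factorial : ℂ) * (M.submatrix (Subtype.val : s → Fin n) Subtype.val).det := by
      simp_rw [hterm]
      simp [Fintype.card_perm]
    rw [← hsum]
    symm
    refine Finset.sum_bij (fun σ _ => fun i => (e (σ i) : Fin n)) ?_ ?_ ?_ ?_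
    · intro σ _
      simp only [Finset.mem_filter, mem_univ, true_and]
      constructor
      · intro a b hab
        exact σ.injective (e.injective (Subtype.ext hab))
      · ext a
        simp only [Finset.mem_image, mem_univ, true_and]
        constructor
        · rintro ⟨i, rfl⟩
          exact (e (σ i)).2
        · intro ha
          exact ⟨σ.symm (e.symm ⟨a, ha⟩), by simp⟩
    · intro σ _ τ _ hst
      ext i
      have := congrFun hst i
      exact congrArg _ (e.injective (Subtype.ext this))
    · intro f hf
      simp only [Finset.mem_filter, mem_univ, true_and] at hf
      have hmem : ∀ i, f i ∈ s := fun i => hf.2 ▸ Finset.mem_image_of_mem _ (mem_univ i)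
      have hinj : Injective fun i => e.symm ⟨f i, hmem i⟩ := by
        intro a b hab
        exact hf.1 (congrArg Subtype.val (e.symm.injective hab))
      refine ⟨Equiv.ofBijective _ (Finite.injective_iff_bijective.1 hinj), mem_univ _, ?_⟩
      ext i
      simp
    · intro σ _
      rfl
  · intro f hf
    have hf' : Injective f := (Finset.mem_filter.1 hf).2
    rw [Finset.mem_powersetCard]
    exact ⟨Finset.subset_univ _, by rw [Finset.card_image_of_injective _ hf']; simp⟩

/-- The coefficients of `det (1 + X M)` are the sums of principal minors; the series is this
polynomial evaluated at `1`. -/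
theorem hasSum_det_one_add (M : Matrix (Fin n) (Fin n) ℂ) :
    HasSum (fun k : ℕ => 1 / (k.factorial : ℂ) * ∑ f : Fin k → Fin n, (M.submatrix f f).det) (1 + M).det := by
  set P := (1 + (Polynomial.X : Polynomial ℂ) • M.map Polynomial.C).det with hP
  have hdeg : P.natDegree < n + 1 := by
    have := Polynomial.natDegree_det_X_add_C_le M 1
    rw [Fintype.card_fin] at this
    rw [hP]
    refine lt_of_le_of_lt (le_of_eq ?_) (Nat.lt_succ_of_le this)
    congr 2
    rw [add_comm]
    congr 1
    ext i j : 2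
    simp [Matrix.one_apply, apply_ite]
  have heval : P.eval 1 = (1 + M).det := by
    have := (Polynomial.evalRingHom (1 : ℂ)).map_det (1 + (Polynomial.X : Polynomial ℂ) • M.map Polynomial.C)
    rw [Polynomial.coe_evalRingHom] at this
    rw [hP, this]
    congr 1
    ext i j
    simp [Matrix.one_apply, apply_ite]
  have hcoeff : ∀ k : ℕ, 1 / (k.factorial : ℂ) * ∑ f : Fin k → Fin n, (M.submatrix f f).det = P.coeff k := fun k => by
    rw [sum_det_submatrix_eq, ← mul_assoc, one_div_mul_cancel (mod_cast k.factorial_ne_zero),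
      one_mul, hP, Matrix.coeff_det_one_add_X_smul_eq_sum_minors]
  simp_rw [hcoeff]
  rw [← heval, Polynomial.eval_eq_sum_range' hdeg]
  simp only [one_pow, mul_one]
  refine hasSum_sum_of_ne_finset_zero fun k hk => Polynomial.coeff_eq_zero_of_natDegree_lt ?_
  simp only [Finset.mem_range, not_lt] at hk
  omega

/-- Expanding the product of sums in each Leibniz term chooses an index `g i` for every variable.
After transposition each summand is a determinant whose row `i` involves only `u i`, so the integral
can be taken row by row. -/
theorem sum_det_submatrix_integral {n k : ℕ} {α : Type*} {mα : MeasurableSpace α} (μ : Measure α)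
    [SigmaFinite μ] (f h : Fin n → α → ℂ) (hfh : ∀ i j, Integrable (fun x => f i x * h j x) μ) :
    Integrable (fun u : Fin k → α => (of fun i j => ∑ l, f l (u i) * h l (u j)).det) (Measure.pi fun _ => μ) ∧
    ∫ u, (of fun i j => ∑ l, f l (u i) * h l (u j)).det ∂(Measure.pi fun _ : Fin k => μ) =
      ∑ g : Fin k → Fin n, ((of fun i j => ∫ x, f i x * h j x ∂μ).submatrix g g).det := by
  have key : ∀ u : Fin k → α, (of fun i j => ∑ l, f l (u i) * h l (u j)).det =
      ∑ g : Fin k → Fin n, (of fun i j => f (g i) (u i) * h (g j) (u i)).det := by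
    intro u
    rw [← Matrix.det_transpose]
    simp only [Matrix.det_apply', of_apply, Matrix.transpose_apply]
    rw [Finset.sum_comm]
    refine sum_congr rfl fun σ _ => ?_
    rw [← mul_sum]
    congr 1
    rw [Finset.prod_univ_sum, Fintype.piFinset_univ]
    refine sum_congr rfl fun g _ => ?_
    rw [prod_mul_distrib, prod_mul_distrib]
    congr 1
    exact (Equiv.prod_comp σ (fun i => f (g i) (u i))).symm
  have hd := fun g : Fin k → Fin n => det_integral_eq μ (fun i j x => f (g i) x * h (g j) x) (fun i j => hfh _ _)
  simp_rw [key]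
  refine ⟨integrable_finsetSum _ fun g _ => (hd g).1, ?_⟩
  rw [integral_finsetSum _ fun g _ => (hd g).1]
  exact sum_congr rfl fun g _ => (hd g).2

theorem hasSum_fredholm_finite (E : Set ℝ) (f h : Fin n → ℝ → ℂ)
    (hfh : ∀ i j, IntegrableOn (fun x => f i x * h j x) E) :
    HasSum (fun k : ℕ => (-1 : ℂ) ^ k / (k.factorial : ℂ) *
      ∫ u in univ.pi (fun _ : Fin k => E), (of fun i j => ∑ l, f l (u i) * h l (u j)).det)
      (1 - of fun i j => ∫ x in E, f i x * h j x).det := by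
  have h1 := hasSum_det_one_add (-of fun i j => ∫ x in E, f i x * h j x)
  rw [← sub_eq_add_neg] at h1
  convert h1 using 1
  funext k
  have h2 := (sum_det_submatrix_integral (k := k) (volume.restrict E) f h hfh).2
  rw [← Measure.restrict_pi_pi, ← volume_pi] at h2
  rw [h2, div_mul_eq_mul_div, one_div_mul_eq_div]
  congr 1
  rw [mul_sum]
  refine sum_congr rfl fun g _ => ?_
  have := Matrix.det_neg ((of fun i j => ∫ x in E, f i x * h j x).submatrix g g)
  rw [Fintype.card_fin] at this
  exact this.symm

/-! ### Hadamard's inequality and convergence of Fredholm series -/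

-- The arithmetic-geometric mean inequality for the eigenvalues. It yields Hadamard's inequality
-- here and the bound on Hermite gap probabilities later.
open scoped ComplexOrder in
theorem Matrix.PosSemidef.det_re_le {k : ℕ} {A : Matrix (Fin k) (Fin k) ℂ} (hA : A.PosSemidef) :
    A.det.re ≤ (A.trace.re / k) ^ k := by
  have hev := hA.eigenvalues_nonneg
  have h1 : A.det.re = ∏ i, hA.1.eigenvalues i := by
    rw [hA.1.det_eq_prod_eigenvalues, ← ofReal_re (∏ i, hA.1.eigenvalues i)]
    push_cast; rfl
  have h2 : A.trace.re = ∑ i, hA.1.eigenvalues i := by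
    rw [hA.1.trace_eq_sum_eigenvalues, ← ofReal_re (∑ i, hA.1.eigenvalues i)]
    push_cast; rfl
  rw [h1, h2]
  rcases Nat.eq_zero_or_pos k with rfl | hk
  · simp
  have hk' : (0 : ℝ) < k := mod_cast hk
  have := Real.geom_mean_le_arith_mean_weighted Finset.univ (fun _ : Fin k => 1 / (k : ℝ))
    hA.1.eigenvalues (fun _ _ => by positivity) (by simp [hk'.ne']) (fun i _ => hev i)
  rw [← mul_sum, Real.finsetProd_rpow _ _ (fun i _ => hev i)] at this
  have hp : 0 ≤ ∏ i, hA.1.eigenvalues i := Finset.prod_nonneg fun i _ => hev i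
  calc ∏ i, hA.1.eigenvalues i = ((∏ i, hA.1.eigenvalues i) ^ (1 / (k : ℝ))) ^ k := by
        rw [← Real.rpow_natCast, ← Real.rpow_mul hp, one_div_mul_cancel hk'.ne', Real.rpow_one]
    _ ≤ _ := by
        refine pow_le_pow_left₀ (Real.rpow_nonneg hp _) (this.trans_eq ?_) k
        ring

open scoped ComplexOrder in
/-- Hadamard's inequality for matrices with bounded entries. -/
theorem norm_det_le_of_norm_le {k : ℕ} {M : Matrix (Fin k) (Fin k) ℂ} {C : ℝ}
    (h : ∀ i j, ‖M i j‖ ≤ C) : ‖M.det‖ ^ 2 ≤ (k * C ^ 2) ^ k := by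
  have h1 := (Matrix.posSemidef_self_mul_conjTranspose M).det_re_le
  have h2 : (M * M.conjTranspose).det.re = ‖M.det‖ ^ 2 := by
    rw [det_mul, Matrix.det_conjTranspose]
    have := Complex.mul_conj M.det
    rw [show star M.det = (starRingEnd ℂ) M.det from rfl, this, ofReal_re, Complex.normSq_eq_norm_sq]
  have h3 : (M * M.conjTranspose).trace.re = ∑ i, ∑ j, ‖M i j‖ ^ 2 := by
    simp only [Matrix.trace, Matrix.diag, Matrix.mul_apply, Matrix.conjTranspose_apply, Complex.re_sum]
    refine sum_congr rfl fun i _ => sum_congr rfl fun j _ => ?_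
    rw [show star (M i j) = (starRingEnd ℂ) (M i j) from rfl, Complex.mul_conj, ofReal_re, Complex.normSq_eq_norm_sq]
  rw [h2, h3] at h1
  refine h1.trans ?_
  rcases Nat.eq_zero_or_pos k with rfl | hk
  · simp
  have hk' : (0 : ℝ) < k := mod_cast hk
  refine pow_le_pow_left₀ (by positivity) ?_ k
  rw [div_le_iff₀ hk']
  calc ∑ i, ∑ j, ‖M i j‖ ^ 2 ≤ ∑ _i : Fin k, ∑ _j : Fin k, C ^ 2 :=
        sum_le_sum fun i _ => sum_le_sum fun j _ =>
          pow_le_pow_left₀ (norm_nonneg _) (h i j) 2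
    _ = _ := by simp; ring

/-- The common form of the kernels before and after the limit, so that convergence of kernels
reduces to convergence of functions of one variable. -/
noncomputable def shiftKernel (φ ψ : ℝ → ℂ) (u v : ℝ) : ℂ := ∫ w in Ioi (0 : ℝ), φ (u + w) * ψ (v + w)

noncomputable def fredholmTerm (K : ℝ → ℝ → ℂ) (E : Set ℝ) (k : ℕ) : ℂ := (-1 : ℂ) ^ k / (k.factorial : ℂ) *
    ∫ u in univ.pi (fun _ : Fin k => E), (of fun i j => K (u i) (u j)).det

local notation "fredholmSum(" K "," E ")" => ∑' k, fredholmTerm K E k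

theorem measurable_shiftKernel {φ ψ : ℝ → ℂ} (hφ : Measurable φ) (hψ : Measurable ψ) :
    Measurable fun p : ℝ × ℝ => shiftKernel φ ψ p.1 p.2 := by
  have : Measurable fun q : (ℝ × ℝ) × ℝ => φ (q.1.1 + q.2) * ψ (q.1.2 + q.2) :=
    (hφ.comp (by fun_prop)).mul (hψ.comp (by fun_prop))
  exact (this.stronglyMeasurable.integral_prod_right').measurable

theorem norm_shift_mul_le {φ ψ : ℝ → ℂ} {c C κ : ℝ} (hφ : ∀ u, c ≤ u → ‖φ u‖ ≤ C * rexp (-κ * u))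
    (hψ : ∀ u, c ≤ u → ‖ψ u‖ ≤ C * rexp (-κ * u)) {u v w : ℝ} (hu : c ≤ u) (hv : c ≤ v) (hw : 0 < w) :
    ‖φ (u + w) * ψ (v + w)‖ ≤ C ^ 2 * rexp (-κ * u) * rexp (-κ * v) * rexp (-(2 * κ) * w) := by
  have hC : 0 ≤ C := by
    have := (norm_nonneg _).trans (hφ c le_rfl)
    exact nonneg_of_mul_nonneg_left this (exp_pos _)
  rw [norm_mul]
  calc _ ≤ (C * rexp (-κ * (u + w))) * (C * rexp (-κ * (v + w))) :=
        mul_le_mul (hφ _ (by linarith)) (hψ _ (by linarith)) (norm_nonneg _) (by positivity)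
    _ = _ := by
        rw [mul_assoc (C ^ 2), mul_assoc (C ^ 2), ← exp_add, ← exp_add, mul_mul_mul_comm, ← exp_add]
        ring_nf

theorem norm_shiftKernel_le {φ ψ : ℝ → ℂ} {c C κ : ℝ} (hκ : 0 < κ) (hφ : ∀ u, c ≤ u → ‖φ u‖ ≤ C * rexp (-κ * u))
    (hψ : ∀ u, c ≤ u → ‖ψ u‖ ≤ C * rexp (-κ * u)) {u v : ℝ} (hu : c ≤ u) (hv : c ≤ v) :
    ‖shiftKernel φ ψ u v‖ ≤ C ^ 2 / (2 * κ) * rexp (-κ * u) * rexp (-κ * v) := by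
  have h2κ : 0 < 2 * κ := by positivity
  refine (norm_integral_le_of_norm_le (g := fun w => C ^ 2 * rexp (-κ * u) * rexp (-κ * v) *
      rexp (-(2 * κ) * w)) ?_ ?_).trans_eq ?_
  · exact (exp_neg_integrableOn_Ioi 0 h2κ).const_mul _
  · refine (ae_restrict_iff' measurableSet_Ioi).2 (.of_forall fun w hw => ?_)
    exact norm_shift_mul_le hφ hψ hu hv hw
  · rw [integral_const_mul, integral_exp_mul_Ioi (by linarith)]
    simp
    field_simp

/-- The exponentials are pulled out of rows and columns, and Hadamard's inequality is applied to the
remaining bounded matrix. The growth `k^{k/2}` is beaten by `k!` in the Fredholm series. -/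
theorem norm_det_kernel_le {K : ℝ → ℝ → ℂ} {c A κ : ℝ} (hA : 0 ≤ A)
    (hK : ∀ u v, c ≤ u → c ≤ v → ‖K u v‖ ≤ A * rexp (-κ * u) * rexp (-κ * v)) {k : ℕ}
    {u : Fin k → ℝ} (hu : ∀ i, c ≤ u i) : ‖(of fun i j => K (u i) (u j)).det‖ ≤
      (√k * A) ^ k * ∏ i, rexp (-(2 * κ) * u i) := by
  set N : Matrix (Fin k) (Fin k) ℂ := of fun i j =>
    K (u i) (u j) * rexp (κ * u i) * rexp (κ * u j) with hN
  have hNb : ∀ i j, ‖N i j‖ ≤ A := by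
    intro i j
    simp only [hN, of_apply]
    rw [norm_mul, norm_mul, norm_real, norm_real, norm_eq_abs, norm_eq_abs, abs_exp, abs_exp]
    calc _ ≤ A * rexp (-κ * u i) * rexp (-κ * u j) * rexp (κ * u i) * rexp (κ * u j) := by
          gcongr; exact hK _ _ (hu i) (hu j)
      _ = A := by
          rw [mul_assoc, mul_assoc, mul_assoc, ← exp_add, ← exp_add, ← exp_add]
          ring_nf; simp
  have hdet : (of fun i j => K (u i) (u j)).det = (∏ i, (rexp (-(2 * κ) * u i) : ℂ)) * N.det := by
    have e : (∏ i, (rexp (-(2 * κ) * u i) : ℂ)) = (∏ i, (rexp (-κ * u i) : ℂ)) * ∏ i, (rexp (-κ * u i) : ℂ) := by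
      rw [← prod_mul_distrib]
      refine prod_congr rfl fun i _ => ?_
      rw [← Complex.ofReal_mul, ← exp_add]; ring_nf
    rw [e, mul_assoc, ← det_mul_column, ← det_mul_row]
    congr 1
    ext i j
    simp only [hN, of_apply]
    have h1 : ∀ x : ℝ, (rexp (-κ * x) : ℂ) * (rexp (κ * x) : ℂ) = 1 := fun x => by
      rw [← Complex.ofReal_mul, ← exp_add]; simp
    linear_combination (-K (u i) (u j) * (rexp (-κ * u i) : ℂ) * (rexp (κ * u i) : ℂ)) * h1 (u j)
      - K (u i) (u j) * h1 (u i)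
  have hb : ‖N.det‖ ≤ (√k * A) ^ k := by
    have := norm_det_le_of_norm_le hNb
    refine (pow_le_pow_iff_left₀ (norm_nonneg _) (by positivity) two_ne_zero).1 ?_
    refine this.trans_eq ?_
    rw [← pow_mul, mul_comm k 2, pow_mul, mul_pow (√k), sq_sqrt (Nat.cast_nonneg k)]
  rw [hdet, norm_mul, norm_prod, mul_comm]
  refine mul_le_mul hb (le_of_eq ?_) (Finset.prod_nonneg fun _ _ => norm_nonneg _) (by positivity)
  refine prod_congr rfl fun i _ => ?_
  rw [norm_real, norm_eq_abs, abs_exp]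

/-- For `x ≥ 0` one has `x ≤ 2^k x² + 2^{-k}`. Squaring removes the root from `√k ^ k`, and then
`k^k ≤ e^k k!` leaves an exponential series plus a geometric one. -/
theorem sqrt_pow_div_factorial_le {a : ℝ} (ha : 0 ≤ a) (k : ℕ) : (√k * a) ^ k / (k.factorial : ℝ) ≤
      (2 * rexp 1 * a ^ 2) ^ k / (k.factorial : ℝ) + (1 / 2) ^ k := by
  have hf : (0 : ℝ) < k.factorial := mod_cast k.factorial_pos
  set x := (√k * a) ^ k / (k.factorial : ℝ) with hx
  have hx0 : 0 ≤ x := by positivity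
  have h1 : (k : ℝ) ^ k ≤ rexp 1 ^ k * k.factorial := by
    have := Real.pow_div_factorial_le_exp (k : ℝ) (Nat.cast_nonneg k) k
    rw [div_le_iff₀ hf] at this
    rwa [← exp_nat_mul, mul_one]
  have h2 : x ^ 2 ≤ (rexp 1 * a ^ 2) ^ k / k.factorial := by
    rw [hx, div_pow, ← pow_mul, mul_comm k 2, pow_mul, mul_pow (√k), sq_sqrt (Nat.cast_nonneg k),
      div_le_div_iff₀ (by positivity) hf, mul_pow, mul_pow]
    have : (0 : ℝ) ≤ (a ^ 2) ^ k * k.factorial := by positivity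
    nlinarith [mul_le_mul_of_nonneg_right h1 this]
  have h3 : x ≤ 2 ^ k * x ^ 2 + (1 / 2) ^ k := by
    have h4 : (2 : ℝ) ^ k * (1 / 2) ^ k = 1 := by rw [← mul_pow]; norm_num
    have h5 : (0 : ℝ) < 2 ^ k := by positivity
    have h6 : (0 : ℝ) < (1 / 2) ^ k := by positivity
    by_cases hc : x ≤ (1 / 2) ^ k
    · have : 0 ≤ 2 ^ k * x ^ 2 := by positivity
      linarith
    · have : 1 ≤ 2 ^ k * x := by
        rw [← h4]; exact mul_le_mul_of_nonneg_left (not_le.1 hc).le h5.le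
      nlinarith
  refine h3.trans ?_
  have : (2 : ℝ) ^ k * x ^ 2 ≤ 2 ^ k * ((rexp 1 * a ^ 2) ^ k / k.factorial) := by gcongr
  refine (add_le_add_left this _).trans_eq ?_
  rw [← mul_div_assoc, ← mul_pow]; ring_nf

theorem summable_sqrt_pow_div_factorial {a : ℝ} (ha : 0 ≤ a) :
    Summable fun k : ℕ => (√k * a) ^ k / (k.factorial : ℝ) :=
  Summable.of_nonneg_of_le (fun _ => by positivity) (sqrt_pow_div_factorial_le ha)
    ((Real.summable_pow_div_factorial _).add (summable_geometric_of_lt_one (by norm_num) (by norm_num)))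

theorem integrable_prod_exp_pi {κ : ℝ} (hκ : 0 < κ) {c : ℝ} {E : Set ℝ} (hE : E ⊆ Ici c) (k : ℕ) :
    IntegrableOn (fun u : Fin k → ℝ => ∏ i, rexp (-κ * u i)) (univ.pi fun _ => E) ∧
    ∫ u in univ.pi (fun _ : Fin k => E), ∏ i, rexp (-κ * u i) ≤ (rexp (-κ * c) / κ) ^ k := by
  have h0 : IntegrableOn (fun x : ℝ => rexp (-κ * x)) (Ici c) :=
    (integrableOn_Ici_iff_integrableOn_Ioi).2 (exp_neg_integrableOn_Ioi c hκ)
  have h1 : IntegrableOn (fun x : ℝ => rexp (-κ * x)) E := h0.mono_set hE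
  have h2 : ∫ x in E, rexp (-κ * x) ≤ rexp (-κ * c) / κ := by
    have := setIntegral_mono_set h0 (.of_forall fun x => (exp_pos _).le) hE.eventuallyLE
    refine this.trans_eq ?_
    rw [integral_Ici_eq_integral_Ioi, integral_exp_mul_Ioi (by linarith)]
    field_simp
  rw [IntegrableOn, volume_pi, Measure.restrict_pi_pi]
  refine ⟨Integrable.fintype_prod (f := fun _ : Fin k => fun x : ℝ => rexp (-κ * x)) fun _ => h1, ?_⟩
  rw [integral_fintype_prod_eq_prod (fun _ : Fin k => fun x : ℝ => rexp (-κ * x)), prod_const]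
  simp only [Finset.card_univ, Fintype.card_fin]
  exact pow_le_pow_left₀ (integral_nonneg fun x => (exp_pos _).le) h2 k

theorem norm_fredholmTerm_le {K : ℝ → ℝ → ℂ} {c A κ : ℝ} (hA : 0 ≤ A) (hκ : 0 < κ)
    (hKm : Measurable fun p : ℝ × ℝ => K p.1 p.2)
    (hK : ∀ u v, c ≤ u → c ≤ v → ‖K u v‖ ≤ A * rexp (-κ * u) * rexp (-κ * v))
    {E : Set ℝ} (hEm : MeasurableSet E) (hE : E ⊆ Ici c) (k : ℕ) :
    IntegrableOn (fun u : Fin k → ℝ => (of fun i j => K (u i) (u j)).det) (univ.pi fun _ => E) ∧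
    ‖fredholmTerm K E k‖ ≤ (√k * (A * (rexp (-(2 * κ) * c) / (2 * κ)))) ^ k / (k.factorial : ℝ) := by
  have hS : MeasurableSet (univ.pi fun _ : Fin k => E) := MeasurableSet.univ_pi fun _ => hEm
  have hp := integrable_prod_exp_pi (κ := 2 * κ) (by positivity) hE k
  have hb : ∀ᵐ u : Fin k → ℝ ∂volume.restrict (univ.pi fun _ => E), ‖(of fun i j => K (u i) (u j)).det‖ ≤
        (√k * A) ^ k * ∏ i, rexp (-(2 * κ) * u i) :=
    (ae_restrict_iff' hS).2 (.of_forall fun u hu =>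
      norm_det_kernel_le hA hK fun i => hE (hu i trivial))
  have hm : Measurable fun u : Fin k → ℝ => (of fun i j => K (u i) (u j)).det := by
    simp only [Matrix.det_apply', of_apply]
    refine Finset.measurable_sum _ fun σ _ => (Finset.measurable_prod _ fun i _ => ?_).const_mul _
    have hp : Measurable fun u : Fin k → ℝ => (u (σ i), u i) :=
      (measurable_pi_apply (σ i)).prodMk (measurable_pi_apply i)
    exact hKm.comp hp
  refine ⟨(hp.1.const_mul _).mono' hm.aestronglyMeasurable hb, ?_⟩
  rw [fredholmTerm, norm_mul, norm_div, norm_pow, norm_neg, norm_one, one_pow, Complex.norm_natCast,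
    one_div, inv_mul_eq_div]
  have hf : (0 : ℝ) < k.factorial := mod_cast k.factorial_pos
  refine div_le_div_of_nonneg_right ?_ hf.le
  refine (norm_integral_le_of_norm_le (hp.1.const_mul _) hb).trans ?_
  rw [integral_const_mul, ← mul_assoc, mul_pow (√k * A)]
  exact mul_le_mul_of_nonneg_left hp.2 (by positivity)

theorem hasFredholmDet_of_bound {K : ℝ → ℝ → ℂ} {c A κ : ℝ} (hA : 0 ≤ A) (hκ : 0 < κ)
    (hKm : Measurable fun p : ℝ × ℝ => K p.1 p.2)
    (hK : ∀ u v, c ≤ u → c ≤ v → ‖K u v‖ ≤ A * rexp (-κ * u) * rexp (-κ * v))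
    {E : Set ℝ} (hEm : MeasurableSet E) (hE : E ⊆ Ici c) :
    HasFredholmDet K E (fredholmSum(K,E)) := by
  have h := norm_fredholmTerm_le hA hκ hKm hK hEm hE
  refine ⟨fun k => (h k).1, ?_⟩
  exact (Summable.of_norm_bounded (summable_sqrt_pow_div_factorial (by positivity))
    fun k => (h k).2).hasSum

/-- Dominated convergence at three levels: in the shift integral, in each `k`-fold integral, and in
the sum over `k`, where the majorant comes from Hadamard's inequality and is uniform along the
filter. -/
theorem tendsto_fredholm {ι : Type*} {l : Filter ι} [l.IsCountablyGenerated] [l.NeBot]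
    {Φ Ψ : ι → ℝ → ℂ} {φ ψ : ℝ → ℂ} {c C κ : ℝ} (hκ : 0 < κ)
    (hΦm : ∀ i, Measurable (Φ i)) (hΨm : ∀ i, Measurable (Ψ i)) (hφm : Measurable φ)
    (hψm : Measurable ψ)
    (hΦ : ∀ᶠ i in l, ∀ u, c ≤ u → ‖Φ i u‖ ≤ C * rexp (-κ * u))
    (hΨ : ∀ᶠ i in l, ∀ u, c ≤ u → ‖Ψ i u‖ ≤ C * rexp (-κ * u))
    (hΦt : ∀ u, c ≤ u → Tendsto (fun i => Φ i u) l (𝓝 (φ u)))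
    (hΨt : ∀ u, c ≤ u → Tendsto (fun i => Ψ i u) l (𝓝 (ψ u)))
    {E : Set ℝ} (hEm : MeasurableSet E) (hE : E ⊆ Ici c) :
    HasFredholmDet (shiftKernel φ ψ) E (fredholmSum(shiftKernel φ ψ,E)) ∧
    Tendsto (fun i => fredholmSum(shiftKernel (Φ i) (Ψ i),E)) l (𝓝 (fredholmSum(shiftKernel φ ψ,E))) ∧
    (∀ u v, c ≤ u → c ≤ v → Tendsto (fun i => shiftKernel (Φ i) (Ψ i) u v) l (𝓝 (shiftKernel φ ψ u v))) := by
  have hφ : ∀ u, c ≤ u → ‖φ u‖ ≤ C * rexp (-κ * u) := fun u hu =>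
    le_of_tendsto (hΦt u hu).norm (hΦ.mono fun i h => h u hu)
  have hψ : ∀ u, c ≤ u → ‖ψ u‖ ≤ C * rexp (-κ * u) := fun u hu =>
    le_of_tendsto (hΨt u hu).norm (hΨ.mono fun i h => h u hu)
  have hA : 0 ≤ C ^ 2 / (2 * κ) := by positivity
  have hKt : ∀ u v, c ≤ u → c ≤ v → Tendsto (fun i => shiftKernel (Φ i) (Ψ i) u v) l (𝓝 (shiftKernel φ ψ u v)) := by
    intro u v hu hv
    refine tendsto_integral_filter_of_dominated_convergence
      (fun w => C ^ 2 * rexp (-κ * u) * rexp (-κ * v) * rexp (-(2 * κ) * w)) ?_ ?_ ?_ ?_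
    · exact .of_forall fun i =>
        (((hΦm i).comp (by fun_prop)).mul ((hΨm i).comp (by fun_prop))).aestronglyMeasurable
    · filter_upwards [hΦ, hΨ] with i h1 h2
      exact (ae_restrict_iff' measurableSet_Ioi).2 (.of_forall fun w hw =>
        norm_shift_mul_le h1 h2 hu hv hw)
    · exact (exp_neg_integrableOn_Ioi 0 (by positivity)).const_mul _
    · refine (ae_restrict_iff' measurableSet_Ioi).2 (.of_forall fun w hw => ?_)
      have hw' : 0 < w := hw
      exact (hΦt _ (by linarith)).mul (hΨt _ (by linarith))
  refine ⟨hasFredholmDet_of_bound hA hκ (measurable_shiftKernel hφm hψm)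
    (fun u v hu hv => norm_shiftKernel_le hκ hφ hψ hu hv) hEm hE, ?_, hKt⟩
  refine tendsto_tsum_of_dominated_convergence
    (summable_sqrt_pow_div_factorial (a := C ^ 2 / (2 * κ) * (rexp (-(2 * κ) * c) / (2 * κ))) (by positivity)) ?_ ?_
  · intro k
    refine Tendsto.const_mul _ ?_
    have hS : MeasurableSet (univ.pi fun _ : Fin k => E) := MeasurableSet.univ_pi fun _ => hEm
    refine tendsto_integral_filter_of_dominated_convergence
      (fun u => (√k * (C ^ 2 / (2 * κ))) ^ k * ∏ i, rexp (-(2 * κ) * u i)) ?_ ?_ ?_ ?_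
    · filter_upwards [hΦ, hΨ] with i h1 h2
      exact (norm_fredholmTerm_le hA hκ (measurable_shiftKernel (hΦm i) (hΨm i))
        (fun u v hu hv => norm_shiftKernel_le hκ h1 h2 hu hv) hEm hE k).1.aestronglyMeasurable
    · filter_upwards [hΦ, hΨ] with i h1 h2
      exact (ae_restrict_iff' hS).2 (.of_forall fun u hu =>
        norm_det_kernel_le hA (fun u v hu hv => norm_shiftKernel_le hκ h1 h2 hu hv)
          fun i => hE (hu i trivial))
    · exact (integrable_prod_exp_pi (by positivity) hE k).1.const_mul _
    · refine (ae_restrict_iff' hS).2 (.of_forall fun u hu => ?_)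
      simp only [Matrix.det_apply', of_apply]
      refine tendsto_finsetSum _ fun σ _ => Tendsto.const_mul _ (tendsto_finsetProd _ fun j _ => ?_)
      exact hKt _ _ (hE (hu _ trivial)) (hE (hu _ trivial))
  · filter_upwards [hΦ, hΨ] with i h1 h2 k
    exact (norm_fredholmTerm_le hA hκ (measurable_shiftKernel (hΦm i) (hΨm i))
      (fun u v hu hv => norm_shiftKernel_le hκ h1 h2 hu hv) hEm hE k).2

/-- Row factors and column factors cancel. This freedom absorbs the diverging prefactors before the
limit and the exponential tilts that balance the two factors of a shift kernel. -/
theorem det_kernel_conj {K K' : ℝ → ℝ → ℂ} {d : ℝ → ℂ} (hd : ∀ u, d u ≠ 0)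
    (h : ∀ u v, K' u v = d u * K u v * (d v)⁻¹) {k : ℕ} (u : Fin k → ℝ) :
    (of fun i j => K' (u i) (u j)).det = (of fun i j => K (u i) (u j)).det := by
  have e : (of fun i j => K' (u i) (u j)) = of fun i j => d (u i) *
      (of fun i j => (d (u j))⁻¹ * (of fun i j => K (u i) (u j)) i j) i j := by
    ext i j
    simp only [of_apply, h]; ring
  rw [e, det_mul_column (fun i => d (u i)), det_mul_row (fun j => (d (u j))⁻¹), ← mul_assoc, ← prod_mul_distrib]
  simp [hd]

theorem fredholmTerm_conj {K K' : ℝ → ℝ → ℂ} {d : ℝ → ℂ} (hd : ∀ u, d u ≠ 0)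
    (h : ∀ u v, K' u v = d u * K u v * (d v)⁻¹) (E : Set ℝ) :
    fredholmTerm K' E = fredholmTerm K E := by
  funext k
  simp only [fredholmTerm, det_kernel_conj hd h]

theorem HasFredholmDet.conj {K K' : ℝ → ℝ → ℂ} {d : ℝ → ℂ} (hd : ∀ u, d u ≠ 0)
    (h : ∀ u v, K' u v = d u * K u v * (d v)⁻¹) {E : Set ℝ} {D : ℂ} (hK : HasFredholmDet K' E D) :
    HasFredholmDet K E D := by
  refine ⟨fun k => ?_, ?_⟩
  · simpa only [det_kernel_conj hd h] using hK.integrableOn k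
  · simpa only [det_kernel_conj hd h] using hK.hasSum

/-! ### Contour formulas and the shift form of the kernel -/

/-- Multiplication by `X` corresponds to `-d/dy` acting on the transform times `exp (-y²)`. -/
theorem gaussTransform_X_mul (q : Polynomial ℂ) : gaussTransform (Polynomial.X * q) =
      Polynomial.C 2 * Polynomial.X * gaussTransform q - Polynomial.derivative (gaussTransform q) := by
  induction q using Polynomial.induction_on' with
  | add p q hp hq =>
    rw [mul_add, gaussTransform_add, gaussTransform_add, hp, hq, Polynomial.derivative_add]; ring
  | monomial k a =>
    rw [← Polynomial.C_mul_X_pow_eq_monomial, mul_left_comm, ← pow_succ', gaussTransform_monomial,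
      gaussTransform_monomial, gaussPoly, Polynomial.derivative_C_mul]
    ring

theorem gaussTransform_C_mul (a : ℂ) (q : Polynomial ℂ) :
    gaussTransform (Polynomial.C a * q) = Polynomial.C a * gaussTransform q := by
  induction q using Polynomial.induction_on' with
  | add p q hp hq => rw [mul_add, gaussTransform_add, gaussTransform_add, hp, hq, mul_add]
  | monomial k b =>
    rw [← Polynomial.C_mul_X_pow_eq_monomial, ← mul_assoc, ← Polynomial.C_mul, gaussTransform_monomial,
      gaussTransform_monomial, Polynomial.C_mul, mul_assoc]

theorem gaussTransform_X_sub_C_mul (b : ℂ) (q : Polynomial ℂ) : gaussTransform ((Polynomial.X - Polynomial.C b) * q) =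
      (Polynomial.C 2 * Polynomial.X * gaussTransform q - Polynomial.derivative (gaussTransform q)) +
        Polynomial.C (-b) * gaussTransform q := by
  rw [← gaussTransform_X_mul, ← gaussTransform_C_mul, ← gaussTransform_add, Polynomial.C_neg]
  congr 1; ring

theorem integrable_line_gauss (q : Polynomial ℂ) (c y : ℝ) : Integrable fun v : ℝ =>
    q.eval (c + v * I) * cexp ((c + v * I) ^ 2 / 4 - (c + v * I) * y) := by
  obtain ⟨C, A, hC, hA, h⟩ := exists_norm_eval_le q I
  refine ((integrable_exp_abs_sub_sq (s := 4) (by norm_num) A).const_mul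
    (C * rexp (A * |c|) * rexp (c ^ 2 / 4 - c * y))).mono'
    (Continuous.aestronglyMeasurable (by fun_prop)) (.of_forall fun v => ?_)
  rw [norm_mul, norm_exp]
  have e1 : ((c + v * I) ^ 2 / 4 - (c + v * I) * y : ℂ).re = c ^ 2 / 4 - c * y - v ^ 2 / 4 := by
    have : ((c + v * I) ^ 2 / 4 - (c + v * I) * y : ℂ) =
        ((c ^ 2 / 4 - c * y - v ^ 2 / 4 : ℝ) : ℂ) + ((c * v / 2 - v * y : ℝ) : ℂ) * I := by
      push_cast
      linear_combination (v ^ 2 / 4 : ℂ) * I_sq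
    rw [this, Complex.add_re, ofReal_re, re_ofReal_mul, Complex.I_re, mul_zero, add_zero]
  rw [e1]
  calc _ ≤ C * rexp (A * (|c| + |v|)) * rexp (c ^ 2 / 4 - c * y - v ^ 2 / 4) := by
        gcongr; exact h c v
    _ = _ := by
        rw [mul_add, exp_add, sub_eq_add_neg (c ^ 2 / 4 - c * y), exp_add, sub_eq_add_neg (A * |v|), exp_add]
        ring

/-- The inverse Laplace transform, for every abscissa `c`. No inversion theorem is used: for `q = 1`
it is a Gaussian integral, and differentiation in `y` brings down a factor `-(c + v I)`, which
matches the recursion for `gaussPoly`. -/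
theorem line_integral_eq_gaussTransform (c : ℝ) (q : Polynomial ℂ) (y : ℝ) : (∫ v : ℝ, q.eval (c + v * I) *
      cexp ((c + v * I) ^ 2 / 4 - (c + v * I) * y)) / (2 * π) =
      (gaussTransform q).eval (y : ℂ) * cexp (-(y : ℂ) ^ 2) := by
  have hpow : ∀ (k : ℕ) (y : ℝ), (∫ v : ℝ, (Polynomial.X ^ k : Polynomial ℂ).eval (c + v * I) *
      cexp ((c + v * I) ^ 2 / 4 - (c + v * I) * y)) / (2 * π) =
      (gaussPoly k).eval (y : ℂ) * cexp (-(y : ℂ) ^ 2) := by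
    intro k
    induction k with
    | zero =>
      intro y
      have h := integral_cexp_quadratic (b := -1 / 4) (by norm_num) (c / 2 * I - I * y) (c ^ 2 / 4 - c * y)
      have e : ∀ v : ℝ, (Polynomial.X ^ 0 : Polynomial ℂ).eval (c + v * I) *
          cexp ((c + v * I) ^ 2 / 4 - (c + v * I) * y) =
          cexp (-1 / 4 * (v : ℂ) ^ 2 + (c / 2 * I - I * y) * v + (c ^ 2 / 4 - c * y)) := fun v => by
        rw [pow_zero, Polynomial.eval_one, one_mul]
        congr 1
        linear_combination (v ^ 2 / 4 : ℂ) * I_sq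
      simp_rw [e]
      rw [h]
      have h2 : ((π : ℂ) / - (-1 / 4)) ^ (1 / 2 : ℂ) = ((2 * √π : ℝ) : ℂ) := by
        have h3 : (2 * √π) = √(4 * π) := by
          rw [Real.sqrt_mul (by norm_num), show (4 : ℝ) = 2 ^ 2 by norm_num, Real.sqrt_sq (by norm_num)]
        rw [h3, Real.sqrt_eq_rpow, Complex.ofReal_cpow (by positivity)]
        push_cast
        congr 1; ring
      have h4 : (c : ℂ) ^ 2 / 4 - c * y - (c / 2 * I - I * y) ^ 2 / (4 * (-1 / 4)) = -(y : ℂ) ^ 2 := by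
        linear_combination ((c / 2 - y) ^ 2 : ℂ) * I_sq
      rw [h2, h4, gaussPoly, eval_C]
      have hpi : (√π : ℂ) ≠ 0 := by exact_mod_cast (sqrt_pos.2 pi_pos).ne'
      have hsq : (π : ℂ) = (√π : ℂ) ^ 2 := by rw [← Complex.ofReal_pow, sq_sqrt pi_pos.le]
      push_cast
      rw [hsq]
      field_simp
    | succ k ih =>
      intro y
      have h1 : HasDerivAt (fun y : ℝ => (∫ v : ℝ, (Polynomial.X ^ k : Polynomial ℂ).eval (c + v * I) *
          cexp ((c + v * I) ^ 2 / 4 - (c + v * I) * y)) / (2 * π))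
          ((∫ v : ℝ, -((Polynomial.X ^ (k + 1) : Polynomial ℂ).eval (c + v * I) *
          cexp ((c + v * I) ^ 2 / 4 - (c + v * I) * y))) / (2 * π)) y := by
        refine HasDerivAt.div_const ?_ _
        -- On the unit ball around `y` the factor `exp (-c x)` is at most `exp (|c| (|y| + 1))`, so
        -- the integrand at `0` gives a uniform majorant.
        have hbound := (integrable_line_gauss (Polynomial.X ^ (k + 1)) c 0).norm.const_mul (rexp (|c| * (|y| + 1)))
        refine (hasDerivAt_integral_of_dominated_loc_of_deriv_le (𝕜 := ℝ) (s := ball y 1)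
          (F := fun (y : ℝ) (v : ℝ) => (Polynomial.X ^ k : Polynomial ℂ).eval (c + v * I) *
            cexp ((c + v * I) ^ 2 / 4 - (c + v * I) * y))
          (F' := fun (y : ℝ) (v : ℝ) => -((Polynomial.X ^ (k + 1) : Polynomial ℂ).eval (c + v * I) *
            cexp ((c + v * I) ^ 2 / 4 - (c + v * I) * y)))
          (Metric.ball_mem_nhds y one_pos) ?_ ?_ ?_ ?_ hbound ?_).2
        · exact .of_forall fun y => Continuous.aestronglyMeasurable (by fun_prop)
        · exact integrable_line_gauss _ _ _
        · exact Continuous.aestronglyMeasurable (by fun_prop)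
        · refine .of_forall fun v x hx => ?_
          rw [norm_neg, norm_mul, norm_mul, mul_left_comm]
          refine mul_le_mul_of_nonneg_left ?_ (norm_nonneg _)
          rw [norm_exp, norm_exp, ← exp_add, exp_le_exp]
          have hx' : |x| ≤ |y| + 1 := by
            have h1 := abs_sub_abs_le_abs_sub x y
            have h2 := hx
            rw [mem_ball, Real.dist_eq] at h2
            linarith
          have e2 : ((c + v * I) * x : ℂ).re = c * x := by simp
          have e3 : -(c * x) ≤ |c| * (|y| + 1) := by
            refine (neg_le_abs _).trans ?_
            rw [abs_mul]; gcongr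
          simp only [Complex.sub_re, e2, Complex.ofReal_zero, mul_zero, Complex.zero_re]
          linarith
        · refine .of_forall fun v x _ => ?_
          have : HasDerivAt (fun x : ℂ => (Polynomial.X ^ k : Polynomial ℂ).eval (c + v * I) *
              cexp ((c + v * I) ^ 2 / 4 - (c + v * I) * x))
              (-((Polynomial.X ^ (k + 1) : Polynomial ℂ).eval (c + v * I) *
            cexp ((c + v * I) ^ 2 / 4 - (c + v * I) * x))) (x : ℂ) := by
            have h5 := ((((hasDerivAt_id (x : ℂ)).const_mul (c + v * I : ℂ)).const_sub
              ((c + v * I) ^ 2 / 4 : ℂ)).cexp).const_mul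
              ((Polynomial.X ^ k : Polynomial ℂ).eval (c + v * I))
            refine h5.congr_deriv ?_
            simp only [eval_pow, eval_X, id]
            ring
          exact this.comp_ofReal
      have h2 := hasDerivAt_poly_gauss (gaussPoly k) y
      have h3 := h1.unique (h2.congr_of_eventuallyEq (Eventually.of_forall ih))
      rw [integral_neg, neg_div, neg_inj] at h3
      rw [h3]
      rfl
  induction q using Polynomial.induction_on' with
  | add p q hp hq =>
    simp only [gaussTransform_add, eval_add, add_mul (Polynomial.eval _ p),
      add_mul (Polynomial.eval _ (gaussTransform p))]
    rw [integral_add (integrable_line_gauss p c y) (integrable_line_gauss q c y), add_div, hp, hq]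
  | monomial k a =>
    rw [← Polynomial.C_mul_X_pow_eq_monomial, gaussTransform_monomial]
    simp only [eval_mul, eval_C, mul_assoc, integral_const_mul]
    rw [← hpow]
    simp only [mul_div_assoc]

noncomputable def nodePoly (b : Fin n → ℝ) : Polynomial ℂ := Lagrange.nodal Finset.univ fun i => (b i : ℂ)

noncomputable def nodeWeight (b : Fin n → ℝ) (j : Fin n) : ℂ :=
  Lagrange.nodalWeight Finset.univ (fun i => (b i : ℂ)) j

theorem nodePoly_eval (b : Fin n → ℝ) (w : ℂ) : (nodePoly b).eval w = ∏ i, (w - b i) := Lagrange.eval_nodal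

/-- By partial fractions this is the sum over all nodes of the residues of `exp (w x - w²/4) /
P(w)`, where P is `nodePoly b`. -/
noncomputable def leftSum (b : Fin n → ℝ) (x : ℝ) : ℂ := ∑ j, nodeWeight b j * leftFun b j x

/-- The inverse Laplace transform of `P(w) exp (w²/4)`, with the full node polynomial P in place of
the individual basis polynomials. -/
noncomputable def rightGauss (b : Fin n → ℝ) (y : ℝ) : ℂ :=
  (gaussTransform (nodePoly b)).eval (y : ℂ) * cexp (-(y : ℂ) ^ 2)

/-- The integrand is minus the `l`-derivative of `e^{b l}` times the transform of `q` with its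
Gaussian, evaluated at `y + l`. Integration therefore undoes multiplication by `X - b`. -/
theorem integral_poly_gauss_shift (q : Polynomial ℂ) (b : ℂ) (y : ℝ) : IntegrableOn (fun l : ℝ => cexp (b * l) *
      ((gaussTransform ((Polynomial.X - Polynomial.C b) * q)).eval ((y + l : ℝ) : ℂ) *
        cexp (-((y + l : ℝ) : ℂ) ^ 2))) (Ioi 0) ∧
    ∫ l in Ioi (0 : ℝ), cexp (b * l) *
      ((gaussTransform ((Polynomial.X - Polynomial.C b) * q)).eval ((y + l : ℝ) : ℂ) *
        cexp (-((y + l : ℝ) : ℂ) ^ 2)) =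
      (gaussTransform q).eval (y : ℂ) * cexp (-(y : ℂ) ^ 2) := by
  have hint : ∀ p : Polynomial ℂ, Integrable fun l : ℝ => cexp (b * l) *
      (p.eval ((y + l : ℝ) : ℂ) * cexp (-((y + l : ℝ) : ℂ) ^ 2)) := by
    intro p
    have := ((integrable_poly_gauss_exp p b).comp_add_left y).const_mul (cexp (-(b * y)))
    refine this.congr (.of_forall fun l => ?_)
    simp only [Complex.ofReal_add]
    have : cexp (b * l) = cexp (-(b * y)) * cexp (b * (y + l)) := by rw [← Complex.exp_add]; ring_nf
    rw [this]; ring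
  set F : ℝ → ℂ := fun l => cexp (b * l) *
      ((gaussTransform q).eval ((y + l : ℝ) : ℂ) * cexp (-((y + l : ℝ) : ℂ) ^ 2)) with hF
  set G : ℝ → ℂ := fun l => cexp (b * l) *
      ((gaussTransform ((Polynomial.X - Polynomial.C b) * q)).eval ((y + l : ℝ) : ℂ) *
        cexp (-((y + l : ℝ) : ℂ) ^ 2)) with hG
  have hd : ∀ l : ℝ, HasDerivAt F (-G l) l := by
    intro l
    have h1 := (hasDerivAt_poly_gauss (gaussTransform q) (y + l)).comp_const_add y l
    have h2 : HasDerivAt (fun l : ℝ => cexp (b * l)) (cexp (b * l) * b) l := by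
      have : HasDerivAt (fun z : ℂ => cexp (b * z)) (cexp (b * l) * b) (l : ℂ) := by
        simpa using ((hasDerivAt_id (l : ℂ)).const_mul b).cexp
      exact this.comp_ofReal
    refine (h2.mul h1).congr_deriv ?_
    simp only [hG]
    rw [gaussTransform_X_sub_C_mul]
    simp only [eval_add, eval_mul, eval_C]
    ring
  have hGi : Integrable G := hint _
  have hFi : Integrable F := hint _
  refine ⟨hGi.integrableOn, ?_⟩
  have htend : Tendsto F atTop (𝓝 0) :=
    tendsto_zero_of_hasDerivAt_of_integrableOn_Ioi (a := 0) (fun x _ => hd x) hGi.neg.integrableOn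
      hFi.integrableOn
  have h := integral_Ioi_of_hasDerivAt_of_tendsto (a := 0) (hd 0).continuousAt.continuousWithinAt
    (fun x _ => hd x) hGi.neg.integrableOn htend
  rw [integral_neg] at h
  have h0 : F 0 = (gaussTransform q).eval (y : ℂ) * cexp (-(y : ℂ) ^ 2) := by simp [hF]
  rw [← h0]
  linear_combination -h

theorem rightFun_eq_integral (b : Fin n → ℝ) (j : Fin n) (y : ℝ) :
    IntegrableOn (fun l : ℝ => cexp (b j * l) * rightGauss b (y + l)) (Ioi 0) ∧
    rightFun b j y = nodeWeight b j * ∫ l in Ioi (0 : ℝ), cexp (b j * l) * rightGauss b (y + l) := by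
  have h := integral_poly_gauss_shift (Lagrange.nodal (Finset.univ.erase j) fun i => (b i : ℂ)) (b j) y
  have e : (Polynomial.X - Polynomial.C (b j : ℂ)) *
      Lagrange.nodal (Finset.univ.erase j) (fun i => (b i : ℂ)) = nodePoly b :=
    by rw [nodePoly, Lagrange.nodal_eq_mul_nodal_erase (mem_univ j)]
  rw [e] at h
  refine ⟨h.1, ?_⟩
  have hb : nodeBasis b j = Polynomial.C (nodeWeight b j) *
      Lagrange.nodal (Finset.univ.erase j) fun i => (b i : ℂ) := by
    rw [nodeBasis, Lagrange.basis_eq_prod_sub_inv_mul_nodal_div (mem_univ j),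
      ← Lagrange.nodal_erase_eq_nodal_div (mem_univ j)]
    rfl
  have h2 := h.2
  simp only [rightGauss]
  rw [h2, rightFun, hb, gaussTransform_C_mul, eval_mul, eval_C]
  ring

/-- Writing each `rightFun` as an integral of the same function `rightGauss` against `exp (b j l)`
shifts the argument of `leftFun b j` by `l`. The sum over `j` then collapses to a product of two
one-variable functions, and no double contour integral appears. -/
theorem sum_leftFun_mul_rightFun (b : Fin n → ℝ) (x y : ℝ) : ∑ j, leftFun b j x * rightFun b j y =
      ∫ l in Ioi (0 : ℝ), leftSum b (x + l) * rightGauss b (y + l) := by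
  have e : ∀ l : ℝ, leftSum b (x + l) * rightGauss b (y + l) =
      ∑ j, leftFun b j x * nodeWeight b j * (cexp (b j * l) * rightGauss b (y + l)) := by
    intro l
    rw [leftSum, Finset.sum_mul]
    refine sum_congr rfl fun j _ => ?_
    have : leftFun b j (x + l) = leftFun b j x * cexp (b j * l) := by
      rw [leftFun, leftFun, ← Complex.exp_add]; push_cast; ring_nf
    rw [this]; ring
  simp_rw [e]
  rw [integral_finsetSum _ fun j _ => ((rightFun_eq_integral b j y).1).const_mul _]
  refine sum_congr rfl fun j _ => ?_
  rw [integral_const_mul, (rightFun_eq_integral b j y).2, mul_assoc]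

theorem inv_nodePoly_eval (hn : 0 < n) {b : Fin n → ℝ} (hb : Injective b) {w : ℂ}
    (hw : ∀ i, w ≠ b i) : ((nodePoly b).eval w)⁻¹ = ∑ j, nodeWeight b j * (w - b j)⁻¹ := by
  have hinj : Set.InjOn (fun i => (b i : ℂ)) (Finset.univ : Finset (Fin n)) :=
    fun i _ j _ h => hb (Complex.ofReal_injective h)
  have : Nonempty (Fin n) := ⟨⟨0, hn⟩⟩
  have h := Lagrange.eval_interpolate_not_at_node (s := Finset.univ) (v := fun i => (b i : ℂ)) 1 (fun i _ => hw i)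
  rw [Lagrange.interpolate_one hinj Finset.univ_nonempty, Polynomial.eval_one] at h
  simp only [Pi.one_apply, mul_one] at h
  exact inv_eq_of_mul_eq_one_right h.symm

open Classical in
-- Partial fractions and Cauchy's formula. The circle may enclose only some of the nodes, which
-- allows the bulk nodes and the outliers to be separated.
theorem circleIntegral_div_nodePoly (hn : 0 < n) {b : Fin n → ℝ} (hb : Injective b)
    {F : ℂ → ℂ} (hF : Differentiable ℂ F) {c : ℂ} {R : ℝ} (hR : 0 < R)
    (hbR : ∀ i, (b i : ℂ) ∈ ball c R ∨ (b i : ℂ) ∉ Metric.closedBall c R) :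
    (2 * π * I)⁻¹ * ∮ w in C(c, R), F w / (nodePoly b).eval w =
      ∑ j, if (b j : ℂ) ∈ ball c R then nodeWeight b j * F (b j) else 0 := by
  have hne : ∀ w ∈ sphere c R, ∀ i, w ≠ b i := by
    rintro w hw i rfl
    rcases hbR i with h | h
    · rw [mem_ball] at h; rw [Metric.mem_sphere] at hw; linarith
    · exact h (Metric.sphere_subset_closedBall hw)
  have e : ∮ w in C(c, R), F w / (nodePoly b).eval w = ∮ w in C(c, R), ∑ j, nodeWeight b j * ((w - b j)⁻¹ • F w) := by
    refine circleIntegral.integral_congr hR.le fun w hw => ?_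
    rw [div_eq_mul_inv, inv_nodePoly_eval hn hb (hne w hw), mul_sum]
    refine sum_congr rfl fun j _ => ?_
    rw [smul_eq_mul]; ring
  have hci : ∀ j, CircleIntegrable (fun w => nodeWeight b j * ((w - b j)⁻¹ • F w)) c R := by
    intro j
    refine ContinuousOn.circleIntegrable hR.le ?_
    refine continuousOn_const.mul (ContinuousOn.smul (ContinuousOn.inv₀ (continuousOn_id.sub continuousOn_const) ?_)
      hF.continuous.continuousOn)
    intro w hw
    exact sub_ne_zero.2 (hne w hw j)
  rw [e, circleIntegral.integral_fun_sum (fun j _ => hci j), mul_sum]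
  refine sum_congr rfl fun j _ => ?_
  have e2 : ∮ w in C(c, R), nodeWeight b j * ((w - b j)⁻¹ • F w) =
      nodeWeight b j * ∮ w in C(c, R), (w - b j)⁻¹ • F w := circleIntegral.integral_const_mul _ _ _ _
  rw [e2]
  split_ifs with h
  · rw [(hF.diffContOnCl).circleIntegral_sub_inv_smul h, smul_eq_mul]
    field_simp [Complex.two_pi_I_ne_zero]
  · have hout := (hbR j).resolve_left h
    rw [Complex.circleIntegral_eq_zero_of_differentiable_on_off_countable hR.le Set.countable_empty,
      mul_zero, mul_zero]
    · refine ContinuousOn.smul (ContinuousOn.inv₀ (continuousOn_id.sub continuousOn_const) fun w hw => ?_) hF.continuous.continuousOn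
      exact sub_ne_zero.2 fun (h' : w = b j) => hout (h' ▸ hw)
    · intro w hw
      refine DifferentiableAt.smul (DifferentiableAt.inv (differentiableAt_id.sub (differentiableAt_const _)) ?_) (hF w)
      exact sub_ne_zero.2 fun (h' : w = b j) => hout (h' ▸ Metric.ball_subset_closedBall hw.1)

/-! ### Deforming contours made of two rays -/

/-- `D` is both the derivative of `H` in the deformation parameter and the derivative of `P` along
the ray, so the integral over the ray changes at the rate `-P l 0`. This is Cauchy's theorem for a
half-infinite contour with moving end point. -/
theorem integral_homotopy {H P D : ℝ → ℝ → ℂ} {g : ℝ → ℝ} {α β : ℝ} (hαβ : α ≤ β) (hg : IntegrableOn g (Ioi 0))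
    (hHm : ∀ l ∈ Icc α β, AEStronglyMeasurable (H l) (volume.restrict (Ioi 0)))
    (hHc : ∀ s, 0 < s → ContinuousOn (fun l => H l s) (Icc α β))
    (hHb : ∀ l ∈ Icc α β, ∀ s, 0 < s → ‖H l s‖ ≤ g s)
    (hHd : ∀ l ∈ Ioo α β, ∀ s, 0 < s → HasDerivAt (fun l => H l s) (D l s) l)
    (hPd : ∀ l ∈ Ioo α β, ∀ s, 0 ≤ s → HasDerivAt (P l) (D l s) s)
    (hDb : ∀ l ∈ Ioo α β, ∀ s, 0 < s → ‖D l s‖ ≤ g s)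
    (hPt : ∀ l ∈ Ioo α β, Tendsto (P l) atTop (𝓝 0))
    (hP0 : ContinuousOn (fun l => P l 0) (Icc α β)) :
    (∫ s in Ioi (0 : ℝ), H β s) - ∫ s in Ioi (0 : ℝ), H α s = -∫ l in α..β, P l 0 := by
  -- `D l` is the derivative of `P l` along the ray, which already makes it measurable.
  have hDm : ∀ l ∈ Ioo α β, AEStronglyMeasurable (D l) (volume.restrict (Ioi 0)) := by
    intro l hl
    refine (aestronglyMeasurable_deriv (P l) _).congr ?_
    exact (ae_restrict_iff' measurableSet_Ioi).2 (.of_forall fun s hs =>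
      (hPd l hl s (le_of_lt hs)).deriv)
  have hcont : ContinuousOn (fun l => ∫ s in Ioi (0 : ℝ), H l s) (Icc α β) := by
    intro l hl
    refine tendsto_integral_filter_of_dominated_convergence g ?_ ?_ hg ?_
    · filter_upwards [self_mem_nhdsWithin] with l hl using hHm l hl
    · filter_upwards [self_mem_nhdsWithin] with l hl
      exact (ae_restrict_iff' measurableSet_Ioi).2 (.of_forall fun s hs => hHb l hl s hs)
    · exact (ae_restrict_iff' measurableSet_Ioi).2 (.of_forall fun s hs => hHc s hs l hl)
  have hderiv : ∀ l ∈ Ioo α β, HasDerivAt (fun l => ∫ s in Ioi (0 : ℝ), H l s) (-P l 0) l := by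
    intro l hl
    have hl' : l ∈ Icc α β := Ioo_subset_Icc_self hl
    have h1 := (hasDerivAt_integral_of_dominated_loc_of_deriv_le (𝕜 := ℝ) (s := Ioo α β)
      (μ := volume.restrict (Ioi 0)) (F := H) (F' := D) (bound := g) (Ioo_mem_nhds hl.1 hl.2)
      (by filter_upwards [Ioo_mem_nhds hl.1 hl.2] with x hx using hHm x (Ioo_subset_Icc_self hx))
      (hg.mono' (hHm l hl') ((ae_restrict_iff' measurableSet_Ioi).2 (.of_forall fun s hs => hHb l hl' s hs)))
      (hDm l hl)
      ((ae_restrict_iff' measurableSet_Ioi).2 (.of_forall fun s hs x hx => hDb x hx s hs))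
      hg
      ((ae_restrict_iff' measurableSet_Ioi).2 (.of_forall fun s hs x hx => hHd x hx s hs))).2
    have hDi : IntegrableOn (D l) (Ioi 0) := hg.mono' (hDm l hl)
      ((ae_restrict_iff' measurableSet_Ioi).2 (.of_forall fun s hs => hDb l hl s hs))
    have h2 := integral_Ioi_of_hasDerivAt_of_tendsto (a := 0)
      (hPd l hl 0 le_rfl).continuousAt.continuousWithinAt (fun s hs => hPd l hl s (le_of_lt hs)) hDi
      (hPt l hl)
    rw [h2, zero_sub] at h1
    exact h1
  have hint : IntervalIntegrable (fun l => -P l 0) volume α β :=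
    (ContinuousOn.neg (by rwa [Set.uIcc_of_le hαβ])).intervalIntegrable
  have := intervalIntegral.integral_eq_sub_of_hasDerivAt_of_le hαβ hcont hderiv hint
  rw [← this, intervalIntegral.integral_neg]

theorem integrableOn_exp_linear_sub_sq (B : ℝ) {c : ℝ} (hc : 0 < c) (C : ℝ) :
    IntegrableOn (fun s : ℝ => C * rexp (B * s - c * s ^ 2)) (Ioi 0) := by
  have h := ((integrable_exp_abs_sub_sq (s := 1 / c) (by positivity) B).const_mul C).integrableOn (s := Ioi 0)
  refine h.congr ((ae_restrict_iff' measurableSet_Ioi).2 (.of_forall fun s hs => ?_))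
  beta_reduce
  rw [abs_of_pos hs]
  congr 2
  field_simp

theorem tendsto_exp_linear_sub_sq (B : ℝ) {c : ℝ} (hc : 0 < c) (C : ℝ) :
    Tendsto (fun s : ℝ => C * rexp (B * s - c * s ^ 2)) atTop (𝓝 0) := by
  have h1 : Tendsto (fun s : ℝ => s * (c * s - B)) atTop atTop :=
    tendsto_id.atTop_mul_atTop₀ (tendsto_atTop_add_const_right _ (-B) (tendsto_id.const_mul_atTop hc))
  have h2 := (Real.tendsto_exp_neg_atTop_nhds_zero.comp h1).const_mul C
  rw [mul_zero] at h2
  refine h2.congr fun s => ?_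
  simp only [comp_apply]
  congr 2; ring

/-- For holomorphic `F` the form `F(w) dw` is closed, so `P` can be taken as `F` times the velocity
`v' + s m'` of the point on the ray. At `s = 0` only the motion of the vertex is left. -/
theorem ray_homotopy {F F' : ℂ → ℂ} {v v' m m' : ℝ → ℂ} {α β M C B c : ℝ} (hαβ : α ≤ β) (hc : 0 < c)
    (hv : ∀ l, HasDerivAt v (v' l) l) (hv' : Continuous v')
    (hm : ∀ l, HasDerivAt m (m' l) l)
    (hM : ∀ l ∈ Icc α β, ‖m l‖ ≤ M ∧ ‖v' l‖ ≤ M ∧ ‖m' l‖ ≤ M)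
    (hF : ∀ l ∈ Icc α β, ∀ s : ℝ, 0 ≤ s → HasDerivAt F (F' (v l + s * m l)) (v l + s * m l))
    (hb : ∀ l ∈ Icc α β, ∀ s : ℝ, 0 ≤ s → ‖F (v l + s * m l)‖ ≤ C * rexp (B * s - c * s ^ 2))
    (hb' : ∀ l ∈ Icc α β, ∀ s : ℝ, 0 ≤ s → ‖F' (v l + s * m l)‖ ≤ C * rexp (B * s - c * s ^ 2)) :
    (∫ s in Ioi (0 : ℝ), F (v β + s * m β) * m β) - ∫ s in Ioi (0 : ℝ), F (v α + s * m α) * m α =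
      -∫ l in α..β, F (v l) * v' l := by
  have hM0 : 0 ≤ M := (norm_nonneg _).trans (hM α ⟨le_rfl, hαβ⟩).1
  have hC : 0 ≤ C := by
    have := (norm_nonneg _).trans (hb α ⟨le_rfl, hαβ⟩ 0 le_rfl)
    exact nonneg_of_mul_nonneg_left this (exp_pos _)
  -- The velocity of a point of the ray grows linearly in `s`; raising the exponent `B` by one
  -- absorbs this.
  have hexp : ∀ s : ℝ, 0 ≤ s → (1 + s) * (C * rexp (B * s - c * s ^ 2)) ≤ C * rexp ((B + 1) * s - c * s ^ 2) := by
    intro s hs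
    have h1 : (B + 1) * s - c * s ^ 2 = s + (B * s - c * s ^ 2) := by ring
    rw [h1, exp_add, mul_left_comm]
    refine mul_le_mul_of_nonneg_left (mul_le_mul_of_nonneg_right ?_ (exp_pos _).le) hC
    linarith [add_one_le_exp s]
  have hmv : ∀ l ∈ Icc α β, ∀ s : ℝ, 0 ≤ s → ‖v' l + s * m' l‖ ≤ M * (1 + s) := by
    intro l hl s hs
    refine (norm_add_le _ _).trans ?_
    rw [norm_mul, norm_real, norm_of_nonneg hs]
    nlinarith [(hM l hl).2.1, (hM l hl).2.2]
  have hda : ∀ (s : ℝ) l, HasDerivAt (fun l => v l + s * m l) (v' l + s * m' l) l := fun s l =>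
    (hv l).add ((hm l).const_mul _)
  have hds : ∀ (s : ℝ) l, HasDerivAt (fun s : ℝ => v l + s * m l) (m l) s := fun s l => by
    simpa using (((hasDerivAt_id (s : ℂ)).mul_const (m l)).const_add (v l)).comp_ofReal
  have hFl : ∀ l ∈ Icc α β, ∀ s : ℝ, 0 ≤ s → HasDerivAt (fun l => F (v l + s * m l))
      (F' (v l + s * m l) * (v' l + s * m' l)) l := fun l hl s hs =>
    HasDerivAt.comp l (hF l hl s hs) (hda s l)
  have hFs : ∀ l ∈ Icc α β, ∀ s : ℝ, 0 ≤ s → HasDerivAt (fun s : ℝ => F (v l + s * m l))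
      (F' (v l + s * m l) * m l) s := fun l hl s hs =>
    HasDerivAt.comp s (hF l hl s hs) (hds s l)
  have key := integral_homotopy (H := fun l s => F (v l + s * m l) * m l)
    (P := fun l s => F (v l + s * m l) * (v' l + s * m' l))
    (D := fun l s => F' (v l + s * m l) * (v' l + s * m' l) * m l + F (v l + s * m l) * m' l)
    (g := fun s => (2 * M ^ 2 + 2 * M) * C * rexp ((B + 1) * s - c * s ^ 2)) hαβ
    (integrableOn_exp_linear_sub_sq _ hc _) ?_ ?_ ?_ ?_ ?_ ?_ ?_ ?_
  · simpa using key
  · intro l hl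
    refine ContinuousOn.aestronglyMeasurable (fun s hs => ?_) measurableSet_Ioi
    exact ((hFs l hl s (le_of_lt hs)).continuousAt.mul continuousAt_const).continuousWithinAt
  · intro s hs l hl
    exact ((hFl l hl s hs.le).continuousAt.mul (hm l).continuousAt).continuousWithinAt
  · intro l hl s hs
    rw [norm_mul]
    have h1 := mul_le_mul (hb l hl s hs.le) (hM l hl).1 (norm_nonneg _) (by positivity)
    have h2 := hexp s hs.le
    have h3 : 0 ≤ C * rexp (B * s - c * s ^ 2) := by positivity
    have h4 : 0 ≤ C * rexp ((B + 1) * s - c * s ^ 2) := by positivity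
    have h5 : C * rexp (B * s - c * s ^ 2) ≤ C * rexp ((B + 1) * s - c * s ^ 2) := by nlinarith
    nlinarith [mul_nonneg hM0 h4, mul_nonneg (sq_nonneg M) h4, mul_le_mul_of_nonneg_right h5 hM0]
  · intro l hl s hs
    refine ((hFl l (Ioo_subset_Icc_self hl) s hs.le).mul (hm l)).congr_deriv ?_
    ring
  · intro l hl s hs
    have h1 : HasDerivAt (fun s : ℝ => v' l + s * m' l) (m' l) s := by
      simpa using (((hasDerivAt_id (s : ℂ)).mul_const (m' l)).const_add (v' l)).comp_ofReal
    refine ((hFs l (Ioo_subset_Icc_self hl) s hs).mul h1).congr_deriv ?_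
    ring
  · intro l hl s hs
    have hl' := Ioo_subset_Icc_self hl
    have h4 : 0 ≤ C * rexp ((B + 1) * s - c * s ^ 2) := by positivity
    have h3 : 0 ≤ C * rexp (B * s - c * s ^ 2) := by positivity
    have h2 := hexp s hs.le
    have e1 : ‖F' (v l + s * m l) * (v' l + s * m' l) * m l‖ ≤ M ^ 2 * (C * rexp ((B + 1) * s - c * s ^ 2)) := by
      rw [norm_mul, norm_mul]
      calc _ ≤ C * rexp (B * s - c * s ^ 2) * (M * (1 + s)) * M := by
            gcongr
            · exact hb' l hl' s hs.le
            · exact hmv l hl' s hs.le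
            · exact (hM l hl').1
        _ = M ^ 2 * ((1 + s) * (C * rexp (B * s - c * s ^ 2))) := by ring
        _ ≤ _ := by gcongr
    have e2 : ‖F (v l + s * m l) * m' l‖ ≤ M * (C * rexp ((B + 1) * s - c * s ^ 2)) := by
      rw [norm_mul]
      calc _ ≤ C * rexp (B * s - c * s ^ 2) * M := by
            gcongr
            · exact hb l hl' s hs.le
            · exact (hM l hl').2.2
        _ ≤ _ := by rw [mul_comm]; gcongr; nlinarith
    refine (norm_add_le _ _).trans ((add_le_add e1 e2).trans ?_)
    nlinarith [mul_nonneg hM0 h4, mul_nonneg (sq_nonneg M) h4]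
  · intro l hl
    have hl' := Ioo_subset_Icc_self hl
    refine squeeze_zero_norm' ?_ (tendsto_exp_linear_sub_sq (B + 1) hc (M * C))
    filter_upwards [eventually_ge_atTop 0] with s hs
    rw [norm_mul]
    calc _ ≤ C * rexp (B * s - c * s ^ 2) * (M * (1 + s)) := by
          gcongr
          · exact hb l hl' s hs
          · exact hmv l hl' s hs
      _ = M * ((1 + s) * (C * rexp (B * s - c * s ^ 2))) := by ring
      _ ≤ _ := by rw [mul_assoc]; exact mul_le_mul_of_nonneg_left (hexp s hs) hM0
  · intro l hl
    have h1 := (hFl l hl 0 le_rfl).continuousAt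
    simp only [Complex.ofReal_zero, zero_mul, add_zero] at h1 ⊢
    exact (h1.mul hv'.continuousAt).continuousWithinAt

noncomputable def rayIntegral (F : ℂ → ℂ) (v m : ℂ) : ℂ := ∫ s in Ioi (0 : ℝ), F (v + s * m) * m

/-- The exponential in the integral representation of the Airy function. -/
noncomputable def airyPhase (u : ℝ) (a : ℂ) : ℂ := cexp (I * a ^ 3 / 3 + I * a * u)

theorem hasDerivAt_airyPhase (u : ℝ) (a : ℂ) : HasDerivAt (airyPhase u) (I * (a ^ 2 + u) * airyPhase u a) a := by
  have h : HasDerivAt (fun a : ℂ => I * a ^ 3 / 3 + I * a * u) (I * (3 * a ^ 2) / 3 + I * 1 * u) a := by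
    have h1 := ((hasDerivAt_pow 3 a).const_mul I).div_const 3
    have h2 := ((hasDerivAt_id a).const_mul I).mul_const (u : ℂ)
    exact (h1.add h2).congr_deriv (by push_cast; ring)
  refine h.cexp.congr_deriv ?_
  rw [airyPhase]; ring

/-- If `m³ = I` the leading term of `I a³ / 3` along the ray is `-s³/3`. It is traded for `-s²` plus
a linear term, a bound uniform in vertices with `‖v‖ ≤ V`. -/
theorem norm_airyPhase_le_of_pow {m : ℂ} (hm : ‖m‖ = 1) (hm3 : m ^ 3 = I) {v : ℂ} {V : ℝ}
    (hv : ‖v‖ ≤ V) (u : ℝ) {s : ℝ} (hs : 0 ≤ s) :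
    ‖airyPhase u (v + s * m)‖ ≤ rexp (V ^ 3 + |u| * V) * rexp ((V ^ 2 + |u| + (V + 1) ^ 2) * s - 1 * s ^ 2) := by
  have hV : 0 ≤ V := (norm_nonneg _).trans hv
  rw [airyPhase, norm_exp, ← exp_add, exp_le_exp]
  have e : I * (v + s * m) ^ 3 / 3 + I * (v + s * m) * u =
      (I * v ^ 3 / 3 + I * v ^ 2 * m * s + I * v * m ^ 2 * s ^ 2 +
        I * v * u + I * m * s * u) + ((-(s ^ 3 / 3) : ℝ) : ℂ) := by
    push_cast
    linear_combination (I * s ^ 3 / 3) * hm3 + (s ^ 3 / 3) * I_mul_I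
  rw [e, Complex.add_re, ofReal_re]
  have hn : ‖I * v ^ 3 / 3 + I * v ^ 2 * m * s + I * v * m ^ 2 * s ^ 2 + I * v * u + I * m * s * u‖ ≤
      V ^ 3 / 3 + V ^ 2 * s + V * s ^ 2 + V * |u| + s * |u| := by
    refine (norm_add_le _ _).trans (add_le_add ((norm_add_le _ _).trans (add_le_add
      ((norm_add_le _ _).trans (add_le_add ((norm_add_le _ _).trans (add_le_add ?_ ?_)) ?_)) ?_)) ?_)
    all_goals simp only [norm_mul, norm_div, norm_pow, norm_I, hm, norm_real,
      norm_eq_abs, abs_of_nonneg hs, one_mul, mul_one, one_pow]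
    · rw [show ‖(3 : ℂ)‖ = 3 by simp]; gcongr
    · gcongr
    · gcongr
    · gcongr
    · exact le_rfl
  refine (add_le_add ((re_le_norm _).trans hn) le_rfl).trans ?_
  have h3 : 0 ≤ V ^ 3 := by positivity
  nlinarith [mul_nonneg hs (sq_nonneg (s / 3 - (V + 1) / 2)), mul_nonneg hs (sq_nonneg (s - (V + 1)))
    , mul_nonneg hs (sq_nonneg (V + 1)), mul_nonneg hs (sq_nonneg (s - 3 * (V + 1) / 2))]

theorem norm_airyPhase_add_mul_I (u x y : ℝ) : ‖airyPhase u (x + y * I)‖ = rexp (y ^ 3 / 3 - x ^ 2 * y - u * y) := by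
  rw [airyPhase, norm_exp]
  congr 1
  have e : I * ((x : ℂ) + y * I) ^ 3 / 3 + I * (x + y * I) * u =
      ((y ^ 3 / 3 - x ^ 2 * y - u * y : ℝ) : ℂ) + ((x ^ 3 / 3 - x * y ^ 2 + x * u : ℝ) : ℂ) * I := by
    have h2 : I ^ 2 = -1 := I_sq
    have h4 : I ^ 4 = 1 := Complex.I_pow_four
    have h3 : I ^ 3 = -I := Complex.I_pow_three
    push_cast
    ring_nf
    rw [h4, h3, h2]; ring
  rw [e, Complex.add_re, ofReal_re, re_ofReal_mul, Complex.I_re, mul_zero, add_zero]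

/-- At height `η > 0` the term `-x² Im a` gives Gaussian decay for every slope between the original
ray (`κ = 1/2`) and the horizontal one (`κ = 0`), although the cubic decay is lost at `κ = 0`. -/
theorem norm_airyPhase_le_of_slope {e κ η : ℝ} (he : e ^ 2 = 3 / 4) (hκ : 0 ≤ κ) (hκ' : κ ≤ 1 / 2)
    (hη : 0 < η) (u : ℝ) {s : ℝ} (hs : 0 ≤ s) :
    ‖airyPhase u (η * I + s * (e + κ * I))‖ ≤ rexp (η ^ 3 + |u| * η) * rexp ((η ^ 2 + |u|) * s - η / 2 * s ^ 2) := by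
  have h : (η * I + s * (e + κ * I) : ℂ) = ((s * e : ℝ) : ℂ) + ((η + s * κ : ℝ) : ℂ) * I := by push_cast; ring
  rw [h, norm_airyPhase_add_mul_I, ← exp_add, exp_le_exp, mul_pow, he]
  have h1 : (η + s * κ) ^ 3 / 3 - s ^ 2 * (3 / 4) * (η + s * κ) - u * (η + s * κ) =
     -(3 / 4 - κ ^ 2 / 3) * κ * s ^ 3 - η * (3 / 4 - κ ^ 2) * s ^ 2 + η ^ 2 * κ * s + η ^ 3 / 3
       - u * η - u * κ * s := by ring
  rw [h1]
  have hk2 : κ ^ 2 ≤ 1 / 4 := by nlinarith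
  have t1 : 0 ≤ (3 / 4 - κ ^ 2 / 3) * κ * s ^ 3 := by
    have : 0 ≤ 3 / 4 - κ ^ 2 / 3 := by linarith
    positivity
  have t2 : η / 2 * s ^ 2 ≤ η * (3 / 4 - κ ^ 2) * s ^ 2 := by
    refine mul_le_mul_of_nonneg_right ?_ (sq_nonneg s); nlinarith
  have t3 : η ^ 2 * κ * s ≤ η ^ 2 * s := by
    refine mul_le_mul_of_nonneg_right ?_ hs; nlinarith [sq_nonneg η]
  have t4 : - (u * η) ≤ |u| * η := by nlinarith [neg_abs_le u]
  have t5 : - (u * κ * s) ≤ |u| * s := by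
    have : - (u * κ) ≤ |u| := by nlinarith [neg_abs_le u, abs_nonneg u]
    nlinarith
  have t6 : 0 ≤ η ^ 3 := by positivity
  nlinarith

theorem airyPhase_ray_homotopy {q q' : ℂ → ℂ} {v v' m m' : ℝ → ℂ} {α β M V B₁ C₁ B₂ C₂ c u : ℝ}
    (hαβ : α ≤ β) (hc : 0 < c) (hC₁ : 0 ≤ C₁) (hC₂ : 0 ≤ C₂)
    (hv : ∀ l, HasDerivAt v (v' l) l) (hv' : Continuous v')
    (hm : ∀ l, HasDerivAt m (m' l) l)
    (hM : ∀ l ∈ Icc α β, ‖m l‖ ≤ 1 ∧ ‖v' l‖ ≤ M ∧ ‖m' l‖ ≤ M) (hV : ∀ l ∈ Icc α β, ‖v l‖ ≤ V)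
    (hq : ∀ l ∈ Icc α β, ∀ s : ℝ, 0 ≤ s → HasDerivAt q (q' (v l + s * m l)) (v l + s * m l))
    (hqb : ∀ l ∈ Icc α β, ∀ s : ℝ, 0 ≤ s → ‖q (v l + s * m l)‖ ≤ C₂ * rexp (B₂ * s))
    (hqb' : ∀ l ∈ Icc α β, ∀ s : ℝ, 0 ≤ s → ‖q' (v l + s * m l)‖ ≤ C₂ * rexp (B₂ * s))
    (hA : ∀ l ∈ Icc α β, ∀ s : ℝ, 0 ≤ s → ‖airyPhase u (v l + s * m l)‖ ≤ C₁ * rexp (B₁ * s - c * s ^ 2)) :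
    rayIntegral (fun a => airyPhase u a * q a) (v β) (m β) - rayIntegral (fun a => airyPhase u a * q a) (v α) (m α) =
        -∫ l in α..β, airyPhase u (v l) * q (v l) * v' l := by
  -- Differentiating the phase brings down `I (a² + u)`, which is dominated by a multiple of `exp (2
  -- s)` along the ray.
  set K : ℝ := (1 + |u|) * rexp (2 * (V + 1)) + 1 with hK
  have hK1 : 1 ≤ K := by rw [hK]; have : 0 ≤ (1 + |u|) * rexp (2 * (V + 1)) := by positivity
                         linarith
  have hpoly : ∀ l ∈ Icc α β, ∀ s : ℝ, 0 ≤ s → ‖I * ((v l + s * m l) ^ 2 + u)‖ + 1 ≤ K * rexp (2 * s) := by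
    intro l hl s hs
    have h1 : ‖v l + s * m l‖ ≤ V + s := by
      refine (norm_add_le _ _).trans (add_le_add (hV l hl) ?_)
      rw [norm_mul, norm_real, norm_of_nonneg hs]
      nlinarith [(hM l hl).1]
    have hV0 : 0 ≤ V := (norm_nonneg _).trans (hV l hl)
    rw [norm_mul, norm_I, one_mul]
    have h2 : ‖(v l + s * m l) ^ 2 + u‖ ≤ (V + s) ^ 2 + |u| := by
      refine (norm_add_le _ _).trans (add_le_add ?_ ?_)
      · rw [norm_pow]; gcongr
      · simp
    have h3 : (V + s) ^ 2 + |u| ≤ (1 + |u|) * (V + 1 + s) ^ 2 := by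
      nlinarith [abs_nonneg u, mul_nonneg (abs_nonneg u) (sq_nonneg (V + s)),
        mul_nonneg (abs_nonneg u) (add_nonneg hV0 hs)]
    have h4 : (V + 1 + s) ^ 2 ≤ rexp (2 * (V + 1)) * rexp (2 * s) := by
      have : V + 1 + s ≤ rexp (V + 1 + s) := by linarith [add_one_le_exp (V + 1 + s)]
      calc (V + 1 + s) ^ 2 ≤ rexp (V + 1 + s) ^ 2 := by gcongr
        _ = _ := by rw [← exp_add, ← exp_nat_mul]; congr 1; push_cast; ring
    have h5 : (1 : ℝ) ≤ rexp (2 * s) := Real.one_le_exp (by positivity)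
    rw [hK, add_mul, one_mul, mul_assoc]
    have h6 := mul_le_mul_of_nonneg_left h4 (show 0 ≤ 1 + |u| by positivity)
    linarith
  have hexp : ∀ s : ℝ, C₁ * rexp (B₁ * s - c * s ^ 2) * (C₂ * rexp (B₂ * s)) *
      (K * rexp (2 * s)) = C₁ * C₂ * K * rexp ((B₁ + B₂ + 2) * s - c * s ^ 2) := by
    intro s
    rw [show (B₁ + B₂ + 2) * s - c * s ^ 2 = (B₁ * s - c * s ^ 2) + B₂ * s + 2 * s by ring, exp_add, exp_add]; ring
  refine ray_homotopy (F := fun a => airyPhase u a * q a)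
    (F' := fun a => I * (a ^ 2 + u) * airyPhase u a * q a + airyPhase u a * q' a)
    (M := max 1 M) (C := C₁ * C₂ * K) (B := B₁ + B₂ + 2) (c := c) hαβ hc hv hv' hm ?_ ?_ ?_ ?_
  · intro l hl
    obtain ⟨h1, h2, h3⟩ := hM l hl
    exact ⟨h1.trans (le_max_left _ _), h2.trans (le_max_right _ _), h3.trans (le_max_right _ _)⟩
  · intro l hl s hs
    exact (hasDerivAt_airyPhase u _).mul (hq l hl s hs)
  · intro l hl s hs
    rw [norm_mul, ← hexp]
    have h1 := mul_le_mul (hA l hl s hs) (hqb l hl s hs) (norm_nonneg _) (by positivity)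
    refine h1.trans (le_mul_of_one_le_right (by positivity) ?_)
    have := hpoly l hl s hs
    linarith [norm_nonneg (I * ((v l + s * m l) ^ 2 + u))]
  · intro l hl s hs
    rw [← hexp]
    have h1 := mul_le_mul (hA l hl s hs) (hqb l hl s hs) (norm_nonneg _) (by positivity)
    have h2 := mul_le_mul (hA l hl s hs) (hqb' l hl s hs) (norm_nonneg _) (by positivity)
    refine le_trans ?_ (mul_le_mul_of_nonneg_left (hpoly l hl s hs) (by positivity))
    refine (norm_add_le _ _).trans ?_
    rw [mul_add (_ * _) _ (1 : ℝ), mul_one (C₁ * _ * _)]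
    refine add_le_add ?_ ?_
    · rw [mul_assoc, norm_mul, mul_comm]
      gcongr
      rw [norm_mul]; exact h1
    · rw [norm_mul]; exact h2

theorem exp_I_pi_div_six : cexp (I * π / 6) = ((√3 / 2 : ℝ) : ℂ) + ((1 / 2 : ℝ) : ℂ) * I := by
  rw [show I * π / 6 = ((π / 6 : ℝ) : ℂ) * I by push_cast; ring,
    Complex.exp_mul_I, ← Complex.ofReal_cos, ← Complex.ofReal_sin, Real.cos_pi_div_six,
    Real.sin_pi_div_six]

theorem exp_five_I_pi_div_six : cexp (5 * I * π / 6) = ((-(√3 / 2) : ℝ) : ℂ) + ((1 / 2 : ℝ) : ℂ) * I := by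
  rw [show 5 * I * π / 6 = ((π - π / 6 : ℝ) : ℂ) * I by push_cast; ring,
    Complex.exp_mul_I, ← Complex.ofReal_cos, ← Complex.ofReal_sin, Real.cos_pi_sub,
    Real.sin_pi_sub, Real.cos_pi_div_six, Real.sin_pi_div_six]

theorem slope_norm_le {e κ : ℝ} (he : e ^ 2 = 3 / 4) (hκ : 0 ≤ κ) (hκ' : κ ≤ 1 / 2) : ‖(e + κ * I : ℂ)‖ ≤ 1 := by
  rw [Complex.norm_add_mul_I, he]
  exact Real.sqrt_le_iff.2 ⟨zero_le_one, by nlinarith⟩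

theorem slope_cube {e : ℝ} (he : e ^ 2 = 3 / 4) : ((e : ℂ) + ((1 / 2 : ℝ) : ℂ) * I) ^ 3 = I := by
  have h : (e : ℂ) ^ 2 = 3 / 4 := by rw [← Complex.ofReal_pow, he]; push_cast; rfl
  have h3 := Complex.I_pow_three
  have h2 := I_sq
  push_cast
  linear_combination (e + 3 / 2 * I) * h + (3 / 4 * e + 1 / 8 * I) * h2

theorem slope_norm {e : ℝ} (he : e ^ 2 = 3 / 4) : ‖((e : ℂ) + ((1 / 2 : ℝ) : ℂ) * I)‖ = 1 := by
  rw [Complex.norm_add_mul_I, he]; norm_num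

section Line

variable {q q' : ℂ → ℂ} {y₀ η C B : ℝ}

/-- The vertex is first raised to height `η`, where horizontal decay holds, and then the ray is
turned down to the horizontal. The first motion leaves an integral over the vertical segment. -/
theorem rayIntegral_airyPhase_eq_horizontal (hη : 0 < η) (hy : y₀ ≤ η) (hB : 0 ≤ B) (hC : 0 ≤ C)
    (hq : ∀ a : ℂ, y₀ ≤ a.im → HasDerivAt q (q' a) a)
    (hb : ∀ a : ℂ, y₀ ≤ a.im → ‖q a‖ ≤ C * rexp (B * ‖a‖))
    (hb' : ∀ a : ℂ, y₀ ≤ a.im → ‖q' a‖ ≤ C * rexp (B * ‖a‖)) (u : ℝ) {e : ℝ} (he : e ^ 2 = 3 / 4) :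
    rayIntegral (fun a => airyPhase u a * q a) (y₀ * I) (e + ((1 / 2 : ℝ) : ℂ) * I) =
      rayIntegral (fun a => airyPhase u a * q a) (η * I) e + ∫ l in y₀..η, airyPhase u (l * I) * q (l * I) * I := by
  have hgrow : ∀ {w m : ℂ} {V s : ℝ}, ‖w‖ ≤ V → ‖m‖ ≤ 1 → 0 ≤ s →
      C * rexp (B * ‖w + s * m‖) ≤ C * rexp (B * V) * rexp (B * s) := by
    intro w m V s hw hm hs
    rw [mul_assoc, ← exp_add, ← mul_add]
    gcongr
    refine (norm_add_le _ _).trans (add_le_add hw ?_)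
    rw [norm_mul, norm_real, norm_of_nonneg hs]
    nlinarith
  have hlin : ∀ l : ℝ, HasDerivAt (fun l : ℝ => (l : ℂ) * I) I l := fun l => by
    simpa using ((hasDerivAt_id (l : ℂ)).mul_const I).comp_ofReal
  have hVl : ∀ l ∈ Icc y₀ η, ‖(l : ℂ) * I‖ ≤ |y₀| + η := by
    intro l hl
    rw [norm_mul, norm_I, mul_one, norm_real, norm_eq_abs, abs_le]
    constructor <;> [linarith [hl.1, neg_abs_le y₀]; linarith [hl.2, abs_nonneg y₀]]
  have him : ∀ (l s κ : ℝ), ((l : ℂ) * I + s * (e + κ * I)).im = l + s * κ := by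
    intro l s κ; simp
  have h1 := airyPhase_ray_homotopy (q := q) (q' := q') (v := fun l => (l : ℂ) * I)
    (v' := fun _ => I) (m := fun _ => (e : ℂ) + ((1 / 2 : ℝ) : ℂ) * I) (m' := fun _ => 0)
    (α := y₀) (β := η) (M := 1) (V := |y₀| + η) (C₁ := rexp ((|y₀| + η) ^ 3 + |u| * (|y₀| + η)))
    (B₁ := (|y₀| + η) ^ 2 + |u| + (|y₀| + η + 1) ^ 2) (c := 1) (u := u)
    (C₂ := C * rexp (B * (|y₀| + η))) (B₂ := B)
    hy one_pos (by positivity) (by positivity) hlin continuous_const (fun l => hasDerivAt_const _ _)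
    (fun l _ => ⟨(slope_norm he).le, by simp, by simp⟩) hVl ?_ ?_ ?_ ?_
  -- During the rotation the vertex is fixed, so the boundary term is zero.
  · have h2 := airyPhase_ray_homotopy (q := q) (q' := q') (v := fun l => (η : ℂ) * I)
      (v' := fun _ => 0) (m := fun l => (e : ℂ) + (l : ℂ) * I) (m' := fun _ => I)
      (α := 0) (β := 1 / 2) (M := 1) (V := |y₀| + η) (C₁ := rexp (η ^ 3 + |u| * η))
      (B₁ := η ^ 2 + |u|) (c := η / 2) (u := u)
      (C₂ := C * rexp (B * (|y₀| + η))) (B₂ := B)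
      (by norm_num) (by positivity) (by positivity) (by positivity) (fun _ => hasDerivAt_const _ _)
      continuous_const (fun l => (hlin l).const_add _)
      (fun l hl => ⟨slope_norm_le he hl.1 hl.2, by simp, by simp⟩) (fun l hl => hVl η ⟨hy, le_rfl⟩)
      ?_ ?_ ?_ ?_
    · have hI : ∫ l in y₀..η, airyPhase u (l * I) * q (l * I) * I =
          -(rayIntegral (fun a => airyPhase u a * q a) (η * I) (e + ((1 / 2 : ℝ) : ℂ) * I) -
          rayIntegral (fun a => airyPhase u a * q a) (y₀ * I) (e + ((1 / 2 : ℝ) : ℂ) * I)) := by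
        rw [h1, neg_neg]
      simp only [mul_zero, intervalIntegral.integral_zero, neg_zero] at h2
      rw [hI, sub_eq_zero.1 h2]
      simp
    · intro l hl s hs
      refine hq _ ?_
      rw [him]; nlinarith [hl.1]
    · intro l hl s hs
      refine (hb _ ?_).trans (hgrow (hVl η ⟨hy, le_rfl⟩) (slope_norm_le he hl.1 hl.2) hs)
      rw [him]; nlinarith [hl.1]
    · intro l hl s hs
      refine (hb' _ ?_).trans (hgrow (hVl η ⟨hy, le_rfl⟩) (slope_norm_le he hl.1 hl.2) hs)
      rw [him]; nlinarith [hl.1]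
    · intro l hl s hs
      exact norm_airyPhase_le_of_slope he hl.1 hl.2 hη u hs
  · intro l hl s hs
    refine hq _ ?_
    rw [him]; nlinarith [hl.1]
  · intro l hl s hs
    refine (hb _ ?_).trans (hgrow (hVl l hl) (slope_norm he).le hs)
    rw [him]; nlinarith [hl.1]
  · intro l hl s hs
    refine (hb' _ ?_).trans (hgrow (hVl l hl) (slope_norm he).le hs)
    rw [him]; nlinarith [hl.1]
  · intro l hl s hs
    exact norm_airyPhase_le_of_pow (slope_norm he) (slope_cube he) (hVl l hl) u hs

theorem integrable_airyPhase_mul_line (hη : 0 < η) (hy : y₀ ≤ η) (hB : 0 ≤ B) (hC : 0 ≤ C)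
    (hq : ∀ a : ℂ, y₀ ≤ a.im → HasDerivAt q (q' a) a)
    (hb : ∀ a : ℂ, y₀ ≤ a.im → ‖q a‖ ≤ C * rexp (B * ‖a‖)) (u : ℝ) :
    Integrable fun x : ℝ => airyPhase u (x + η * I) * q (x + η * I) := by
  have h := (integrable_exp_abs_sub_sq (s := 1 / η) (by positivity) B).const_mul
    (rexp (η ^ 3 / 3 - u * η) * (C * rexp (B * η)))
  refine h.mono' (Continuous.aestronglyMeasurable ?_) (.of_forall fun x => ?_)
  · refine continuous_iff_continuousAt.2 fun x => ?_
    have hc : ContinuousAt (fun x : ℝ => (x : ℂ) + η * I) x := by fun_prop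
    have h1 : y₀ ≤ ((x : ℂ) + η * I).im := by simpa using hy
    exact ContinuousAt.mul (ContinuousAt.comp (f := fun x : ℝ => (x : ℂ) + η * I)
        (hasDerivAt_airyPhase u _).continuousAt hc)
      (ContinuousAt.comp (f := fun x : ℝ => (x : ℂ) + η * I) (hq _ h1).continuousAt hc)
  · have h1 : y₀ ≤ ((x : ℂ) + η * I).im := by simpa using hy
    rw [norm_mul, norm_airyPhase_add_mul_I]
    have h2 : ‖(x : ℂ) + η * I‖ ≤ |x| + η := by
      refine (norm_add_le _ _).trans_eq ?_
      rw [norm_mul, norm_I, mul_one, norm_real, norm_real, norm_eq_abs, norm_of_nonneg hη.le]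
    have h3 : ‖q (x + η * I)‖ ≤ C * rexp (B * (|x| + η)) := (hb _ h1).trans (by gcongr)
    refine (mul_le_mul_of_nonneg_left h3 (exp_pos _).le).trans_eq ?_
    have h4 : η ^ 3 / 3 - x ^ 2 * η - u * η + (B * (|x| + η)) = (η ^ 3 / 3 - u * η) + B * η +
      (B * |x| - x ^ 2 / (1 / η)) := by field_simp; ring
    rw [mul_left_comm, ← exp_add, h4, exp_add, exp_add]
    ring

/-- The vertical segments produced by the two rays cancel, and the two horizontal half-lines join to
a line. -/
theorem rayIntegral_sub_eq_line (hη : 0 < η) (hy : y₀ ≤ η) (hB : 0 ≤ B) (hC : 0 ≤ C)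
    (hq : ∀ a : ℂ, y₀ ≤ a.im → HasDerivAt q (q' a) a)
    (hb : ∀ a : ℂ, y₀ ≤ a.im → ‖q a‖ ≤ C * rexp (B * ‖a‖))
    (hb' : ∀ a : ℂ, y₀ ≤ a.im → ‖q' a‖ ≤ C * rexp (B * ‖a‖)) (u : ℝ) :
    rayIntegral (fun a => airyPhase u a * q a) (y₀ * I) (cexp (I * π / 6)) -
      rayIntegral (fun a => airyPhase u a * q a) (y₀ * I) (cexp (5 * I * π / 6)) =
      ∫ x : ℝ, airyPhase u (x + η * I) * q (x + η * I) := by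
  have h3 : √3 ^ 2 = 3 := sq_sqrt (by norm_num)
  have hs : 0 < √3 / 2 := by positivity
  rw [exp_I_pi_div_six, exp_five_I_pi_div_six,
    rayIntegral_airyPhase_eq_horizontal hη hy hB hC hq hb hb' u (by rw [div_pow, h3]; norm_num),
    rayIntegral_airyPhase_eq_horizontal hη hy hB hC hq hb hb' u (by rw [neg_sq, div_pow, h3]; norm_num),
    add_sub_add_right_eq_sub]
  set G : ℝ → ℂ := fun x => airyPhase u (x + η * I) * q (x + η * I) with hG
  have hGi : Integrable G := integrable_airyPhase_mul_line hη hy hB hC hq hb u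
  have e1 : rayIntegral (fun a => airyPhase u a * q a) (η * I) ((√3 / 2 : ℝ) : ℂ) = ∫ x in Ioi (0 : ℝ), G x := by
    have := integral_comp_mul_right_Ioi G 0 hs
    rw [zero_mul, eq_inv_smul_iff₀ hs.ne'] at this
    rw [← this, rayIntegral, integral_mul_const, mul_comm, real_smul]
    congr 1
    refine integral_congr_ae (.of_forall fun s => ?_)
    simp only [hG]
    push_cast
    rw [add_comm]
  have e2 : rayIntegral (fun a => airyPhase u a * q a) (η * I) ((-(√3 / 2) : ℝ) : ℂ) =
      -∫ x in Ioi (0 : ℝ), G (-x) := by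
    have := integral_comp_mul_right_Ioi (fun x => G (-x)) 0 hs
    rw [zero_mul, eq_inv_smul_iff₀ hs.ne'] at this
    rw [← this, rayIntegral, integral_mul_const, mul_comm, real_smul, ← neg_mul]
    push_cast
    congr 1
    refine integral_congr_ae (.of_forall fun s => ?_)
    simp only [hG]
    push_cast
    rw [add_comm]
    ring_nf
  rw [e1, e2, sub_neg_eq_add, integral_comp_neg_Ioi, neg_zero, add_comm,
    intervalIntegral.integral_Iic_add_Ioi hGi.integrableOn hGi.integrableOn]

end Line

/-! ### The r-Airy functions as line integrals -/

/-- The integrand is entire, so the contour can be moved up to any sufficiently high line without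
crossing a singularity. -/
theorem airyPlus_eq_line (r : ℕ) (τ u : ℝ) {η : ℝ} (hη : |τ| + 2 ≤ η) :
    airyPlus r τ u = (∫ x : ℝ, airyPhase u (x + η * I) * (-(I * (x + η * I)) - τ) ^ r) / (2 * π) := by
  have hη0 : 0 < η := by linarith [abs_nonneg τ]
  have hbase : ∀ a : ℂ, ‖-(I * a) - τ‖ ≤ rexp (‖a‖ + |τ|) := fun a => by
    have h1 : ‖-(I * a) - τ‖ ≤ ‖a‖ + |τ| := by
      refine (norm_sub_le _ _).trans_eq ?_
      rw [norm_neg, norm_mul, norm_I, one_mul, norm_real, norm_eq_abs]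
    linarith [add_one_le_exp (‖a‖ + |τ|)]
  have hpow : ∀ (k : ℕ) (a : ℂ), ‖(-(I * a) - τ) ^ k‖ ≤ rexp (k * |τ|) * rexp (k * ‖a‖) := by
    intro k a
    rw [norm_pow, ← exp_add]
    refine (pow_le_pow_left₀ (norm_nonneg _) (hbase a) k).trans_eq ?_
    rw [← exp_nat_mul]; congr 1; ring
  have key := rayIntegral_sub_eq_line (q := fun a => (-(I * a) - τ) ^ r)
    (q' := fun a => r * (-(I * a) - τ) ^ (r - 1) * (-I)) (y₀ := -(τ + 1)) (η := η)
    (B := r) (C := (r + 1) * rexp (r * |τ|))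
    hη0 (by linarith [neg_abs_le τ]) (by positivity) (by positivity) ?_ ?_ ?_ u
  · rw [airyPlus, airyContourIntegral, ← key, rayIntegral, rayIntegral]
    have : ((-(τ + 1) : ℝ) : ℂ) * I = -(I * (τ + 1)) := by push_cast; ring
    rw [this]
    simp only [airyPhase]
  · intro a _
    have h1 : HasDerivAt (fun a : ℂ => -(I * a) - τ) (-I) a := by
      simpa using (((hasDerivAt_id a).const_mul I).neg.sub_const (τ : ℂ))
    exact h1.pow r
  · intro a _
    refine (hpow r a).trans ?_
    rw [mul_assoc]
    exact le_mul_of_one_le_left (by positivity) (by linarith [show (0 : ℝ) ≤ r by positivity])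
  · intro a _
    rw [norm_mul, norm_mul, norm_neg, norm_I, mul_one, Complex.norm_natCast, mul_assoc]
    refine mul_le_mul (by linarith) ((hpow (r - 1) a).trans ?_) (norm_nonneg _) (by positivity)
    have : ((r - 1 : ℕ) : ℝ) ≤ r := mod_cast Nat.sub_le r 1
    gcongr

theorem airyFun_eq_airyPlus (u : ℝ) : airyFun u = airyPlus 0 0 u := by simp [airyFun, airyPlus]

theorem airyFun_eq_airyMinus (u : ℝ) : airyFun u = airyMinus 0 0 u := by simp [airyFun, airyMinus]

theorem rAiryKernel_eq_shiftKernel (r : ℕ) (τ : ℝ) :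
    rAiryKernel r τ = shiftKernel (airyMinus r τ) (airyPlus r τ) := by
  funext u v
  rw [rAiryKernel, shiftKernel]
  simp only [add_comm]

theorem airyKernel_eq_rAiryKernel : airyKernel = rAiryKernel 0 0 := by
  funext u v
  simp only [airyKernel, rAiryKernel, ← airyFun_eq_airyPlus, ← airyFun_eq_airyMinus]

/-- A ray that leaves the unit circle on its own side, upwards at 30 degrees, never comes closer to
the centre than `√3/2`. This keeps moving rays away from the pole. -/
theorem three_quarters_le_norm_sq {w m : ℂ} {e : ℝ} (hw : ‖w‖ = 1) (he : e ^ 2 = 3 / 4)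
    (hm : m = e + ((1 / 2 : ℝ) : ℂ) * I) (h : 0 ≤ w.re * e) {s : ℝ} (hs : 0 ≤ s) :
    3 / 4 ≤ ‖w + s * m‖ ^ 2 := by
  have h1 : w.re * w.re + w.im * w.im = 1 := by rw [← Complex.normSq_apply, ← Complex.sq_norm, hw]; norm_num
  have h2 : -1 ≤ w.im := by nlinarith [sq_nonneg w.re]
  rw [Complex.sq_norm, Complex.normSq_apply, hm]
  have e1 : (w + s * (e + ((1 / 2 : ℝ) : ℂ) * I)).re = w.re + s * e := by simp
  have e2 : (w + s * (e + ((1 / 2 : ℝ) : ℂ) * I)).im = w.im + s * (1 / 2) := by simp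
  rw [e1, e2]
  nlinarith [mul_nonneg hs h, mul_nonneg hs (show 0 ≤ w.im + 1 by linarith), sq_nonneg (s - 1 / 2)]

theorem hasDerivAt_inv_pow_linear (r : ℕ) (τ : ℝ) {a : ℂ} (ha : I * a - τ ≠ 0) :
    HasDerivAt (fun a : ℂ => ((I * a - τ) ^ r)⁻¹) (-(r * I) * ((I * a - τ) ^ (r + 1))⁻¹) a := by
  have h1 : HasDerivAt (fun a : ℂ => I * a - τ) I a := by
    simpa using (((hasDerivAt_id a).const_mul I).sub_const (τ : ℂ))
  refine ((h1.pow r).inv (pow_ne_zero _ ha)).congr_deriv ?_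
  rcases r with _ | r
  · simp
  · rw [Nat.add_sub_cancel, Pi.pow_apply]
    field_simp
    ring

theorem norm_I_mul_sub (τ : ℝ) (a : ℂ) : ‖I * a - τ‖ = ‖a + I * τ‖ := by
  have : I * a - τ = I * (a + I * τ) := by linear_combination (-τ : ℂ) * I_mul_I
  rw [this, norm_mul, norm_I, one_mul]

theorem rayIntegral_half_circle (r : ℕ) (τ u : ℝ) {w w' : ℝ → ℂ} {e α β : ℝ} (hαβ : α ≤ β)
    (he : e ^ 2 = 3 / 4) (hw : ∀ l, HasDerivAt w (w' l) l) (hw' : Continuous w') (hn : ∀ l, ‖w l‖ = 1)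
    (hn' : ∀ l, ‖w' l‖ = 1) (hre : ∀ l ∈ Icc α β, 0 ≤ (w l).re * e) :
    rayIntegral (fun a => airyPhase u a * ((I * a - τ) ^ r)⁻¹) (-(I * τ) + w β) (e + ((1 / 2 : ℝ) : ℂ) * I) -
      rayIntegral (fun a => airyPhase u a * ((I * a - τ) ^ r)⁻¹) (-(I * τ) + w α) (e + ((1 / 2 : ℝ) : ℂ) * I) =
      -∫ l in α..β, airyPhase u (-(I * τ) + w l) * ((I * (-(I * τ) + w l) - τ) ^ r)⁻¹ * w' l := by
  have hdist : ∀ l ∈ Icc α β, ∀ s : ℝ, 0 ≤ s → 1 / 2 ≤ ‖I * (-(I * τ) + w l + s *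
      (e + ((1 / 2 : ℝ) : ℂ) * I)) - τ‖ := by
    intro l hl s hs
    rw [norm_I_mul_sub]
    have h := three_quarters_le_norm_sq (hn l) he rfl (hre l hl) hs
    rw [show -(I * τ) + w l + s * (e + ((1 / 2 : ℝ) : ℂ) * I) + I * τ = w l + s * (e + ((1 / 2 : ℝ) : ℂ) * I) by ring]
    nlinarith [norm_nonneg (w l + s * (e + ((1 / 2 : ℝ) : ℂ) * I))]
  have hinv : ∀ (k : ℕ) (z : ℂ), 1 / 2 ≤ ‖z‖ → ‖(z ^ k)⁻¹‖ ≤ 2 ^ k := by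
    intro k z hz
    rw [norm_inv, norm_pow, ← inv_pow]
    refine pow_le_pow_left₀ (by positivity) ?_ k
    rw [inv_le_comm₀ (by linarith) (by norm_num)]
    linarith
  refine airyPhase_ray_homotopy (q := fun a => ((I * a - τ) ^ r)⁻¹)
    (q' := fun a => -(r * I) * ((I * a - τ) ^ (r + 1))⁻¹)
    (v := fun l => -(I * τ) + w l) (v' := w') (m := fun _ => e + ((1 / 2 : ℝ) : ℂ) * I)
    (m' := fun _ => 0) (M := 1) (V := |τ| + 1) (C₁ := rexp ((|τ| + 1) ^ 3 + |u| * (|τ| + 1)))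
    (B₁ := (|τ| + 1) ^ 2 + |u| + (|τ| + 1 + 1) ^ 2) (c := 1) (u := u)
    (C₂ := (r + 1) * 2 ^ (r + 1)) (B₂ := 0)
    hαβ one_pos (by positivity) (by positivity) (fun l => (hw l).const_add _) hw'
    (fun l => hasDerivAt_const _ _)
    (fun l _ => ⟨(slope_norm he).le, (hn' l).le, by simp⟩) ?_ ?_ ?_ ?_ ?_
  · intro l _
    refine (norm_add_le _ _).trans_eq ?_
    rw [norm_neg, norm_mul, norm_I, one_mul, norm_real, hn, norm_eq_abs]
  · intro l hl s hs
    refine hasDerivAt_inv_pow_linear r τ fun h => ?_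
    have := hdist l hl s hs
    rw [h] at this; norm_num at this
  · intro l hl s hs
    rw [zero_mul, Real.exp_zero, mul_one]
    refine (hinv r _ (hdist l hl s hs)).trans ?_
    rw [pow_succ]
    have : (0 : ℝ) ≤ r := by positivity
    nlinarith [pow_pos (two_pos (α := ℝ)) r, mul_nonneg this (pow_pos (two_pos (α := ℝ)) r).le]
  · intro l hl s hs
    rw [zero_mul, Real.exp_zero, mul_one, norm_mul, norm_neg, norm_mul, norm_I, mul_one, Complex.norm_natCast]
    exact mul_le_mul (by linarith) (hinv (r + 1) _ (hdist l hl s hs)) (norm_nonneg _) (by positivity)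
  · intro l hl s hs
    refine norm_airyPhase_le_of_pow (slope_norm he) (slope_cube he) ?_ u hs
    refine (norm_add_le _ _).trans_eq ?_
    rw [norm_neg, norm_mul, norm_I, one_mul, norm_real, hn, norm_eq_abs]

/-- The defining contour passes below the pole `-Iτ`, the line above it. The vertices of the right
and left rays are led around the pole along the right and left halves of the unit circle; together
these halves give the full circle integral. Above the pole the contour rises freely. -/
theorem airyMinus_eq_line (r : ℕ) (τ u : ℝ) {η : ℝ} (hη : |τ| + 2 ≤ η) :
    airyMinus r τ u = ((∫ x : ℝ, airyPhase u (x + η * I) * ((I * (x + η * I) - τ) ^ r)⁻¹) +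
      ∮ a in C(-(I * τ), 1), airyPhase u a * ((I * a - τ) ^ r)⁻¹) / (2 * π) := by
  have hη0 : 0 < η := by linarith [abs_nonneg τ]
  set F : ℂ → ℂ := fun a => airyPhase u a * ((I * a - τ) ^ r)⁻¹ with hF
  have him : ∀ a : ℂ, -τ + 1 ≤ a.im → 1 ≤ ‖I * a - τ‖ := by
    intro a ha
    rw [norm_I_mul_sub]
    have h1 := Complex.abs_im_le_norm (a + I * τ)
    have h2 : (a + I * τ).im = a.im + τ := by simp
    rw [h2] at h1
    linarith [le_abs_self (a.im + τ)]
  have hinv : ∀ (k : ℕ) (z : ℂ), 1 ≤ ‖z‖ → ‖(z ^ k)⁻¹‖ ≤ 1 := by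
    intro k z hz
    rw [norm_inv, norm_pow]
    exact inv_le_one_of_one_le₀ (one_le_pow₀ hz)
  have key := rayIntegral_sub_eq_line (q := fun a => ((I * a - τ) ^ r)⁻¹)
    (q' := fun a => -(r * I) * ((I * a - τ) ^ (r + 1))⁻¹) (y₀ := -τ + 1) (η := η)
    (B := 0) (C := r + 1)
    hη0 (by linarith [neg_abs_le τ]) le_rfl (by positivity) ?_ ?_ ?_ u
  · have h3 : √3 ^ 2 = 3 := sq_sqrt (by norm_num)
    have hs : 0 < √3 / 2 := by positivity
    have hpi := pi_pos
    have hcis : ∀ l : ℝ, ‖cexp (l * I)‖ = 1 := norm_exp_ofReal_mul_I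
    have hre : ∀ l ∈ Icc (-(π / 2)) (π / 2), 0 ≤ (cexp (l * I)).re := by
      intro l hl
      rw [Complex.exp_ofReal_mul_I_re]; exact Real.cos_nonneg_of_mem_Icc hl
    have hlin : ∀ l : ℝ, HasDerivAt (fun l : ℝ => (l : ℂ) * I) I l := fun l => by
      simpa using ((hasDerivAt_id (l : ℂ)).mul_const I).comp_ofReal
    have hR := rayIntegral_half_circle r τ u (w := fun l => cexp (l * I))
      (w' := fun l => cexp (l * I) * I) (e := √3 / 2)
      (α := -(π / 2)) (β := π / 2) (by linarith) (by rw [div_pow, h3]; norm_num)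
      (fun l => (hlin l).cexp) (by fun_prop) hcis (fun l => by rw [norm_mul, hcis]; simp)
      (fun l hl => mul_nonneg (hre l hl) hs.le)
    -- The parametrization `π - l` makes the vertex of the left ray rise along the left half-circle
    -- as `l` increases.
    have hL := rayIntegral_half_circle r τ u (w := fun l => cexp ((π - l : ℝ) * I))
      (w' := fun l => -(cexp ((π - l : ℝ) * I) * I)) (e := -(√3 / 2))
      (α := -(π / 2)) (β := π / 2) (by linarith) (by rw [neg_sq, div_pow, h3]; norm_num)
      (fun l => by
        have h := ((hlin (π - l)).cexp).scomp l ((hasDerivAt_id l).const_sub π)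
        simpa [comp_def] using h) (by fun_prop) (fun l => hcis _)
      (fun l => by rw [norm_neg, norm_mul, hcis]; simp)
      (fun l hl => by
        refine mul_nonneg_of_nonpos_of_nonpos ?_ (by linarith)
        rw [Complex.exp_ofReal_mul_I_re, Real.cos_pi_sub, neg_nonpos]
        exact Real.cos_nonneg_of_mem_Icc hl)
    have e1 : cexp (((π / 2 : ℝ) : ℂ) * I) = I := by push_cast; exact Complex.exp_pi_div_two_mul_I
    have e2 : cexp (((-(π / 2) : ℝ) : ℂ) * I) = -I := by
      rw [← Complex.exp_neg_pi_div_two_mul_I]; push_cast; rw [neg_div]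
    have e3 : cexp (((π - π / 2 : ℝ) : ℂ) * I) = I := by rw [show π - π / 2 = π / 2 by ring, e1]
    have e4 : cexp (((π - -(π / 2) : ℝ) : ℂ) * I) = -I := by
      rw [show ((π - -(π / 2) : ℝ) : ℂ) * I = ((-(π / 2) : ℝ) : ℂ) * I + 2 * π * I by push_cast; ring,
        Complex.exp_periodic, e2]
    beta_reduce at hR hL
    rw [e1, e2] at hR
    rw [e3, e4] at hL
    have v1 : -(I * τ) + I = ((-τ + 1 : ℝ) : ℂ) * I := by push_cast; ring
    have v2 : -(I * τ) + -I = -(I * (τ + 1)) := by ring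
    rw [v1, v2, ← exp_I_pi_div_six] at hR
    rw [v1, v2, ← exp_five_I_pi_div_six] at hL
    set G : ℝ → ℂ := fun l => F (-(I * τ) + cexp (l * I)) * (cexp (l * I) * I) with hG
    have hper : Function.Periodic G (2 * π) := by
      intro l
      have : cexp (((l + 2 * π : ℝ) : ℂ) * I) = cexp (l * I) := by
        rw [← Complex.exp_periodic (l * I)]; congr 1; push_cast; ring
      simp only [hG, this]
    have hLint : ∫ l in (-(π / 2))..(π / 2), airyPhase u (-(I * τ) + cexp ((π - l : ℝ) * I)) * ((I * (-(I * τ) +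
        cexp ((π - l : ℝ) * I)) - τ) ^ r)⁻¹ *
        -(cexp ((π - l : ℝ) * I) * I) =
        -∫ l in (π / 2)..(3 * π / 2), G l := by
      have := intervalIntegral.integral_comp_sub_left (a := -(π / 2)) (b := π / 2) G π
      rw [show π - π / 2 = π / 2 by ring, show π - -(π / 2) = 3 * π / 2 by ring] at this
      rw [← this, ← intervalIntegral.integral_neg]
      simp only [hG, hF, mul_neg]
    have hGc : Continuous G := by
      refine continuous_iff_continuousAt.2 fun l => ?_
      have hz : I * (-(I * τ) + cexp (l * I)) - τ ≠ 0 := by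
        rw [← norm_ne_zero_iff, norm_I_mul_sub, show -(I * τ) + cexp (l * I) + I * τ = cexp (l * I) by ring, hcis]
        exact one_ne_zero
      have hF1 : ContinuousAt F (-(I * τ) + cexp (l * I)) :=
        (hasDerivAt_airyPhase u _).continuousAt.mul (hasDerivAt_inv_pow_linear r τ hz).continuousAt
      refine ContinuousAt.mul (ContinuousAt.comp (f := fun l : ℝ => -(I * τ) + cexp (l * I)) hF1 ?_) ?_ <;> fun_prop
    -- The circle is started at `-π/2`, so that its two halves are the paths of the two vertices.
    have hcirc : ∮ a in C(-(I * τ), 1), F a = (∫ l in (-(π / 2))..(π / 2), G l) +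
        ∫ l in (π / 2)..(3 * π / 2), G l := by
      rw [intervalIntegral.integral_add_adjacent_intervals (hGc.intervalIntegrable _ _)
        (hGc.intervalIntegrable _ _), circleIntegral]
      have := hper.intervalIntegral_add_eq (-(π / 2)) 0
      rw [show -(π / 2) + 2 * π = 3 * π / 2 by ring, zero_add] at this
      rw [this]
      refine intervalIntegral.integral_congr fun l _ => ?_
      simp only [hG, circleMap, deriv_circleMap, smul_eq_mul, Complex.ofReal_one, one_mul, zero_add]
      ring
    rw [hLint, neg_neg] at hL
    rw [airyMinus, airyContourIntegral]
    change (rayIntegral F _ _ - rayIntegral F _ _) / _ = (_ + ∮ a in C(-(I * τ), 1), F a) / _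
    rw [← key, hcirc]
    congr 1
    linear_combination -hR + hL
  · intro a ha
    refine hasDerivAt_inv_pow_linear r τ fun h => ?_
    have := him a ha
    rw [h] at this; norm_num at this
  · intro a ha
    rw [zero_mul, Real.exp_zero, mul_one]
    exact (hinv r _ (him a ha)).trans (by linarith [show (0 : ℝ) ≤ r by positivity])
  · intro a ha
    rw [zero_mul, Real.exp_zero, mul_one, norm_mul, norm_neg, norm_mul, norm_I, mul_one, Complex.norm_natCast]
    have h1 := hinv (r + 1) _ (him a ha)
    have h2 : (0 : ℝ) ≤ r := by positivity
    nlinarith [norm_nonneg (((I * a - τ) ^ (r + 1))⁻¹)]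

/-! ### Saddle point analysis at the edge -/

/-- The rescaled integrand `exp (n (ζ - ζ² / 2)) / (1 + ζ) ^ n` at `ζ = ε ω`. -/
noncomputable def saddle (n : ℕ) (ε : ℝ) (ω : ℂ) : ℂ := cexp (n * (ε * ω - (ε * ω) ^ 2 / 2)) / (1 + ε * ω) ^ n

theorem logTaylor_four (z : ℂ) : Complex.logTaylor 4 z = z - z ^ 2 / 2 + z ^ 3 / 3 := by
  rw [Complex.logTaylor, sum_range_succ, sum_range_succ, sum_range_succ, sum_range_succ, Finset.sum_range_zero]
  push_cast
  ring

/-- The exponent is `n` times the second-order Taylor polynomial of `log (1 + ζ)` minus the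
logarithm itself. With `n ε³ = 1` the cubic term is exactly `-ω³/3`, and `δ` is `n` times the Taylor
remainder. -/
theorem exists_saddle_eq {ε : ℝ} (hn : n * ε ^ 3 = 1) {ω : ℂ} (h1 : ‖(ε : ℂ) * ω‖ < 1 / 2) :
    ∃ δ : ℂ, ‖δ‖ ≤ ‖(ε : ℂ)‖ * ‖ω‖ ^ 4 ∧ saddle n ε ω = cexp (-ω ^ 3 / 3 - δ) := by
  refine ⟨n * (Complex.log (1 + ε * ω) - Complex.logTaylor 4 (ε * ω)), ?_, ?_⟩
  · have h3 := Complex.norm_log_sub_logTaylor_le 3 (h1.trans (by norm_num))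
    rw [norm_mul, Complex.norm_natCast]
    have h4 : (1 - ‖(ε : ℂ) * ω‖)⁻¹ ≤ 2 := by rw [inv_le_comm₀ (by linarith) (by norm_num)]; linarith
    have h5 : (n : ℝ) * ‖(ε : ℂ)‖ ^ 3 = 1 := by
      have := congrArg abs hn
      rw [abs_mul, Nat.abs_cast, abs_pow, abs_one] at this
      rw [norm_real, norm_eq_abs, this]
    have h6 : ‖(ε : ℂ) * ω‖ ^ (3 + 1) * (1 - ‖(ε : ℂ) * ω‖)⁻¹ / ((3 : ℕ) + 1) ≤ ‖(ε : ℂ) * ω‖ ^ 4 := by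
      have : ‖(ε : ℂ) * ω‖ ^ (3 + 1) * (1 - ‖(ε : ℂ) * ω‖)⁻¹ ≤ ‖(ε : ℂ) * ω‖ ^ 4 * 2 := by gcongr
      push_cast
      have h7 : 0 ≤ ‖(ε : ℂ) * ω‖ ^ 4 := by positivity
      linarith
    calc (n : ℝ) * _ ≤ n * ‖(ε : ℂ) * ω‖ ^ 4 := by gcongr; exact h3.trans h6
      _ = (n * ‖(ε : ℂ)‖ ^ 3) * (‖(ε : ℂ)‖ * ‖ω‖ ^ 4) := by rw [norm_mul]; ring
      _ = _ := by rw [h5, one_mul]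
  · have hne : 1 + (ε : ℂ) * ω ≠ 0 := by
      intro h
      have : (ε : ℂ) * ω = -1 := by linear_combination h
      rw [this] at h1; norm_num at h1
    symm
    rw [saddle, eq_div_iff (pow_ne_zero _ hne), ← Complex.exp_log hne, ← Complex.exp_nat_mul,
      Complex.exp_log hne, ← Complex.exp_add, logTaylor_four]
    congr 1
    have h2' : (n : ℂ) * (ε : ℂ) ^ 3 = 1 := mod_cast congrArg ((↑) : ℝ → ℂ) hn
    linear_combination (ω ^ 3 / 3) * h2'

theorem tendsto_saddle {ε : ℕ → ℝ} (hε : Tendsto ε atTop (𝓝 0)) (hn : ∀ᶠ n : ℕ in atTop, n * ε n ^ 3 = 1)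
    {ω : ℕ → ℂ} {ω₀ : ℂ} (hω : Tendsto ω atTop (𝓝 ω₀)) :
    Tendsto (fun n => saddle n (ε n) (ω n)) atTop (𝓝 (cexp (-ω₀ ^ 3 / 3))) := by
  have hε' : Tendsto (fun n => (ε n : ℂ)) atTop (𝓝 0) := by
    simpa [comp_def] using (Complex.continuous_ofReal.tendsto 0).comp hε
  have hz : Tendsto (fun n => (ε n : ℂ) * ω n) atTop (𝓝 0) := by simpa using hε'.mul hω
  have hz1 : ∀ᶠ n in atTop, ‖(ε n : ℂ) * ω n‖ < 1 / 2 := by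
    have := hz.norm
    rw [norm_zero] at this
    exact this.eventually (gt_mem_nhds (by norm_num))
  -- The estimate holds only for large `n`; elsewhere the value of `δ` is immaterial.
  have hex : ∀ n : ℕ, ∃ δ : ℂ, (n * ε n ^ 3 = 1 ∧ ‖(ε n : ℂ) * ω n‖ < 1 / 2) →
      ‖δ‖ ≤ ‖(ε n : ℂ)‖ * ‖ω n‖ ^ 4 ∧ saddle n (ε n) (ω n) = cexp (-ω n ^ 3 / 3 - δ) := by
    intro n
    by_cases h : n * ε n ^ 3 = 1 ∧ ‖(ε n : ℂ) * ω n‖ < 1 / 2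
    · obtain ⟨δ, hδ⟩ := exists_saddle_eq h.1 h.2
      exact ⟨δ, fun _ => hδ⟩
    · exact ⟨0, fun h' => absurd h' h⟩
  choose δ hδ using hex
  have herr : Tendsto δ atTop (𝓝 0) := by
    have hb : Tendsto (fun n => ‖(ε n : ℂ)‖ * ‖ω n‖ ^ 4) atTop (𝓝 0) := by simpa using hε'.norm.mul (hω.norm.pow 4)
    refine squeeze_zero_norm' ?_ hb
    filter_upwards [hz1, hn] with n h1 h2 using (hδ n ⟨h2, h1⟩).1
  have hlim := (((hω.pow 3).neg.div_const 3).sub herr).cexp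
  rw [sub_zero] at hlim
  refine hlim.congr' ?_
  filter_upwards [hz1, hn] with n h1 h2 using (hδ n ⟨h2, h1⟩).2.symm

theorem one_sub_cos_ge {x : ℝ} (hx : |x| ≤ π) : 2 / π ^ 2 * x ^ 2 ≤ 1 - Real.cos x := by
  linarith [Real.cos_le_one_sub_mul_cos_sq hx]

/-- On this circle `|1 + εω|` is constant, so only the exponential varies; it is largest at the real
point `ω = -η`. With `κ = 1 - cos (ε Y)` the loss is at least `2Rη κ/ε²`. A negative `u ≥ -c₀` gives
back at most half of it once `c₀ ε ≤ η`, and `κ ≥ (2/π²)(εY)²` makes the remainder Gaussian in `Y`.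
-/
theorem norm_saddle_circle_le {ε η c₀ : ℝ} (hε : 0 < ε) (hn : n * ε ^ 3 = 1) (hη : 0 < η)
    (hηε : η * ε ≤ 1 / 2) (hcε : c₀ * ε ≤ η) {Y : ℝ} (hY : |ε * Y| ≤ π) {u : ℝ}
    (hu : -c₀ ≤ u) {ω : ℂ} (hω : 1 + ε * ω = ((1 - η * ε : ℝ) : ℂ) * cexp ((ε * Y : ℝ) * I)) :
    ‖saddle n ε ω * cexp (u * ω)‖ ≤ ‖saddle n ε (-η)‖ * rexp (-η * u) * rexp (-(η / π ^ 2) * Y ^ 2) := by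
  set R : ℝ := 1 - η * ε with hR
  have hR0 : 1 / 2 ≤ R := by rw [hR]; linarith
  set φ : ℝ := ε * Y with hφ
  have hζ : (ε : ℂ) * ω = R * cexp (φ * I) - 1 := by linear_combination hω
  have hn1 : ‖(1 + (ε : ℂ) * ω) ^ n‖ = R ^ n := by
    rw [hω, norm_pow, norm_mul, norm_exp_ofReal_mul_I, mul_one, norm_real, norm_of_nonneg (by linarith)]
  have hn2 : ‖(1 + (ε : ℂ) * (-η)) ^ n‖ = R ^ n := by
    rw [show 1 + (ε : ℂ) * (-η) = (R : ℂ) by rw [hR]; push_cast; ring, norm_pow, norm_real,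
      norm_of_nonneg (by linarith)]
  have hωre : ε * ω.re = R * Real.cos φ - 1 := by
    have := congrArg Complex.re hζ
    rw [re_ofReal_mul, Complex.sub_re, re_ofReal_mul, Complex.exp_ofReal_mul_I_re, Complex.one_re] at this
    exact this
  have hωim : ε * ω.im = R * Real.sin φ := by
    have := congrArg Complex.im hζ
    rw [Complex.im_ofReal_mul, Complex.sub_im, Complex.im_ofReal_mul, Complex.exp_ofReal_mul_I_im,
      Complex.one_im, sub_zero] at this
    exact this
  have hsq : (((ε : ℂ) * ω) ^ 2 / 2).re = ((ε * ω.re) ^ 2 - (ε * ω.im) ^ 2) / 2 := by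
    rw [show ((ε : ℂ) * ω) ^ 2 / 2 = ((1 / 2 : ℝ) : ℂ) * (((ε : ℂ) * ω) * ((ε : ℂ) * ω)) by
      push_cast; ring, re_ofReal_mul, Complex.mul_re, re_ofReal_mul,
      Complex.im_ofReal_mul]
    ring
  have hre : ((n : ℂ) * (ε * ω - (ε * ω) ^ 2 / 2)).re =
      n * ((R * Real.cos φ - 1) - ((R * Real.cos φ - 1) ^ 2 - (R * Real.sin φ) ^ 2) / 2) := by
    rw [show (n : ℂ) = ((n : ℝ) : ℂ) by simp, re_ofReal_mul, Complex.sub_re, hsq, re_ofReal_mul, hωre, hωim]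
  have hre0 : ((n : ℂ) * (ε * (-η) - (ε * (-η)) ^ 2 / 2)).re = n * ((R - 1) - (R - 1) ^ 2 / 2) := by
    rw [show (n : ℂ) * (ε * (-η) - (ε * (-η)) ^ 2 / 2) = ((n * ((R - 1) - (R - 1) ^ 2 / 2) : ℝ) : ℂ) by
      rw [hR]; push_cast; ring, ofReal_re]
  have hure : ((u : ℂ) * ω).re = u * ω.re := re_ofReal_mul _ _
  rw [norm_mul, saddle, saddle, norm_div, norm_div, hn1, hn2, norm_exp, norm_exp,
    norm_exp, hre, hre0, hure, div_mul_eq_mul_div, div_mul_eq_mul_div, div_mul_eq_mul_div]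
  refine div_le_div_of_nonneg_right ?_ (by positivity)
  rw [← exp_add, ← exp_add, ← exp_add, exp_le_exp]
  set κ : ℝ := 1 - Real.cos φ with hκ
  have hκ0 : 0 ≤ κ := by rw [hκ]; linarith [Real.cos_le_one φ]
  have hκφ : 2 / π ^ 2 * φ ^ 2 ≤ κ := one_sub_cos_ge hY
  have hcos : Real.cos φ = 1 - κ := by rw [hκ]; ring
  have hsin : Real.sin φ ^ 2 = 1 - (1 - κ) ^ 2 := by have := Real.sin_sq_add_cos_sq φ; rw [hcos] at this; linarith
  have hω1 : ω.re = -η - R * κ / ε := by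
    rw [eq_sub_iff_add_eq, ← mul_right_inj' hε.ne', mul_add, hωre, hcos, mul_div_cancel₀ _ hε.ne', hR]
    ring
  have hn3 : (n : ℝ) * ε * ε = 1 / ε := by field_simp; linear_combination hn
  have e1 : n * ((R * Real.cos φ - 1) - ((R * Real.cos φ - 1) ^ 2 - (R * Real.sin φ) ^ 2) / 2) =
      n * ((R - 1) - (R - 1) ^ 2 / 2) - n * (κ * (2 * R - R ^ 2 * (2 - κ))) := by
    rw [mul_pow R (Real.sin φ), hsin, hcos]; ring
  -- The discarded term is `n R² κ²`; what is kept uses `1 - R = η ε`.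
  have e2 : n * (κ * (2 * R * (η * ε))) ≤ n * (κ * (2 * R - R ^ 2 * (2 - κ))) := by
    refine mul_le_mul_of_nonneg_left (mul_le_mul_of_nonneg_left ?_ hκ0) (Nat.cast_nonneg _)
    have : η * ε = 1 - R := by rw [hR]; ring
    rw [this]; nlinarith [sq_nonneg R]
  have hn4 : (n : ℝ) * ε = 1 / ε ^ 2 := by field_simp; linear_combination hn
  have e3 : n * (κ * (2 * R * (η * ε))) = 2 * R * η * (κ / ε ^ 2) := by
    rw [show n * (κ * (2 * R * (η * ε))) = (n * ε) * (κ * (2 * R * η)) by ring, hn4]; ring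
  have e4 : u * ω.re ≤ -η * u + c₀ * ε * R * (κ / ε ^ 2) := by
    rw [hω1]
    have h1 : c₀ * ε * R * (κ / ε ^ 2) = c₀ * (R * κ / ε) := by field_simp
    have h2 : 0 ≤ R * κ / ε := div_nonneg (mul_nonneg (by linarith) hκ0) hε.le
    have h3 := mul_le_mul_of_nonneg_right hu h2
    rw [h1]; linarith
  have hκε : 0 ≤ κ / ε ^ 2 := by positivity
  have e5 : 2 / π ^ 2 * Y ^ 2 ≤ κ / ε ^ 2 := by
    rw [le_div_iff₀ (by positivity)]
    calc _ = 2 / π ^ 2 * φ ^ 2 := by rw [hφ]; ring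
      _ ≤ κ := hκφ
  have e6 : c₀ * ε * R * (κ / ε ^ 2) ≤ η * R * (κ / ε ^ 2) := by gcongr
  have e7 : 1 / 2 * η * (2 / π ^ 2 * Y ^ 2) ≤ R * η * (κ / ε ^ 2) := by gcongr
  have e8 : 1 / 2 * η * (2 / π ^ 2 * Y ^ 2) = η / π ^ 2 * Y ^ 2 := by ring
  rw [e1]
  linarith

/-- On a vertical line the decay `exp (-n ε² Y² / 2)` competes with the growth of `|1 + εω|^n`. To
leading order they cancel; the denominator `(1 + εη)²` in the growth exponent leaves a surplus of
order `n ε³ η Y²`, which is Gaussian since `n ε³ = 1`. -/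
theorem norm_saddle_line_inv_le {ε η : ℝ} (hε : 0 < ε) (hn : n * ε ^ 3 = 1) (hη : 0 < η) (hηε : η * ε ≤ 1) (Y v : ℝ) :
    ‖(saddle n ε (η + Y * I))⁻¹ * cexp (-v * (η + Y * I))‖ ≤
      ‖(saddle n ε η)⁻¹‖ * rexp (-η * v) * rexp (-(η / 4) * Y ^ 2) := by
  have h1 : ‖1 + (ε : ℂ) * (η + Y * I)‖ ≤ (1 + ε * η) * rexp (ε ^ 2 * Y ^ 2 / (2 * (1 + ε * η) ^ 2)) := by
    rw [show 1 + (ε : ℂ) * (η + Y * I) = ((1 + ε * η : ℝ) : ℂ) + ((ε * Y : ℝ) : ℂ) * I by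
      push_cast; ring, Complex.norm_add_mul_I]
    refine Real.sqrt_le_iff.2 ⟨by positivity, ?_⟩
    rw [mul_pow (1 + ε * η) (rexp _), mul_pow, ← exp_nat_mul]
    have h2 := add_one_le_exp (((2 : ℕ) : ℝ) * (ε ^ 2 * Y ^ 2 / (2 * (1 + ε * η) ^ 2)))
    have h3 := mul_le_mul_of_nonneg_left h2 (sq_nonneg (1 + ε * η))
    refine le_trans (le_of_eq ?_) h3
    push_cast
    field_simp
    ring
  have hre : ((n : ℂ) * (ε * (η + Y * I) - (ε * (η + Y * I)) ^ 2 / 2)).re =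
      n * (ε * η - (ε * η) ^ 2 / 2) + n * (ε * Y) ^ 2 / 2 := by
    rw [show (n : ℂ) * (ε * (η + Y * I) - (ε * (η + Y * I)) ^ 2 / 2) =
      ((n * (ε * η - (ε * η) ^ 2 / 2) + n * (ε * Y) ^ 2 / 2 : ℝ) : ℂ) + ((n * (ε * Y - ε ^ 2 * η * Y) : ℝ) : ℂ) * I by
      push_cast
      linear_combination (-(n : ℂ) * (ε * Y) ^ 2 / 2) * I_sq]
    rw [Complex.add_re, ofReal_re, re_ofReal_mul, Complex.I_re, mul_zero, add_zero]
  have hre0 : ((n : ℂ) * (ε * η - (ε * η) ^ 2 / 2)).re = n * (ε * η - (ε * η) ^ 2 / 2) := by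
    rw [show (n : ℂ) * (ε * η - (ε * η) ^ 2 / 2) = ((n * (ε * η - (ε * η) ^ 2 / 2) : ℝ) : ℂ) by
      push_cast; ring, ofReal_re]
  have hv : (-(v : ℂ) * (η + Y * I)).re = -η * v := by simp; ring
  have h10 : ‖(1 + (ε : ℂ) * η)‖ = 1 + ε * η := by
    rw [show 1 + (ε : ℂ) * η = ((1 + ε * η : ℝ) : ℂ) by push_cast; ring, norm_real, norm_of_nonneg (by positivity)]
  rw [norm_mul, saddle, saddle, inv_div, inv_div, norm_div, norm_div, norm_exp, norm_exp,
    norm_exp, hre, hre0, hv, norm_pow, norm_pow, h10]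
  have h4 : ‖1 + (ε : ℂ) * (η + Y * I)‖ ^ n ≤
      (1 + ε * η) ^ n * rexp (n * (ε ^ 2 * Y ^ 2 / (2 * (1 + ε * η) ^ 2))) := by
    refine (pow_le_pow_left₀ (norm_nonneg _) h1 n).trans_eq ?_
    rw [mul_pow, ← exp_nat_mul]
  rw [div_mul_eq_mul_div, div_mul_eq_mul_div, div_mul_eq_mul_div, exp_add,
    div_le_div_iff₀ (by positivity) (by positivity)]
  have h5 : n * (ε ^ 2 * Y ^ 2 / (2 * (1 + ε * η) ^ 2)) ≤ -(η / 4) * Y ^ 2 + n * (ε * Y) ^ 2 / 2 := by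
    have hx : 0 ≤ ε * η := by positivity
    have hx1 : ε * η ≤ 1 := by linarith
    -- This rests on `1 ≤ (1 - x/2)(1 + x)²` for `0 ≤ x ≤ 1`, with `x = εη`.
    have h6 : ε ^ 2 * Y ^ 2 / (2 * (1 + ε * η) ^ 2) ≤ (ε * Y) ^ 2 / 2 * (1 - ε * η / 2) := by
      rw [div_le_iff₀ (by positivity)]
      have : 1 ≤ (1 - ε * η / 2) * (1 + ε * η) ^ 2 := by nlinarith [mul_nonneg hx hx]
      nlinarith [mul_le_mul_of_nonneg_left this (sq_nonneg (ε * Y))]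
    have h7 : (n : ℝ) * ((ε * Y) ^ 2 / 2 * (1 - ε * η / 2)) = -(η / 4) * Y ^ 2 + n * (ε * Y) ^ 2 / 2 := by
      linear_combination (-(η / 4) * Y ^ 2) * hn
    rw [← h7]
    gcongr
  have h8 := exp_le_exp.2 h5
  rw [exp_add] at h8
  have h9 := mul_le_mul_of_nonneg_left h8 (show 0 ≤ (1 + ε * η) ^ n by positivity)
  have h11 := mul_le_mul_of_nonneg_right (h4.trans h9)
    (show 0 ≤ rexp (-η * v) * rexp (n * (ε * η - (ε * η) ^ 2 / 2)) by positivity)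
  refine le_trans (le_of_eq ?_) (h11.trans_eq ?_) <;> ring

/-- The point `ω` of the circle `|1 + εω| = 1 - ηε` with `arg (1 + εω) = ε Y`. -/
noncomputable def circlePoint (ε η Y : ℝ) : ℂ := (((1 - η * ε : ℝ) : ℂ) * cexp ((ε * Y : ℝ) * I) - 1) / ε

/-- The last factor is `dω/dY` without its factor `I`. -/
noncomputable def circlePart (n : ℕ) (ε η : ℝ) (g : ℂ → ℂ) (u : ℝ) : ℂ :=
  ∫ Y in (-(π / ε))..(π / ε), saddle n ε (circlePoint ε η Y) * cexp (u * circlePoint ε η Y) * g (circlePoint ε η Y) *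
      (((1 - η * ε : ℝ) : ℂ) * cexp ((ε * Y : ℝ) * I))

noncomputable def linePart (n : ℕ) (ε η : ℝ) (p : ℂ → ℂ) (v : ℝ) : ℂ :=
  ∫ Y : ℝ, (saddle n ε (η + Y * I))⁻¹ * cexp (-v * (η + Y * I)) * p (η + Y * I)

noncomputable def smallCirclePart (n : ℕ) (ε τ : ℝ) (g : ℂ → ℂ) (u : ℝ) : ℂ :=
  ∮ ω in C((τ : ℂ), 1), saddle n ε ω * cexp (u * ω) * g ω

theorem measurable_saddle (n : ℕ) (ε : ℝ) : Measurable (saddle n ε) := by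
  unfold saddle
  refine Measurable.div (by fun_prop) (by fun_prop)

theorem measurable_circlePoint (ε η : ℝ) : Measurable (circlePoint ε η) := by
  unfold circlePoint
  refine Measurable.div_const (by fun_prop) _

/-- A difference quotient at `ε = 0`: on the scale of `ω` the circle straightens to the vertical
line through `-η`. -/
theorem tendsto_circlePoint {ε : ℕ → ℝ} (hε : Tendsto ε atTop (𝓝 0)) (hε0 : ∀ᶠ n : ℕ in atTop, 0 < ε n) (η Y : ℝ) :
    Tendsto (fun n => circlePoint (ε n) η Y) atTop (𝓝 (-η + Y * I)) := by
  have hd : HasDerivAt (fun x : ℂ => (1 - η * x) * cexp (x * Y * I)) (-η + Y * I) 0 := by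
    have h1 : HasDerivAt (fun x : ℂ => 1 - η * x) (-(η * 1)) 0 :=
      ((hasDerivAt_id (0 : ℂ)).const_mul (η : ℂ)).const_sub 1
    have h2 : HasDerivAt (fun x : ℂ => cexp (x * Y * I)) (cexp (0 * Y * I) * (1 * Y * I)) 0 :=
      (((hasDerivAt_id (0 : ℂ)).mul_const (Y : ℂ)).mul_const I).cexp
    refine (h1.mul h2).congr_deriv ?_
    simp
  have hε' : Tendsto (fun n => (ε n : ℂ)) atTop (𝓝[≠] 0) := by
    refine tendsto_nhdsWithin_iff.2 ⟨?_, ?_⟩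
    · simpa [comp_def] using (Complex.continuous_ofReal.tendsto 0).comp hε
    · filter_upwards [hε0] with n h
      simpa using h.ne'
  refine ((hasDerivAt_iff_tendsto_slope.1 hd).comp hε').congr fun n => ?_
  simp only [comp_apply, slope_def_field, circlePoint]
  push_cast
  simp

/-- The Gaussian bound gives both conclusions: a bound uniform in `u ≥ -c₀`, as the Fredholm series
require, and the pointwise limit by dominated convergence, with the growing interval inserted as an
indicator. -/
theorem circlePart_limit {ε : ℕ → ℝ} (hε : Tendsto ε atTop (𝓝 0)) (hε0 : ∀ᶠ n : ℕ in atTop, 0 < ε n)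
    (hn : ∀ᶠ n : ℕ in atTop, n * ε n ^ 3 = 1)
    {η c₀ C : ℝ} (hη : 0 < η) {g : ℕ → ℂ → ℂ} {g₀ : ℝ → ℂ}
    (hgm : ∀ n, Measurable (g n))
    (hg : ∀ᶠ n in atTop, ∀ Y, ‖g n (circlePoint (ε n) η Y)‖ ≤ C)
    (hgt : ∀ Y, Tendsto (fun n => g n (circlePoint (ε n) η Y)) atTop (𝓝 (g₀ Y))) :
    (∃ D, ∀ᶠ n in atTop, ∀ u, -c₀ ≤ u → ‖circlePart n (ε n) η (g n) u‖ ≤ D * rexp (-η * u)) ∧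
    ∀ u, Tendsto (fun n => circlePart n (ε n) η (g n) u) atTop
      (𝓝 (∫ Y : ℝ, cexp (u * (-η + Y * I) - (-η + Y * I) ^ 3 / 3) * g₀ Y)) := by
  have hb : 0 < η / π ^ 2 := by positivity
  have hgauss : Integrable fun Y : ℝ => rexp (-(η / π ^ 2) * Y ^ 2) := integrable_exp_neg_mul_sq hb
  set M : ℝ := ‖cexp (-(-(η : ℂ)) ^ 3 / 3)‖ + 1 with hM
  have hsad : ∀ᶠ n : ℕ in atTop, ‖saddle n (ε n) (-η)‖ ≤ M := by
    have := (tendsto_saddle hε hn (tendsto_const_nhds (x := (-(η : ℂ))))).norm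
    exact (this.eventually (gt_mem_nhds (lt_add_one _))).mono fun n h => h.le
  have hC : 0 ≤ C := by
    obtain ⟨n, h⟩ := hg.exists
    exact (norm_nonneg _).trans (h 0)
  have hsmall : ∀ (c : ℝ) {d : ℝ}, 0 < d → ∀ᶠ n in atTop, c * ε n ≤ d := by
    intro c d hd
    have : Tendsto (fun n => c * ε n) atTop (𝓝 0) := by simpa using hε.const_mul c
    exact (this.eventually (gt_mem_nhds hd)).mono fun n h => h.le
  have hpt : ∀ c₁ : ℝ, ∀ᶠ n in atTop, ∀ u, -c₁ ≤ u → ∀ Y, |ε n * Y| ≤ π →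
      ‖saddle n (ε n) (circlePoint (ε n) η Y) * cexp (u * circlePoint (ε n) η Y) * g n (circlePoint (ε n) η Y) *
          (((1 - η * ε n : ℝ) : ℂ) * cexp ((ε n * Y : ℝ) * I))‖ ≤
        M * C * rexp (-η * u) * rexp (-(η / π ^ 2) * Y ^ 2) := by
    intro c₁
    filter_upwards [hε0, hn, hsad, hg, hsmall η (show (0 : ℝ) < 1 / 2 by norm_num), hsmall c₁ hη] with
      n h1 h2 h3 h4 h5 h6 u hu Y hY
    have hω : 1 + (ε n : ℂ) * circlePoint (ε n) η Y = ((1 - η * ε n : ℝ) : ℂ) * cexp ((ε n * Y : ℝ) * I) := by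
      have : (ε n : ℂ) ≠ 0 := mod_cast h1.ne'
      rw [circlePoint, mul_div_cancel₀ _ this]; ring
    have h7 := norm_saddle_circle_le h1 h2 hη h5 h6 hY hu hω
    have h8 : ‖((1 - η * ε n : ℝ) : ℂ) * cexp ((ε n * Y : ℝ) * I)‖ ≤ 1 := by
      rw [norm_mul, norm_exp_ofReal_mul_I, mul_one, norm_real, norm_eq_abs, abs_le]
      have : 0 ≤ η * ε n := by positivity
      constructor <;> linarith
    rw [norm_mul, norm_mul]
    calc _ ≤ (‖saddle n (ε n) (-η)‖ * rexp (-η * u) * rexp (-(η / π ^ 2) * Y ^ 2)) * C * 1 := by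
          gcongr
          exact h4 Y
      _ ≤ (M * rexp (-η * u) * rexp (-(η / π ^ 2) * Y ^ 2)) * C * 1 := by gcongr
      _ = _ := by ring
  have hmem : ∀ n, 0 < ε n → ∀ Y, Y ∈ Ioc (-(π / ε n)) (π / ε n) → |ε n * Y| ≤ π := by
    intro n h1 Y hY
    rw [abs_mul, abs_of_pos h1, mul_comm, ← le_div_iff₀ h1, abs_le]
    exact ⟨hY.1.le, hY.2⟩
  constructor
  · refine ⟨M * C * ∫ Y : ℝ, rexp (-(η / π ^ 2) * Y ^ 2), ?_⟩
    filter_upwards [hpt c₀, hε0] with n h1 h2 u hu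
    have hp : 0 < π / ε n := div_pos pi_pos h2
    rw [circlePart, intervalIntegral.integral_of_le (by linarith)]
    refine (norm_integral_le_of_norm_le (hgauss.const_mul (M * C * rexp (-η * u))).integrableOn
      ((ae_restrict_iff' measurableSet_Ioc).2 (.of_forall fun Y hY =>
        h1 u hu Y (hmem n h2 Y hY)))).trans ?_
    refine (setIntegral_le_integral (hgauss.const_mul _) (.of_forall fun Y => by positivity)).trans_eq ?_
    rw [integral_const_mul]; ring
  · intro u
    have hrew : ∀ᶠ n in atTop, circlePart n (ε n) η (g n) u = ∫ Y : ℝ,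
        (Ioc (-(π / ε n)) (π / ε n)).indicator (fun Y =>
          saddle n (ε n) (circlePoint (ε n) η Y) * cexp (u * circlePoint (ε n) η Y) *
        g n (circlePoint (ε n) η Y) * (((1 - η * ε n : ℝ) : ℂ) * cexp ((ε n * Y : ℝ) * I))) Y := by
      filter_upwards [hε0] with n h2
      have hp : 0 < π / ε n := div_pos pi_pos h2
      rw [circlePart, intervalIntegral.integral_of_le (by linarith), integral_indicator measurableSet_Ioc]
    refine Tendsto.congr' (hrew.mono fun n h => h.symm) ?_
    refine tendsto_integral_filter_of_dominated_convergence
      (fun Y => M * C * rexp (-η * u) * rexp (-(η / π ^ 2) * Y ^ 2)) ?_ ?_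
      (hgauss.const_mul _) ?_
    · refine .of_forall fun n => (Measurable.indicator ?_ measurableSet_Ioc).aestronglyMeasurable
      have h1 := measurable_circlePoint (ε n) η
      have h2 := (measurable_saddle n (ε n)).comp h1
      have h3 := (hgm n).comp h1
      refine ((h2.mul (by fun_prop)).mul h3).mul (by fun_prop)
    · filter_upwards [hpt |u|, hε0] with n h1 h2
      refine .of_forall fun Y => ?_
      by_cases hY : Y ∈ Ioc (-(π / ε n)) (π / ε n)
      · rw [indicator_of_mem hY]
        exact h1 u (neg_abs_le u) Y (hmem n h2 Y hY)
      · rw [indicator_of_notMem hY, norm_zero]; positivity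
    · refine .of_forall fun Y => ?_
      have hcp := tendsto_circlePoint hε hε0 η Y
      have hind : ∀ᶠ n in atTop, Y ∈ Ioc (-(π / ε n)) (π / ε n) := by
        filter_upwards [hε0, hsmall (|Y| + 1) pi_pos] with n h1 h2
        rw [← le_div_iff₀ h1] at h2
        constructor
        · linarith [neg_abs_le Y]
        · linarith [le_abs_self Y]
      have hl : Tendsto (fun n => saddle n (ε n) (circlePoint (ε n) η Y) *
          cexp (u * circlePoint (ε n) η Y) * g n (circlePoint (ε n) η Y) *
          (((1 - η * ε n : ℝ) : ℂ) * cexp ((ε n * Y : ℝ) * I))) atTop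
          (𝓝 (cexp (-(-η + Y * I) ^ 3 / 3) * cexp (u * (-η + Y * I)) * g₀ Y *
            (((1 - η * 0 : ℝ) : ℂ) * cexp ((0 * Y : ℝ) * I)))) := by
        refine (((tendsto_saddle hε hn hcp).mul (hcp.const_mul _).cexp).mul (hgt Y)).mul ?_
        have hc : Continuous fun x : ℝ =>
          ((1 - η * x : ℝ) : ℂ) * cexp ((x * Y : ℝ) * I) := by fun_prop
        exact (hc.tendsto 0).comp hε
      rw [← Complex.exp_add] at hl
      refine Tendsto.congr' (f₁ := _) ?_ (hl.trans_eq ?_)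
      · filter_upwards [hind] with n h
        rw [indicator_of_mem h]
      · congr 1
        simp only [mul_zero, sub_zero, zero_mul, Complex.ofReal_one, Complex.ofReal_zero, Complex.exp_zero, mul_one]
        congr 2; ring

theorem linePart_limit {ε : ℕ → ℝ} (hε : Tendsto ε atTop (𝓝 0)) (hε0 : ∀ᶠ n : ℕ in atTop, 0 < ε n)
    (hn : ∀ᶠ n : ℕ in atTop, n * ε n ^ 3 = 1)
    {η A C : ℝ} (hη : 0 < η) {p : ℕ → ℂ → ℂ} {p₀ : ℝ → ℂ}
    (hpm : ∀ n, Measurable (p n))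
    (hp : ∀ᶠ n in atTop, ∀ Y : ℝ, ‖p n (η + Y * I)‖ ≤ C * rexp (A * |Y|))
    (hpt : ∀ Y : ℝ, Tendsto (fun n => p n (η + Y * I)) atTop (𝓝 (p₀ Y))) :
    (∃ D, ∀ᶠ n in atTop, ∀ v, ‖linePart n (ε n) η (p n) v‖ ≤ D * rexp (-η * v)) ∧
    ∀ v : ℝ, Tendsto (fun n => linePart n (ε n) η (p n) v) atTop
      (𝓝 (∫ Y : ℝ, cexp (-v * (η + Y * I) + (η + Y * I) ^ 3 / 3) * p₀ Y)) := by
  have hgauss : Integrable fun Y : ℝ => rexp (A * |Y| - Y ^ 2 / (4 / η)) :=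
    integrable_exp_abs_sub_sq (by positivity) A
  set M : ℝ := ‖(cexp (-(η : ℂ) ^ 3 / 3))⁻¹‖ + 1 with hM
  have hsad : ∀ᶠ n : ℕ in atTop, ‖(saddle n (ε n) η)⁻¹‖ ≤ M := by
    have := ((tendsto_saddle hε hn (tendsto_const_nhds (x := ((η : ℂ))))).inv₀ (exp_ne_zero _)).norm
    exact (this.eventually (gt_mem_nhds (lt_add_one _))).mono fun n h => h.le
  have hC : 0 ≤ C := by
    obtain ⟨n, h⟩ := hp.exists
    have := (norm_nonneg _).trans (h 0)
    simpa using this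
  have hpt' : ∀ᶠ n in atTop, ∀ v Y : ℝ, ‖(saddle n (ε n) (η + Y * I))⁻¹ * cexp (-v * (η + Y * I)) * p n (η + Y * I)‖ ≤
        M * C * rexp (-η * v) * rexp (A * |Y| - Y ^ 2 / (4 / η)) := by
    have h0 : ∀ᶠ n in atTop, η * ε n ≤ 1 := by
      have : Tendsto (fun n => η * ε n) atTop (𝓝 0) := by simpa using hε.const_mul η
      exact (this.eventually (gt_mem_nhds one_pos)).mono fun n h => h.le
    filter_upwards [hε0, hn, hsad, hp, h0] with n h1 h2 h3 h4 h5 v Y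
    rw [norm_mul]
    have h6 := norm_saddle_line_inv_le h1 h2 hη h5 Y v
    calc _ ≤ (‖(saddle n (ε n) η)⁻¹‖ * rexp (-η * v) * rexp (-(η / 4) * Y ^ 2)) *
          (C * rexp (A * |Y|)) := mul_le_mul h6 (h4 Y) (norm_nonneg _) (by positivity)
      _ ≤ (M * rexp (-η * v) * rexp (-(η / 4) * Y ^ 2)) * (C * rexp (A * |Y|)) := by gcongr
      _ = M * C * rexp (-η * v) * (rexp (A * |Y|) * rexp (-(η / 4) * Y ^ 2)) := by ring
      _ = _ := by rw [← exp_add]; congr 2; field_simp; ring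
  constructor
  · refine ⟨M * C * ∫ Y : ℝ, rexp (A * |Y| - Y ^ 2 / (4 / η)), ?_⟩
    filter_upwards [hpt'] with n h1 v
    refine (norm_integral_le_of_norm_le (hgauss.const_mul (M * C * rexp (-η * v)))
      (.of_forall fun Y => h1 v Y)).trans_eq ?_
    rw [integral_const_mul]; ring
  · intro v
    refine tendsto_integral_filter_of_dominated_convergence
      (fun Y => M * C * rexp (-η * v) * rexp (A * |Y| - Y ^ 2 / (4 / η))) ?_ ?_
      (hgauss.const_mul _) ?_
    · refine .of_forall fun n => Measurable.aestronglyMeasurable ?_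
      have h1 : Measurable fun Y : ℝ => (η : ℂ) + Y * I := by fun_prop
      have h2 := (measurable_saddle n (ε n)).comp h1
      have h3 := (hpm n).comp h1
      exact (h2.inv.mul (by fun_prop)).mul h3
    · filter_upwards [hpt'] with n h1 using .of_forall fun Y => h1 v Y
    · refine .of_forall fun Y => ?_
      have hl := (((tendsto_saddle hε hn (tendsto_const_nhds (x := (η : ℂ) + Y * I))).inv₀
        (exp_ne_zero _)).mul_const (cexp (-v * (η + Y * I)))).mul (hpt Y)
      rw [← Complex.exp_neg, ← Complex.exp_add] at hl
      refine hl.trans_eq ?_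
      congr 3; ring

/-- The contour is compact, so only the size of `ω` matters. Since the circle may reach into the
right half-plane, growth in `u` has to be allowed; it is compensated by the decay of the other
factor of the kernel. -/
theorem smallCirclePart_limit {ε : ℕ → ℝ} (hε : Tendsto ε atTop (𝓝 0)) (hn : ∀ᶠ n : ℕ in atTop, n * ε n ^ 3 = 1)
    {τ : ℕ → ℝ} {τ₀ c₀ C : ℝ} (hτ : Tendsto τ atTop (𝓝 τ₀))
    {g : ℕ → ℂ → ℂ} {g₀ : ℝ → ℂ} (hgm : ∀ n, Measurable (g n))
    (hg : ∀ᶠ n in atTop, ∀ θ, ‖g n (circleMap (τ n) 1 θ)‖ ≤ C)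
    (hgt : ∀ θ, Tendsto (fun n => g n (circleMap (τ n) 1 θ)) atTop (𝓝 (g₀ θ))) :
    (∃ D, ∀ᶠ n in atTop, ∀ u, -c₀ ≤ u → ‖smallCirclePart n (ε n) (τ n) (g n) u‖ ≤ D * rexp ((|τ₀| + 2) * u)) ∧
    ∀ u : ℝ, Tendsto (fun n => smallCirclePart n (ε n) (τ n) (g n) u) atTop
      (𝓝 (∫ θ in 0..2 * π, (circleMap 0 1 θ * I) *
        (cexp (u * circleMap τ₀ 1 θ - circleMap τ₀ 1 θ ^ 3 / 3) * g₀ θ))) := by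
  set κ : ℝ := |τ₀| + 2 with hκ
  have hcm : ∀ θ, Tendsto (fun n => circleMap (τ n) 1 θ) atTop (𝓝 (circleMap τ₀ 1 θ)) := by
    intro θ
    have : Tendsto (fun n => (τ n : ℂ)) atTop (𝓝 τ₀) := (Complex.continuous_ofReal.tendsto τ₀).comp hτ
    simpa only [circleMap] using this.add_const _
  have hC : 0 ≤ C := by
    obtain ⟨n, h⟩ := hg.exists
    exact (norm_nonneg _).trans (h 0)
  have hnorm : ∀ᶠ n in atTop, ∀ θ, ‖circleMap (τ n) 1 θ‖ ≤ κ := by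
    have : ∀ᶠ n in atTop, |τ n| < |τ₀| + 1 := hτ.abs.eventually (gt_mem_nhds (lt_add_one _))
    filter_upwards [this] with n h θ
    rw [circleMap]
    refine (norm_add_le _ _).trans ?_
    rw [norm_mul, norm_exp_ofReal_mul_I, norm_real, norm_real, norm_eq_abs, norm_eq_abs, abs_one]
    linarith
  have hκ0 : 0 ≤ κ := by positivity
  -- The term `κ³/3` bounds `ω³/3`, and `κ⁴` bounds the remainder `δ`, as `|ω| ≤ κ` and `|ε| ≤ 1`.
  set M : ℝ := rexp (κ ^ 3 / 3 + κ ^ 4) with hM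
  have hsad : ∀ᶠ n : ℕ in atTop, ∀ θ, ‖saddle n (ε n) (circleMap (τ n) 1 θ)‖ ≤ M := by
    have h1 : Tendsto (fun n => ‖(ε n : ℂ)‖ * κ) atTop (𝓝 0) := by
      have : Tendsto (fun n => ‖(ε n : ℂ)‖) atTop (𝓝 0) := by
        simpa [comp_def] using ((Complex.continuous_ofReal.tendsto 0).comp hε).norm
      simpa using this.mul_const κ
    have h1' : ∀ᶠ n in atTop, ‖(ε n : ℂ)‖ * κ < 1 / 2 := h1.eventually (gt_mem_nhds (by norm_num))
    filter_upwards [h1', hn, hnorm] with n h2 h3 h4 θ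
    have h5 : ‖(ε n : ℂ) * circleMap (τ n) 1 θ‖ < 1 / 2 := by
      rw [norm_mul]
      exact (mul_le_mul_of_nonneg_left (h4 θ) (norm_nonneg _)).trans_lt h2
    obtain ⟨δ, hδ, he⟩ := exists_saddle_eq h3 h5
    rw [he, norm_exp, hM, exp_le_exp]
    refine (re_le_norm _).trans ((norm_sub_le _ _).trans (add_le_add ?_ (hδ.trans ?_)))
    · rw [norm_div, norm_neg, norm_pow, show ‖(3 : ℂ)‖ = 3 by simp]
      have := pow_le_pow_left₀ (norm_nonneg _) (h4 θ) 3
      linarith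
    · have h6 : ‖(ε n : ℂ)‖ ≤ 1 := by nlinarith [norm_nonneg (ε n : ℂ), abs_nonneg τ₀]
      have h7 := pow_le_pow_left₀ (norm_nonneg _) (h4 θ) 4
      nlinarith [norm_nonneg (ε n : ℂ), pow_nonneg (norm_nonneg (circleMap (τ n) 1 θ)) 4]
  have hexp : ∀ᶠ n in atTop, ∀ (u : ℝ) θ, ‖cexp (u * circleMap (τ n) 1 θ)‖ ≤ rexp (κ * |u|) := by
    filter_upwards [hnorm] with n h u θ
    rw [norm_exp, exp_le_exp]
    refine (re_le_norm _).trans ?_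
    rw [norm_mul, norm_real, norm_eq_abs, mul_comm]
    exact mul_le_mul_of_nonneg_right (h θ) (abs_nonneg u)
  have hpt : ∀ᶠ n in atTop, ∀ (u : ℝ) θ, ‖deriv (circleMap (τ n) 1) θ • (saddle n (ε n) (circleMap (τ n) 1 θ) *
      cexp (u * circleMap (τ n) 1 θ) * g n (circleMap (τ n) 1 θ))‖ ≤ M * rexp (κ * |u|) * C := by
    filter_upwards [hsad, hexp, hg] with n h1 h2 h3 u θ
    rw [norm_smul, deriv_circleMap, norm_mul, norm_circleMap_zero, abs_one, norm_I, one_mul, one_mul,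
      norm_mul, norm_mul]
    exact mul_le_mul (mul_le_mul (h1 θ) (h2 u θ) (norm_nonneg _) (by positivity)) (h3 θ) (norm_nonneg _)
      (by positivity)
  constructor
  -- The factor `exp (2κ|c₀|)` pays for replacing `|u|` by `u` on `u ≥ -c₀`.
  · refine ⟨M * C * rexp (2 * κ * |c₀|) * (2 * π), ?_⟩
    filter_upwards [hpt] with n h1 u hu
    rw [smallCirclePart, circleIntegral]
    refine (intervalIntegral.norm_integral_le_of_norm_le_const (fun θ _ => h1 u θ)).trans ?_
    rw [sub_zero, abs_of_pos two_pi_pos]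
    have : |u| ≤ u + 2 * |c₀| := by
      rw [abs_le]; constructor
      · linarith [le_abs_self c₀]
      · linarith [abs_nonneg c₀]
    have h2 : rexp (κ * |u|) ≤ rexp (2 * κ * |c₀|) * rexp (κ * u) := by rw [← exp_add, exp_le_exp]; nlinarith
    calc _ ≤ M * (rexp (2 * κ * |c₀|) * rexp (κ * u)) * C * (2 * π) := by gcongr
      _ = _ := by ring
  · intro u
    simp only [smallCirclePart, circleIntegral]
    refine intervalIntegral.tendsto_integral_filter_of_dominated_convergence
      (fun _ => M * rexp (κ * |u|) * C) ?_ ?_ intervalIntegrable_const ?_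
    · refine .of_forall fun n => Measurable.aestronglyMeasurable ?_
      have h1 : Measurable (circleMap (τ n) 1) := (continuous_circleMap _ _).measurable
      have h2 := (measurable_saddle n (ε n)).comp h1
      have h3 := (hgm n).comp h1
      have h4 : Measurable fun θ => cexp (u * circleMap (τ n) 1 θ) := Complex.measurable_exp.comp (h1.const_mul _)
      exact (measurable_deriv (circleMap (τ n) 1)).smul ((h2.mul h4).mul h3)
    · filter_upwards [hpt] with n h1 using .of_forall fun θ _ => h1 u θ
    · refine .of_forall fun θ _ => ?_
      have hl := ((tendsto_saddle hε hn (hcm θ)).mul ((hcm θ).const_mul (u : ℂ)).cexp).mul (hgt θ)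
      rw [← Complex.exp_add] at hl
      simp only [deriv_circleMap, smul_eq_mul]
      refine (hl.const_mul _).trans_eq ?_
      congr 3
      · congr 1; ring

/-! ### The functions before the limit on the edge scale -/

/-- The node polynomial on the scale of the contours, relative to `w ^ n`. -/
noncomputable def relFactor (b : Fin n → ℝ) (N ε m : ℝ) (ω : ℂ) : ℂ :=
  m * (N ^ n * (1 + ε * ω) ^ n) / (nodePoly b).eval (N * (1 + ε * ω) : ℂ)

theorem measurable_relFactor (b : Fin n → ℝ) (N ε m : ℝ) : Measurable (relFactor b N ε m) := by
  unfold relFactor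
  refine Measurable.div (by fun_prop) ?_
  exact (nodePoly b).continuous.measurable.comp (by fun_prop)

/-- The abscissa is `N(1 + εη)` and `w = N(1 + εω)`. By `N² = 2n` the exponent `w²/4 - wN` becomes
`-3n/2 - n(ζ - ζ²/2)` with `ζ = εω`, and by `γNε = 1` the shift `γv` contributes `-Nγv - vω`. The
prefactor is inverse to that of `leftSum`, apart from the exponentials in `u` and `v`. -/
theorem rightGauss_eq_linePart (b : Fin n → ℝ) {N ε γ m η : ℝ} (hN : 0 < N) (hN2 : N ^ 2 = 2 * n)
    (hε : 0 < ε) (hγ : γ * N * ε = 1) (hm : m ≠ 0) (hη : 0 < η) (v : ℝ) :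
    rightGauss b (N + γ * v) = (N : ℂ) ^ n * m * cexp (-(3 * n / 2 : ℝ)) * cexp (-(N * γ * v : ℝ)) *
      (N * ε / (2 * π) * linePart n ε η (fun ζ => (relFactor b N ε m ζ)⁻¹) v) := by
  have hNε : 0 < N * ε := by positivity
  rw [rightGauss, ← line_integral_eq_gaussTransform (N * (1 + ε * η))]
  set f : ℝ → ℂ := fun t => (nodePoly b).eval (((N * (1 + ε * η) : ℝ) : ℂ) + t * I) *
    cexp ((((N * (1 + ε * η) : ℝ) : ℂ) + t * I) ^ 2 / 4 -
      (((N * (1 + ε * η) : ℝ) : ℂ) + t * I) * (N + γ * v : ℝ)) with hf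
  have h1 : ∫ t, f t = (N * ε : ℝ) • ∫ Y, f (N * ε * Y) := by
    rw [Measure.integral_comp_mul_left, smul_smul, abs_of_pos (by positivity), mul_inv_cancel₀ hNε.ne', one_smul]
  rw [h1, real_smul]
  have hN2' : (N : ℂ) ^ 2 = 2 * n := mod_cast congrArg ((↑) : ℝ → ℂ) hN2
  have hγ' : (γ : ℂ) * N * ε = 1 := mod_cast congrArg ((↑) : ℝ → ℂ) hγ
  have hm' : (m : ℂ) ≠ 0 := mod_cast hm
  have hN' : (N : ℂ) ≠ 0 := mod_cast hN.ne'
  have hpt : ∀ Y : ℝ, f (N * ε * Y) = ((N : ℂ) ^ n * m * cexp (-(3 * n / 2 : ℝ)) *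
      cexp (-(N * γ * v : ℝ))) * ((saddle n ε (η + Y * I))⁻¹ *
        cexp (-v * (η + Y * I)) * (relFactor b N ε m (η + Y * I))⁻¹) := by
    intro Y
    set ω : ℂ := η + Y * I with hω
    have hw : ((N * (1 + ε * η) : ℝ) : ℂ) + ((N * ε * Y : ℝ) : ℂ) * I = N * (1 + ε * ω) := by rw [hω]; push_cast; ring
    have hne : 1 + (ε : ℂ) * ω ≠ 0 := by
      intro h
      have := congrArg Complex.re h
      simp [hω] at this
      nlinarith [mul_pos hε hη]
    simp only [hf, hw]
    have hexp : cexp ((N * (1 + ε * ω)) ^ 2 / 4 - N * (1 + ε * ω) * (N + γ * v : ℝ)) =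
        cexp (-(3 * n / 2 : ℝ)) * cexp (-(N * γ * v : ℝ)) * (cexp (-v * ω) *
          (cexp (n * (ε * ω - (ε * ω) ^ 2 / 2)))⁻¹) := by
      rw [← Complex.exp_neg, ← Complex.exp_add, ← Complex.exp_add, ← Complex.exp_add]
      congr 1
      push_cast
      linear_combination ((1 + ε * ω) ^ 2 / 4 - (1 + ε * ω)) * hN2' - v * ω * hγ'
    rw [hexp, saddle, relFactor]
    have := exp_ne_zero (n * (ε * ω - (ε * ω) ^ 2 / 2))
    field_simp
  have hint : ∫ Y, f (N * ε * Y) = ((N : ℂ) ^ n * m * cexp (-(3 * n / 2 : ℝ)) *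
      cexp (-(N * γ * v : ℝ))) * linePart n ε η (fun ζ => (relFactor b N ε m ζ)⁻¹) v := by
    rw [linePart, ← integral_const_mul]
    exact integral_congr_ae (Eventually.of_forall hpt)
  rw [hint]
  push_cast
  ring

theorem leftIntegrand_eq (b : Fin n → ℝ) {N ε γ m : ℝ} (hN : 0 < N) (hN2 : N ^ 2 = 2 * n)
    (hγ : γ * N * ε = 1) (hm : m ≠ 0) (u : ℝ) {ω : ℂ} (hne : 1 + (ε : ℂ) * ω ≠ 0) :
    cexp (N * (1 + ε * ω) * (N + γ * u : ℝ) - (N * (1 + ε * ω)) ^ 2 / 4) / (nodePoly b).eval (N * (1 + ε * ω) : ℂ) =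
      (((N : ℂ) ^ n)⁻¹ / m * cexp (3 * n / 2 : ℝ) * cexp (N * γ * u : ℝ)) *
        (saddle n ε ω * cexp (u * ω) * relFactor b N ε m ω) := by
  have hN2' : (N : ℂ) ^ 2 = 2 * n := mod_cast congrArg ((↑) : ℝ → ℂ) hN2
  have hγ' : (γ : ℂ) * N * ε = 1 := mod_cast congrArg ((↑) : ℝ → ℂ) hγ
  have hm' : (m : ℂ) ≠ 0 := mod_cast hm
  have hN' : (N : ℂ) ≠ 0 := mod_cast hN.ne'
  have hexp : cexp (N * (1 + ε * ω) * (N + γ * u : ℝ) - (N * (1 + ε * ω)) ^ 2 / 4) =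
      cexp (3 * n / 2 : ℝ) * cexp (N * γ * u : ℝ) * (cexp (u * ω) * (cexp (n * (ε * ω - (ε * ω) ^ 2 / 2)))) := by
    rw [← Complex.exp_add, ← Complex.exp_add, ← Complex.exp_add]
    congr 1
    push_cast
    linear_combination (-(1 + ε * ω) ^ 2 / 4 + (1 + ε * ω)) * hN2' + u * ω * hγ'
  rw [hexp, saddle, relFactor]
  generalize (nodePoly b).eval (N * (1 + ε * ω) : ℂ) = P
  generalize 1 + (ε : ℂ) * ω = z at hne ⊢
  field_simp

theorem circleIntegral_eq_intervalIntegral_scaled (f : ℂ → ℂ) {N ε η : ℝ} (hε : 0 < ε) :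
    ∮ w in C(0, N * (1 - η * ε)), f w = N * ε * I * ∫ Y in (-(π / ε))..(π / ε), f (N * (1 + ε * circlePoint ε η Y)) *
        (((1 - η * ε : ℝ) : ℂ) * cexp ((ε * Y : ℝ) * I)) := by
  set R : ℝ := N * (1 - η * ε) with hR
  set G : ℝ → ℂ := fun θ => f (circleMap 0 R θ) * circleMap 0 R θ with hG
  have hper : Function.Periodic G (2 * π) := by
    intro θ
    simp only [hG, (periodic_circleMap 0 R) θ]
  have h1 : ∮ w in C(0, R), f w = I * ∫ θ in (-π)..π, G θ := by
    rw [circleIntegral, ← intervalIntegral.integral_const_mul]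
    have := (hper.comp fun z => I * z).intervalIntegral_add_eq (-π) 0
    rw [show -π + 2 * π = π by ring, zero_add] at this
    simp only [comp_def] at this
    rw [this]
    refine intervalIntegral.integral_congr fun θ _ => ?_
    simp only [hG, deriv_circleMap, smul_eq_mul]; ring
  have h2 := intervalIntegral.integral_comp_mul_left (a := -(π / ε)) (b := π / ε) G hε.ne'
  rw [mul_neg, mul_div_cancel₀ _ hε.ne', eq_inv_smul_iff₀ hε.ne'] at h2
  have hε' : (ε : ℂ) ≠ 0 := mod_cast hε.ne'
  rw [h1, ← h2, real_smul, ← intervalIntegral.integral_const_mul,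
    ← intervalIntegral.integral_const_mul, ← intervalIntegral.integral_const_mul]
  refine intervalIntegral.integral_congr fun Y _ => ?_
  have h3 : circleMap 0 R (ε * Y) = N * (((1 - η * ε : ℝ) : ℂ) * cexp ((ε * Y : ℝ) * I)) := by
    rw [circleMap, zero_add, hR]; push_cast; ring
  have h4 : (N : ℂ) * (1 + ε * circlePoint ε η Y) = circleMap 0 R (ε * Y) := by
    rw [h3, circlePoint, mul_div_cancel₀ _ hε']; ring
  simp only [hG]
  rw [h4, h3]; ring

theorem circleIntegral_scaled (f : ℂ → ℂ) {N ε τ : ℝ} : ∮ w in C((N * (1 + ε * τ) : ℝ), N * ε), f w = N * ε *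
      ∮ ω in C((τ : ℂ), 1), f (N * (1 + ε * ω)) := by
  rw [circleIntegral, circleIntegral, ← intervalIntegral.integral_const_mul]
  refine intervalIntegral.integral_congr fun θ _ => ?_
  have h : (N : ℂ) * (1 + ε * circleMap τ 1 θ) = circleMap ((N * (1 + ε * τ) : ℝ)) (N * ε) θ := by
    simp only [circleMap]; push_cast; ring
  simp only [deriv_circleMap, smul_eq_mul, h]
  simp only [circleMap]; push_cast; ring

theorem circleIntegral_left_eq (b : Fin n → ℝ)
    {N ε γ m η : ℝ} (hN : 0 < N) (hN2 : N ^ 2 = 2 * n) (hε : 0 < ε) (hγ : γ * N * ε = 1) (hm : m ≠ 0)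
    (hηε : η * ε < 1) (u : ℝ) :
    (2 * π * I)⁻¹ * ∮ w in C(0, N * (1 - η * ε)), cexp (w * (N + γ * u : ℝ) - w ^ 2 / 4) / (nodePoly b).eval w =
    (((N : ℂ) ^ n)⁻¹ / m * cexp (3 * n / 2 : ℝ) * cexp (N * γ * u : ℝ)) *
      (N * ε / (2 * π) * circlePart n ε η (relFactor b N ε m) u) := by
  rw [circleIntegral_eq_intervalIntegral_scaled _ hε, circlePart]
  have hint : ∫ Y in (-(π / ε))..(π / ε), cexp (N * (1 + ε * circlePoint ε η Y) * (N + γ * u : ℝ) -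
        (N * (1 + ε * circlePoint ε η Y)) ^ 2 / 4) / (nodePoly b).eval (N * (1 + ε * circlePoint ε η Y) : ℂ) *
        (((1 - η * ε : ℝ) : ℂ) * cexp ((ε * Y : ℝ) * I)) =
      (((N : ℂ) ^ n)⁻¹ / m * cexp (3 * n / 2 : ℝ) * cexp (N * γ * u : ℝ)) *
      ∫ Y in (-(π / ε))..(π / ε), saddle n ε (circlePoint ε η Y) *
        cexp (u * circlePoint ε η Y) * relFactor b N ε m (circlePoint ε η Y) *
          (((1 - η * ε : ℝ) : ℂ) * cexp ((ε * Y : ℝ) * I)) := by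
    rw [← intervalIntegral.integral_const_mul]
    refine intervalIntegral.integral_congr fun Y _ => ?_
    have hne : 1 + (ε : ℂ) * circlePoint ε η Y ≠ 0 := by
      have hε' : (ε : ℂ) ≠ 0 := mod_cast hε.ne'
      have hr : ((1 - η * ε : ℝ) : ℂ) ≠ 0 := mod_cast (show (0 : ℝ) < 1 - η * ε by linarith).ne'
      rw [circlePoint, mul_div_cancel₀ _ hε', add_sub_cancel]
      exact mul_ne_zero hr (exp_ne_zero _)
    rw [leftIntegrand_eq b hN hN2 hγ hm u hne]
    ring
  rw [hint]
  have hpi : (π : ℂ) ≠ 0 := mod_cast Real.pi_ne_zero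
  generalize (∫ Y in (-(π / ε))..(π / ε), saddle n ε (circlePoint ε η Y) *
    cexp (u * circlePoint ε η Y) * relFactor b N ε m (circlePoint ε η Y) *
      (((1 - η * ε : ℝ) : ℂ) * cexp ((ε * Y : ℝ) * I))) = J
  field_simp

theorem leftSum_eq_circlePart (hn : 0 < n) {b : Fin n → ℝ} (hb : Injective b)
    {N ε γ m η : ℝ} (hN : 0 < N) (hN2 : N ^ 2 = 2 * n) (hε : 0 < ε) (hγ : γ * N * ε = 1) (hm : m ≠ 0)
    (hηε : η * ε < 1) (hbb : ∀ i, |b i| < N * (1 - η * ε)) (u : ℝ) :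
    leftSum b (N + γ * u) = (((N : ℂ) ^ n)⁻¹ / m * cexp (3 * n / 2 : ℝ) * cexp (N * γ * u : ℝ)) *
      (N * ε / (2 * π) * circlePart n ε η (relFactor b N ε m) u) := by
  classical
  have hR : 0 < N * (1 - η * ε) := mul_pos hN (by linarith)
  have hball : ∀ i, (b i : ℂ) ∈ ball (0 : ℂ) (N * (1 - η * ε)) := fun i => by
    rw [mem_ball_zero_iff, norm_real]; exact hbb i
  have h := circleIntegral_div_nodePoly hn hb
    (F := fun w => cexp (w * (N + γ * u : ℝ) - w ^ 2 / 4)) (by fun_prop) hR (fun i => Or.inl (hball i))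
  have hl : leftSum b (N + γ * u) = ∑ j, if (b j : ℂ) ∈ ball (0 : ℂ) (N * (1 - η * ε)) then
      nodeWeight b j * cexp (b j * (N + γ * u : ℝ) - b j ^ 2 / 4) else 0 := by
    rw [leftSum]
    exact sum_congr rfl fun j _ => by rw [if_pos (hball j), leftFun]
  rw [hl, ← h, circleIntegral_left_eq b hN hN2 hε hγ hm hηε u]

/-- When outliers approach the critical point, one circle about `0` cannot collect all residues and
still pass to its left. Each node lies in exactly one of two disks: the large one about `0`, or the
one of radius `Nε` about `N(1 + ετ)`. -/
theorem leftSum_eq_circlePart_add (hn : 0 < n) {b : Fin n → ℝ} (hb : Injective b)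
    {N ε γ m η τ : ℝ} (hN : 0 < N) (hN2 : N ^ 2 = 2 * n) (hε : 0 < ε) (hγ : γ * N * ε = 1) (hm : m ≠ 0)
    (hηε : η * ε < 1) (hτ : ε < 1 + ε * τ)
    (hbb : ∀ i, (|b i| < N * (1 - η * ε) ∧ N * ε < |b i - N * (1 + ε * τ)|) ∨
      (N * (1 - η * ε) < |b i| ∧ |b i - N * (1 + ε * τ)| < N * ε)) (u : ℝ) :
    leftSum b (N + γ * u) = (((N : ℂ) ^ n)⁻¹ / m * cexp (3 * n / 2 : ℝ) * cexp (N * γ * u : ℝ)) *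
      (N * ε / (2 * π) * (circlePart n ε η (relFactor b N ε m) u -
        I * smallCirclePart n ε τ (relFactor b N ε m) u)) := by
  classical
  have hR : 0 < N * (1 - η * ε) := mul_pos hN (by linarith)
  have hNε : 0 < N * ε := by positivity
  have hd1 : ∀ i, dist (b i : ℂ) 0 = |b i| := fun i => by rw [dist_zero_right, norm_real, norm_eq_abs]
  have hd2 : ∀ i, dist (b i : ℂ) ((N * (1 + ε * τ) : ℝ) : ℂ) = |b i - N * (1 + ε * τ)| := fun i => by
    rw [Complex.dist_eq, ← Complex.ofReal_sub, norm_real, norm_eq_abs]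
  have h1 := circleIntegral_div_nodePoly hn hb (c := 0)
    (F := fun w => cexp (w * (N + γ * u : ℝ) - w ^ 2 / 4)) (by fun_prop) hR (fun i => by
      rw [mem_ball, Metric.mem_closedBall, hd1]
      exact (hbb i).imp (fun h => h.1) (fun h => not_le.2 h.1))
  have h2 := circleIntegral_div_nodePoly hn hb (c := ((N * (1 + ε * τ) : ℝ) : ℂ))
    (F := fun w => cexp (w * (N + γ * u : ℝ) - w ^ 2 / 4)) (by fun_prop) hNε (fun i => by
      rw [mem_ball, Metric.mem_closedBall, hd2]
      exact (hbb i).symm.imp (fun h => h.2) (fun h => not_le.2 h.2))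
  have hl : leftSum b (N + γ * u) = (∑ j, if (b j : ℂ) ∈ ball (0 : ℂ) (N * (1 - η * ε)) then
        nodeWeight b j * cexp (b j * (N + γ * u : ℝ) - b j ^ 2 / 4) else 0) +
      ∑ j, if (b j : ℂ) ∈ ball ((N * (1 + ε * τ) : ℝ) : ℂ) (N * ε) then
        nodeWeight b j * cexp (b j * (N + γ * u : ℝ) - b j ^ 2 / 4) else 0 := by
    rw [leftSum, ← Finset.sum_add_distrib]
    refine sum_congr rfl fun j _ => ?_
    rw [mem_ball, mem_ball, hd1, hd2, leftFun]
    rcases hbb j with h | h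
    · rw [if_pos h.1, if_neg (not_lt.2 h.2.le), add_zero]
    · rw [if_neg (not_lt.2 h.1.le), if_pos h.2, zero_add]
  rw [hl, ← h1, ← h2, circleIntegral_left_eq b hN hN2 hε hγ hm hηε u, circleIntegral_scaled, smallCirclePart]
  have hint : ∮ ω in C((τ : ℂ), 1), cexp (N * (1 + ε * ω) * (N + γ * u : ℝ) -
        (N * (1 + ε * ω)) ^ 2 / 4) / (nodePoly b).eval (N * (1 + ε * ω) : ℂ) =
      (((N : ℂ) ^ n)⁻¹ / m * cexp (3 * n / 2 : ℝ) * cexp (N * γ * u : ℝ)) *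
      ∮ ω in C((τ : ℂ), 1), saddle n ε ω * cexp (u * ω) * relFactor b N ε m ω := by
    rw [← circleIntegral.integral_const_mul]
    refine circleIntegral.integral_congr zero_le_one fun ω hω => ?_
    have hne : 1 + (ε : ℂ) * ω ≠ 0 := by
      intro h
      rw [mem_sphere_iff_norm] at hω
      have h3 : ((1 + ε * τ : ℝ) : ℂ) = -(ε * (ω - τ)) := by push_cast; linear_combination h
      have h4 := congrArg norm h3
      rw [norm_neg, norm_mul, hω, norm_real, norm_real, norm_of_nonneg hε.le, norm_of_nonneg (by linarith)] at h4
      linarith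
    exact leftIntegrand_eq b hN hN2 hγ hm u hne
  rw [hint]
  have hpi : (π : ℂ) ≠ 0 := mod_cast Real.pi_ne_zero
  generalize (∮ ω in C((τ : ℂ), 1), saddle n ε ω * cexp (u * ω) * relFactor b N ε m ω) = J
  rw [mul_inv, Complex.inv_I]
  field_simp
  ring

/-! ### Gap probabilities as Fredholm series -/

theorem measurableEmbedding_affine (α : ℝ) {γ : ℝ} (hγ : γ ≠ 0) : MeasurableEmbedding fun ξ : ℝ => α + γ * ξ :=
  ((Homeomorph.mulLeft₀ γ hγ).trans (Homeomorph.addLeft α)).measurableEmbedding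

theorem integral_affine (G : ℝ → ℂ) (α : ℝ) {γ : ℝ} (hγ : 0 < γ) : ∫ x, G x = γ * ∫ ξ, G (α + γ * ξ) := by
  have h := Measure.integral_comp_mul_left (fun y => G (α + y)) γ
  have h2 := integral_add_left_eq_self (μ := (volume : Measure ℝ)) G α
  rw [h, h2, real_smul, abs_of_pos (by positivity)]
  have : (γ : ℂ) ≠ 0 := mod_cast hγ.ne'
  push_cast
  field_simp

/-- A gap is the expectation of `∏ (1 + f (x i))` for `f` equal to `-1` on the window and `0`
elsewhere. This is an `n × n` determinant, which is the Fredholm series of a kernel of rank at most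
`n`. -/
theorem gap_eq_tsum_fredholmTerm {b : Fin n → ℝ} (hb : Injective b) (α : ℝ) {γ : ℝ}
    (hγ : 0 < γ) {E : Set ℝ} (hE : MeasurableSet E) :
    (((ensembleLaw 1 0 b).real (gapEvent α γ E) : ℝ) : ℂ) =
      fredholmSum(fun u v => γ * ∑ l, leftFun b l (α + γ * u) * rightFun b l (α + γ * v),E) := by
  have hemb := measurableEmbedding_affine α hγ.ne'
  have hbij : Function.Bijective fun ξ : ℝ => α + γ * ξ :=
    ((Homeomorph.mulLeft₀ γ hγ.ne').trans (Homeomorph.addLeft α)).bijective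
  set F : Set ℝ := (fun ξ : ℝ => α + γ * ξ) '' E with hF
  have hFm : MeasurableSet F := hemb.measurableSet_image.2 hE
  have hFc : (fun ξ : ℝ => α + γ * ξ) '' Eᶜ = Fᶜ := Set.image_compl_eq hbij
  have hSm : MeasurableSet {x : Fin n → ℝ | ∀ j, x j ∈ Fᶜ} := by
    simp only [Set.ofPred_forall]
    exact MeasurableSet.iInter fun j => measurable_pi_apply j hFm.compl
  have h1 := integral_prod_one_add hb (f := F.indicator fun _ => (-1 : ℂ))
    (measurable_const.indicator hFm) (M := 1) (fun x => by
      by_cases hx : x ∈ F <;> simp [hx])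
  have h2 : ∫ x, ∏ i, (1 + F.indicator (fun _ => (-1 : ℂ)) (x i)) ∂ensembleLaw 1 0 b =
      (((ensembleLaw 1 0 b).real {x | ∀ j, x j ∈ Fᶜ} : ℝ) : ℂ) := by
    have : ∀ x : Fin n → ℝ, ∏ i, (1 + F.indicator (fun _ => (-1 : ℂ)) (x i)) =
        ({x | ∀ j, x j ∈ Fᶜ} : Set (Fin n → ℝ)).indicator (fun _ => (1 : ℂ)) x := by
      intro x
      by_cases hx : ∀ j, x j ∈ Fᶜ
      · rw [indicator_of_mem (by exact hx)]
        refine Finset.prod_eq_one fun j _ => ?_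
        rw [indicator_of_notMem (hx j), add_zero]
      · rw [indicator_of_notMem (by exact hx)]
        push Not at hx
        obtain ⟨j, hj⟩ := hx
        refine Finset.prod_eq_zero (mem_univ j) ?_
        rw [indicator_of_mem (by simpa using hj)]; norm_num
    simp only [this]
    rw [integral_indicator hSm, integral_const]
    simp [Measure.real]
  rw [gapEvent, hFc, ← h2, h1]
  have h3 := (hasSum_fredholm_finite E (fun l ξ => γ * leftFun b l (α + γ * ξ))
    (fun l ξ => rightFun b l (α + γ * ξ)) (fun i j => by
      have hi := integrable_leftFun_mul_rightFun b i j
      have := ((hi.comp_add_left α).comp_mul_left' hγ.ne').const_mul (γ : ℂ)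
      refine (this.congr (.of_forall fun ξ => ?_)).integrableOn
      beta_reduce
      ring)).tsum_eq
  have h4 : ∀ u v : ℝ, ∑ l, γ * leftFun b l (α + γ * u) * rightFun b l (α + γ * v) =
      γ * ∑ l, leftFun b l (α + γ * u) * rightFun b l (α + γ * v) := fun u v => by
    rw [mul_sum]; exact sum_congr rfl fun l _ => by ring
  simp only [h4] at h3
  unfold fredholmTerm
  rw [h3]
  congr 1
  ext i j
  simp only [Matrix.add_apply, Matrix.sub_apply, statMatrix, of_apply]
  rw [sub_eq_add_neg]
  congr 1
  have h5 : ∀ x, F.indicator (fun _ => (-1 : ℂ)) x * (leftFun b i x * rightFun b j x) =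
      -F.indicator (fun x => leftFun b i x * rightFun b j x) x := by
    intro x
    by_cases hx : x ∈ F <;> simp [hx]
  simp only [h5]
  rw [integral_neg, integral_affine _ α hγ, ← integral_const_mul, ← integral_indicator hE]
  congr 1
  refine integral_congr_ae (.of_forall fun ξ => ?_)
  beta_reduce
  by_cases hξ : ξ ∈ E
  · have : α + γ * ξ ∈ F := ⟨ξ, hξ, rfl⟩
    rw [indicator_of_mem this, indicator_of_mem hξ]; ring
  · have : α + γ * ξ ∉ F := by
      rintro ⟨ξ', h, he⟩
      exact hξ (hbij.1 he ▸ h)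
    rw [indicator_of_notMem this, indicator_of_notMem hξ, mul_zero]

theorem kernel_affine (b : Fin n → ℝ) (α : ℝ) {γ : ℝ} (hγ : 0 < γ) (u v : ℝ) :
    γ * ∑ l, leftFun b l (α + γ * u) * rightFun b l (α + γ * v) =
      γ ^ 2 * shiftKernel (fun u => leftSum b (α + γ * u)) (fun v => rightGauss b (α + γ * v)) u v := by
  rw [sum_leftFun_mul_rightFun, shiftKernel]
  have := integral_comp_mul_left_Ioi (fun l => leftSum b (α + γ * u + l) * rightGauss b (α + γ * v + l)) 0 hγ
  rw [mul_zero, eq_inv_smul_iff₀ hγ.ne'] at this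
  rw [← this, real_smul, ← mul_assoc, ← sq]
  congr 1
  refine integral_congr_ae (.of_forall fun l => ?_)
  beta_reduce
  rw [mul_add, mul_add, add_assoc, add_assoc]

/-- A pair of functions with at most exponential growth and compensating exponential decay. -/
structure IsShiftPair (κ : ℝ) (φ ψ : ℝ → ℂ) : Prop where
  left_measurable : Measurable φ
  right_measurable : Measurable ψ
  left_le : ∀ c, ∃ C, ∀ u, c ≤ u → ‖φ u‖ ≤ C * rexp (κ * u)
  right_le : ∀ c, ∃ C, ∀ u, c ≤ u → ‖ψ u‖ ≤ C * rexp (-(κ + 2) * u)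

/-- Under the shift by `w` the two exponentials cancel, so an exponential can be moved from one
factor to the other at the price of a conjugation. -/
theorem shiftKernel_tilt (φ ψ : ℝ → ℂ) (κ u v : ℝ) : shiftKernel φ ψ u v = cexp (κ * u : ℝ) *
      shiftKernel (fun u => cexp (-(κ * u) : ℝ) * φ u) (fun v => cexp (κ * v : ℝ) * ψ v) u v *
        (cexp (κ * v : ℝ))⁻¹ := by
  rw [shiftKernel, shiftKernel, ← integral_const_mul, ← integral_mul_const]
  refine integral_congr_ae (.of_forall fun w => ?_)
  beta_reduce
  have : cexp (κ * u : ℝ) * cexp (-(κ * (u + w)) : ℝ) * cexp (κ * (v + w) : ℝ) * (cexp (κ * v : ℝ))⁻¹ = 1 := by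
    rw [← Complex.exp_neg, ← Complex.exp_add, ← Complex.exp_add, ← Complex.exp_add, Complex.exp_eq_one_iff]
    exact ⟨0, by push_cast; ring⟩
  linear_combination (-(φ (u + w) * ψ (v + w))) * this

/-- Growth `e^{κu}` on the left and decay `e^{-(κ+2)u}` on the right become decay `e^{-u}` on both
sides after tilting by `κ + 1`; conjugation does not change the Fredholm terms. -/
theorem tendsto_fredholm_tilt {ι : Type*} {l : Filter ι} [l.IsCountablyGenerated] [l.NeBot]
    {Φ Ψ : ι → ℝ → ℂ} {φ ψ : ℝ → ℂ} {c C C' κ : ℝ}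
    (hΦm : ∀ i, Measurable (Φ i)) (hΨm : ∀ i, Measurable (Ψ i)) (hφm : Measurable φ) (hψm : Measurable ψ)
    (hΦ : ∀ᶠ i in l, ∀ u, c ≤ u → ‖Φ i u‖ ≤ C * rexp (κ * u))
    (hΨ : ∀ᶠ i in l, ∀ u, c ≤ u → ‖Ψ i u‖ ≤ C' * rexp (-(κ + 2) * u))
    (hΦt : ∀ u, c ≤ u → Tendsto (fun i => Φ i u) l (𝓝 (φ u)))
    (hΨt : ∀ u, c ≤ u → Tendsto (fun i => Ψ i u) l (𝓝 (ψ u)))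
    {E : Set ℝ} (hEm : MeasurableSet E) (hE : E ⊆ Ici c) :
    HasFredholmDet (shiftKernel φ ψ) E (fredholmSum(shiftKernel φ ψ,E)) ∧
    Tendsto (fun i => fredholmSum(shiftKernel (Φ i) (Ψ i),E)) l (𝓝 (fredholmSum(shiftKernel φ ψ,E))) ∧
    (∀ u v, c ≤ u → c ≤ v → Tendsto (fun i => shiftKernel (Φ i) (Ψ i) u v) l (𝓝 (shiftKernel φ ψ u v))) := by
  have hd : ∀ u : ℝ, cexp ((κ + 1) * u : ℝ) ≠ 0 := fun u => exp_ne_zero _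
  have hnorm : ∀ x : ℝ, ‖cexp (x : ℂ)‖ = rexp x := fun x => by rw [norm_exp, ofReal_re]
  have hm : ∀ (a : ℝ) (f : ℝ → ℂ), Measurable f → Measurable fun u : ℝ => cexp (a * u : ℝ) * f u :=
    fun a f hf => Measurable.mul (by fun_prop) hf
  have hm' : ∀ (a : ℝ) (f : ℝ → ℂ), Measurable f → Measurable fun u : ℝ => cexp (-(a * u) : ℝ) * f u :=
    fun a f hf => Measurable.mul (by fun_prop) hf
  obtain ⟨h1, h2, h3⟩ := tendsto_fredholm (l := l) (κ := 1) (c := c) (C := max C C')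
    (Φ := fun i u => cexp (-((κ + 1) * u) : ℝ) * Φ i u)
    (Ψ := fun i v => cexp ((κ + 1) * v : ℝ) * Ψ i v)
    (φ := fun u => cexp (-((κ + 1) * u) : ℝ) * φ u)
    (ψ := fun v => cexp ((κ + 1) * v : ℝ) * ψ v) one_pos
    (fun i => hm' _ _ (hΦm i)) (fun i => hm _ _ (hΨm i)) (hm' _ _ hφm) (hm _ _ hψm)
    (hΦ.mono fun i h u hu => by
      rw [norm_mul, hnorm]
      calc _ ≤ rexp (-((κ + 1) * u)) * (C * rexp (κ * u)) := by gcongr; exact h u hu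
        _ = C * rexp (-1 * u) := by rw [mul_left_comm, ← exp_add]; congr 2; ring
        _ ≤ _ := by gcongr; exact le_max_left _ _)
    (hΨ.mono fun i h u hu => by
      rw [norm_mul, hnorm]
      calc _ ≤ rexp ((κ + 1) * u) * (C' * rexp (-(κ + 2) * u)) := by gcongr; exact h u hu
        _ = C' * rexp (-1 * u) := by rw [mul_left_comm, ← exp_add]; congr 2; ring
        _ ≤ _ := by gcongr; exact le_max_right _ _)
    (fun u hu => (hΦt u hu).const_mul _) (fun u hu => (hΨt u hu).const_mul _) hEm hE
  have hterm : ∀ φ ψ : ℝ → ℂ, fredholmTerm (shiftKernel φ ψ) E = fredholmTerm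
      (shiftKernel (fun u => cexp (-((κ + 1) * u) : ℝ) * φ u) (fun v => cexp ((κ + 1) * v : ℝ) * ψ v)) E := fun φ ψ =>
    fredholmTerm_conj hd (shiftKernel_tilt φ ψ (κ + 1)) E
  refine ⟨?_, ?_, fun u v hu hv => ?_⟩
  · rw [hterm]
    refine HasFredholmDet.conj (d := fun u => (cexp ((κ + 1) * u : ℝ))⁻¹)
      (fun u => inv_ne_zero (hd u)) (fun u v => ?_) h1
    rw [shiftKernel_tilt φ ψ (κ + 1)]
    have h5 := hd u
    have h6 := hd v
    field_simp
  · rw [hterm φ ψ]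
    refine h2.congr fun i => ?_
    rw [hterm (Φ i) (Ψ i)]
  · rw [shiftKernel_tilt φ ψ (κ + 1) u v]
    refine (((h3 u v hu hv).const_mul _).mul_const _).congr fun i => ?_
    rw [shiftKernel_tilt (Φ i) (Ψ i) (κ + 1) u v]

/-! ### From asymptotics of the factors to gap probabilities -/

/-- The scaling of the edge: `N = √(2n)`, `ε = n^{-1/3}`, `γ = (√2 n^{1/6})⁻¹`. -/
structure IsEdgeScaling (N ε γ : ℕ → ℝ) : Prop where
  tendsto_zero : Tendsto ε atTop (𝓝 0)
  pos : ∀ᶠ n in atTop, 0 < ε n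
  cube : ∀ᶠ n : ℕ in atTop, n * ε n ^ 3 = 1
  N_pos : ∀ᶠ n in atTop, 0 < N n
  N_sq : ∀ᶠ n : ℕ in atTop, N n ^ 2 = 2 * n
  gamma : ∀ᶠ n in atTop, γ n * N n * ε n = 1

theorem continuous_leftSum (b : Fin n → ℝ) : Continuous (leftSum b) := by
  unfold leftSum
  exact continuous_finsetSum _ fun j _ => (continuous_leftFun b j).const_mul _

theorem continuous_rightGauss (b : Fin n → ℝ) : Continuous (rightGauss b) := by
  unfold rightGauss
  exact Continuous.mul ((gaussTransform (nodePoly b)).continuous.comp Complex.continuous_ofReal) (by fun_prop)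

/-- The limit of the gap probabilities and of the correlation kernels, given the asymptotics of the
contour integrals. -/
theorem tendsto_gap_of_parts {N ε γ m : ℕ → ℝ} (hs : IsEdgeScaling N ε γ) {b : ∀ n, Fin n → ℝ}
    (hb : ∀ᶠ n in atTop, Injective (b n)) (hm : ∀ᶠ n in atTop, m n ≠ 0) {κ : ℝ} (hκ : 0 ≤ κ)
    {L : ℕ → ℝ → ℂ} {φ ψ : ℝ → ℂ} {p₀ : ℝ → ℂ}
    (hL : ∀ᶠ n in atTop, ∀ u, leftSum (b n) (N n + γ n * u) =
      (((N n : ℂ) ^ n)⁻¹ / m n * cexp (3 * n / 2 : ℝ) * cexp (N n * γ n * u : ℝ)) * (N n * ε n / (2 * π) * L n u))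
    (hLb : ∀ c, ∃ C, ∀ᶠ n in atTop, ∀ u, c ≤ u → ‖L n u‖ ≤ C * rexp (κ * u))
    (hLt : ∀ u, Tendsto (fun n => L n u) atTop (𝓝 (2 * π * φ u)))
    (hp : ∃ C A, ∀ᶠ n in atTop, ∀ Y : ℝ,
      ‖(relFactor (b n) (N n) (ε n) (m n) ((κ + 2 : ℝ) + Y * I))⁻¹‖ ≤ C * rexp (A * |Y|))
    (hpt : ∀ Y : ℝ, Tendsto (fun n => (relFactor (b n) (N n) (ε n) (m n) ((κ + 2 : ℝ) + Y * I))⁻¹)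
      atTop (𝓝 (p₀ Y)))
    (hψ : ∀ v : ℝ, ∫ Y : ℝ, cexp (-v * ((κ + 2 : ℝ) + Y * I) + ((κ + 2 : ℝ) + Y * I) ^ 3 / 3) * p₀ Y = 2 * π * ψ v) :
    IsShiftPair κ φ ψ ∧ ∀ E : Set ℝ, MeasurableSet E → BddBelow E →
      (Tendsto (fun n => (((ensembleLaw 1 0 (b n)).real (gapEvent (N n) (γ n) E) : ℝ) : ℂ)) atTop
        (𝓝 (fredholmSum(shiftKernel φ ψ,E)))) := by
  have hpi : (2 * π : ℂ) ≠ 0 := mod_cast two_pi_pos.ne'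
  have hpin : 0 < ‖(2 * π : ℂ)‖ := norm_pos_iff.2 hpi
  obtain ⟨C, A, hp⟩ := hp
  -- The line is placed at `Re ω = κ + 2`, so that the right factor decays faster than the left one
  -- can grow.
  obtain ⟨⟨D, hD⟩, hRt⟩ := linePart_limit hs.tendsto_zero hs.pos hs.cube (η := κ + 2) (by linarith)
    (p := fun n ζ => (relFactor (b n) (N n) (ε n) (m n) ζ)⁻¹)
    (fun n => (measurable_relFactor _ _ _ _).inv) hp hpt
  simp only [hψ] at hRt
  -- Each function is divided by its prefactor, including one `N ε`. The two powers of `N ε` combine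
  -- with the `γ²` of the rescaled kernel to `(γNε)² = 1`.
  set Φ : ℕ → ℝ → ℂ := fun n u => leftSum (b n) (N n + γ n * u) /
    ((((N n : ℂ) ^ n)⁻¹ / m n * cexp (3 * n / 2 : ℝ) * cexp (N n * γ n * u : ℝ)) * (N n * ε n))
    with hΦ
  set Ψ : ℕ → ℝ → ℂ := fun n v => rightGauss (b n) (N n + γ n * v) /
    (((N n : ℂ) ^ n * m n * cexp (-(3 * n / 2 : ℝ)) * cexp (-(N n * γ n * v : ℝ))) * (N n * ε n)) with hΨ
  have hgood : ∀ᶠ n : ℕ in atTop, 0 < N n ∧ 0 < ε n ∧ m n ≠ 0 ∧ 0 < γ n := by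
    filter_upwards [hs.N_pos, hs.pos, hm, hs.gamma] with n h1 h2 h3 h4
    refine ⟨h1, h2, h3, ?_⟩
    have h5 : 0 < N n * ε n := mul_pos h1 h2
    rw [mul_assoc] at h4
    exact pos_of_mul_pos_left (h4 ▸ one_pos) h5.le
  have hΦe : ∀ᶠ n in atTop, ∀ u, Φ n u = L n u / (2 * π) := by
    filter_upwards [hL, hgood] with n h1 ⟨h2, h3, h4, h5⟩ u
    have e1 : (N n : ℂ) ≠ 0 := mod_cast h2.ne'
    have e2 : (ε n : ℂ) ≠ 0 := mod_cast h3.ne'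
    have e3 : (m n : ℂ) ≠ 0 := mod_cast h4
    simp only [hΦ]
    rw [h1]
    have := exp_ne_zero ((3 * n / 2 : ℝ) : ℂ)
    have := exp_ne_zero ((N n * γ n * u : ℝ) : ℂ)
    field_simp
  have hΨe : ∀ᶠ n : ℕ in atTop, ∀ v, Ψ n v =
      linePart n (ε n) (κ + 2) (fun ζ => (relFactor (b n) (N n) (ε n) (m n) ζ)⁻¹) v / (2 * π) := by
    filter_upwards [hgood, hs.N_sq, hs.gamma] with n ⟨h2, h3, h4, h5⟩ h6 h7 v
    have e1 : (N n : ℂ) ≠ 0 := mod_cast h2.ne'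
    have e2 : (ε n : ℂ) ≠ 0 := mod_cast h3.ne'
    have e3 : (m n : ℂ) ≠ 0 := mod_cast h4
    simp only [hΨ]
    rw [rightGauss_eq_linePart (b n) h2 h6 h3 h7 h4 (η := κ + 2) (by linarith) v]
    have := exp_ne_zero (-((3 * n / 2 : ℝ) : ℂ))
    have := exp_ne_zero (-((N n * γ n * v : ℝ) : ℂ))
    field_simp
  have hΦm : ∀ n, Measurable (Φ n) := fun n =>
    Measurable.div ((continuous_leftSum (b n)).measurable.comp (by fun_prop)) (by fun_prop)
  have hΨm : ∀ n, Measurable (Ψ n) := fun n =>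
    Measurable.div ((continuous_rightGauss (b n)).measurable.comp (by fun_prop)) (by fun_prop)
  have hΦt : ∀ u, Tendsto (fun n => Φ n u) atTop (𝓝 (φ u)) := by
    intro u
    have := (hLt u).div_const (2 * π : ℂ)
    rw [mul_div_cancel_left₀ _ hpi] at this
    exact this.congr' (hΦe.mono fun n h => (h u).symm)
  have hΨt : ∀ v, Tendsto (fun n => Ψ n v) atTop (𝓝 (ψ v)) := by
    intro v
    have := (hRt v).div_const (2 * π : ℂ)
    rw [mul_div_cancel_left₀ _ hpi] at this
    exact this.congr' (hΨe.mono fun n h => (h v).symm)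
  have hΦb : ∀ c, ∃ C, ∀ᶠ n in atTop, ∀ u, c ≤ u → ‖Φ n u‖ ≤ C * rexp (κ * u) := by
    intro c
    obtain ⟨C, hC⟩ := hLb c
    refine ⟨C / ‖(2 * π : ℂ)‖, ?_⟩
    filter_upwards [hC, hΦe] with n h1 h2 u hu
    rw [h2, norm_div, div_mul_eq_mul_div]
    gcongr
    exact h1 u hu
  have hΨb : ∀ᶠ n in atTop, ∀ v, ‖Ψ n v‖ ≤ D / ‖(2 * π : ℂ)‖ * rexp (-(κ + 2) * v) := by
    filter_upwards [hD, hΨe] with n h1 h2 v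
    rw [h2, norm_div, div_mul_eq_mul_div]
    gcongr
    exact h1 v
  have hφm : Measurable φ := measurable_of_tendsto_metrizable hΦm (tendsto_pi_nhds.2 hΦt)
  have hψm : Measurable ψ := measurable_of_tendsto_metrizable hΨm (tendsto_pi_nhds.2 hΨt)
  refine ⟨⟨hφm, hψm, fun c => ?_, fun c => ?_⟩, fun E hE hEb => ?_⟩
  · obtain ⟨C, hC⟩ := hΦb c
    exact ⟨C, fun u hu => le_of_tendsto (hΦt u).norm (hC.mono fun n h => h u hu)⟩
  · exact ⟨_, fun u _ => le_of_tendsto (hΨt u).norm (hΨb.mono fun n h => h u)⟩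
  · obtain ⟨c, hc⟩ := hEb
    obtain ⟨C, hC⟩ := hΦb c
    obtain ⟨-, h2, -⟩ := tendsto_fredholm_tilt (c := c) hΦm hΨm hφm hψm hC
      (hΨb.mono fun n h u _ => h u) (fun u _ => hΦt u) (fun u _ => hΨt u) hE hc
    refine h2.congr' ?_
    filter_upwards [hb, hgood, hs.N_sq, hs.gamma] with n h1 ⟨h2, h3, h4, h5⟩ h6 h7
    rw [gap_eq_tsum_fredholmTerm h1 (N n) h5 hE]
    symm
    -- The remaining prefactors multiply to `exp (Nγ(u - v))`, a conjugation.
    rw [fredholmTerm_conj (d := fun u => cexp (N n * γ n * u : ℝ)) (fun u => exp_ne_zero _)]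
    intro u v
    have e1 : (N n : ℂ) ≠ 0 := mod_cast h2.ne'
    have e2 : (ε n : ℂ) ≠ 0 := mod_cast h3.ne'
    have e3 : (m n : ℂ) ≠ 0 := mod_cast h4
    have e7 : (γ n : ℂ) * N n * ε n = 1 := mod_cast congrArg ((↑) : ℝ → ℂ) h7
    rw [kernel_affine (b n) (N n) h5, shiftKernel, shiftKernel, ← integral_const_mul, ← integral_const_mul,
      ← integral_mul_const]
    refine integral_congr_ae (.of_forall fun w => ?_)
    simp only [hΦ, hΨ]
    have k1 : cexp (-((3 * n / 2 : ℝ) : ℂ)) = (cexp ((3 * n / 2 : ℝ) : ℂ))⁻¹ := Complex.exp_neg _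
    have k2 : cexp (-((N n * γ n * (v + w) : ℝ) : ℂ)) =
      (cexp ((N n * γ n * v : ℝ) : ℂ) * cexp ((N n * γ n * w : ℝ) : ℂ))⁻¹ := by
      rw [← Complex.exp_add, ← Complex.exp_neg]; congr 1; push_cast; ring
    have k3 : cexp ((N n * γ n * (u + w) : ℝ) : ℂ) =
      cexp ((N n * γ n * u : ℝ) : ℂ) * cexp ((N n * γ n * w : ℝ) : ℂ) := by
      rw [← Complex.exp_add]; congr 1; push_cast; ring
    rw [k1, k2, k3]
    have := exp_ne_zero ((3 * n / 2 : ℝ) : ℂ)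
    have := exp_ne_zero ((N n * γ n * u : ℝ) : ℂ)
    have := exp_ne_zero ((N n * γ n * v : ℝ) : ℂ)
    have := exp_ne_zero ((N n * γ n * w : ℝ) : ℂ)
    field_simp
    linear_combination (leftSum (b n) (N n + γ n * (u + w)) * rightGauss (b n) (N n + γ n * (v + w))) *
      (γ n * N n * ε n + 1) * e7

/-! ### Separating coinciding nodes -/

theorem nodePoly_outlierTarget {n r : ℕ} (hr : r ≤ n) (β : ℝ) (w : ℂ) :
    (nodePoly (outlierTarget n r β)).eval w = w ^ (n - r) * (w - β) ^ r := by
  rw [nodePoly_eval]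
  have h1 : ∀ i : Fin n, w - (outlierTarget n r β i : ℂ) = (fun k : ℕ => if k + r < n then w else w - β) i := by
    intro i
    simp only [outlierTarget]
    split_ifs <;> simp
  rw [prod_congr rfl fun i _ => h1 i,
    Fin.prod_univ_eq_prod_range (fun k : ℕ => if k + r < n then w else w - (β : ℂ)) n]
  obtain ⟨k, rfl⟩ := Nat.exists_eq_add_of_le' hr
  rw [Finset.prod_range_add, Nat.add_sub_cancel]
  congr 1
  · rw [prod_congr rfl (g := fun _ => w), prod_const, Finset.card_range]
    intro i hi
    rw [Finset.mem_range] at hi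
    rw [if_pos (by omega)]
  · rw [prod_congr rfl (g := fun _ => w - (β : ℂ)), prod_const, Finset.card_range]
    intro i _
    rw [if_neg (by omega)]

/-- There are `n` factors, each `1 + O(n⁻²)` by the choice of the tolerance `D / (2(n+1)²)`, so
their product is `1 + O(1/n)`. -/
theorem nodePoly_ratio_sub_one_le {b b' : Fin n → ℝ} {w : ℂ} {D : ℝ} (hD : 0 < D)
    (hbb : ∀ l, |b l - b' l| ≤ D / (2 * (n + 1) ^ 2)) (hw : ∀ l, D ≤ ‖w - b' l‖) :
    ‖(nodePoly b).eval w / (nodePoly b').eval w - 1‖ ≤ 1 / (n + 1) := by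
  have hne : ∀ l, w - (b' l : ℂ) ≠ 0 := fun l h => by
    have := hw l
    rw [h, norm_zero] at this
    linarith
  rw [nodePoly_eval, nodePoly_eval, ← Finset.prod_div_distrib]
  have e : ∀ l, (w - b l) / (w - b' l) = 1 + ((b' l : ℂ) - b l) / (w - b' l) := fun l => by
    have := hne l
    field_simp
    ring
  simp only [e]
  have h1 := Finset.norm_prod_one_add_sub_one_le Finset.univ fun l => ((b' l : ℂ) - b l) / (w - b' l)
  have h2 : ∀ l, ‖((b' l : ℂ) - b l) / (w - b' l)‖ ≤ 1 / (2 * (n + 1) ^ 2) := by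
    intro l
    rw [norm_div, ← Complex.ofReal_sub, norm_real, norm_eq_abs, abs_sub_comm, div_le_iff₀ (hD.trans_le (hw l))]
    refine (hbb l).trans ?_
    rw [div_mul_eq_mul_div, one_mul]
    gcongr
    exact hw l
  have h3 : ∑ l, ‖((b' l : ℂ) - b l) / (w - b' l)‖ ≤ 1 / (2 * (n + 1)) := by
    refine (Finset.sum_le_card_nsmul _ _ _ fun l _ => h2 l).trans ?_
    rw [Finset.card_univ, Fintype.card_fin, nsmul_eq_mul, mul_one_div, div_le_div_iff₀ (by positivity)
      (by positivity)]
    nlinarith [show (0 : ℝ) ≤ n by positivity]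
  have h0 : 0 ≤ ∑ l, ‖((b' l : ℂ) - b l) / (w - b' l)‖ := Finset.sum_nonneg fun l _ => norm_nonneg _
  have h4 : (1 : ℝ) / (2 * (n + 1)) ≤ 1 := by
    rw [div_le_one (by positivity)]
    linarith [show (0 : ℝ) ≤ n by positivity]
  have h5 := Real.abs_exp_sub_one_le (x := ∑ l, ‖((b' l : ℂ) - b l) / (w - b' l)‖)
    (by rw [abs_of_nonneg h0]; exact h3.trans h4)
  refine h1.trans ((le_abs_self _).trans (h5.trans ?_))
  rw [abs_of_nonneg h0]
  calc 2 * _ ≤ 2 * (1 / (2 * ((n : ℝ) + 1))) := by gcongr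
    _ = _ := by field_simp

theorem monotone_outlierTarget (n r : ℕ) {β : ℝ} (hβ : 0 ≤ β) : Monotone (outlierTarget n r β) := by
  intro i j hij
  simp only [outlierTarget]
  have : (i : ℕ) ≤ j := hij
  split_ifs <;> first | exact le_rfl | exact hβ | omega

/-- The biorthogonal formulas need distinct nodes. The law depends continuously on the nodes, so a
small displacement changes the given probability arbitrarily little; adding `s · l` to the weakly
increasing target separates all nodes. -/
theorem exists_injective_nodes (n r : ℕ) {β : ℝ} (hβ : 0 ≤ β) {S : Set (Fin n → ℝ)} (hS : MeasurableSet S)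
    {δ e : ℝ} (hδ : 0 < δ) (he : 0 < e) :
    ∃ b : Fin n → ℝ, Injective b ∧ (∀ l, |b l - outlierTarget n r β l| ≤ δ) ∧
      |(ensembleLaw 1 0 b).real S - (ensembleLaw 1 0 (outlierTarget n r β)).real S| ≤ e := by
  obtain ⟨B, hB⟩ : ∃ B : ℝ → Fin n → ℝ, B = fun s l => outlierTarget n r β l + s * (l : ℕ) := ⟨_, rfl⟩
  have hBc : Continuous B := by
    refine continuous_pi fun l => ?_
    simp only [hB]; fun_prop
  have hB0 : B 0 = outlierTarget n r β := by funext l; simp [hB]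
  have h1 : ∀ᶠ s in 𝓝[>] (0 : ℝ), ∀ l, |B s l - outlierTarget n r β l| ≤ δ := by
    refine eventually_all.2 fun l => ?_
    have hc : Continuous fun s => |B s l - outlierTarget n r β l| :=
      (((continuous_apply l).comp hBc).sub continuous_const).abs
    have ht := hc.tendsto 0
    rw [hB0, sub_self, abs_zero] at ht
    exact ((ht.eventually (gt_mem_nhds hδ)).mono fun s h => h.le).filter_mono nhdsWithin_le_nhds
  have h2 : ∀ᶠ s in 𝓝[>] (0 : ℝ), |(ensembleLaw 1 0 (B s)).real S -
      (ensembleLaw 1 0 (outlierTarget n r β)).real S| ≤ e := by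
    have hp : Continuous fun s => ((0 : Fin n → ℝ), B s) := continuous_const.prodMk hBc
    have hg := continuous_ensembleLaw_apply (n := n) (zero_lt_one' ℝ) hS
    have hc := hg.comp hp
    simp only [comp_def] at hc
    have hfin : ∀ s, ensembleLaw 1 0 (B s) S ≠ ⊤ := fun s => by
      have := isProbabilityMeasure_ensembleLaw one_pos 0 (B s)
      exact measure_ne_top _ _
    have ht : Tendsto (fun s => (ensembleLaw 1 0 (B s)).real S) (𝓝 0) (𝓝 ((ensembleLaw 1 0 (B 0)).real S)) :=
      (ENNReal.tendsto_toReal (hfin 0)).comp (hc.tendsto 0)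
    have ht' := (ht.sub_const ((ensembleLaw 1 0 (B 0)).real S)).abs
    rw [sub_self, abs_zero, hB0] at ht'
    exact ((ht'.eventually (gt_mem_nhds he)).mono fun s h => h.le).filter_mono nhdsWithin_le_nhds
  obtain ⟨s, ⟨h3, h4⟩, h5⟩ := ((h1.and h2).and self_mem_nhdsWithin).exists
  refine ⟨B s, ?_, h3, h4⟩
  refine StrictMono.injective fun i j hij => ?_
  have h6 := monotone_outlierTarget n r hβ hij.le
  have h7 : ((i : ℕ) : ℝ) < (j : ℕ) := mod_cast hij
  have h8 : s * ((i : ℕ) : ℝ) < s * ((j : ℕ) : ℝ) := mul_lt_mul_of_pos_left h7 h5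
  simp only [hB]
  linarith

/-- For the exact targets the power of `z = 1 + εω` coming from the zero nodes cancels and only the
`r` outlier factors remain; `ρ` is the error of the displacement. The scale `μ` makes `(z - β)/μ`
converge: `ε` in the critical case, `1 - β` below it. -/
theorem relFactor_eq {n r : ℕ} (hr : r ≤ n) {b : Fin n → ℝ} {N ε β μ : ℝ} (hN : 0 < N) (hε : 0 < ε)
    (hμ : μ ≠ 0) (hb : ∀ l, |b l - outlierTarget n r (N * β) l| ≤ N * ε / (2 * (n + 1) ^ 2)) {ω : ℂ}
    (h1 : ε ≤ ‖1 + (ε : ℂ) * ω‖) (h2 : ε ≤ ‖1 + (ε : ℂ) * ω - β‖) :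
    ∃ ρ : ℂ, ‖ρ - 1‖ ≤ 1 / (n + 1) ∧ relFactor b N ε (μ ^ r) ω = ((1 + ε * ω) / ((1 + ε * ω - β) / μ)) ^ r * ρ⁻¹ := by
  have hN' : (N : ℂ) ≠ 0 := mod_cast hN.ne'
  have hμ' : (μ : ℂ) ≠ 0 := mod_cast hμ
  refine ⟨_, nodePoly_ratio_sub_one_le (w := N * (1 + ε * ω)) (mul_pos hN hε) hb fun l => ?_, ?_⟩
  · have hn : ‖(N : ℂ)‖ = N := by rw [norm_real, norm_of_nonneg hN.le]
    simp only [outlierTarget]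
    split_ifs
    · rw [Complex.ofReal_zero, sub_zero, norm_mul, hn]
      gcongr
    · rw [show (N : ℂ) * (1 + ε * ω) - (N * β : ℝ) = N * (1 + ε * ω - β) by push_cast; ring, norm_mul, hn]
      gcongr
  · rw [nodePoly_outlierTarget hr, relFactor, inv_div]
    have hz : 1 + (ε : ℂ) * ω ≠ 0 := norm_pos_iff.1 (hε.trans_le h1)
    have hz2 : 1 + (ε : ℂ) * ω - β ≠ 0 := norm_pos_iff.1 (hε.trans_le h2)
    generalize (nodePoly b).eval (N * (1 + ε * ω) : ℂ) = P
    generalize 1 + (ε : ℂ) * ω = z at hz hz2 ⊢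
    obtain ⟨k, rfl⟩ := Nat.exists_eq_add_of_le' hr
    rw [Nat.add_sub_cancel, show (N : ℂ) * z - (N * β : ℝ) = N * (z - β) by push_cast; ring, mul_pow, mul_pow,
      div_div_eq_mul_div, div_pow, mul_pow]
    push_cast
    have := pow_ne_zero r hz2
    field_simp
    ring

theorem norm_relFactor_le {n r : ℕ} (hn : 1 ≤ n) (hr : r ≤ n) {b : Fin n → ℝ} {N ε β μ : ℝ} (hN : 0 < N)
    (hε : 0 < ε) (hμ : μ ≠ 0)
    (hb : ∀ l, |b l - outlierTarget n r (N * β) l| ≤ N * ε / (2 * (n + 1) ^ 2)) {ω : ℂ}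
    (h1 : ε ≤ ‖1 + (ε : ℂ) * ω‖) (h2 : ε ≤ ‖1 + (ε : ℂ) * ω - β‖) :
    ‖relFactor b N ε (μ ^ r) ω‖ ≤ 2 * (‖1 + (ε : ℂ) * ω‖ / ‖(1 + ε * ω - β) / μ‖) ^ r ∧
    ‖(relFactor b N ε (μ ^ r) ω)⁻¹‖ ≤ 2 * (‖(1 + ε * ω - β) / μ‖ / ‖1 + (ε : ℂ) * ω‖) ^ r := by
  obtain ⟨ρ, hρ, he⟩ := relFactor_eq hr hN hε hμ hb h1 h2
  have hn' : (1 : ℝ) ≤ n := mod_cast hn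
  have h3 : ‖ρ - 1‖ ≤ 1 / 2 := hρ.trans (one_div_le_one_div_of_le two_pos (by linarith))
  have h4 : 1 / 2 ≤ ‖ρ‖ := by
    have := norm_sub_norm_le (1 : ℂ) (1 - ρ)
    rw [norm_one, sub_sub_cancel, norm_sub_rev] at this
    linarith
  have h5 : ‖ρ‖ ≤ 2 := by
    have := norm_add_le (1 : ℂ) (ρ - 1)
    rw [norm_one, add_sub_cancel] at this
    linarith
  have h6 : ‖ρ‖⁻¹ ≤ 2 := by rw [inv_le_comm₀ (by linarith) two_pos]; linarith
  rw [he, mul_inv, inv_inv, norm_mul, norm_mul, norm_inv ρ, ← inv_pow, inv_div, norm_pow, norm_pow,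
    norm_div, norm_div (_ / _) (1 + (ε : ℂ) * ω), mul_comm, mul_comm _ ‖ρ‖]
  exact ⟨mul_le_mul_of_nonneg_right h6 (by positivity), mul_le_mul_of_nonneg_right h5 (by positivity)⟩

theorem tendsto_relFactor {r : ℕ} {N ε γ β μ : ℕ → ℝ} (hs : IsEdgeScaling N ε γ)
    (hμ : ∀ᶠ n in atTop, μ n ≠ 0) {b : ∀ n, Fin n → ℝ}
    (hb : ∀ᶠ n : ℕ in atTop, ∀ l, |b n l - outlierTarget n r (N n * β n) l| ≤
      N n * ε n / (2 * (n + 1) ^ 2)) {ω : ℕ → ℂ} {ω₀ G : ℂ} (hω : Tendsto ω atTop (𝓝 ω₀))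
    (hG : Tendsto (fun n => (1 + ε n * ω n - β n) / μ n) atTop (𝓝 G)) (hG0 : G ≠ 0)
    (h1 : ∀ᶠ n in atTop, ε n ≤ ‖1 + (ε n : ℂ) * ω n‖) (h2 : ∀ᶠ n in atTop, ε n ≤ ‖1 + (ε n : ℂ) * ω n - β n‖) :
    Tendsto (fun n => relFactor (b n) (N n) (ε n) (μ n ^ r) (ω n)) atTop (𝓝 (G ^ r)⁻¹) := by
  have hex : ∀ n : ℕ, ∃ ρ : ℂ, (r ≤ n ∧ 0 < N n ∧ 0 < ε n ∧ μ n ≠ 0 ∧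
      (∀ l, |b n l - outlierTarget n r (N n * β n) l| ≤ N n * ε n / (2 * (n + 1) ^ 2)) ∧
      ε n ≤ ‖1 + (ε n : ℂ) * ω n‖ ∧ ε n ≤ ‖1 + (ε n : ℂ) * ω n - β n‖) → ‖ρ - 1‖ ≤ 1 / (n + 1) ∧
      relFactor (b n) (N n) (ε n) (μ n ^ r) (ω n) =
      ((1 + ε n * ω n) / ((1 + ε n * ω n - β n) / μ n)) ^ r * ρ⁻¹ := by
    intro n
    by_cases h : (r ≤ n ∧ 0 < N n ∧ 0 < ε n ∧ μ n ≠ 0 ∧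
      (∀ l, |b n l - outlierTarget n r (N n * β n) l| ≤ N n * ε n / (2 * (n + 1) ^ 2)) ∧
      ε n ≤ ‖1 + (ε n : ℂ) * ω n‖ ∧ ε n ≤ ‖1 + (ε n : ℂ) * ω n - β n‖)
    · obtain ⟨a1, a2, a3, a4, a5, a6, a7⟩ := h
      obtain ⟨ρ, hρ⟩ := relFactor_eq a1 a2 a3 a4 a5 a6 a7
      exact ⟨ρ, fun _ => hρ⟩
    · exact ⟨0, fun h' => absurd h' h⟩
  choose ρ hρ using hex
  have hall : ∀ᶠ n : ℕ in atTop, (r ≤ n ∧ 0 < N n ∧ 0 < ε n ∧ μ n ≠ 0 ∧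
      (∀ l, |b n l - outlierTarget n r (N n * β n) l| ≤ N n * ε n / (2 * (n + 1) ^ 2)) ∧
      ε n ≤ ‖1 + (ε n : ℂ) * ω n‖ ∧ ε n ≤ ‖1 + (ε n : ℂ) * ω n - β n‖) := by
    filter_upwards [eventually_ge_atTop r, hs.N_pos, hs.pos, hμ, hb, h1, h2] with n a1 a2 a3 a4 a5 a6 a7
      using ⟨a1, a2, a3, a4, a5, a6, a7⟩
  have hρt : Tendsto ρ atTop (𝓝 1) := by
    rw [tendsto_iff_norm_sub_tendsto_zero]
    refine squeeze_zero' (.of_forall fun n => norm_nonneg _) (hall.mono fun n h => (hρ n h).1) ?_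
    exact tendsto_one_div_add_atTop_nhds_zero_nat
  have hε' : Tendsto (fun n => (ε n : ℂ)) atTop (𝓝 0) := by
    simpa [comp_def] using (Complex.continuous_ofReal.tendsto 0).comp hs.tendsto_zero
  have hz : Tendsto (fun n => 1 + (ε n : ℂ) * ω n) atTop (𝓝 1) := by simpa using (hε'.mul hω).const_add 1
  have hlim := ((hz.div hG hG0).pow r).mul (hρt.inv₀ one_ne_zero)
  rw [one_div, inv_one, mul_one, inv_pow] at hlim
  exact hlim.congr' (hall.mono fun n h => (hρ n h).2.symm)

theorem isEdgeScaling : IsEdgeScaling (fun n => √(2 * n)) (fun n => 1 / (n : ℝ) ^ (1 / 3 : ℝ))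
    (fun n => 1 / (√2 * (n : ℝ) ^ (1 / 6 : ℝ))) where
  tendsto_zero := by
    have h := (tendsto_rpow_atTop (show (0 : ℝ) < 1 / 3 by norm_num)).comp tendsto_natCast_atTop_atTop
    refine h.inv_tendsto_atTop.congr fun n => ?_
    simp only [Pi.inv_apply, comp_apply, one_div]
  pos := by
    filter_upwards [eventually_gt_atTop 0] with n hn
    have : (0 : ℝ) < n := mod_cast hn
    positivity
  cube := by
    filter_upwards [eventually_gt_atTop 0] with n hn
    have hn' : (0 : ℝ) < n := mod_cast hn
    rw [div_pow, one_pow, ← Real.rpow_natCast, ← Real.rpow_mul hn'.le]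
    norm_num
    field_simp
  N_pos := by
    filter_upwards [eventually_gt_atTop 0] with n hn
    have : (0 : ℝ) < n := mod_cast hn
    positivity
  N_sq := .of_forall fun n => sq_sqrt (by positivity)
  gamma := by
    filter_upwards [eventually_gt_atTop 0] with n hn
    have hn' : (0 : ℝ) < n := mod_cast hn
    have h : (n : ℝ) ^ (1 / 6 : ℝ) * (n : ℝ) ^ (1 / 3 : ℝ) = √n := by
      rw [← Real.rpow_add hn', Real.sqrt_eq_rpow]; norm_num
    have h1 : 0 < (n : ℝ) ^ (1 / 6 : ℝ) := by positivity
    have h2 : 0 < (n : ℝ) ^ (1 / 3 : ℝ) := by positivity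
    have h3 : 0 < √2 := by positivity
    rw [Real.sqrt_mul two_pos.le, ← h]
    field_simp

theorem measurableSet_forall_mem_image (α : ℝ) {γ : ℝ} (hγ : γ ≠ 0) {E : Set ℝ} (hE : MeasurableSet E) :
    MeasurableSet (gapEvent (n := n) α γ E) := by
  simp only [gapEvent, Set.ofPred_forall]
  exact MeasurableSet.iInter fun j =>
    measurable_pi_apply j ((measurableEmbedding_affine α hγ).measurableSet_image.2 hE.compl)

/-- The displaced nodes may depend on `n` and on the event, with an error `1/(n+1)` in probability.
A limit proved for all sufficiently close distinct nodes therefore passes to the coinciding ones. -/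
theorem tendsto_gap_of_close_nodes {r : ℕ} {N ε γ β : ℕ → ℝ} (hs : IsEdgeScaling N ε γ)
    (hβ : ∀ n, 0 ≤ N n * β n) {κ : ℝ} {φ ψ : ℝ → ℂ}
    (main : ∀ b : ∀ n, Fin n → ℝ, (∀ᶠ n in atTop, Injective (b n)) →
      (∀ᶠ n : ℕ in atTop, ∀ l, |b n l - outlierTarget n r (N n * β n) l| ≤ N n * ε n / (2 * (n + 1) ^ 2)) →
      IsShiftPair κ φ ψ ∧ ∀ E : Set ℝ, MeasurableSet E → BddBelow E →
      (Tendsto (fun n => (((ensembleLaw 1 0 (b n)).real (gapEvent (N n) (γ n) E) : ℝ) : ℂ)) atTop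
        (𝓝 (fredholmSum(shiftKernel φ ψ,E))))) :
    IsShiftPair κ φ ψ ∧ ∀ E : Set ℝ, MeasurableSet E → BddBelow E →
      (Tendsto (fun n => (((ensembleLaw 1 0 (outlierTarget n r (N n * β n))).real (gapEvent (N n) (γ n) E) : ℝ) : ℂ)) atTop
        (𝓝 (fredholmSum(shiftKernel φ ψ,E)))) := by
  have hγ : ∀ᶠ n in atTop, γ n ≠ 0 := hs.gamma.mono fun n h h0 => by rw [h0] at h; norm_num at h
  have key : ∀ E : Set ℝ, MeasurableSet E → ∃ b : ∀ n, Fin n → ℝ, (∀ᶠ n in atTop, Injective (b n)) ∧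
      (∀ᶠ n : ℕ in atTop, ∀ l, |b n l - outlierTarget n r (N n * β n) l| ≤ N n * ε n / (2 * (n + 1) ^ 2)) ∧
      ∀ᶠ n : ℕ in atTop, |(ensembleLaw 1 0 (b n)).real (gapEvent (N n) (γ n) E) -
        (ensembleLaw 1 0 (outlierTarget n r (N n * β n))).real (gapEvent (N n) (γ n) E)| ≤ 1 / (n + 1) := by
    intro E hE
    have hex : ∀ n : ℕ, ∃ b : Fin n → ℝ, (0 < N n ∧ 0 < ε n ∧ γ n ≠ 0) → (Injective b ∧
        (∀ l, |b l - outlierTarget n r (N n * β n) l| ≤ N n * ε n / (2 * (n + 1) ^ 2)) ∧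
        |(ensembleLaw 1 0 b).real (gapEvent (N n) (γ n) E) -
        (ensembleLaw 1 0 (outlierTarget n r (N n * β n))).real (gapEvent (N n) (γ n) E)| ≤ 1 / (n + 1)) := by
      intro n
      by_cases h : 0 < N n ∧ 0 < ε n ∧ γ n ≠ 0
      · obtain ⟨b, hb⟩ := exists_injective_nodes n r (hβ n) (measurableSet_forall_mem_image (n := n) (N n) h.2.2 hE)
          (δ := N n * ε n / (2 * (n + 1) ^ 2)) (e := 1 / (n + 1))
          (div_pos (mul_pos h.1 h.2.1) (by positivity)) (by positivity)
        exact ⟨b, fun _ => hb⟩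
      · exact ⟨0, fun h' => absurd h' h⟩
    choose b hb using hex
    have hall : ∀ᶠ n in atTop, 0 < N n ∧ 0 < ε n ∧ γ n ≠ 0 := by
      filter_upwards [hs.N_pos, hs.pos, hγ] with n h1 h2 h3 using ⟨h1, h2, h3⟩
    exact ⟨b, hall.mono fun n h => (hb n h).1, hall.mono fun n h => (hb n h).2.1, hall.mono fun n h => (hb n h).2.2⟩
  refine ⟨?_, fun E hE hEb => ?_⟩
  · obtain ⟨b, h1, h2, -⟩ := key ∅ MeasurableSet.empty
    exact (main b h1 h2).1
  · obtain ⟨b, h1, h2, h3⟩ := key E hE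
    refine tendsto_of_tendsto_of_dist ((main b h1 h2).2 E hE hEb) ?_
    refine squeeze_zero' (.of_forall fun n => dist_nonneg) (h3.mono fun n h => ?_)
      (tendsto_one_div_add_atTop_nhds_zero_nat (𝕜 := ℝ))
    rwa [Complex.dist_of_im_eq (by simp), ofReal_re, ofReal_re, Real.dist_eq]

/-! ### The limit at the critical time -/

theorem exp_growth_le_of_decay {η κ : ℝ} (h : 0 ≤ η + κ) (c u : ℝ) (hu : c ≤ u) :
    rexp (-η * u) ≤ rexp ((η + κ) * |c|) * rexp (κ * u) := by
  rw [← exp_add, exp_le_exp]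
  have : -|c| ≤ u := (neg_abs_le c).trans hu
  nlinarith

theorem line_airyPlus (r : ℕ) (τ v : ℝ) {η : ℝ} (hη : |τ| + 2 ≤ η) :
    ∫ Y : ℝ, cexp (-v * ((η : ℝ) + Y * I) + ((η : ℝ) + Y * I) ^ 3 / 3) *
      ((η : ℂ) + Y * I - τ) ^ r = 2 * π * airyPlus r τ v := by
  have hpi : (2 * π : ℂ) ≠ 0 := mod_cast two_pi_pos.ne'
  rw [airyPlus_eq_line r τ v hη, mul_div_cancel₀ _ hpi, ← integral_neg_eq_self]
  refine integral_congr_ae (.of_forall fun Y => ?_)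
  have e : (η : ℂ) + (-Y : ℝ) * I = -(I * (Y + η * I)) := by
    push_cast
    linear_combination (η : ℂ) * I_mul_I
  beta_reduce
  rw [e, airyPhase]
  congr 2
  have := Complex.I_pow_three
  linear_combination (-((Y : ℂ) + η * I) ^ 3 / 3) * this

theorem line_airyMinus (r : ℕ) (τ u η : ℝ) : ∫ Y : ℝ, cexp (u * (-η + Y * I) - (-η + Y * I) ^ 3 / 3) *
      ((-(η : ℂ) + Y * I - τ) ^ r)⁻¹ =
    ∫ x : ℝ, airyPhase u (x + η * I) * ((I * (x + η * I) - τ) ^ r)⁻¹ := by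
  refine integral_congr_ae (.of_forall fun Y => ?_)
  have e : -(η : ℂ) + Y * I = I * (Y + η * I) := by linear_combination (-η : ℂ) * I_mul_I
  beta_reduce
  rw [e, airyPhase]
  congr 2
  have := Complex.I_pow_three
  linear_combination (-((Y : ℂ) + η * I) ^ 3 / 3) * this

/-- The substitution `ω = I a` carries the circle about `-Iτ` to the circle about `τ`, with the
angle shifted by `π/2`. -/
theorem small_circle_airyMinus (r : ℕ) (τ u : ℝ) : -I * ∫ θ in 0..2 * π, (circleMap 0 1 θ * I) *
      (cexp (u * circleMap τ 1 θ - circleMap τ 1 θ ^ 3 / 3) * ((circleMap τ 1 θ - τ) ^ r)⁻¹) =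
    ∮ a in C(-(I * τ), 1), airyPhase u a * ((I * a - τ) ^ r)⁻¹ := by
  set G : ℝ → ℂ := fun θ => -I * ((circleMap 0 1 θ * I) *
    (cexp (u * circleMap τ 1 θ - circleMap τ 1 θ ^ 3 / 3) * ((circleMap τ 1 θ - τ) ^ r)⁻¹)) with hG
  have hper : Function.Periodic G (2 * π) := by
    intro θ
    simp only [hG, (periodic_circleMap 0 1) θ, (periodic_circleMap (τ : ℂ) 1) θ]
  rw [← intervalIntegral.integral_const_mul]
  change ∫ θ in 0..2 * π, G θ = _
  have h1 := hper.intervalIntegral_add_eq 0 (π / 2)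
  have h2 := intervalIntegral.integral_comp_add_right (a := 0) (b := 2 * π) G (π / 2)
  rw [zero_add, add_comm (2 * π)] at h2
  rw [zero_add] at h1
  rw [h1, ← h2, circleIntegral]
  refine intervalIntegral.integral_congr fun θ _ => ?_
  have hexp : cexp (((θ + π / 2 : ℝ) : ℂ) * I) = I * cexp (θ * I) := by
    rw [show ((θ + π / 2 : ℝ) : ℂ) * I = π / 2 * I + θ * I by
      push_cast; ring, Complex.exp_add, Complex.exp_pi_div_two_mul_I]
  have e : circleMap τ 1 (θ + π / 2) = I * circleMap (-(I * τ)) 1 θ := by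
    simp only [circleMap, hexp]
    push_cast
    linear_combination (τ : ℂ) * I_mul_I
  have e0 : circleMap 0 1 (θ + π / 2) = I * circleMap 0 1 θ := by simp only [circleMap, hexp]; push_cast; ring
  simp only [hG, deriv_circleMap, smul_eq_mul]
  rw [e, e0, airyPhase]
  have h3 : cexp (u * (I * circleMap (-(I * τ)) 1 θ) - (I * circleMap (-(I * τ)) 1 θ) ^ 3 / 3) =
      cexp (I * circleMap (-(I * τ)) 1 θ ^ 3 / 3 + I * circleMap (-(I * τ)) 1 θ * u) := by
    congr 1
    linear_combination (-(circleMap (-(I * τ)) 1 θ) ^ 3 / 3) * Complex.I_pow_three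
  rw [h3]
  linear_combination (-I * circleMap 0 1 θ * (cexp (I * circleMap (-(I * τ)) 1 θ ^ 3 / 3 +
        I * circleMap (-(I * τ)) 1 θ * u) *
        ((I * circleMap (-(I * τ)) 1 θ - τ) ^ r)⁻¹)) * I_mul_I

theorem one_add_mul_circlePoint {ε : ℝ} (hε : ε ≠ 0) (η Y : ℝ) : 1 + (ε : ℂ) * circlePoint ε η Y =
      ((1 - η * ε : ℝ) : ℂ) * cexp ((ε * Y : ℝ) * I) := by
  have : (ε : ℂ) ≠ 0 := mod_cast hε
  rw [circlePoint, mul_div_cancel₀ _ this]; ring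

theorem norm_one_add_mul_circlePoint {ε η : ℝ} (hε : ε ≠ 0) (h : η * ε ≤ 1) (Y : ℝ) :
    ‖1 + (ε : ℂ) * circlePoint ε η Y‖ = 1 - η * ε := by
  rw [one_add_mul_circlePoint hε, norm_mul, norm_exp_ofReal_mul_I, mul_one, norm_real, norm_of_nonneg (by linarith)]

theorem re_one_add_mul_line (ε η Y : ℝ) : (1 + (ε : ℂ) * (η + Y * I)).re = 1 + ε * η := by simp

/-- Outliers at `N e^{τε}` have coordinate `ω ≈ τ`, so the node factor tends to `(ω - τ)^{-r}` on
the left and to its inverse on the right. The large circle tends to a line left of `τ` and the small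
one surrounds `τ`: after `ω = I a` this is the representation of `airyMinus` by a line and a circle.
-/
theorem tendsto_gap_critical (r : ℕ) (τ : ℝ) {N ε γ : ℕ → ℝ} (hs : IsEdgeScaling N ε γ) (hN : ∀ n, 0 ≤ N n) :
    IsShiftPair (|τ| + 2) (airyMinus r τ) (airyPlus r τ) ∧ ∀ E : Set ℝ, MeasurableSet E → BddBelow E →
      (Tendsto (fun n => (((ensembleLaw 1 0 (outlierTarget n r (N n * rexp (τ * ε n)))).real (gapEvent (N n) (γ n) E) : ℝ) : ℂ)) atTop
        (𝓝 (fredholmSum(shiftKernel (airyMinus r τ) (airyPlus r τ),E)))) := by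
  have hpi : (2 * π : ℂ) ≠ 0 := mod_cast two_pi_pos.ne'
  refine tendsto_gap_of_close_nodes hs (fun n => mul_nonneg (hN n) (exp_pos _).le) fun b hb hbc => ?_
  -- The exact coordinate of the outliers on the scale of `ω`.
  set τ' : ℕ → ℝ := fun n => (rexp (τ * ε n) - 1) / ε n with hτ'
  have hτ : Tendsto τ' atTop (𝓝 τ) := by
    have hd : HasDerivAt (fun x : ℝ => rexp (τ * x)) τ 0 := by
      have := ((hasDerivAt_id (0 : ℝ)).const_mul τ).exp
      simpa using this
    have h1 : Tendsto ε atTop (𝓝[≠] 0) := tendsto_nhdsWithin_iff.2 ⟨hs.tendsto_zero, hs.pos.mono fun n h => h.ne'⟩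
    refine ((hasDerivAt_iff_tendsto_slope.1 hd).comp h1).congr fun n => ?_
    simp only [comp_apply, slope_def_field, mul_zero, Real.exp_zero, sub_zero, hτ']
  -- Since `|τ'| ≤ |τ| + 1` eventually, the circle through `-η` stays at distance at least `1` from
  -- the outliers.
  set η : ℝ := |τ| + 3 with hη
  have hη0 : 0 < η := by positivity
  have hβ : ∀ᶠ n in atTop, rexp (τ * ε n) = 1 + ε n * τ' n := by
    filter_upwards [hs.pos] with n h
    rw [hτ', mul_div_cancel₀ _ h.ne']; ring
  have hτb : ∀ᶠ n in atTop, |τ' n| ≤ |τ| + 1 := (hτ.abs.eventually (gt_mem_nhds (lt_add_one _))).mono fun n h => h.le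
  have hsmall : ∀ (c : ℝ) {d : ℝ}, 0 < d → ∀ᶠ n in atTop, c * ε n ≤ d := by
    intro c d hd
    have : Tendsto (fun n => c * ε n) atTop (𝓝 0) := by simpa using hs.tendsto_zero.const_mul c
    exact (this.eventually (gt_mem_nhds hd)).mono fun n h => h.le
  have hμ : ∀ᶠ n in atTop, ε n ≠ 0 := hs.pos.mono fun n h => h.ne'
  have hεb : ∀ᶠ n in atTop, (η + 2) * ε n ≤ 1 / 2 := hsmall _ (by norm_num)
  have hG : ∀ᶠ n in atTop, ∀ ω : ℂ, (1 + ε n * ω - (rexp (τ * ε n) : ℝ)) / ε n = ω - τ' n := by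
    filter_upwards [hβ, hμ] with n h1 h2 ω
    have : (ε n : ℂ) ≠ 0 := mod_cast h2
    rw [h1, div_eq_iff this]; push_cast; ring
  have hτc : Tendsto (fun n => (τ' n : ℂ)) atTop (𝓝 τ) := (Complex.continuous_ofReal.tendsto τ).comp hτ
  have hGt : ∀ {ω : ℕ → ℂ} {ω₀ : ℂ}, Tendsto ω atTop (𝓝 ω₀) →
      Tendsto (fun n => (1 + ε n * ω n - (rexp (τ * ε n) : ℝ)) / ε n) atTop (𝓝 (ω₀ - τ)) := by
    intro ω ω₀ hω
    exact (hω.sub hτc).congr' (hG.mono fun n h => (h _).symm)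
  have hdist : ∀ᶠ n in atTop, ∀ ω : ℂ, 1 ≤ ‖ω - τ' n‖ → ε n ≤ ‖1 + (ε n : ℂ) * ω - (rexp (τ * ε n) : ℝ)‖ := by
    filter_upwards [hβ, hs.pos] with n h1 h2 ω hω
    rw [h1, show 1 + (ε n : ℂ) * ω - (1 + ε n * τ' n : ℝ) = ε n * (ω - τ' n) by push_cast; ring, norm_mul,
      norm_real, norm_of_nonneg h2.le]
    exact le_mul_of_one_le_right h2.le hω
  -- the three contours stay away from the nodes
  have hc1 : ∀ᶠ n in atTop, ∀ Y, ε n ≤ ‖1 + (ε n : ℂ) * circlePoint (ε n) η Y‖ ∧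
      ‖1 + (ε n : ℂ) * circlePoint (ε n) η Y‖ ≤ 1 := by
    filter_upwards [hεb, hs.pos] with n h1 h2 Y
    rw [norm_one_add_mul_circlePoint h2.ne' (by nlinarith)]
    constructor <;> nlinarith
  have hc2 : ∀ᶠ n in atTop, ∀ Y, 1 ≤ ‖circlePoint (ε n) η Y - τ' n‖ := by
    filter_upwards [hεb, hs.pos, hτb] with n h1 h2 h3 Y
    have h4 : (ε n : ℂ) * (circlePoint (ε n) η Y - τ' n) =
      (1 + (ε n : ℂ) * circlePoint (ε n) η Y) - ((1 + ε n * τ' n : ℝ) : ℂ) := by push_cast; ring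
    have h5 := norm_sub_norm_le ((1 + ε n * τ' n : ℝ) : ℂ) (1 + (ε n : ℂ) * circlePoint (ε n) η Y)
    rw [norm_sub_rev, ← h4, norm_mul, norm_real, norm_real, norm_of_nonneg h2.le,
      norm_one_add_mul_circlePoint h2.ne' (by nlinarith)] at h5
    have h6 := (abs_le.1 h3).1
    have h7 := le_abs_self (1 + ε n * τ' n)
    rw [norm_eq_abs] at h5
    have h8 : ε n * 1 ≤ ε n * ‖circlePoint (ε n) η Y - τ' n‖ := by nlinarith
    exact le_of_mul_le_mul_left h8 h2
  have hl1 : ∀ᶠ n in atTop, ∀ Y : ℝ, 1 ≤ ‖1 + (ε n : ℂ) * ((|τ| + 2 + 2 : ℝ) + Y * I)‖ := by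
    filter_upwards [hs.pos] with n h2 Y
    refine le_trans ?_ (re_le_norm _)
    rw [re_one_add_mul_line]
    have : 0 ≤ ε n * (|τ| + 2 + 2) := by positivity
    linarith
  have hl2 : ∀ᶠ n in atTop, ∀ Y : ℝ, 1 ≤ ‖((|τ| + 2 + 2 : ℝ) : ℂ) + Y * I - τ' n‖ := by
    filter_upwards [hτb] with n h1 Y
    refine le_trans ?_ (re_le_norm _)
    have : (((|τ| + 2 + 2 : ℝ) : ℂ) + Y * I - τ' n).re = |τ| + 2 + 2 - τ' n := by simp
    rw [this]
    linarith [(abs_le.1 h1).2]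
  have hs1 : ∀ᶠ n in atTop, ∀ θ, ε n ≤ ‖1 + (ε n : ℂ) * circleMap (τ' n) 1 θ‖ ∧
      ‖1 + (ε n : ℂ) * circleMap (τ' n) 1 θ‖ ≤ 2 := by
    filter_upwards [hεb, hs.pos, hτb] with n h1 h2 h3 θ
    have h4 : ‖(ε n : ℂ) * circleMap (τ' n) 1 θ‖ ≤ ε n * (|τ| + 2) := by
      rw [norm_mul, norm_real, norm_of_nonneg h2.le]
      refine mul_le_mul_of_nonneg_left ?_ h2.le
      rw [circleMap]
      refine (norm_add_le _ _).trans ?_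
      rw [norm_mul, norm_exp_ofReal_mul_I, norm_real, norm_real, norm_eq_abs, norm_eq_abs, abs_one]
      linarith
    have h5 := norm_add_le (1 : ℂ) ((ε n : ℂ) * circleMap (τ' n) 1 θ)
    have h6 := norm_sub_le (1 + (ε n : ℂ) * circleMap (τ' n) 1 θ) ((ε n : ℂ) * circleMap (τ' n) 1 θ)
    rw [add_sub_cancel_right] at h6
    rw [norm_one] at h5 h6
    constructor <;> nlinarith [abs_nonneg τ]
  have hs2 : ∀ n θ, ‖circleMap (τ' n) 1 θ - τ' n‖ = 1 := fun n θ => by simp [circleMap]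
  -- convergence of the contour integrals
  have hgm : ∀ n, Measurable (relFactor (b n) (N n) (ε n) (ε n ^ r)) := fun n => measurable_relFactor _ _ _ _
  have hne1 : ∀ Y : ℝ, -(η : ℂ) + Y * I - τ ≠ 0 := by
    intro Y h
    have := congrArg Complex.re h
    simp at this
    linarith [neg_abs_le τ]
  have hcb : ∀ᶠ n in atTop, ∀ Y, ‖relFactor (b n) (N n) (ε n) (ε n ^ r) (circlePoint (ε n) η Y)‖ ≤ 2 := by
    filter_upwards [hc1, hc2, hdist, hG, hbc, hs.pos, hs.N_pos, eventually_ge_atTop (max 1 r)] with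
      n h1 h2 h3 h4 h5 h6 h7 h8 Y
    have h9 := (norm_relFactor_le (le_of_max_le_left h8) (le_of_max_le_right h8) h7 h6 h6.ne' h5
      (h1 Y).1 (h3 _ (h2 Y))).1
    rw [h4] at h9
    refine h9.trans ?_
    have : (‖1 + (ε n : ℂ) * circlePoint (ε n) η Y‖ / ‖circlePoint (ε n) η Y - τ' n‖) ^ r ≤ 1 :=
      pow_le_one₀ (by positivity) (div_le_one_of_le₀ ((h1 Y).2.trans (h2 Y)) (norm_nonneg _))
    linarith
  have hct : ∀ Y, Tendsto (fun n => relFactor (b n) (N n) (ε n) (ε n ^ r) (circlePoint (ε n) η Y)) atTop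
      (𝓝 (((-(η : ℂ) + Y * I - τ) ^ r)⁻¹)) := by
    intro Y
    have hω := tendsto_circlePoint hs.tendsto_zero hs.pos η Y
    refine tendsto_relFactor hs hμ hbc hω (hGt hω) (hne1 Y) (hc1.mono fun n h => (h Y).1) ?_
    filter_upwards [hc2, hdist] with n h1 h2 using h2 _ (h1 Y)
  have hsb : ∀ᶠ n in atTop, ∀ θ, ‖relFactor (b n) (N n) (ε n) (ε n ^ r) (circleMap (τ' n) 1 θ)‖ ≤ 2 * 2 ^ r := by
    filter_upwards [hs1, hdist, hG, hbc, hs.pos, hs.N_pos, eventually_ge_atTop (max 1 r)] with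
      n h1 h3 h4 h5 h6 h7 h8 θ
    have h9 := (norm_relFactor_le (le_of_max_le_left h8) (le_of_max_le_right h8) h7 h6 h6.ne' h5
      (h1 θ).1 (h3 _ (hs2 n θ).ge)).1
    rw [h4, hs2, div_one] at h9
    refine h9.trans ?_
    gcongr
    exact (h1 θ).2
  have hst : ∀ θ, Tendsto (fun n => relFactor (b n) (N n) (ε n) (ε n ^ r) (circleMap (τ' n) 1 θ)) atTop
      (𝓝 (((circleMap τ 1 θ - τ) ^ r)⁻¹)) := by
    intro θ
    have hω : Tendsto (fun n => circleMap (τ' n) 1 θ) atTop (𝓝 (circleMap τ 1 θ)) := by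
      simpa only [circleMap] using hτc.add_const _
    refine tendsto_relFactor hs hμ hbc hω (hGt hω) ?_ (hs1.mono fun n h => (h θ).1) ?_
    · simp [circleMap]
    · filter_upwards [hdist] with n h2 using h2 _ (hs2 n θ).ge
  have hC := fun c₀ : ℝ => circlePart_limit (c₀ := c₀) hs.tendsto_zero hs.pos hs.cube hη0 hgm hcb hct
  have hS := fun c₀ : ℝ => smallCirclePart_limit (c₀ := c₀) hs.tendsto_zero hs.cube hτ hgm hsb hst
  refine tendsto_gap_of_parts hs hb (m := fun n => ε n ^ r) (hμ.mono fun n h => pow_ne_zero r h)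
    (κ := |τ| + 2) (by positivity)
    (L := fun n u => circlePart n (ε n) η (relFactor (b n) (N n) (ε n) (ε n ^ r)) u -
      I * smallCirclePart n (ε n) (τ' n) (relFactor (b n) (N n) (ε n) (ε n ^ r)) u)
    (p₀ := fun Y => (((|τ| + 2 + 2 : ℝ) : ℂ) + Y * I - τ) ^ r) ?_ ?_ ?_ ?_ ?_ ?_
  · filter_upwards [hb, hbc, hs.pos, hs.N_pos, hs.N_sq, hs.gamma, hβ, hεb, hτb, eventually_gt_atTop 0] with
      n h1 h2 h3 h4 h5 h6 h7 h8 h9 h10 u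
    have h11 := abs_le.1 h9
    refine leftSum_eq_circlePart_add h10 h1 h4 h5 h3 h6 (pow_ne_zero r h3.ne') (by nlinarith)
      (by nlinarith) (fun i => ?_) u
    have hNε : 0 < N n * ε n := mul_pos h4 h3
    have h12 : |b n i - outlierTarget n r (N n * rexp (τ * ε n)) i| ≤ N n * ε n / 2 := by
      refine (h2 i).trans (div_le_div_of_nonneg_left hNε.le two_pos ?_)
      have : (0 : ℝ) ≤ n := by positivity
      nlinarith
    have h13 : N n * ((η + 2) * ε n) ≤ N n * (1 / 2) := mul_le_mul_of_nonneg_left h8 h4.le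
    have h14 : -(N n * ε n * (|τ| + 1)) ≤ N n * ε n * τ' n := by nlinarith
    have h15 : 0 ≤ N n * ε n * |τ| := by positivity
    simp only [outlierTarget] at h12
    split_ifs at h12
    · left
      rw [sub_zero] at h12
      have h16 := neg_abs_le (b n i - N n * (1 + ε n * τ' n))
      have h17 := le_abs_self (b n i)
      constructor <;> nlinarith
    · right
      rw [h7] at h12
      have h16 := neg_abs_le (b n i - N n * (1 + ε n * τ' n))
      have h17 := le_abs_self (b n i)
      constructor <;> nlinarith
  · intro c
    obtain ⟨⟨D₁, h1⟩, -⟩ := hC |c|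
    obtain ⟨⟨D₂, h2⟩, -⟩ := hS |c|
    refine ⟨|D₁| * rexp ((η + (|τ| + 2)) * |c|) + D₂, ?_⟩
    filter_upwards [h1, h2] with n h1 h2 u hu
    have hu' : -|c| ≤ u := (neg_abs_le c).trans hu
    refine (norm_sub_le _ _).trans ?_
    rw [norm_mul, norm_I, one_mul, add_mul]
    refine add_le_add ((h1 u hu').trans ?_) (h2 u hu')
    calc D₁ * rexp (-η * u) ≤ |D₁| * rexp (-η * u) := by gcongr; exact le_abs_self _
      _ ≤ |D₁| * (rexp ((η + (|τ| + 2)) * |c|) * rexp ((|τ| + 2) * u)) := by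
          gcongr; exact exp_growth_le_of_decay (by positivity) c u hu
      _ = _ := by ring
  · intro u
    have h1 := ((hC 0).2 u).sub (((hS 0).2 u).const_mul I)
    refine h1.trans_eq ?_
    rw [line_airyMinus, airyMinus_eq_line r τ u (η := η) (by linarith), mul_div_cancel₀ _ hpi, sub_eq_add_neg,
      ← neg_mul, small_circle_airyMinus]
  · refine ⟨2 * (|τ| + 2 + 2 + (|τ| + 1)) ^ r, r, ?_⟩
    filter_upwards [hl1, hl2, hdist, hG, hbc, hs.pos, hs.N_pos, hεb, hτb, eventually_ge_atTop (max 1 r)] with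
      n h1 h2 h3 h4 h5 h6 h7 h8 h9 h10 Y
    have h11 := (norm_relFactor_le (le_of_max_le_left h10) (le_of_max_le_right h10) h7 h6 h6.ne' h5
      (le_trans (by nlinarith) (h1 Y)) (h3 _ (h2 Y))).2
    rw [h4] at h11
    refine h11.trans ?_
    rw [mul_assoc]
    refine mul_le_mul_of_nonneg_left ?_ two_pos.le
    rw [exp_nat_mul, ← mul_pow]
    refine pow_le_pow_left₀ (by positivity) ?_ r
    rw [div_le_iff₀ (by linarith [h1 Y])]
    have h12 : ‖((|τ| + 2 + 2 : ℝ) : ℂ) + Y * I - τ' n‖ ≤ (|τ| + 2 + 2 + (|τ| + 1)) + |Y| := by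
      refine (norm_sub_le _ _).trans ?_
      have h13 := norm_add_le ((|τ| + 2 + 2 : ℝ) : ℂ) (Y * I)
      rw [norm_mul, norm_I, mul_one, norm_real, norm_real, norm_eq_abs,
        norm_eq_abs, abs_of_nonneg (show (0 : ℝ) ≤ |τ| + 2 + 2 by positivity)] at h13
      rw [norm_real, norm_eq_abs]
      linarith
    have h13 := add_one_le_exp |Y|
    have h14 : (|τ| + 2 + 2 + (|τ| + 1)) + |Y| ≤ (|τ| + 2 + 2 + (|τ| + 1)) * rexp |Y| := by
      nlinarith [abs_nonneg τ, abs_nonneg Y]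
    have h15 : 0 ≤ (|τ| + 2 + 2 + (|τ| + 1)) * rexp |Y| := by positivity
    exact (h12.trans h14).trans (le_mul_of_one_le_right h15 (h1 Y))
  · intro Y
    have h1 := tendsto_relFactor (r := r) hs hμ hbc (tendsto_const_nhds (x := ((|τ| + 2 + 2 : ℝ) : ℂ) + Y * I))
      (hGt tendsto_const_nhds) (fun h => by
        have := congrArg Complex.re h
        simp at this
        linarith [le_abs_self τ])
      (by filter_upwards [hl1, hεb, hs.pos] with n h1 h2 h3 using le_trans (by nlinarith) (h1 Y))
      (by filter_upwards [hl2, hdist] with n h1 h2 using h2 _ (h1 Y))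
    have h2 := h1.inv₀ (inv_ne_zero (pow_ne_zero r (fun h => by
        have := congrArg Complex.re h
        simp at this
        linarith [le_abs_self τ])))
    rwa [inv_inv] at h2
  · intro v
    exact line_airyPlus r τ v (by linarith)

/-! ### The limit before the critical time -/

/-- If the relative position of the outliers stays below `1`, a single circle of radius `N(1 - 2ε)`
encloses all nodes. Near the critical point `(z - β)/(1 - β)` tends to `1`, so neither `r` nor `β`
survives in the limit. -/
theorem tendsto_gap_subcritical (r : ℕ) {N ε γ β : ℕ → ℝ} {β₀ : ℝ} (hs : IsEdgeScaling N ε γ)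
    (hN : ∀ n, 0 ≤ N n) (hβp : ∀ n, 0 < β n) (hβ : Tendsto β atTop (𝓝 β₀)) (hβ₀ : β₀ < 1) :
    IsShiftPair 2 airyFun airyFun ∧ ∀ E : Set ℝ, MeasurableSet E → BddBelow E →
      (Tendsto (fun n => (((ensembleLaw 1 0 (outlierTarget n r (N n * β n))).real (gapEvent (N n) (γ n) E) : ℝ) : ℂ)) atTop
        (𝓝 (fredholmSum(shiftKernel airyFun airyFun,E)))) := by
  have hpi : (2 * π : ℂ) ≠ 0 := mod_cast two_pi_pos.ne'
  refine tendsto_gap_of_close_nodes hs (fun n => mul_nonneg (hN n) (hβp n).le) fun b hb hbc => ?_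
  -- Here `1 - β₀ = 2d`, so eventually `1 - β ≥ 3d/2`; since `4ε ≤ d/2`, the contours keep distance
  -- `d` from the outliers.
  set d : ℝ := (1 - β₀) / 2 with hd
  have hd0 : 0 < d := by rw [hd]; linarith
  have hβb : ∀ᶠ n in atTop, β n ≤ 1 - (3 / 2) * d :=
    (hβ.eventually (gt_mem_nhds (show β₀ < 1 - (3 / 2) * d by rw [hd]; linarith))).mono fun n h => h.le
  have hsmall : ∀ (c : ℝ) {d : ℝ}, 0 < d → ∀ᶠ n in atTop, c * ε n ≤ d := by
    intro c d hd
    have : Tendsto (fun n => c * ε n) atTop (𝓝 0) := by simpa using hs.tendsto_zero.const_mul c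
    exact (this.eventually (gt_mem_nhds hd)).mono fun n h => h.le
  have hμ' : ∀ᶠ n in atTop, d ≤ 1 - β n ∧ 1 - β n ≤ 1 := by
    filter_upwards [hβb] with n h
    constructor <;> linarith [hβp n]
  have hμ : ∀ᶠ n in atTop, 1 - β n ≠ 0 := hμ'.mono fun n h => by linarith [h.1]
  have hεb : ∀ᶠ n in atTop, 4 * ε n ≤ 1 / 2 := hsmall _ (by norm_num)
  have hεd : ∀ᶠ n in atTop, 4 * ε n ≤ d / 2 := hsmall _ (by linarith)
  have hβc : Tendsto (fun n => (β n : ℂ)) atTop (𝓝 β₀) := (Complex.continuous_ofReal.tendsto β₀).comp hβ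
  have hεc : Tendsto (fun n => (ε n : ℂ)) atTop (𝓝 0) := by
    simpa [comp_def] using (Complex.continuous_ofReal.tendsto 0).comp hs.tendsto_zero
  have hβ₀' : (1 : ℂ) - β₀ ≠ 0 := by
    have : (1 - β₀ : ℝ) ≠ 0 := by linarith
    exact_mod_cast this
  have hGt : ∀ {ω : ℕ → ℂ} {ω₀ : ℂ}, Tendsto ω atTop (𝓝 ω₀) →
      Tendsto (fun n => (1 + ε n * ω n - β n) / ((1 - β n : ℝ) : ℂ)) atTop (𝓝 1) := by
    intro ω ω₀ hω
    have h1 := (((hεc.mul hω).const_add 1).sub hβc).div (hβc.const_sub 1) hβ₀'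
    rw [zero_mul, add_zero, div_self hβ₀'] at h1
    refine h1.congr fun n => ?_
    push_cast; rfl
  have hc0 : ∀ᶠ n in atTop, ∀ Y, ‖1 + (ε n : ℂ) * circlePoint (ε n) 2 Y‖ = 1 - 2 * ε n := by
    filter_upwards [hεb, hs.pos] with n h1 h2 Y
    exact norm_one_add_mul_circlePoint h2.ne' (by linarith) Y
  have hc1 : ∀ᶠ n in atTop, ∀ Y, ε n ≤ ‖1 + (ε n : ℂ) * circlePoint (ε n) 2 Y‖ := by
    filter_upwards [hc0, hεb, hs.pos] with n h1 h2 h3 Y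
    rw [h1]; linarith
  have hc2 : ∀ᶠ n in atTop, ∀ Y, d ≤ ‖1 + (ε n : ℂ) * circlePoint (ε n) 2 Y - β n‖ := by
    filter_upwards [hc0, hβb, hεd] with n h1 h2 h3 Y
    have h4 := norm_sub_norm_le (1 + (ε n : ℂ) * circlePoint (ε n) 2 Y) (β n)
    rw [h1, norm_real, norm_of_nonneg (hβp n).le] at h4
    linarith
  have hl1 : ∀ᶠ n in atTop, ∀ Y : ℝ, 1 ≤ ‖1 + (ε n : ℂ) * ((2 + 2 : ℝ) + Y * I)‖ := by
    filter_upwards [hs.pos] with n h2 Y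
    refine le_trans ?_ (re_le_norm _)
    rw [re_one_add_mul_line]
    linarith
  have hl2 : ∀ᶠ n in atTop, ∀ Y : ℝ, d ≤ ‖1 + (ε n : ℂ) * ((2 + 2 : ℝ) + Y * I) - β n‖ := by
    filter_upwards [hs.pos, hβb] with n h2 h3 Y
    refine le_trans ?_ (re_le_norm _)
    rw [Complex.sub_re, re_one_add_mul_line, ofReal_re]
    linarith
  have hdiv : ∀ᶠ n in atTop, ∀ z : ℂ, ‖z / ((1 - β n : ℝ) : ℂ)‖ = ‖z‖ / (1 - β n) := by
    filter_upwards [hμ'] with n h z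
    rw [norm_div, norm_real, norm_of_nonneg (by linarith [h.1])]
  have hgm : ∀ n, Measurable (relFactor (b n) (N n) (ε n) ((1 - β n) ^ r)) := fun n =>
    measurable_relFactor _ _ _ _
  have hcb : ∀ᶠ n in atTop, ∀ Y, ‖relFactor (b n) (N n) (ε n) ((1 - β n) ^ r) (circlePoint (ε n) 2 Y)‖ ≤
      2 * (1 / d) ^ r := by
    filter_upwards [hc0, hc1, hc2, hdiv, hbc, hs.pos, hs.N_pos, hμ', hεd, eventually_ge_atTop (max 1 r)] with
      n h0 h1 h2 h3 h5 h6 h7 h8 h9 h10 Y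
    have h11 := (norm_relFactor_le (le_of_max_le_left h10) (le_of_max_le_right h10) h7 h6
      (by have := h8.1; exact (by linarith : (0:ℝ) < 1 - β n).ne') h5 (h1 Y) ((by linarith : ε n ≤ d).trans (h2 Y))).1
    rw [h3, h0] at h11
    refine h11.trans ?_
    have : d ≤ ‖1 + (ε n : ℂ) * circlePoint (ε n) 2 Y - β n‖ / (1 - β n) :=
      (h2 Y).trans (le_div_self (norm_nonneg _) (by linarith [h8.1]) h8.2)
    have h12 : 0 ≤ 1 - 2 * ε n := by rw [← h0 Y]; exact norm_nonneg _
    have h13 : 0 ≤ (1 - 2 * ε n) / (‖1 + (ε n : ℂ) * circlePoint (ε n) 2 Y - β n‖ / (1 - β n)) :=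
      div_nonneg h12 (hd0.le.trans this)
    gcongr
    linarith
  have hct : ∀ Y, Tendsto (fun n => relFactor (b n) (N n) (ε n) ((1 - β n) ^ r) (circlePoint (ε n) 2 Y)) atTop
      (𝓝 1) := by
    intro Y
    have hω := tendsto_circlePoint hs.tendsto_zero hs.pos 2 Y
    have h1 := tendsto_relFactor (r := r) hs hμ hbc hω (hGt hω) one_ne_zero (hc1.mono fun n h => h Y)
      (by filter_upwards [hc2, hεd, hs.pos] with n h1 h2 h3 using (by linarith : ε n ≤ d).trans (h1 Y))
    rwa [one_pow, inv_one] at h1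
  have hC := fun c₀ : ℝ => circlePart_limit (c₀ := c₀) hs.tendsto_zero hs.pos hs.cube two_pos hgm hcb hct
  refine tendsto_gap_of_parts hs hb (m := fun n => (1 - β n) ^ r) (hμ.mono fun n h => pow_ne_zero r h)
    (κ := 2) two_pos.le
    (L := fun n u => circlePart n (ε n) 2 (relFactor (b n) (N n) (ε n) ((1 - β n) ^ r)) u)
    (p₀ := fun Y => 1) ?_ ?_ ?_ ?_ ?_ ?_
  · filter_upwards [hb, hbc, hs.pos, hs.N_pos, hs.N_sq, hs.gamma, hμ, hεb, hβb, hεd, eventually_gt_atTop 0] with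
      n h1 h2 h3 h4 h5 h6 h7 h8 h9 h10 h11 u
    refine leftSum_eq_circlePart h11 h1 h4 h5 h3 h6 (pow_ne_zero r h7) (by linarith) (fun i => ?_) u
    have hNε : 0 < N n * ε n := mul_pos h4 h3
    have h12 : |b n i - outlierTarget n r (N n * β n) i| ≤ N n * ε n / 2 := by
      refine (h2 i).trans (div_le_div_of_nonneg_left hNε.le two_pos ?_)
      have : (0 : ℝ) ≤ n := by positivity
      nlinarith
    have h13 : |outlierTarget n r (N n * β n) i| ≤ N n * β n := by
      have := mul_pos h4 (hβp n)
      simp only [outlierTarget]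
      split_ifs
      · simpa using this.le
      · rw [abs_of_pos this]
    have h14 := abs_add_le (b n i - outlierTarget n r (N n * β n) i) (outlierTarget n r (N n * β n) i)
    rw [sub_add_cancel] at h14
    have h15 := mul_le_mul_of_nonneg_left h9 h4.le
    have h16 := mul_le_mul_of_nonneg_left h10 h4.le
    have h17 := mul_pos h4 hd0
    linarith
  · intro c
    obtain ⟨⟨D₁, h1⟩, -⟩ := hC |c|
    refine ⟨|D₁| * rexp ((2 + 2) * |c|), ?_⟩
    filter_upwards [h1] with n h1 u hu
    refine (h1 u ((neg_abs_le c).trans hu)).trans ?_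
    calc D₁ * rexp (-2 * u) ≤ |D₁| * rexp (-2 * u) := by gcongr; exact le_abs_self _
      _ ≤ |D₁| * (rexp ((2 + 2) * |c|) * rexp (2 * u)) := by
          gcongr; exact exp_growth_le_of_decay (by positivity) c u hu
      _ = _ := by ring
  · intro u
    refine ((hC 0).2 u).trans_eq ?_
    have h1 := line_airyMinus 0 0 u 2
    have h2 := airyMinus_eq_line 0 0 u (η := 2) (by simp)
    simp only [pow_zero, inv_one, mul_one] at h1 h2 ⊢
    -- With `r = 0` there is no pole, and the circle integral of an entire function vanishes.
    have h3 : ∮ a in C(-(I * (0 : ℝ)), 1), airyPhase u a = 0 :=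
      Complex.circleIntegral_eq_zero_of_differentiable_on_off_countable zero_le_one Set.countable_empty
        (fun z _ => (hasDerivAt_airyPhase u z).continuousAt.continuousWithinAt)
        (fun z _ => (hasDerivAt_airyPhase u z).differentiableAt)
    rw [h1, airyFun_eq_airyMinus, h2, h3, add_zero, mul_div_cancel₀ _ hpi]
  · refine ⟨2 * (1 + 4 / d) ^ r, r, ?_⟩
    filter_upwards [hl1, hl2, hdiv, hbc, hs.pos, hs.N_pos, hεb, hεd, hμ', eventually_ge_atTop (max 1 r)] with
      n h1 h2 h3 h5 h6 h7 h8 h9 h10 h11 Y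
    have h12 := (norm_relFactor_le (le_of_max_le_left h11) (le_of_max_le_right h11) h7 h6
      (by have := h10.1; exact (by linarith : (0:ℝ) < 1 - β n).ne') h5 (le_trans (by linarith) (h1 Y))
      ((by linarith : ε n ≤ d).trans (h2 Y))).2
    refine h12.trans ?_
    rw [mul_assoc]
    refine mul_le_mul_of_nonneg_left ?_ two_pos.le
    rw [exp_nat_mul, ← mul_pow]
    refine pow_le_pow_left₀ (by positivity) ?_ r
    rw [div_le_iff₀ (by linarith [h1 Y])]
    have hμ0 : 0 < 1 - β n := by linarith [h10.1]
    have e : (1 + (ε n : ℂ) * ((2 + 2 : ℝ) + Y * I) - β n) / ((1 - β n : ℝ) : ℂ) =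
        1 + ((ε n / (1 - β n) : ℝ) : ℂ) * ((2 + 2 : ℝ) + Y * I) := by
      have : ((1 - β n : ℝ) : ℂ) ≠ 0 := mod_cast hμ0.ne'
      rw [div_eq_iff this]
      push_cast at this ⊢
      field_simp
      ring
    have h13 : ε n / (1 - β n) ≤ 1 / d := by
      rw [div_le_div_iff₀ hμ0 hd0]
      nlinarith [h10.1]
    have h14 : ‖((2 + 2 : ℝ) : ℂ) + Y * I‖ ≤ 4 + |Y| := by
      refine (norm_add_le _ _).trans_eq ?_
      rw [norm_mul, norm_I, mul_one, norm_real, norm_real, norm_eq_abs, norm_eq_abs]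
      norm_num
    have h15 : 4 + |Y| ≤ 4 * rexp |Y| := by nlinarith [add_one_le_exp |Y|, abs_nonneg Y]
    have h16 : ‖(1 + (ε n : ℂ) * ((2 + 2 : ℝ) + Y * I) - β n) / ((1 - β n : ℝ) : ℂ)‖ ≤
        1 + 1 / d * (4 * rexp |Y|) := by
      rw [e]
      refine (norm_add_le _ _).trans ?_
      rw [norm_one, norm_mul, norm_real, norm_of_nonneg (by positivity)]
      gcongr
      exact h14.trans h15
    have h17 : 1 + 1 / d * (4 * rexp |Y|) ≤ (1 + 4 / d) * rexp |Y| := by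
      have := Real.one_le_exp (abs_nonneg Y)
      have e2 : 1 / d * (4 * rexp |Y|) = 4 / d * rexp |Y| := by ring
      rw [e2]; linarith
    have h18 : 0 ≤ (1 + 4 / d) * rexp |Y| := by positivity
    exact (h16.trans h17).trans (le_mul_of_one_le_right h18 (h1 Y))
  · intro Y
    have h1 := tendsto_relFactor (r := r) hs hμ hbc (tendsto_const_nhds (x := ((2 + 2 : ℝ) : ℂ) + Y * I))
      (hGt tendsto_const_nhds) one_ne_zero
      (by filter_upwards [hl1, hεb] with n h1 h2 using le_trans (by linarith) (h1 Y))
      (by filter_upwards [hl2, hεd, hs.pos] with n h1 h2 h3 using (by linarith : ε n ≤ d).trans (h1 Y))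
    have h2 := h1.inv₀ (inv_ne_zero (pow_ne_zero r one_ne_zero))
    rwa [inv_inv, one_pow] at h2
  · intro v
    have h := line_airyPlus 0 0 v (η := 2 + 2) (by norm_num)
    rw [airyFun_eq_airyPlus, ← h]
    simp

/-! ### Back to the Brownian bridges -/

theorem IsShiftPair.hasFredholmDet {κ : ℝ} {φ ψ : ℝ → ℂ} (h : IsShiftPair κ φ ψ) {E : Set ℝ}
    (hE : MeasurableSet E) (hEb : BddBelow E) :
    HasFredholmDet (shiftKernel φ ψ) E (fredholmSum(shiftKernel φ ψ,E)) := by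
  obtain ⟨c, hc⟩ := hEb
  obtain ⟨C, hC⟩ := h.left_le c
  obtain ⟨C', hC'⟩ := h.right_le c
  exact (tendsto_fredholm_tilt (l := (atTop : Filter ℕ)) (Φ := fun _ => φ) (Ψ := fun _ => ψ)
    (fun _ => h.left_measurable) (fun _ => h.right_measurable) h.left_measurable h.right_measurable
    (.of_forall fun _ => hC) (.of_forall fun _ => hC')
    (fun _ _ => tendsto_const_nhds) (fun _ _ => tendsto_const_nhds) hE (fun x hx => hc hx)).1

/-- The Fredholm sum is real because it is a limit of probabilities. -/
theorem IsShiftPair.exists_real {κ : ℝ} {φ ψ : ℝ → ℂ} (h : IsShiftPair κ φ ψ) {E : Set ℝ}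
    (hE : MeasurableSet E) (hEb : BddBelow E) {p : ℕ → ℝ}
    (hp : Tendsto (fun n => (p n : ℂ)) atTop (𝓝 (fredholmSum(shiftKernel φ ψ,E)))) :
    ∃ d : ℝ, HasFredholmDet (shiftKernel φ ψ) E d ∧ Tendsto p atTop (𝓝 d) := by
  set D := fredholmSum(shiftKernel φ ψ,E) with hD
  have h1 : Tendsto p atTop (𝓝 D.re) := (continuous_re.tendsto D).comp hp
  have h2 : D = (D.re : ℂ) := tendsto_nhds_unique hp ((Complex.continuous_ofReal.tendsto _).comp h1)
  exact ⟨D.re, h2 ▸ h.hasFredholmDet hE hEb, h1⟩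

theorem smul_outlierTarget (n r : ℕ) (c a : ℝ) : c • outlierTarget n r a = outlierTarget n r (c * a) := by
  ext j
  simp only [Pi.smul_apply, outlierTarget, smul_eq_mul]
  split_ifs <;> simp

theorem sqrt_clock_mul (s : ℝ) : √(clock s * (1 - clock s)) = 1 / (2 * Real.cosh s) := by
  have h : clock s * (1 - clock s) = (1 / (2 * Real.cosh s)) ^ 2 := by
    have h1 : rexp (-2 * s) = rexp (-s) ^ 2 := by rw [← exp_nat_mul]; congr 1; push_cast; ring
    have h2 : rexp s * rexp (-s) = 1 := by rw [← exp_add]; simp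
    have h3 := exp_pos (-s)
    have h4 : rexp s = 1 / rexp (-s) := by rw [eq_div_iff h3.ne', h2]
    rw [clock, Real.cosh_eq, h1, h4]
    field_simp
    ring
  rw [h, Real.sqrt_sq (by have := Real.cosh_pos s; positivity)]

/-- The relation that locates the transition: after normalizing the variance, the outliers sit at
the edge `√(2n)` times `e^{s - τ₀}`, hence below, at or above it according to the sign of `s - τ₀`.
-/
theorem sqrt_clock_smul_target (n r : ℕ) (τ₀ s : ℝ) : √(clock s * (1 - clock s)) •
      ((2 / (1 - clock s)) • outlierTarget n r (rexp (-τ₀) * √(n / 2))) =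
    outlierTarget n r (√(2 * n) * rexp (s - τ₀)) := by
  rw [smul_outlierTarget, smul_outlierTarget, sqrt_clock_mul]
  congr 1
  have h1 : rexp (-2 * s) = rexp (-s) ^ 2 := by rw [← exp_nat_mul]; congr 1; push_cast; ring
  have h3 := exp_pos (-s)
  have h4 : rexp s = 1 / rexp (-s) := by rw [Real.exp_neg]; field_simp
  have h5 : √(2 * n) = 2 * √(n / 2) := by
    rw [show (2 * n : ℝ) = 2 ^ 2 * (n / 2) by ring, Real.sqrt_mul (by norm_num), Real.sqrt_sq (by norm_num)]
  have h6 : 1 - clock s = rexp (-s) ^ 2 / (1 + rexp (-s) ^ 2) := by rw [clock, h1]; field_simp; ring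
  rw [h5, h6, Real.cosh_eq, sub_eq_add_neg, exp_add, h4]
  field_simp

theorem gap_edgeWindow_eq (hn : 0 < n) (r : ℕ) (τ₀ s : ℝ) {E : Set ℝ} (hE : MeasurableSet E) :
    (ensembleLaw (clock s * (1 - clock s)) 0 ((2 / (1 - clock s)) • outlierTarget n r (rexp (-τ₀) * √(n / 2)))).real
        {x | ∀ j, x j ∈ edgeWindow n s Eᶜ} =
    (ensembleLaw 1 0 (outlierTarget n r (√(2 * n) * rexp (s - τ₀)))).real
      (gapEvent (√(2 * n)) (1 / (√2 * (n : ℝ) ^ (1 / 6 : ℝ))) E) := by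
  have hn' : (0 : ℝ) < n := mod_cast hn
  set γ := 1 / (√2 * (n : ℝ) ^ (1 / 6 : ℝ)) with hγ
  have hγ0 : γ ≠ 0 := by positivity
  have hc := Real.cosh_pos s
  have hw : ∀ y, y ∈ edgeWindow n s Eᶜ ↔
      2 * Real.cosh s * y ∈ (fun ξ : ℝ => √(2 * n) + γ * ξ) '' Eᶜ := by
    intro y
    simp only [edgeWindow, Set.mem_image]
    refine exists_congr fun ξ => and_congr_right fun _ => ?_
    rw [div_eq_iff (by positivity), hγ, mul_comm y, div_eq_inv_mul, inv_eq_one_div (√2 * _)]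
  have hS := measurableSet_forall_mem_image (n := n) (√(2 * n)) hγ0 hE
  have hS' : MeasurableSet {x : Fin n → ℝ | ∀ j, x j ∈ edgeWindow n s Eᶜ} := by
    have := (measurable_const_smul (α := Fin n → ℝ) (2 * Real.cosh s)) hS
    convert this using 1
    ext x
    exact forall_congr' fun j => hw _
  rw [ensembleLaw_real_scale (mul_pos (clock_pos s) (sub_pos.2 (clock_lt_one s))) _ _ hS', smul_zero,
    sqrt_clock_smul_target]
  congr 1
  ext x
  refine forall_congr' fun j => (hw _).trans ?_
  rw [sqrt_clock_mul, Pi.smul_apply, smul_eq_mul]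
  congr! 1
  field_simp

theorem bridgeLaw_eq_ensembleLaw {r : ℕ} {τ₀ : ℝ} {ℙ : (n : ℕ) → ℝ → Measure (Fin n → ℝ)}
    (hP : ∀ n : ℕ, r ≤ n → ∀ t ∈ Ioo (0 : ℝ) 1,
      IsOutlierBridgeLaw n r (rexp (-τ₀) * √(n / 2)) t (ℙ n t)) {n : ℕ} (hn : r ≤ n) {t : ℝ}
    (ht : t ∈ Ioo (0 : ℝ) 1) :
    ℙ n t = ensembleLaw (t * (1 - t)) 0 ((2 / (1 - t)) • outlierTarget n r (rexp (-τ₀) * √(n / 2))) :=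
  (hP n hn t ht).eq (by positivity) (isOutlierBridgeLaw_ensembleLaw n r _ ht)

/-- The relative position is `exp (σ - τ₀ + τ ε)`. It tends to a number below `1` when `σ < τ₀` and
equals `exp (τ ε)` when `σ = τ₀`, which are the hypotheses of the two limit theorems. -/
theorem tendsto_gap_edgeWindow {r : ℕ} {τ₀ : ℝ} {ℙ : (n : ℕ) → ℝ → Measure (Fin n → ℝ)}
    (hP : ∀ n : ℕ, r ≤ n → ∀ t ∈ Ioo (0 : ℝ) 1,
      IsOutlierBridgeLaw n r (rexp (-τ₀) * √(n / 2)) t (ℙ n t)) (σ τ : ℝ) {E : Set ℝ}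
    (hE : MeasurableSet E) (hEb : BddBelow E) :
    (σ < τ₀ → ∃ d : ℝ, HasFredholmDet airyKernel E d ∧
      Tendsto (fun n : ℕ => (ℙ n (clock (σ + τ / (n : ℝ) ^ (1 / 3 : ℝ)))).real
        {x | ∀ j, x j ∈ edgeWindow n (σ + τ / (n : ℝ) ^ (1 / 3 : ℝ)) Eᶜ}) atTop (𝓝 d)) ∧
    (σ = τ₀ → ∃ d : ℝ, HasFredholmDet (rAiryKernel r τ) E d ∧
      Tendsto (fun n : ℕ => (ℙ n (clock (σ + τ / (n : ℝ) ^ (1 / 3 : ℝ)))).real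
        {x | ∀ j, x j ∈ edgeWindow n (σ + τ / (n : ℝ) ^ (1 / 3 : ℝ)) Eᶜ}) atTop (𝓝 d)) := by
  have key : (fun n : ℕ => (ℙ n (clock (σ + τ / (n : ℝ) ^ (1 / 3 : ℝ)))).real
      {x | ∀ j, x j ∈ edgeWindow n (σ + τ / (n : ℝ) ^ (1 / 3 : ℝ)) Eᶜ}) =ᶠ[atTop] fun n : ℕ =>
      (ensembleLaw 1 0 (outlierTarget n r (√(2 * n) * rexp (σ - τ₀ + τ * (1 / (n : ℝ) ^ (1 / 3 : ℝ)))))).real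
        (gapEvent (√(2 * n)) (1 / (√2 * (n : ℝ) ^ (1 / 6 : ℝ))) E) := by
    filter_upwards [eventually_gt_atTop 0, eventually_ge_atTop r] with n h0 hr
    rw [bridgeLaw_eq_ensembleLaw hP hr ⟨clock_pos _, clock_lt_one _⟩, gap_edgeWindow_eq h0 r τ₀ _ hE,
      show σ + τ / (n : ℝ) ^ (1 / 3 : ℝ) - τ₀ = σ - τ₀ + τ * (1 / (n : ℝ) ^ (1 / 3 : ℝ)) by ring]
  constructor
  · intro hlt
    have hε := isEdgeScaling.tendsto_zero
    have hβ : Tendsto (fun n : ℕ => rexp (σ - τ₀ + τ * (1 / (n : ℝ) ^ (1 / 3 : ℝ)))) atTop (𝓝 (rexp (σ - τ₀))) := by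
      have := (hε.const_mul τ).const_add (σ - τ₀)
      rw [mul_zero, add_zero] at this
      exact (continuous_exp.tendsto _).comp this
    obtain ⟨h1, h2⟩ := tendsto_gap_subcritical r isEdgeScaling (fun n => sqrt_nonneg _)
      (fun n => exp_pos _) hβ (Real.exp_lt_one_iff.2 (by linarith))
    obtain ⟨d, h3, h4⟩ := h1.exists_real hE hEb (h2 E hE hEb)
    refine ⟨d, ?_, h4.congr' key.symm⟩
    rwa [show airyKernel = shiftKernel airyFun airyFun by
      rw [airyKernel_eq_rAiryKernel, rAiryKernel_eq_shiftKernel, ← funext airyFun_eq_airyPlus,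
        ← funext airyFun_eq_airyMinus]]
  · rintro rfl
    obtain ⟨h1, h2⟩ := tendsto_gap_critical r τ isEdgeScaling (fun n => sqrt_nonneg _)
    obtain ⟨d, h3, h4⟩ := h1.exists_real hE hEb (h2 E hE hEb)
    refine ⟨d, rAiryKernel_eq_shiftKernel r τ ▸ h3, h4.congr' ?_⟩
    filter_upwards [key] with n h
    rw [h, sub_self, zero_add]

/-! ### Positivity for the Hermite ensemble -/

open scoped ComplexOrder

/-- The Hankel matrix of the moments of `g` against the Gaussian weight. -/
noncomputable def gaussMoment (n : ℕ) (g : ℝ → ℂ) : Matrix (Fin n) (Fin n) ℂ :=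
  of fun i j => ∫ x : ℝ, g x * ((x : ℂ) ^ (i : ℕ) * ((x : ℂ) ^ (j : ℕ) * cexp (-(x : ℂ) ^ 2)))

theorem integrable_gaussMoment {g : ℝ → ℂ} (hg : Measurable g) {M : ℝ} (hM : ∀ x, ‖g x‖ ≤ M) (i j : ℕ) :
    Integrable fun x : ℝ => g x * ((x : ℂ) ^ i * ((x : ℂ) ^ j * cexp (-(x : ℂ) ^ 2))) := by
  have h := integrable_poly_gauss_exp (Polynomial.X ^ (i + j)) 0
  simp only [eval_pow, eval_X, zero_mul, Complex.exp_zero, mul_one] at h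
  simp only [pow_add, mul_assoc] at h
  exact h.bdd_mul hg.aestronglyMeasurable (Eventually.of_forall hM)

/-- Without sources both determinants in the density are Vandermonde determinants, and Andréief with
monomials gives Hankel matrices. Unlike the biorthogonal matrices these are Hermitian for real `g`.
-/
theorem integral_prod_hermite : (gaussMoment n fun _ => 1).det ≠ 0 ∧
    ∀ {g : ℝ → ℂ}, Measurable g → ∀ {M : ℝ}, (∀ x, ‖g x‖ ≤ M) → ∫ x, ∏ i, g (x i) ∂ensembleLaw 1 0 (0 : Fin n → ℝ) =
        (gaussMoment n g).det / (gaussMoment n fun _ => 1).det := by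
  set v := (vandermonde fun i : Fin n => ((i : ℕ) : ℝ)).det with hv
  have hv0 : 0 < v := det_vandermonde_pos (natCast_mem_weylChamber n)
  have key : ∀ {g : ℝ → ℂ}, Measurable g → ∀ {M : ℝ}, (∀ x, ‖g x‖ ≤ M) → (gaussMoment n g).det =
      (v ^ 2 : ℝ) * ∫ x in weylChamber n, (∏ i, g (x i)) * (ensembleDensity 1 0 (0 : Fin n → ℝ) x : ℂ) := by
    intro g hg M hM
    have h := integral_det_mul_det (n := n) (fun i x => g x * (x : ℂ) ^ (i : ℕ))
      (fun j x => (x : ℂ) ^ (j : ℕ) * cexp (-(x : ℂ) ^ 2)) (fun i j => by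
        simpa only [mul_assoc] using integrable_gaussMoment hg hM i j)
    simp only [mul_assoc] at h
    rw [gaussMoment, ← h, ← integral_const_mul]
    refine integral_congr_ae (.of_forall fun x => ?_)
    beta_reduce
    have e1 := det_mul_column (fun i => g (x i)) (of fun i j : Fin n => ((x i : ℝ) : ℂ) ^ (j : ℕ))
    have e2 := det_mul_column (fun i => cexp (-((x i : ℝ) : ℂ) ^ 2)) (of fun i j : Fin n => ((x i : ℝ) : ℂ) ^ (j : ℕ))
    simp only [of_apply] at e1 e2
    simp only [mul_comm (((x _ : ℝ) : ℂ) ^ _) (cexp _)]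
    rw [e1, e2]
    have e3 : (of fun i j : Fin n => ((x i : ℝ) : ℂ) ^ (j : ℕ)).det = ((v * confluentDet n 0 x : ℝ) : ℂ) := by
      rw [confluentDet_zero_mul, det_vandermonde]
      have := det_vandermonde fun i => ((x i : ℝ) : ℂ)
      rw [vandermonde] at this
      rw [this]
      push_cast
      rfl
    rw [e3, ensembleDensity, ← Complex.exp_sum, sum_neg_distrib]
    push_cast
    rw [div_one]
    ring
  have hm : ∫ x in weylChamber n, (ensembleDensity 1 0 (0 : Fin n → ℝ) x : ℂ) =
    (ensembleMass 1 0 (0 : Fin n → ℝ) : ℂ) := integral_ofReal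
  have hm0 : (ensembleMass 1 0 (0 : Fin n → ℝ) : ℂ) ≠ 0 := by exact_mod_cast (ensembleMass_pos one_pos 0 _).ne'
  have hv2 : ((v ^ 2 : ℝ) : ℂ) ≠ 0 := mod_cast (pow_pos hv0 2).ne'
  have h1 := key (g := fun _ => 1) measurable_const (M := 1) (by simp)
  simp only [Finset.prod_const_one, one_mul] at h1
  rw [hm] at h1
  refine ⟨h1 ▸ mul_ne_zero hv2 hm0, fun {g} hg {M} hM => ?_⟩
  rw [key hg hM, h1, mul_div_mul_left _ _ hv2]
  exact integral_ensembleLaw one_pos 0 0 _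

theorem posSemidef_gaussMoment {S : Set ℝ} (hS : MeasurableSet S) :
    (gaussMoment n (S.indicator fun _ => 1)).PosSemidef := by
  have hm : Measurable (S.indicator fun _ => (1 : ℂ)) := measurable_const.indicator hS
  have hb : ∀ x, ‖S.indicator (fun _ => (1 : ℂ)) x‖ ≤ 1 := fun x => by
    by_cases hx : x ∈ S <;> simp [hx]
  have hstar : ∀ x, star (S.indicator (fun _ => (1 : ℂ)) x) = S.indicator (fun _ => (1 : ℂ)) x := fun x => by
    by_cases hx : x ∈ S <;> simp [hx]
  refine Matrix.PosSemidef.of_dotProduct_mulVec_nonneg ?_ fun v => ?_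
  · ext i j
    rw [Matrix.conjTranspose_apply]
    simp only [gaussMoment, of_apply]
    rw [Complex.star_def, ← integral_conj]
    refine integral_congr_ae (.of_forall fun x => ?_)
    have := hstar x
    rw [Complex.star_def] at this
    simp only [map_mul, this, map_pow, Complex.conj_ofReal, ← Complex.exp_conj, map_neg]
    ring
  · have e : star v ⬝ᵥ (gaussMoment n (S.indicator fun _ => 1)).mulVec v =
        ∫ x : ℝ, ((S.indicator (fun _ => 1) x * (‖∑ i, v i * (x : ℂ) ^ (i : ℕ)‖ ^ 2 * rexp (-x ^ 2)) : ℝ) : ℂ) := by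
      simp only [dotProduct, Matrix.mulVec, gaussMoment, of_apply, mul_sum, Pi.star_apply,
        ← integral_const_mul, ← integral_mul_const]
      have hint : ∀ i j : Fin n, Integrable fun x : ℝ => star (v i) *
          (S.indicator (fun _ => 1) x * ((x : ℂ) ^ (i : ℕ) * ((x : ℂ) ^ (j : ℕ) * cexp (-(x : ℂ) ^ 2))) * v j) :=
        fun i j => ((integrable_gaussMoment hm hb i j).mul_const _).const_mul _
      simp only [← integral_finsetSum _ fun j _ => hint _ j]
      rw [← integral_finsetSum _ fun i _ => integrable_finsetSum _ fun j _ => hint i j]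
      refine integral_congr_ae (.of_forall fun x => ?_)
      beta_reduce
      push_cast
      rw [← Complex.mul_conj', map_sum, Finset.sum_mul_sum, Finset.sum_comm, Finset.sum_mul, mul_sum]
      refine sum_congr rfl fun i _ => ?_
      rw [Finset.sum_mul, mul_sum]
      refine sum_congr rfl fun j _ => ?_
      have : ((S.indicator (fun _ => (1 : ℝ)) x : ℝ) : ℂ) = S.indicator (fun _ => 1) x := by
        by_cases hx : x ∈ S <;> simp [hx]
      rw [this]
      simp only [map_mul, map_pow, Complex.conj_ofReal, Complex.star_def]
      ring
    rw [e, integral_complex_ofReal]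
    refine Complex.zero_le_real.2 (integral_nonneg fun x => mul_nonneg ?_ (by positivity))
    exact indicator_nonneg (fun _ _ => zero_le_one) x

/-- For the Hermite ensemble the gap probability is at most the exponential of minus the mean number
of particles. -/
theorem gap_le_exp_neg_mean (n : ℕ) {F : Set ℝ} (hF : MeasurableSet F) :
    (ensembleLaw 1 0 (0 : Fin n → ℝ)).real {x | ∀ j, x j ∉ F} ≤
      rexp (-∫ x, ∑ j, F.indicator (fun _ => (1 : ℝ)) (x j) ∂ensembleLaw 1 0 (0 : Fin n → ℝ)) := by
  have := isProbabilityMeasure_ensembleLaw one_pos 0 (0 : Fin n → ℝ)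
  obtain ⟨hG0, hprod⟩ := integral_prod_hermite (n := n)
  set f : ℝ → ℂ := F.indicator fun _ => 1 with hf
  have hfm : Measurable f := measurable_const.indicator hF
  have hfb : ∀ x, ‖f x‖ ≤ 1 := fun x => by by_cases hx : x ∈ F <;> simp [hf, hx]
  have h1 := posSemidef_gaussMoment (n := n) MeasurableSet.univ
  rw [Set.indicator_univ] at h1
  have h2 := posSemidef_gaussMoment (n := n) hF.compl
  -- Conjugation by the inverse of a factor `B` of the Gram matrix keeps all determinants of ratios
  -- and makes `1 - G` the conjugate of the moment matrix of the complement of `F`, hence positive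
  -- semidefinite.
  obtain ⟨B, hB⟩ : ∃ B : Matrix (Fin n) (Fin n) ℂ, gaussMoment n (fun _ => 1) = B.conjTranspose * B := by
    open scoped MatrixOrder in exact CStarAlgebra.nonneg_iff_eq_star_mul_self.1 h1.nonneg
  have hdet : B.det ≠ 0 := fun h => hG0 (by rw [hB, det_mul, h, mul_zero])
  have hBu : IsUnit B.det := hdet.isUnit
  have hBu' : IsUnit B.conjTranspose.det := by rw [Matrix.det_conjTranspose]; exact hBu.star
  set G := (B⁻¹).conjTranspose * gaussMoment n f * B⁻¹ with hG
  have hinv : (B⁻¹).conjTranspose = B.conjTranspose⁻¹ := Matrix.conjTranspose_nonsing_inv B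
  have hadd : ∀ z : ℂ, gaussMoment n (fun x => 1 + z * f x) = gaussMoment n (fun _ => 1) + z • gaussMoment n f := by
    intro z
    ext i j
    simp only [gaussMoment, of_apply, Matrix.add_apply, Matrix.smul_apply, smul_eq_mul, add_mul, mul_assoc]
    rw [integral_add (integrable_gaussMoment (g := fun _ => 1) measurable_const (M := 1) (by simp) i j)
      ((integrable_gaussMoment hfm hfb i j).const_mul z)]
    exact congrArg _ (integral_const_mul _ _)
  have hconj : ∀ z : ℂ, 1 + z • G = (B⁻¹).conjTranspose * gaussMoment n (fun x => 1 + z * f x) * B⁻¹ := by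
    intro z
    rw [hadd, hB, Matrix.mul_add, Matrix.add_mul, hinv, ← Matrix.mul_assoc, Matrix.nonsing_inv_mul _ hBu',
      Matrix.one_mul, Matrix.mul_nonsing_inv _ hBu, hG, hinv, Matrix.mul_smul, Matrix.smul_mul]
  have hz : ∀ z : ℂ, ∫ x, ∏ i, (1 + z * f (x i)) ∂ensembleLaw 1 0 (0 : Fin n → ℝ) = (1 + z • G).det := by
    intro z
    rw [hprod (g := fun x => 1 + z * f x) (by fun_prop) (M := 1 + ‖z‖) (fun x => (norm_add_le _ _).trans (by
        rw [norm_one, norm_mul]; gcongr; exact mul_le_of_le_one_right (norm_nonneg _) (hfb x))),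
      hconj, det_mul, det_mul, hB, det_mul, hinv, Matrix.det_nonsing_inv,
      Matrix.det_nonsing_inv]
    simp only [Ring.inverse_eq_inv']
    have := hBu'.ne_zero
    field_simp
  have htr := integral_sum_eq_of_prod hfm hfb hz
  set T := ∫ x, ∑ j, F.indicator (fun _ => (1 : ℝ)) (x j) ∂ensembleLaw 1 0 (0 : Fin n → ℝ) with hT
  have hofR : ∀ x, f x = ((F.indicator (fun _ => (1 : ℝ)) x : ℝ) : ℂ) := fun x => by
    by_cases hx : x ∈ F <;> simp [hf, hx]
  have htr' : G.trace = (T : ℂ) := by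
    rw [← htr, hT, ← integral_complex_ofReal]
    push_cast
    simp only [hofR]
  have hgap : (((ensembleLaw 1 0 (0 : Fin n → ℝ)).real {x | ∀ j, x j ∉ F} : ℝ) : ℂ) = (1 + (-1 : ℂ) • G).det := by
    rw [← hz]
    have hms : MeasurableSet {x : Fin n → ℝ | ∀ j, x j ∉ F} := by
      simp only [Set.ofPred_forall]
      exact MeasurableSet.iInter fun j => (measurable_pi_apply j hF.compl : MeasurableSet ((fun x : Fin n → ℝ => x j) ⁻¹' Fᶜ))
    rw [← integral_indicator_one hms, ← integral_complex_ofReal]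
    refine integral_congr_ae (.of_forall fun x => ?_)
    beta_reduce
    by_cases hx : x ∈ {x : Fin n → ℝ | ∀ j, x j ∉ F}
    · rw [indicator_of_mem hx, Finset.prod_eq_one fun j _ => ?_]
      · simp
      · simp [hf, indicator_of_notMem (hx j)]
    · rw [indicator_of_notMem hx]
      obtain ⟨j, hj⟩ := not_forall.1 hx
      rw [Finset.prod_eq_zero (mem_univ j)]
      · simp
      · simp [hf, indicator_of_mem (not_not.1 hj)]
  have hcompl : (fun x => 1 + (-1 : ℂ) * f x) = Fᶜ.indicator fun _ => 1 := by
    ext x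
    by_cases hx : x ∈ F <;> simp [hf, hx]
  have hC : (1 + (-1 : ℂ) • G).PosSemidef := by
    rw [hconj, hcompl]
    exact h2.conjTranspose_mul_mul_same _
  -- The trace of `1 - G` is `n - T`, where `T` is the mean number of particles in `F`, so the
  -- determinant is at most `(1 - T/n)^n`.
  have h3 := hC.det_re_le
  rw [← hgap, ofReal_re, Matrix.trace_add, Matrix.trace_smul, htr', Matrix.trace_one] at h3
  have h4 : ((Fintype.card (Fin n) : ℂ) + (-1 : ℂ) • (T : ℂ)).re = n - T := by simp [sub_eq_add_neg]
  rw [h4] at h3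
  rcases Nat.eq_zero_or_pos n with rfl | hn
  · simpa [hT] using h3
  have hn' : (0 : ℝ) < n := mod_cast hn
  have h5 : T ≤ n := by
    have h6 : T ≤ ∫ _x, (n : ℝ) ∂ensembleLaw 1 0 (0 : Fin n → ℝ) := by
      refine integral_mono_of_nonneg (.of_forall fun x => Finset.sum_nonneg fun j _ =>
        indicator_nonneg (fun _ _ => zero_le_one) _) (integrable_const _) (.of_forall fun x => ?_)
      refine (Finset.sum_le_card_nsmul Finset.univ _ 1 fun j _ => ?_).trans (by simp)
      exact Set.indicator_le_self' (fun _ _ => zero_le_one) _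
    simpa using h6
  refine h3.trans ?_
  rw [sub_div, div_self hn'.ne']
  exact Real.one_sub_div_pow_le_exp_neg h5

/-! ### Interlacing and stochastic comparison -/

theorem integrable_poly_weight (p : Polynomial ℝ) (β : ℝ) :
    Integrable fun x : ℝ => p.eval x * rexp (-x ^ 2 + β * x) := by
  refine (integrable_poly_gauss_exp (p.map Complex.ofRealHom) β).re.congr (.of_forall fun x => ?_)
  have h : (p.map Complex.ofRealHom).eval (x : ℂ) * cexp (-(x : ℂ) ^ 2) * cexp (β * x) =
      ((p.eval x * rexp (-x ^ 2 + β * x) : ℝ) : ℂ) := by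
    rw [Polynomial.eval_map, mul_assoc, ← Complex.exp_add]
    have := Polynomial.eval₂_at_apply (p := p) Complex.ofRealHom x
    rw [Complex.ofRealHom_eq_coe] at this
    rw [this]
    push_cast
    rfl
  beta_reduce
  rw [h]
  exact ofReal_re _

/-- The monic orthogonal-type basis for which `p_{j+1} w` is a multiple of the derivative of `x^j w`,
where `w(x) = exp (-x² + βx)`. -/
noncomputable def weightPoly (β : ℝ) : ℕ → Polynomial ℝ
  | 0 => 1
  | j + 1 => Polynomial.X ^ j * (Polynomial.X - Polynomial.C (β / 2)) -
      Polynomial.C (1 / 2) * Polynomial.derivative (Polynomial.X ^ j)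

theorem weightPoly_monic (β : ℝ) (j : ℕ) : (weightPoly β j).Monic ∧ (weightPoly β j).natDegree = j := by
  cases j with
  | zero => exact ⟨Polynomial.monic_one, Polynomial.natDegree_one⟩
  | succ j =>
    have h1 : (Polynomial.X ^ j * (Polynomial.X - Polynomial.C (β / 2))).Monic :=
      (Polynomial.monic_X_pow j).mul (Polynomial.monic_X_sub_C _)
    have h2 : (Polynomial.X ^ j * (Polynomial.X - Polynomial.C (β / 2))).natDegree = j + 1 := by
      rw [(Polynomial.monic_X_pow j).natDegree_mul (Polynomial.monic_X_sub_C _),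
        Polynomial.natDegree_X_pow, Polynomial.natDegree_X_sub_C]
    have h3 : (Polynomial.C (1 / 2 : ℝ) * Polynomial.derivative (Polynomial.X ^ j)).natDegree < j + 1 := by
      refine Nat.lt_succ_of_le ((Polynomial.natDegree_C_mul_le _ _).trans
        ((Polynomial.natDegree_derivative_le _).trans ?_))
      rw [Polynomial.natDegree_X_pow]; omega
    refine ⟨h1.sub_of_left ?_, ?_⟩
    · exact Polynomial.degree_lt_degree (by rwa [h2])
    · rw [weightPoly, Polynomial.natDegree_sub_eq_left_of_natDegree_lt (by rwa [h2]), h2]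

theorem hasDerivAt_pow_weight (β : ℝ) (j : ℕ) (x : ℝ) :
    HasDerivAt (fun x : ℝ => -(1 / 2) * (x ^ j * rexp (-x ^ 2 + β * x)))
      ((weightPoly β (j + 1)).eval x * rexp (-x ^ 2 + β * x)) x := by
  have h1 : HasDerivAt (fun x : ℝ => rexp (-x ^ 2 + β * x)) (rexp (-x ^ 2 + β * x) * (-(2 * x) + β)) x := by
    have := (((hasDerivAt_id x).pow 2).neg.add ((hasDerivAt_id x).const_mul β)).exp
    refine this.congr_deriv ?_
    simp
  refine (((hasDerivAt_pow j x).mul h1).const_mul _).congr_deriv ?_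
  simp only [weightPoly, Polynomial.derivative_X_pow, Polynomial.eval_sub, eval_mul, eval_pow, eval_X, eval_C]
  ring

/-- The integrand is an exact derivative, so the half-line integral is a boundary term that is a
monomial times the weight. -/
theorem integral_weightPoly (β : ℝ) (j : ℕ) : (∫ x, (weightPoly β (j + 1)).eval x * rexp (-x ^ 2 + β * x) = 0) ∧ ∀ t,
      ∫ x in Iic t, (weightPoly β (j + 1)).eval x * rexp (-x ^ 2 + β * x) =
        -(1 / 2) * (t ^ j * rexp (-t ^ 2 + β * t)) := by
  have h1 := integrable_poly_weight (weightPoly β (j + 1)) β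
  have h2 : Integrable fun x : ℝ => -(1 / 2) * (x ^ j * rexp (-x ^ 2 + β * x)) := by
    have := integrable_poly_weight (Polynomial.X ^ j) β
    simp only [eval_pow, eval_X] at this
    exact this.const_mul _
  have hd := hasDerivAt_pow_weight β j
  refine ⟨integral_eq_zero_of_hasDerivAt_of_integrable hd h1 h2, fun t => ?_⟩
  rw [integral_Iic_of_hasDerivAt_of_tendsto (hd t).continuousAt.continuousWithinAt (fun x _ => hd x)
    h1.integrableOn (tendsto_zero_of_hasDerivAt_of_integrableOn_Iic (a := 0) (fun x _ => hd x)
      h1.integrableOn h2.integrableOn), sub_zero]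

/-- `x` and `y` interlace: `x₀ ≤ y₀ < x₁ ≤ y₁ < ⋯ < xₙ`. -/
def Interlaces (x : Fin (n + 1) → ℝ) (y : Fin n → ℝ) : Prop := ∀ k : Fin n, x k.castSucc ≤ y k ∧ y k < x k.succ

theorem Interlaces.strictMono_left {x : Fin (n + 1) → ℝ} {y : Fin n → ℝ} (h : Interlaces x y) :
    StrictMono x := Fin.strictMono_iff_lt_succ.2 fun k => (h k).1.trans_lt (h k).2

theorem Interlaces.strictMono_right {x : Fin (n + 1) → ℝ} {y : Fin n → ℝ} (h : Interlaces x y) : StrictMono y := by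
  cases n with
  | zero => exact fun i => i.elim0
  | succ n =>
    refine Fin.strictMono_iff_lt_succ.2 fun k => ?_
    have h1 := (h k.castSucc).2
    have h2 := (h k.succ).1
    rw [Fin.succ_castSucc] at h1
    exact h1.trans_le h2

theorem det_vandermonde_natCast_pos (n : ℕ) : 0 < (vandermonde fun i : Fin n => ((i : ℕ) : ℝ)).det :=
  det_vandermonde_pos (natCast_mem_weylChamber n)

/-- In the basis `weightPoly` the Vandermonde determinant of `x` is a determinant with separated
rows, and interlacing confines each `x i` to its own gap. Row operations turn integrals over gaps
into integrals over half-lines, whose boundary terms rebuild the Vandermonde determinant and weight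
of `y`. -/
theorem exists_lintegral_interlaces (n : ℕ) (β : ℝ) : ∃ c : ℝ, 0 < c ∧ ∀ y : Fin n → ℝ, StrictMono y →
    ∫⁻ x, {x : Fin (n + 1) → ℝ | Interlaces x y}.indicator
      (fun x => ENNReal.ofReal (confluentDet (n + 1) 0 x * rexp (∑ i, (-x i ^ 2 + β * x i)))) x =
    ENNReal.ofReal (c * (confluentDet n 0 y * rexp (∑ i, (-y i ^ 2 + β * y i)))) := by
  set W := ∫ x : ℝ, rexp (-x ^ 2 + β * x) with hW
  set v := fun n : ℕ => (vandermonde fun i : Fin n => ((i : ℕ) : ℝ)).det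
  have hv : ∀ n, 0 < v n := det_vandermonde_natCast_pos
  have hWi : Integrable fun x : ℝ => rexp (-x ^ 2 + β * x) := by simpa using integrable_poly_weight 1 β
  have hW0 : 0 < W := by
    refine (integral_pos_iff_support_of_nonneg (fun x => (exp_pos _).le) hWi).2 ?_
    have : (Function.support fun x : ℝ => rexp (-x ^ 2 + β * x)) = univ := by ext x; simp [(exp_pos _).ne']
    rw [this]; simp
  -- `W` is the full-line integral of the weight, each `1/2` comes from a boundary term, and `v n`,
  -- `v (n + 1)` convert between Vandermonde and confluent determinants.
  refine ⟨W / 2 ^ n * v n / v (n + 1), by have := hv n; have := hv (n + 1); positivity, fun y hy => ?_⟩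
  set J : Fin (n + 1) → Set ℝ := Fin.lastCases univ fun k => Iic (y k) with hJ
  have hJl : J (Fin.last n) = univ := by simp [hJ]
  have hJc : ∀ k : Fin n, J k.castSucc = Iic (y k) := fun k => by simp [hJ]
  have hJm : ∀ i, MeasurableSet (J i) := fun i => by
    refine Fin.lastCases ?_ (fun k => ?_) i
    · rw [hJl]; exact MeasurableSet.univ
    · rw [hJc]; exact measurableSet_Iic
  have hJs : ∀ k : Fin n, J k.castSucc ⊆ J k.succ := by
    intro k
    refine Fin.lastCases (motive := fun i => ∀ k : Fin n, k.succ = i → J k.castSucc ⊆ J i) ?_ ?_ k.succ k rfl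
    · intro k _; rw [hJl]; exact Set.subset_univ _
    · intro l k hk
      rw [hJc, hJc]
      have : k < l := by
        have := congrArg Fin.val hk
        simp at this
        exact Fin.lt_def.2 (by omega)
      exact Set.Iic_subset_Iic.2 (hy this).le
  -- The gaps are differences of the nested half-lines `J`, the last of which is the whole line.
  set I : Fin (n + 1) → Set ℝ := Fin.cons (J 0) fun k => J k.succ \ J k.castSucc with hI
  have hIm : ∀ i, MeasurableSet (I i) := fun i => by
    refine Fin.cases ?_ (fun k => ?_) i
    · exact hJm 0
    · exact (hJm _).diff (hJm _)
  have hmem : ∀ x : Fin (n + 1) → ℝ, (∀ i, x i ∈ I i) ↔ Interlaces x y := by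
    intro x
    constructor
    · intro h k
      have h1 : x k.castSucc ∈ J k.castSucc := by
        refine Fin.cases (motive := fun i => x i ∈ I i → x i ∈ J i) ?_ ?_ k.castSucc (h _)
        · exact id
        · exact fun l hl => hl.1
      have h2 : x k.succ ∉ J k.castSucc := (h k.succ).2
      rw [hJc] at h1 h2
      exact ⟨h1, not_le.1 h2⟩
    · intro h
      have h1 : ∀ i, x i ∈ J i := fun i => by
        refine Fin.lastCases ?_ (fun k => ?_) i
        · rw [hJl]; trivial
        · rw [hJc]; exact (h k).1
      refine Fin.cases (h1 0) fun k => ⟨h1 _, ?_⟩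
      rw [hJc]
      exact not_le.2 (h k).2
  set f : Fin (n + 1) → ℝ → ℝ := fun j x => (weightPoly β j).eval x * rexp (-x ^ 2 + β * x) with hf
  have hfi : ∀ j, Integrable (f j) := fun j => integrable_poly_weight _ β
  -- the determinant of the integrals over the gaps
  have hdet : (of fun i j => ∫ x, (I i).indicator (f j) x).det =
      W / 2 ^ n * ((vandermonde y).det * rexp (∑ i, (-y i ^ 2 + β * y i))) := by
    have h1 : (of fun i j => ∫ x in J i, f j x).det = (of fun i j => ∫ x, (I i).indicator (f j) x).det := by
      refine Matrix.det_eq_of_forall_row_eq_smul_add_pred (fun _ => 1) (fun j => ?_) fun k j => ?_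
      · simp only [of_apply]
        rw [integral_indicator (hIm 0)]; rfl
      · simp only [of_apply, one_mul]
        rw [integral_indicator (hIm _)]
        change _ = (∫ x in J k.succ \ J k.castSucc, f j x) + _
        have h2 : ∫ x in J k.succ \ J k.castSucc, f j x = (∫ x in J k.succ, f j x) - ∫ x in J k.castSucc, f j x :=
          setIntegral_sdiff (hJm _) (hfi j).integrableOn (hJs k)
        exact (sub_eq_iff_eq_add.1 h2.symm)
    -- In the last row the integrals run over the whole line and all but the first vanish.
    rw [← h1, Matrix.det_succ_row _ (Fin.last n), Fin.sum_univ_succ, Finset.sum_eq_zero, add_zero]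
    · simp only [of_apply, hJl, Measure.restrict_univ, Fin.val_last, Fin.val_zero, add_zero]
      have e1 : ∫ x, f 0 x = W := by simp [hf, weightPoly, hW]
      have e2 : ((of fun i j => ∫ x in J i, f j x).submatrix (Fin.last n).succAbove (Fin.succAbove 0)).det =
          (-(1 / 2)) ^ n * (rexp (∑ i, (-y i ^ 2 + β * y i)) * (vandermonde y).det) := by
        have h3 := Matrix.det_smul (of fun i j : Fin n =>
          rexp (-y i ^ 2 + β * y i) * (vandermonde y) i j) (-(1 / 2))
        rw [Fintype.card_fin, det_mul_column, ← Real.exp_sum] at h3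
        rw [← h3]
        congr 1
        ext i j
        simp only [Matrix.submatrix_apply, of_apply, Fin.succAbove_last, Fin.zero_succAbove, hJc,
          Matrix.smul_apply, Matrix.vandermonde_apply, smul_eq_mul]
        rw [show f j.succ = fun x => (weightPoly β (j + 1)).eval x * rexp (-x ^ 2 + β * x) from rfl,
          (integral_weightPoly β j).2]
        ring
      rw [e1, e2]
      have : (-1 : ℝ) ^ n * (-(1 / 2)) ^ n = (1 / 2) ^ n := by rw [← mul_pow]; norm_num
      rw [div_eq_mul_inv W, ← inv_pow, inv_eq_one_div]
      linear_combination (W * (rexp (∑ i, (-y i ^ 2 + β * y i)) * (vandermonde y).det)) * this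
    · intro j _
      simp only [of_apply, hJl, Measure.restrict_univ]
      rw [show f j.succ = fun x => (weightPoly β (j + 1)).eval x * rexp (-x ^ 2 + β * x) from rfl,
        (integral_weightPoly β j).1]
      ring
  obtain ⟨h1, h2⟩ := det_integral_eq (volume : Measure ℝ) (fun i j => (I i).indicator (f j))
    fun i j => (hfi j).indicator (hIm i)
  rw [hdet] at h2
  have h3 : ∀ x : Fin (n + 1) → ℝ, (of fun i j => (I i).indicator (f j) (x i)).det =
      v (n + 1) * {x | Interlaces x y}.indicator
        (fun x => confluentDet (n + 1) 0 x * rexp (∑ i, (-x i ^ 2 + β * x i))) x := by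
    intro x
    by_cases hx : Interlaces x y
    · rw [indicator_of_mem hx, ← mul_assoc, confluentDet_zero_mul,
        Matrix.det_eval_matrixOfPolynomials_eq_det_vandermonde x (fun j => weightPoly β j)
          (fun j => (weightPoly_monic β j).2) (fun j => (weightPoly_monic β j).1), mul_comm (Matrix.det _),
        Real.exp_sum, ← det_mul_column]
      congr 1
      ext i j
      simp only [of_apply]
      rw [indicator_of_mem ((hmem x).2 hx i), mul_comm]
    · rw [indicator_of_notMem hx, mul_zero]
      obtain ⟨i, hi⟩ := not_forall.1 (mt (hmem x).1 hx)
      exact Matrix.det_eq_zero_of_row_eq_zero i fun j => by rw [of_apply, indicator_of_notMem hi]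
  simp only [h3] at h1 h2
  have hv' := (hv (n + 1)).ne'
  rw [integral_const_mul, ← confluentDet_zero_mul] at h2
  have h4 : Integrable fun x : Fin (n + 1) → ℝ => {x | Interlaces x y}.indicator
      (fun x => confluentDet (n + 1) 0 x * rexp (∑ i, (-x i ^ 2 + β * x i))) x := by
    refine (h1.const_mul (v (n + 1))⁻¹).congr (.of_forall fun x => ?_)
    beta_reduce
    rw [inv_mul_cancel_left₀ hv']
  have h5 : ∀ x : Fin (n + 1) → ℝ, {x : Fin (n + 1) → ℝ | Interlaces x y}.indicator
      (fun x => ENNReal.ofReal (confluentDet (n + 1) 0 x * rexp (∑ i, (-x i ^ 2 + β * x i)))) x =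
      ENNReal.ofReal ({x : Fin (n + 1) → ℝ | Interlaces x y}.indicator
        (fun x => confluentDet (n + 1) 0 x * rexp (∑ i, (-x i ^ 2 + β * x i))) x) := fun x => by
    by_cases hx : Interlaces x y
    · rw [indicator_of_mem hx, indicator_of_mem hx]
    · rw [indicator_of_notMem hx, indicator_of_notMem hx, ENNReal.ofReal_zero]
  simp only [h5]
  rw [← ofReal_integral_eq_lintegral_ofReal h4 (.of_forall fun x => indicator_nonneg
    (fun x hx => mul_nonneg (confluentDet_nonneg 0 hx.strictMono_left.monotone) (exp_pos _).le) x)]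
  congr 1
  rw [volume_pi, div_mul_eq_mul_div, eq_div_iff hv', mul_comm, h2]
  ring

/-- The change of variables from the unit box to the box between consecutive coordinates of `x`. The
two descriptions of that box differ only on its boundary, a null set. -/
theorem confluentDet_succ_eq (b : Fin (n + 1) → ℝ) {x : Fin (n + 1) → ℝ} (hx : StrictMono x) :
    IntegrableOn (fun y => confluentDet n (fun i => b i.castSucc) y *
      rexp (b (Fin.last n) * (∑ i, x i - ∑ i, y i))) {y | Interlaces x y} ∧
    confluentDet (n + 1) b x = ∫ y in {y | Interlaces x y}, confluentDet n (fun i => b i.castSucc) y *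
      rexp (b (Fin.last n) * (∑ i, x i - ∑ i, y i)) := by
  set F : (Fin n → ℝ) → ℝ := fun y => confluentDet n (fun i => b i.castSucc) y *
      rexp (b (Fin.last n) * (∑ i, x i - ∑ i, y i)) with hF
  have hFc : Continuous F := (continuous_confluentDet_right _).mul (by fun_prop)
  set a : Fin n → ℝ := fun i => x i.castSucc with ha
  set d : Fin n → ℝ := fun i => x i.succ - x i.castSucc with hd
  have hd0 : ∀ i, 0 < d i := fun i => sub_pos.2 (hx i.castSucc_lt_succ)
  have hset : {y | Interlaces x y} =ᵐ[volume] Icc a fun i => x i.succ := by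
    have : {y | Interlaces x y} = univ.pi fun i => Set.Ico (a i) (x i.succ) := by
      ext y; simp [Interlaces, Set.mem_pi, ha]
    rw [this]
    exact Measure.univ_pi_Ico_ae_eq_Icc
  have hint : IntegrableOn F (Icc a fun i => x i.succ) := hFc.continuousOn.integrableOn_compact isCompact_Icc
  refine ⟨(integrableOn_congr_set_ae hset).2 hint, ?_⟩
  rw [setIntegral_congr_set hset]
  have hdet : (Matrix.diagonal d).det = ∏ i, d i := Matrix.det_diagonal
  have hp : 0 < ∏ i, d i := prod_pos fun i _ => hd0 i
  have hvol := Real.smul_map_diagonal_volume_pi (D := d) (by rw [hdet]; exact hp.ne')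
  rw [hdet, abs_of_pos hp] at hvol
  set H : (Fin n → ℝ) → ℝ := fun y => (Icc a fun i => x i.succ).indicator F (a + y) with hH
  have hHm : Measurable H := (hFc.measurable.indicator measurableSet_Icc).comp (measurable_const_add a)
  have h1 : ∫ y in Icc a fun i => x i.succ, F y = ∫ y, H y := by
    rw [← integral_indicator measurableSet_Icc, hH]
    exact (integral_add_left_eq_self _ a).symm
  have hT : ∀ u, a + Matrix.toLin' (Matrix.diagonal d) u = interlace x u := fun u => by
    ext i
    rw [Pi.add_apply, Matrix.toLin'_apply, Matrix.mulVec_diagonal, interlace, mul_comm]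
  rw [h1, ← hvol, integral_smul_measure, integral_map
    (LinearMap.continuous_of_finiteDimensional _).measurable.aemeasurable hHm.aestronglyMeasurable,
    ENNReal.toReal_ofReal hp.le, smul_eq_mul, confluentDet]
  congr 1
  rw [← integral_indicator measurableSet_Icc]
  refine integral_congr_ae (.of_forall fun u => ?_)
  simp only [hH, hT]
  have hiff : interlace x u ∈ Icc a (fun i => x i.succ) ↔ u ∈ Icc (0 : Fin n → ℝ) 1 := by
    simp only [Set.mem_Icc, Pi.le_def, ← forall_and, interlace, ha, Pi.zero_apply, Pi.one_apply]
    refine forall_congr' fun i => and_congr ?_ ?_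
    · rw [le_add_iff_nonneg_right, mul_nonneg_iff_of_pos_right (hd0 i)]
    · rw [← le_sub_iff_add_le', mul_le_iff_le_one_left (hd0 i)]
  by_cases hu : u ∈ Icc (0 : Fin n → ℝ) 1
  · rw [indicator_of_mem hu, indicator_of_mem (hiff.2 hu)]
  · rw [indicator_of_notMem hu, indicator_of_notMem (mt hiff.1 hu)]

theorem measurableSet_interlaces (n : ℕ) :
    MeasurableSet {p : (Fin (n + 1) → ℝ) × (Fin n → ℝ) | Interlaces p.1 p.2} := by
  simp only [Interlaces, Set.ofPred_forall, Set.ofPred_and]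
  exact MeasurableSet.iInter fun k => (measurableSet_le (by fun_prop) (by fun_prop)).inter
    (measurableSet_lt (by fun_prop) (by fun_prop))

/-- Removing one source lowers the largest particle stochastically. -/
theorem ensembleLaw_max_le_succ (b : Fin (n + 1) → ℝ) (X : ℝ) : (ensembleLaw 1 0 b).real {x | ∀ j, x j ≤ X} ≤
      (ensembleLaw 1 0 fun i : Fin n => b i.castSucc).real {x | ∀ j, x j ≤ X} := by
  set b' : Fin n → ℝ := fun i => b i.castSucc with hb'
  set β := b (Fin.last n) with hβ
  have hms : ∀ m, MeasurableSet {x : Fin m → ℝ | ∀ j, x j ≤ X} := fun m => by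
    simp only [Set.ofPred_forall]
    exact MeasurableSet.iInter fun j => measurableSet_le (measurable_pi_apply j) measurable_const
  obtain ⟨c, hc, hcy⟩ := exists_lintegral_interlaces n β
  -- A joint density for the two ensembles. Integrating out `y` is the recursion for `confluentDet`
  -- and gives the larger ensemble; integrating out `x` gives a multiple of the smaller one.
  set R : (Fin (n + 1) → ℝ) → (Fin n → ℝ) → ENNReal := fun x y =>
    {x : Fin (n + 1) → ℝ | Interlaces x y}.indicator
      (fun x => ENNReal.ofReal (confluentDet (n + 1) 0 x * rexp (∑ i, (-x i ^ 2 + β * x i)))) x *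
      ENNReal.ofReal (confluentDet n b' y * rexp (-(β * ∑ i, y i))) with hR
  have hRm : Measurable (Function.uncurry R) := by
    have h1 : Measurable fun p : (Fin (n + 1) → ℝ) × (Fin n → ℝ) =>
        {p : (Fin (n + 1) → ℝ) × (Fin n → ℝ) | Interlaces p.1 p.2}.indicator (fun p => ENNReal.ofReal
          (confluentDet (n + 1) 0 p.1 * rexp (∑ i, (-p.1 i ^ 2 + β * p.1 i)))) p := by
      refine Measurable.indicator ?_ (measurableSet_interlaces n)
      exact (((continuous_confluentDet_right 0).comp continuous_fst).mul (by fun_prop)).measurable.ennreal_ofReal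
    exact h1.mul ((((continuous_confluentDet_right b').comp continuous_snd).mul
      (by fun_prop)).measurable.ennreal_ofReal)
  -- the larger ensemble is a marginal of the interlacing pair
  have hx : ∀ S : Set (Fin (n + 1) → ℝ), MeasurableSet S → ensembleMeasure 1 0 b S = ∫⁻ x in S, ∫⁻ y, R x y := by
    intro S hS
    rw [ensembleMeasure, withDensity_apply _ hS, Measure.restrict_restrict hS, Set.inter_comm,
      ← Measure.restrict_restrict (measurableSet_weylChamber _),
      ← lintegral_indicator (measurableSet_weylChamber _)]
    refine lintegral_congr fun x => ?_
    by_cases hx : x ∈ weylChamber (n + 1)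
    · obtain ⟨h1, h2⟩ := confluentDet_succ_eq b hx
      have hmi : MeasurableSet {y : Fin n → ℝ | Interlaces x y} := measurable_prodMk_left (measurableSet_interlaces n)
      rw [indicator_of_mem hx, ensembleDensity, h2, mul_right_comm, ← integral_const_mul,
        ofReal_integral_eq_lintegral_ofReal (h1.const_mul _), ← lintegral_indicator hmi]
      · refine lintegral_congr fun y => ?_
        by_cases hy : Interlaces x y
        · simp only [hR]
          rw [indicator_of_mem (by exact hy), indicator_of_mem (by exact hy),
            ← ENNReal.ofReal_mul (mul_nonneg (confluentDet_nonneg 0 hx.monotone) (exp_pos _).le)]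
          congr 1
          have : rexp (-(∑ i, x i ^ 2) / 1) * rexp (β * (∑ i, x i - ∑ i, y i)) =
              rexp (∑ i, (-x i ^ 2 + β * x i)) * rexp (-(β * ∑ i, y i)) := by
            rw [← exp_add, ← exp_add, Finset.sum_add_distrib, sum_neg_distrib, ← mul_sum]
            congr 1; ring
          linear_combination (confluentDet (n + 1) 0 x * confluentDet n b' y) * this
        · simp only [hR]
          rw [indicator_of_notMem (by exact hy), indicator_of_notMem (by exact hy), zero_mul]
      · refine (ae_restrict_iff' hmi).2 (.of_forall fun y hy => ?_)
        exact mul_nonneg (mul_nonneg (confluentDet_nonneg 0 hx.monotone) (exp_pos _).le)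
          (mul_nonneg (confluentDet_nonneg _ (Interlaces.strictMono_right hy).monotone) (exp_pos _).le)
    · rw [indicator_of_notMem hx]
      refine (lintegral_eq_zero_of_ae_eq_zero (.of_forall fun y => ?_)).symm
      simp only [hR]
      rw [indicator_of_notMem (fun h : Interlaces x y => hx h.strictMono_left), zero_mul]; rfl
  -- so is the smaller one
  have hy : ∀ y, ∫⁻ x, R x y =
      (weylChamber n).indicator (fun y => ENNReal.ofReal c * ENNReal.ofReal (ensembleDensity 1 0 b' y)) y := by
    intro y
    simp only [hR]
    rw [lintegral_mul_const' _ _ ENNReal.ofReal_ne_top]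
    by_cases hy : y ∈ weylChamber n
    · rw [indicator_of_mem hy, hcy y hy, ← ENNReal.ofReal_mul (mul_nonneg hc.le
        (mul_nonneg (confluentDet_nonneg 0 hy.monotone) (exp_pos _).le)), ← ENNReal.ofReal_mul hc.le]
      congr 1
      have : rexp (∑ i, (-y i ^ 2 + β * y i)) * rexp (-(β * ∑ i, y i)) = rexp (-(∑ i, y i ^ 2) / 1) := by
        rw [← exp_add, Finset.sum_add_distrib, sum_neg_distrib, ← mul_sum]
        congr 1; ring
      rw [ensembleDensity, ← this]; ring
    · rw [indicator_of_notMem hy]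
      have : ∀ x, {x : Fin (n + 1) → ℝ | Interlaces x y}.indicator (fun x => ENNReal.ofReal
          (confluentDet (n + 1) 0 x * rexp (∑ i, (-x i ^ 2 + β * x i)))) x = 0 := fun x =>
        indicator_of_notMem (fun h : Interlaces x y => hy h.strictMono_right) _
      simp only [this, lintegral_zero, zero_mul]
  have hy' : ∀ S : Set (Fin n → ℝ), MeasurableSet S →
      ∫⁻ y in S, ∫⁻ x, R x y = ENNReal.ofReal c * ensembleMeasure 1 0 b' S := by
    intro S hS
    simp only [hy]
    rw [lintegral_indicator (measurableSet_weylChamber n), Measure.restrict_restrict (measurableSet_weylChamber n),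
      lintegral_const_mul' _ _ ENNReal.ofReal_ne_top, ensembleMeasure, withDensity_apply _ hS,
      Measure.restrict_restrict hS, Set.inter_comm]
  have hmass : ensembleMeasure 1 0 b univ = ENNReal.ofReal c * ensembleMeasure 1 0 b' univ := by
    rw [hx _ MeasurableSet.univ, ← hy' _ MeasurableSet.univ, Measure.restrict_univ, Measure.restrict_univ]
    exact lintegral_lintegral_swap hRm.aemeasurable
  -- Under interlacing every `y k` lies below `x k.succ`, so a bound on all `x` bounds all `y`.
  have hnum : ensembleMeasure 1 0 b {x | ∀ j, x j ≤ X} ≤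
      ENNReal.ofReal c * ensembleMeasure 1 0 b' {x | ∀ j, x j ≤ X} := by
    rw [hx _ (hms _), ← hy' _ (hms _), lintegral_lintegral_swap hRm.aemeasurable, ← lintegral_indicator (hms n)]
    refine lintegral_mono fun y => ?_
    by_cases h : y ∈ {x : Fin n → ℝ | ∀ j, x j ≤ X}
    · rw [indicator_of_mem h]
      exact setLIntegral_le_lintegral _ _
    · rw [indicator_of_notMem h]
      refine (setLIntegral_eq_zero (hms _) fun x hx => ?_).le
      obtain ⟨k, hk⟩ := not_forall.1 h
      simp only [hR]
      rw [indicator_of_notMem (fun h' : Interlaces x y => hk ((h' k).2.le.trans (hx k.succ))), zero_mul]; rfl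
  have hc0 : ENNReal.ofReal c ≠ 0 := (ENNReal.ofReal_pos.2 hc).ne'
  refine ENNReal.toReal_mono ?_ ?_
  · have := isProbabilityMeasure_ensembleLaw one_pos 0 b'
    exact measure_ne_top _ _
  · simp only [ensembleLaw, Measure.smul_apply, smul_eq_mul]
    rw [hmass, ENNReal.mul_inv (Or.inl hc0) (Or.inl ENNReal.ofReal_ne_top)]
    calc _ ≤ (ENNReal.ofReal c)⁻¹ * (ensembleMeasure 1 0 b' univ)⁻¹ *
          (ENNReal.ofReal c * ensembleMeasure 1 0 b' {x | ∀ j, x j ≤ X}) := by gcongr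
      _ = _ := by
        rw [mul_mul_mul_comm, ENNReal.inv_mul_cancel hc0 ENNReal.ofReal_ne_top, one_mul]

theorem ensembleLaw_outlier_max_le (n r : ℕ) (a X : ℝ) :
    (ensembleLaw 1 0 (outlierTarget (n + r) r a)).real {x | ∀ j, x j ≤ X} ≤
      (ensembleLaw 1 0 (0 : Fin n → ℝ)).real {x | ∀ j, x j ≤ X} := by
  induction r with
  | zero =>
    have : outlierTarget n 0 a = 0 := by ext j; simp [outlierTarget]
    rw [Nat.add_zero, this]
  | succ r ih =>
    refine (ensembleLaw_max_le_succ (outlierTarget (n + r + 1) (r + 1) a) X).trans (le_of_eq_of_le ?_ ih)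
    congr 2
    ext j
    simp only [outlierTarget, Fin.val_castSucc, ← add_assoc, add_lt_add_iff_right]

/-! ### Fredholm sums as functions of the window -/

/-- The tilt by `κ + 1` balances the two factors. The resulting kernel satisfies Hadamard-type
bounds and has the same diagonal and the same Fredholm terms. -/
theorem IsShiftPair.exists_kernel {κ : ℝ} {φ ψ : ℝ → ℂ} (h : IsShiftPair κ φ ψ) (c : ℝ) :
    ∃ (K : ℝ → ℝ → ℂ) (A : ℝ), 0 ≤ A ∧ (Measurable fun p : ℝ × ℝ => K p.1 p.2) ∧
      (∀ u v, c ≤ u → c ≤ v → ‖K u v‖ ≤ A * rexp (-1 * u) * rexp (-1 * v)) ∧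
      fredholmTerm (shiftKernel φ ψ) = fredholmTerm K ∧ ∀ u, K u u = shiftKernel φ ψ u u := by
  have hd : ∀ u : ℝ, cexp ((κ + 1) * u : ℝ) ≠ 0 := fun u => exp_ne_zero _
  have hnorm : ∀ x : ℝ, ‖cexp (x : ℂ)‖ = rexp x := fun x => by rw [norm_exp, ofReal_re]
  obtain ⟨C, hC⟩ := h.left_le c
  obtain ⟨C', hC'⟩ := h.right_le c
  have hΦ : ∀ u, c ≤ u → ‖cexp (-((κ + 1) * u) : ℝ) * φ u‖ ≤ max C C' * rexp (-1 * u) := by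
    intro u hu
    rw [norm_mul, hnorm]
    calc _ ≤ rexp (-((κ + 1) * u)) * (C * rexp (κ * u)) := by gcongr; exact hC u hu
      _ = C * rexp (-1 * u) := by rw [mul_left_comm, ← exp_add]; congr 2; ring
      _ ≤ _ := by gcongr; exact le_max_left _ _
  have hΨ : ∀ u, c ≤ u → ‖cexp ((κ + 1) * u : ℝ) * ψ u‖ ≤ max C C' * rexp (-1 * u) := by
    intro u hu
    rw [norm_mul, hnorm]
    calc _ ≤ rexp ((κ + 1) * u) * (C' * rexp (-(κ + 2) * u)) := by gcongr; exact hC' u hu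
      _ = C' * rexp (-1 * u) := by rw [mul_left_comm, ← exp_add]; congr 2; ring
      _ ≤ _ := by gcongr; exact le_max_right _ _
  refine ⟨_, max C C' ^ 2 / (2 * 1), by positivity,
    measurable_shiftKernel (Measurable.mul (by fun_prop) h.left_measurable)
      (Measurable.mul (by fun_prop) h.right_measurable),
    fun u v hu hv => norm_shiftKernel_le one_pos hΦ hΨ hu hv,
    funext fun E => fredholmTerm_conj hd (shiftKernel_tilt φ ψ (κ + 1)) E, fun u => ?_⟩
  rw [shiftKernel_tilt φ ψ (κ + 1), mul_right_comm, mul_inv_cancel₀ (hd u), one_mul]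
  rfl

/-- Indicators of the windows converge pointwise inside a fixed half-line on which all terms are
dominated. It yields right-continuity and the limit at `+∞`. -/
theorem IsShiftPair.tendsto_set {κ : ℝ} {φ ψ : ℝ → ℂ} (h : IsShiftPair κ φ ψ) {ι : Type*} {l : Filter ι}
    [l.IsCountablyGenerated] {c : ℝ} {E : ι → Set ℝ} {E₀ : Set ℝ} (hE : ∀ i, MeasurableSet (E i))
    (hE₀ : MeasurableSet E₀) (hE₀c : E₀ ⊆ Ici c) (hc : ∀ᶠ i in l, E i ⊆ Ici c)
    (ht : ∀ u, ∀ᶠ i in l, (u ∈ E i ↔ u ∈ E₀)) :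
    Tendsto (fun i => fredholmSum(shiftKernel φ ψ,E i)) l (𝓝 (fredholmSum(shiftKernel φ ψ,E₀))) := by
  obtain ⟨K, A, hA, hKm, hK, hterm, -⟩ := h.exists_kernel c
  rw [hterm]
  refine tendsto_tsum_of_dominated_convergence
    (summable_sqrt_pow_div_factorial (a := A * (rexp (-(2 * 1) * c) / (2 * 1))) (by positivity))
    (fun k => ?_) (hc.mono fun i hi k => (norm_fredholmTerm_le hA one_pos hKm hK (hE i) hi k).2)
  have hi := (norm_fredholmTerm_le hA one_pos hKm hK measurableSet_Ici (subset_refl (Ici c)) k).1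
  have hpi : ∀ S : Set ℝ, MeasurableSet S → MeasurableSet (univ.pi fun _ : Fin k => S) := fun S hS =>
    MeasurableSet.univ_pi fun _ => hS
  have hind : ∀ S : Set ℝ, MeasurableSet S → S ⊆ Ici c →
      ∫ u in univ.pi (fun _ : Fin k => S), (of fun i j => K (u i) (u j)).det =
      ∫ u in univ.pi (fun _ : Fin k => Ici c), (univ.pi fun _ : Fin k => S).indicator
        (fun u => (of fun i j => K (u i) (u j)).det) u := fun S hS hSc => by
    rw [setIntegral_indicator (hpi S hS), Set.inter_eq_right.2 (Set.pi_mono fun _ _ => hSc)]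
  unfold fredholmTerm
  rw [hind E₀ hE₀ hE₀c]
  refine Tendsto.const_mul _ (Tendsto.congr' (hc.mono fun i hi => (hind _ (hE i) hi).symm) ?_)
  refine tendsto_integral_filter_of_dominated_convergence _ (.of_forall fun i =>
    hi.aestronglyMeasurable.indicator (hpi _ (hE i))) (.of_forall fun i =>
      .of_forall fun u => norm_indicator_le_norm_self _ u) hi.norm (.of_forall fun u => ?_)
  refine tendsto_const_nhds.congr' ?_
  filter_upwards [eventually_all.2 fun j => ht (u j)] with i hi
  by_cases hu : u ∈ univ.pi fun _ : Fin k => E₀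
  · rw [indicator_of_mem hu, indicator_of_mem (Set.mem_univ_pi.2 fun j => (hi j).2 (hu j trivial))]
  · rw [indicator_of_notMem hu, indicator_of_notMem (fun h' : u ∈ univ.pi fun _ : Fin k => E i =>
      hu fun j _ => (hi j).1 (h' j trivial))]

theorem fredholmTerm_zero (K : ℝ → ℝ → ℂ) (E : Set ℝ) : fredholmTerm K E 0 = 1 := by
  simp [fredholmTerm, Measure.real, volume_pi_pi]

theorem tsum_fredholmTerm_empty (K : ℝ → ℝ → ℂ) : ∑' k, fredholmTerm K ∅ k = 1 := by
  rw [tsum_eq_single 0 fun k hk => ?_]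
  · exact fredholmTerm_zero K ∅
  · obtain ⟨m, rfl⟩ := Nat.exists_eq_succ_of_ne_zero hk
    simp [fredholmTerm, Set.univ_pi_empty]

theorem integral_fin_one (μ : Measure ℝ) [SigmaFinite μ] {f : ℝ → ℂ} (hf : Integrable f μ) :
    ∫ u : Fin 1 → ℝ, f (u 0) ∂(Measure.pi fun _ => μ) = ∫ x, f x ∂μ := by
  simpa using (det_integral_eq (n := 1) μ (fun _ _ => f) fun _ _ => hf).2

/-- On short intervals the Fredholm determinant is `1 - ∫ K(u, u) du` to first order. -/
theorem IsShiftPair.exists_norm_sub_le {κ : ℝ} {φ ψ : ℝ → ℂ} (h : IsShiftPair κ φ ψ) (c : ℝ) :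
    ∃ C : ℝ, ∀ a ℓ : ℝ, c ≤ a → 0 ≤ ℓ → ℓ ≤ 1 → IntegrableOn (fun u => shiftKernel φ ψ u u) (Ioc a (a + ℓ)) ∧
      ‖fredholmSum(shiftKernel φ ψ,Ioc a (a + ℓ)) - (1 - ∫ u in Ioc a (a + ℓ), shiftKernel φ ψ u u)‖ ≤ C * ℓ ^ 2 := by
  obtain ⟨K, A, hA, hKm, hK, hterm, hdiag⟩ := h.exists_kernel c
  set B := A * rexp (-2 * c) with hB
  have hB0 : 0 ≤ B := by positivity
  have hs := summable_sqrt_pow_div_factorial hB0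
  -- The constant is the part `k ≥ 2` of the Hadamard majorant; each such term carries at least
  -- `ℓ²`.
  refine ⟨∑' k : ℕ, (√(k + 2 : ℕ) * B) ^ (k + 2) / ((k + 2).factorial : ℝ), fun a ℓ ha hℓ hℓ1 => ?_⟩
  set I := Ioc a (a + ℓ) with hI
  have hIc : I ⊆ Ici c := fun u hu => ha.trans hu.1.le
  have hIm : MeasurableSet I := measurableSet_Ioc
  have hb : ∀ k : ℕ, ‖fredholmTerm K I k‖ ≤ (√k * B) ^ k / (k.factorial : ℝ) * ℓ ^ k := by
    intro k
    have h1 : ∀ u ∈ univ.pi (fun _ : Fin k => I), ‖(of fun i j => K (u i) (u j)).det‖ ≤ (√k * B) ^ k := by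
      intro u hu
      refine (norm_det_kernel_le hA hK fun i => hIc (hu i trivial)).trans ?_
      have h2 : ∏ i, rexp (-(2 * 1) * u i) ≤ rexp (-2 * c) ^ k := by
        refine (prod_le_prod (fun i _ => (exp_pos _).le) (g := fun _ => rexp (-2 * c))
          fun i _ => ?_).trans_eq (by simp)
        have := hIc (hu i trivial)
        exact exp_le_exp.2 (by have : c ≤ u i := this; linarith)
      calc _ ≤ (√k * A) ^ k * rexp (-2 * c) ^ k := by gcongr
        _ = _ := by rw [← mul_pow, mul_assoc]
    have hvol : volume (univ.pi fun _ : Fin k => I) = ENNReal.ofReal (ℓ ^ k) := by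
      rw [volume_pi_pi]
      simp [hI, Real.volume_Ioc, ENNReal.ofReal_pow hℓ]
    have h3 := norm_setIntegral_le_of_norm_le_const (by rw [hvol]; exact ENNReal.ofReal_lt_top) h1
    rw [Measure.real, hvol, ENNReal.toReal_ofReal (by positivity)] at h3
    rw [fredholmTerm, norm_mul, norm_div, norm_pow, norm_neg, norm_one, one_pow, Complex.norm_natCast]
    calc _ ≤ 1 / (k.factorial : ℝ) * ((√k * B) ^ k * ℓ ^ k) := by gcongr
      _ = _ := by ring
  have hsum : Summable (fredholmTerm K I) := by
    refine Summable.of_norm_bounded hs fun k => (hb k).trans ?_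
    exact mul_le_of_le_one_right (by positivity) (pow_le_one₀ hℓ hℓ1)
  have h1 := (norm_fredholmTerm_le hA one_pos hKm hK hIm hIc 1).1
  have hint : IntegrableOn (fun u => shiftKernel φ ψ u u) I := by
    simp only [← hdiag]
    refine IntegrableOn.of_bound (by simp [hI, Real.volume_Ioc])
      (hKm.comp (measurable_id.prodMk measurable_id)).aestronglyMeasurable B
      ((ae_restrict_iff' hIm).2 (.of_forall fun u hu => ?_))
    have hu' : c ≤ u := hIc hu
    refine (hK u u hu' hu').trans ?_
    rw [mul_assoc, ← exp_add, hB]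
    gcongr
    linarith
  refine ⟨hint, ?_⟩
  have ht1 : fredholmTerm K I 1 = -∫ u in I, shiftKernel φ ψ u u := by
    rw [← integral_fin_one _ hint]
    simp [fredholmTerm, volume_pi, Measure.restrict_pi_pi, hdiag]
  rw [hterm, ← hsum.sum_add_tsum_nat_add 2, sum_range_succ, Finset.sum_range_one, fredholmTerm_zero, ht1,
    ← sub_eq_add_neg, add_sub_cancel_left]
  have hs2 := (summable_nat_add_iff 2).2 hs
  rw [← tsum_mul_right]
  refine tsum_of_norm_bounded (hs2.mul_right (ℓ ^ 2)).hasSum fun k => (hb (k + 2)).trans ?_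
  refine mul_le_mul_of_nonneg_left ?_ (by positivity)
  rw [pow_add]
  exact mul_le_of_le_one_left (by positivity) (pow_le_one₀ hℓ hℓ1)

/-- A gap of the Hermite ensemble is at most as likely as disjoint parts of it allow. -/
theorem hermite_gap_le_exp {n m : ℕ} (α : ℝ) {γ : ℝ} (hγ : γ ≠ 0) {E : Set ℝ} (hE : MeasurableSet E)
    {I : ℕ → Set ℝ} (hI : ∀ i, MeasurableSet (I i)) (hIE : ∀ i, i < m → I i ⊆ E)
    (hd : Pairwise (Function.onFun Disjoint I)) :
    (ensembleLaw 1 0 (0 : Fin n → ℝ)).real (gapEvent α γ E) ≤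
      rexp (-∑ i ∈ Finset.range m, (1 - (ensembleLaw 1 0 (0 : Fin n → ℝ)).real (gapEvent α γ (I i)))) := by
  have := isProbabilityMeasure_ensembleLaw one_pos 0 (0 : Fin n → ℝ)
  set μ := ensembleLaw 1 0 (0 : Fin n → ℝ)
  set f : ℝ → ℝ := fun ξ => α + γ * ξ with hf
  have hfe := measurableEmbedding_affine α hγ
  have hbij : Function.Bijective f :=
    ⟨hfe.injective, fun y => ⟨(y - α) / γ, by rw [hf]; beta_reduce; rw [mul_div_cancel₀ _ hγ]; ring⟩⟩
  have hset : ∀ S : Set ℝ, gapEvent (n := n) α γ S = {x | ∀ j, x j ∉ f '' S} := fun S => by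
    rw [gapEvent, Set.image_compl_eq hbij]; rfl
  have hms : ∀ i, MeasurableSet {x : Fin n → ℝ | ∀ j, x j ∉ f '' I i} := fun i =>
    hset (I i) ▸ measurableSet_forall_mem_image α hγ (hI i)
  have hi1 : ∀ i, Integrable (fun x => 1 - {x : Fin n → ℝ | ∀ j, x j ∉ f '' I i}.indicator (fun _ => (1 : ℝ)) x) μ :=
    fun i => (integrable_const _).sub ((integrable_const _).indicator (hms i))
  simp only [hset]
  refine (gap_le_exp_neg_mean n (hfe.measurableSet_image.2 hE)).trans ?_
  rw [exp_le_exp, neg_le_neg_iff]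
  have h1 : ∀ i, 1 - μ.real {x | ∀ j, x j ∉ f '' I i} =
      ∫ x, (1 - {x : Fin n → ℝ | ∀ j, x j ∉ f '' I i}.indicator (fun _ => (1 : ℝ)) x) ∂μ := by
    intro i
    rw [integral_sub (integrable_const _) ((integrable_const _).indicator (hms i)),
      integral_indicator_const _ (hms i)]
    simp
  have hint : Integrable (fun x : Fin n → ℝ => ∑ j, (f '' E).indicator (fun _ => (1 : ℝ)) (x j)) μ := by
    refine integrable_finsetSum _ fun j _ => ?_
    refine Integrable.of_bound (C := 1) ?_ (.of_forall fun x => ?_)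
    · exact ((measurable_const.indicator (hfe.measurableSet_image.2 hE)).comp
        (measurable_pi_apply j)).aestronglyMeasurable
    · refine (norm_indicator_le_norm_self _ _).trans (by simp)
  simp only [h1]
  rw [← integral_finsetSum _ fun i _ => hi1 i]
  refine integral_mono (integrable_finsetSum _ fun i _ => hi1 i) hint fun x => ?_
  -- The event that some particle lies in a part is bounded by the number of particles there;
  -- disjointness then bounds the sum by the number in `E`.
  have h2 : ∀ i, 1 - {x : Fin n → ℝ | ∀ j, x j ∉ f '' I i}.indicator (fun _ => (1 : ℝ)) x ≤
      ∑ j, (f '' I i).indicator (fun _ => (1 : ℝ)) (x j) := by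
    intro i
    by_cases hx : ∀ j, x j ∉ f '' I i
    · rw [indicator_of_mem (by exact hx), sub_self]
      exact Finset.sum_nonneg fun j _ => indicator_nonneg (fun _ _ => zero_le_one) _
    · obtain ⟨j, hj⟩ := not_forall.1 hx
      rw [indicator_of_notMem (by exact hx), sub_zero]
      refine le_trans ?_ (Finset.single_le_sum (f := fun j => (f '' I i).indicator (fun _ => (1 : ℝ)) (x j))
        (fun j _ => indicator_nonneg (fun _ _ => zero_le_one) _) (mem_univ j))
      rw [indicator_of_mem (not_not.1 hj)]
  refine (sum_le_sum fun i _ => h2 i).trans ?_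
  rw [Finset.sum_comm]
  refine sum_le_sum fun j _ => ?_
  by_cases hj : ∃ i ∈ Finset.range m, x j ∈ f '' I i
  · obtain ⟨i, hi, hji⟩ := hj
    rw [Finset.sum_eq_single i, indicator_of_mem hji,
      indicator_of_mem (Set.image_mono (hIE i (Finset.mem_range.1 hi)) hji)]
    · intro k _ hki
      refine indicator_of_notMem (fun hk => ?_) _
      exact Set.disjoint_left.1 ((Set.disjoint_image_iff hbij.1).2 (hd hki)) hk hji
    · exact fun h => absurd hi h
  · push Not at hj
    rw [Finset.sum_eq_zero fun i hi => indicator_of_notMem (hj i hi) _]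
    exact indicator_nonneg (fun _ _ => zero_le_one) _

/-! ### The lower tail of the limit laws -/

/-- On the line at height `2` the dependence on `u` separates into `exp (-2u)` and a Fourier kernel.
The density is an exponential, hence nowhere zero, and its symmetry makes the Airy function real. -/
theorem airyFun_eq_fourier : ∃ g : ℝ → ℂ, Continuous g ∧ Integrable g ∧ (∀ x, g x ≠ 0) ∧
    (∀ x, (starRingEnd ℂ) (g x) = g (-x)) ∧ ∀ u : ℝ, airyFun u =
      rexp (-2 * u) / (2 * π) * ∫ x : ℝ, g x * cexp (x * u * I) := by
  refine ⟨fun x => airyPhase 0 (x + (2 : ℝ) * I), ?_, ?_, fun x => exp_ne_zero _, fun x => ?_, fun u => ?_⟩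
  · unfold airyPhase; fun_prop
  · have := integrable_airyPhase_mul_line (η := 2) (y₀ := 0) (B := 0) (C := 1) (q := fun _ => 1)
      (q' := fun _ => 0) two_pos two_pos.le le_rfl zero_le_one (fun a _ => hasDerivAt_const a 1)
      (fun a _ => by simp) 0
    simpa using this
  · simp only [airyPhase, ← Complex.exp_conj, map_add, map_div₀, map_mul, map_pow, Complex.conj_I,
      Complex.conj_ofReal, map_ofNat]
    congr 1
    push_cast
    ring
  · rw [airyFun_eq_airyPlus, airyPlus_eq_line 0 0 u (η := 2) (by simp), div_mul_eq_mul_div]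
    congr 1
    rw [← integral_const_mul]
    refine integral_congr_ae (.of_forall fun x => ?_)
    simp only [airyPhase, pow_zero, mul_one]
    rw [Complex.ofReal_exp, ← Complex.exp_add, ← Complex.exp_add]
    congr 1
    push_cast
    linear_combination (2 * u : ℂ) * I_mul_I

theorem continuous_airyFun : Continuous airyFun := by
  obtain ⟨g, hgc, hgi, -, -, hg⟩ := airyFun_eq_fourier
  rw [funext hg]
  refine Continuous.mul (by fun_prop) (continuous_of_dominated (fun u => ?_)
    (fun u => .of_forall fun x => ?_) hgi.norm (.of_forall fun x => by fun_prop))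
  · exact Continuous.aestronglyMeasurable (by fun_prop)
  · rw [norm_mul, ← Complex.ofReal_mul, norm_exp_ofReal_mul_I, mul_one]

theorem conj_airyFun (u : ℝ) : (starRingEnd ℂ) (airyFun u) = airyFun u := by
  obtain ⟨g, -, -, -, hgs, hg⟩ := airyFun_eq_fourier
  rw [hg, map_mul, map_div₀, ← integral_conj, ← integral_neg_eq_self]
  simp only [map_mul, Complex.conj_ofReal, map_ofNat, hgs, neg_neg, ← Complex.exp_conj, Complex.conj_I]
  congr 2
  ext x
  push_cast
  ring_nf

/-- Otherwise the Fourier transform of a continuous integrable function without zeros would vanish,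
contradicting Fourier inversion. -/
theorem exists_airyFun_ne_zero : ∃ u, airyFun u ≠ 0 := by
  by_contra! h
  obtain ⟨g, hgc, hgi, hg0, -, hg⟩ := airyFun_eq_fourier
  have hz : ∀ u : ℝ, ∫ x : ℝ, g x * cexp (x * u * I) = 0 := by
    intro u
    have := (hg u).symm.trans (h u)
    refine (mul_eq_zero.1 this).resolve_left (div_ne_zero ?_ ?_)
    · exact_mod_cast (exp_pos _).ne'
    · exact_mod_cast two_pi_pos.ne'
  have hf : FourierTransform.fourier g = 0 := by
    ext w
    rw [Real.fourier_eq', Pi.zero_apply, ← hz (-2 * π * w)]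
    refine integral_congr_ae (.of_forall fun x => ?_)
    simp only [smul_eq_mul, mul_comm (g x)]
    congr 2
    simp
    ring
  have h1 := hgc.fourierInv_fourier_eq hgi (by rw [hf]; exact integrable_zero _ _ _)
  have h2 := congrFun h1 0
  rw [hf, Real.fourierInv_eq'] at h2
  simp only [Pi.zero_apply, smul_zero, integral_zero] at h2
  exact hg0 0 h2.symm

/-- The Airy function is real, so the diagonal of the kernel is `∫_u^∞ |A|²`, which does not
increase with `u` and is positive just left of a point where A is nonzero. -/
theorem airy_diag_lower_bound {κ : ℝ} (h : IsShiftPair κ airyFun airyFun) (hκ : 0 ≤ κ) :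
    ∃ u₀ κ₀ : ℝ, 0 < κ₀ ∧ ∀ u ≤ u₀, κ₀ ≤ (shiftKernel airyFun airyFun u u).re := by
  have hint : ∀ c, IntegrableOn (fun w => ‖airyFun w‖ ^ 2) (Ioi c) := by
    intro c
    obtain ⟨C, hC⟩ := h.right_le c
    have h1 := (integrableOn_exp_mul_Ioi (a := -(2 * (κ + 2))) (by linarith) c).const_mul (C ^ 2)
    refine h1.mono' (continuous_airyFun.norm.pow 2).aestronglyMeasurable ?_
    refine (ae_restrict_iff' measurableSet_Ioi).2 (.of_forall fun u hu => ?_)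
    rw [norm_of_nonneg (by positivity)]
    calc ‖airyFun u‖ ^ 2 ≤ (C * rexp (-(κ + 2) * u)) ^ 2 := by
          gcongr; exact hC u (le_of_lt hu)
      _ = _ := by rw [mul_pow, ← exp_nat_mul]; congr 2; push_cast; ring
  have hK : ∀ u, (shiftKernel airyFun airyFun u u).re = ∫ w in Ioi u, ‖airyFun w‖ ^ 2 := by
    intro u
    have e : ∀ w, airyFun w * airyFun w = ((‖airyFun w‖ ^ 2 : ℝ) : ℂ) := fun w => by
      nth_rw 1 [← conj_airyFun w]
      rw [Complex.conj_mul']; push_cast; rfl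
    simp only [shiftKernel, e]
    rw [integral_complex_ofReal, ofReal_re]
    have := (measurePreserving_add_left volume u).setIntegral_preimage_emb
      (measurableEmbedding_addLeft u) (fun w => ‖airyFun w‖ ^ 2) (Ioi u)
    rwa [Set.preimage_const_add_Ioi, sub_self] at this
  obtain ⟨p, hp⟩ := exists_airyFun_ne_zero
  refine ⟨p - 1, ∫ w in Ioi (p - 1), ‖airyFun w‖ ^ 2, ?_, fun u hu => ?_⟩
  · refine lt_of_le_of_ne (integral_nonneg fun w => by positivity) fun h0 => ?_
    have h1 := (integral_eq_zero_iff_of_nonneg (fun w => by positivity) (hint (p - 1))).1 h0.symm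
    have h2 := Measure.eqOn_open_of_ae_eq h1 isOpen_Ioi (continuous_airyFun.norm.pow 2).continuousOn
      continuousOn_const
    have h3 := h2 (show p ∈ Ioi (p - 1) by simp)
    simp at h3
    exact hp h3
  · rw [hK]
    exact setIntegral_mono_set (hint u) (.of_forall fun w => by positivity)
      (LE.le.eventuallyLE (Set.Ioi_subset_Ioi hu))

theorem IsEdgeScaling.gamma_pos {N ε γ : ℕ → ℝ} (hs : IsEdgeScaling N ε γ) : ∀ᶠ n in atTop, 0 < γ n := by
  filter_upwards [hs.pos, hs.N_pos, hs.gamma] with n h1 h2 h3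
  by_contra h
  have := mul_nonneg h2.le h1.le
  nlinarith

/-- The lower tail of the limit law of the largest particle. -/
theorem airy_gap_le_exp {N ε γ : ℕ → ℝ} (hs : IsEdgeScaling N ε γ) (hN : ∀ n, 0 ≤ N n) :
    ∃ u₀ κ₀ : ℝ, 0 < κ₀ ∧ ∀ x < u₀, (fredholmSum(shiftKernel airyFun airyFun,Ioi x)).re ≤
      rexp (-(κ₀ * (u₀ - x))) := by
  obtain ⟨h, hlim⟩ := tendsto_gap_subcritical 0 hs hN (β := fun _ => 1 / 2) (β₀ := 1 / 2)
    (fun _ => by norm_num) tendsto_const_nhds (by norm_num)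
  have h0 : ∀ n a, outlierTarget n 0 a = 0 := fun n a => by ext j; simp [outlierTarget]
  simp only [h0] at hlim
  have hre : ∀ E, MeasurableSet E → BddBelow E → Tendsto (fun n => (ensembleLaw 1 0 (0 : Fin n → ℝ)).real
      (gapEvent (N n) (γ n) E)) atTop
      (𝓝 (fredholmSum(shiftKernel airyFun airyFun,E)).re) := fun E hE hEb =>
    (continuous_re.tendsto _).comp (hlim E hE hEb)
  obtain ⟨u₀, κ₀, hκ₀, hdiag⟩ := airy_diag_lower_bound h two_pos.le
  refine ⟨u₀, κ₀, hκ₀, fun x hx => ?_⟩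
  obtain ⟨C, hC⟩ := h.exists_norm_sub_le x
  set ℓ := u₀ - x with hℓ
  have hℓ0 : 0 < ℓ := sub_pos.2 hx
  -- The interval from `x` to `u₀` is cut into `m` pieces of length `e`. Each is occupied with
  -- limiting probability at least `κ₀ e - C e²`; the quadratic errors sum to `Cℓ²/m` and disappear
  -- as `m → ∞`.
  have key : ∀ᶠ m : ℕ in atTop, (fredholmSum(shiftKernel airyFun airyFun,Ioi x)).re ≤
      rexp (-(κ₀ * ℓ - C * ℓ ^ 2 * (1 / m))) := by
    filter_upwards [eventually_gt_atTop 0, eventually_ge_atTop ⌈ℓ⌉₊] with m hm hmℓ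
    have hm' : (0 : ℝ) < m := mod_cast hm
    set e := ℓ / m with he
    have he0 : 0 < e := div_pos hℓ0 hm'
    have he1 : e ≤ 1 := (div_le_one hm').2 (Nat.ceil_le.1 hmℓ)
    have hme : m * e = ℓ := mul_div_cancel₀ _ hm'.ne'
    set I : ℕ → Set ℝ := fun i => Ioc (x + i * e) (x + i * e + e) with hI
    have hIx : ∀ i, I i ⊆ Ioi x := fun i u hu => by
      have : (0 : ℝ) ≤ i * e := by positivity
      exact lt_of_le_of_lt (by linarith) hu.1
    have hdisj : Pairwise (Function.onFun Disjoint I) := by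
      refine (pairwise_disjoint_on I).2 fun i j hij => Set.disjoint_left.2 fun u hu hu' => ?_
      have : (i + 1 : ℝ) ≤ j := mod_cast hij
      have h1 := mul_le_mul_of_nonneg_right this he0.le
      have h2 := hu.2
      have h3 := hu'.1
      linarith
    have hbd : ∀ i, BddBelow (I i) := fun i => bddBelow_Ioc
    have h1 : (fredholmSum(shiftKernel airyFun airyFun,Ioi x)).re ≤ rexp
        (-∑ i ∈ Finset.range m, (1 - (fredholmSum(shiftKernel airyFun airyFun,I i)).re)) := by
      refine le_of_tendsto_of_tendsto (hre _ measurableSet_Ioi bddBelow_Ioi)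
        ((continuous_exp.tendsto _).comp (tendsto_finsetSum _ fun i _ =>
          (hre (I i) measurableSet_Ioc (hbd i)).const_sub 1).neg) ?_
      filter_upwards [hs.gamma_pos] with n hn
      exact hermite_gap_le_exp (N n) hn.ne' measurableSet_Ioi (fun i => measurableSet_Ioc) (fun i _ => hIx i) hdisj
    refine h1.trans (exp_le_exp.2 (neg_le_neg ?_))
    have h2 : ∀ i ∈ Finset.range m, κ₀ * e - C * e ^ 2 ≤ 1 - (fredholmSum(shiftKernel airyFun airyFun,I i)).re := by
      intro i hi
      have hi' : (i + 1 : ℝ) ≤ m := mod_cast Finset.mem_range.1 hi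
      have h3 := mul_le_mul_of_nonneg_right hi' he0.le
      obtain ⟨h4, h5⟩ := hC (x + i * e) e (by have : (0 : ℝ) ≤ i * e := by positivity
                                              linarith) he0.le he1
      have h6 := (Complex.abs_re_le_norm _).trans h5
      rw [Complex.sub_re, Complex.sub_re, Complex.one_re] at h6
      have h7 : κ₀ * e ≤ (∫ u in Ioc (x + i * e) (x + i * e + e), shiftKernel airyFun airyFun u u).re := by
        have h8 : (∫ u in Ioc (x + i * e) (x + i * e + e), (shiftKernel airyFun airyFun u u).re) =
          (∫ u in Ioc (x + i * e) (x + i * e + e), shiftKernel airyFun airyFun u u).re := integral_re h4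
        rw [← h8]
        have h9 := setIntegral_mono_on (f := fun _ => κ₀) (μ := volume)
          (integrableOn_const (by simp [Real.volume_Ioc])) h4.re
          measurableSet_Ioc (fun u hu => hdiag u (by have := hu.2; linarith))
        rw [setIntegral_const, Measure.real, Real.volume_Ioc, add_sub_cancel_left,
          ENNReal.toReal_ofReal he0.le, smul_eq_mul, mul_comm] at h9
        exact h9
      have := (abs_le.1 h6).2
      linarith
    calc κ₀ * ℓ - C * ℓ ^ 2 * (1 / m) = ∑ i ∈ Finset.range m, (κ₀ * e - C * e ^ 2) := by
          rw [Finset.sum_const, Finset.card_range, nsmul_eq_mul, he]; field_simp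
      _ ≤ _ := sum_le_sum h2
  have hlim2 : Tendsto (fun m : ℕ => rexp (-(κ₀ * ℓ - C * ℓ ^ 2 * (1 / m)))) atTop (𝓝 (rexp (-(κ₀ * ℓ)))) := by
    refine (continuous_exp.tendsto _).comp ?_
    have := ((tendsto_const_div_atTop_nhds_zero_nat (1 : ℝ)).const_mul (C * ℓ ^ 2)).const_sub (κ₀ * ℓ)
    simpa using this.neg
  exact ge_of_tendsto hlim2 key

/-- A limit of distribution functions that is a Fredholm determinant is a distribution function as soon
as it vanishes at `-∞`. -/
theorem IsShiftPair.exists_distribution {κ : ℝ} {φ ψ : ℝ → ℂ} (h : IsShiftPair κ φ ψ) {p : ℕ → ℝ → ℝ}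
    (hp : ∀ x, Tendsto (fun n => (p n x : ℂ)) atTop (𝓝 (fredholmSum(shiftKernel φ ψ,Ioi x))))
    (hmono : ∀ᶠ n in atTop, Monotone (p n)) 
    (hbot : Tendsto (fun x => (fredholmSum(shiftKernel φ ψ,Ioi x)).re) atBot (𝓝 0)) :
    ∃ ν : Measure ℝ, IsProbabilityMeasure ν ∧ ∀ x : ℝ, HasFredholmDet (shiftKernel φ ψ) (Ioi x) (ν.real (Iic x)) := by
  choose d hd hpd using fun x => h.exists_real measurableSet_Ioi bddBelow_Ioi (hp x)
  have hde : ∀ x, (fredholmSum(shiftKernel φ ψ,Ioi x)) = (d x : ℂ) := fun x =>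
    tendsto_nhds_unique (hp x) ((Complex.continuous_ofReal.tendsto _).comp (hpd x))
  simp only [hde, ofReal_re] at hbot
  have hdm : Monotone d := fun x y hxy =>
    le_of_tendsto_of_tendsto (hpd x) (hpd y) (hmono.mono fun n hn => hn hxy)
  -- Used twice below: with `y` decreasing to `x` for right-continuity, and with `y → ∞`, where the
  -- windows shrink to the empty set and the Fredholm sum is `1`.
  have hset : ∀ {l : Filter ℝ} [l.IsCountablyGenerated] {c : ℝ} {E₀ : Set ℝ}, MeasurableSet E₀ →
      E₀ ⊆ Ici c → (∀ᶠ y in l, Ioi y ⊆ Ici c) → (∀ u, ∀ᶠ y in l, (u ∈ Ioi y ↔ u ∈ E₀)) →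
      Tendsto d l (𝓝 (fredholmSum(shiftKernel φ ψ,E₀)).re) := by
    intro l _ c E₀ h1 h2 h3 h4
    have := h.tendsto_set (E := fun y => Ioi y) (fun y => measurableSet_Ioi) h1 h2 h3 h4
    simp only [hde] at this
    exact (continuous_re.tendsto _).comp this
  have hright : ∀ x, ContinuousWithinAt d (Ici x) x := fun x => by
    have h1 := hset (l := 𝓝[≥] x) (c := x) (E₀ := Ioi x) measurableSet_Ioi Set.Ioi_subset_Ici_self
      (eventually_mem_nhdsWithin.mono fun y hy => (Set.Ioi_subset_Ioi hy).trans Set.Ioi_subset_Ici_self)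
      (fun u => by
        by_cases hu : x < u
        · exact (show ∀ᶠ y in 𝓝[≥] x, y < u from mem_nhdsWithin_of_mem_nhds (Iio_mem_nhds hu)).mono fun y hy => ⟨fun _ => hu, fun _ => hy⟩
        · exact eventually_mem_nhdsWithin.mono fun y hy =>
            ⟨fun h' => absurd (lt_of_le_of_lt hy h') hu, fun h' => absurd h' hu⟩)
    rwa [hde, ofReal_re] at h1
  have htop : Tendsto d atTop (𝓝 1) := by
    have h1 := hset (l := atTop) (c := 0) (E₀ := ∅) MeasurableSet.empty (Set.empty_subset _)
      ((eventually_ge_atTop 0).mono fun y hy => (Set.Ioi_subset_Ioi hy).trans Set.Ioi_subset_Ici_self)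
      (fun u => (eventually_ge_atTop u).mono fun y hy => by simpa using hy)
    rwa [tsum_fredholmTerm_empty, Complex.one_re] at h1
  set F : StieltjesFunction ℝ := ⟨d, hdm, hright⟩
  have := F.isProbabilityMeasure hbot htop
  refine ⟨F.measure, this, fun x => ?_⟩
  rw [Measure.real, F.measure_Iic hbot, sub_zero, ENNReal.toReal_ofReal (hdm.le_of_tendsto hbot x)]
  exact hd x

/-- The ensemble of `n + r` particles with `r` outliers is compared with the Hermite ensemble of `n`
particles, whose largest particle is stochastically lower. The two edge scalings are close: `N (n +
r) ≤ N n + γ n` and `γ (n + r) ≥ γ n / 2`, which for `x ≤ 0` costs at most the passage from `x` to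
`x/2 + 1`. -/
theorem outlier_gap_le_airy (r : ℕ) (τ : ℝ) {x : ℝ} (hx : x ≤ 0) :
    (fredholmSum(shiftKernel (airyMinus r τ) (airyPlus r τ),Ioi x)).re ≤
      (fredholmSum(shiftKernel airyFun airyFun,Ioi (x / 2 + 1))).re := by
  have hs := isEdgeScaling
  have hγp := hs.gamma_pos
  set N : ℕ → ℝ := fun n => √(2 * n) with hN
  set ε : ℕ → ℝ := fun n => 1 / (n : ℝ) ^ (1 / 3 : ℝ) with hε
  set γ : ℕ → ℝ := fun n => 1 / (√2 * (n : ℝ) ^ (1 / 6 : ℝ)) with hγ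
  have hN0 : ∀ n, 0 ≤ N n := fun n => sqrt_nonneg _
  have h1 := (tendsto_gap_critical r τ hs hN0).2 (Ioi x) measurableSet_Ioi bddBelow_Ioi
  have h2 := (tendsto_gap_subcritical 0 hs hN0 (β := fun _ => 1 / 2) (β₀ := 1 / 2)
    (fun _ => by norm_num) tendsto_const_nhds (by norm_num)).2 (Ioi (x / 2 + 1)) measurableSet_Ioi bddBelow_Ioi
  have h0 : ∀ n a, outlierTarget n 0 a = 0 := fun n a => by ext j; simp [outlierTarget]
  simp only [h0] at h2
  have h1' := (continuous_re.tendsto _).comp ((tendsto_add_atTop_iff_nat r).2 h1)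
  have h2' := (continuous_re.tendsto _).comp h2
  refine le_of_tendsto_of_tendsto h1' h2' ?_
  have hεr : ∀ᶠ n in atTop, r * ε n ≤ 1 := by
    have := hs.tendsto_zero.const_mul (r : ℝ)
    rw [mul_zero] at this
    exact (this.eventually (gt_mem_nhds one_pos)).mono fun n h => h.le
  filter_upwards [hγp, (tendsto_add_atTop_nat r).eventually hγp, hεr, hs.N_pos, hs.gamma, eventually_ge_atTop (max 1 r)] with
    n hn hnr hr hNp hg hmax
  have hset : ∀ {m : ℕ} {g : ℝ} (α y : ℝ), 0 < g →
      {v : Fin m → ℝ | ∀ j, v j ∈ (fun ξ : ℝ => α + g * ξ) '' (Ioi y)ᶜ} = {v | ∀ j, v j ≤ α + g * y} := by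
    intro m g α y hg
    ext v
    refine forall_congr' fun j => ⟨?_, fun h => ⟨(v j - α) / g, ?_, ?_⟩⟩
    · rintro ⟨ξ, hξ, hv⟩
      have : ξ ≤ y := not_lt.1 hξ
      rw [← hv]
      beta_reduce
      gcongr
    · have : v j ≤ α + g * y := h
      exact not_lt.2 ((div_le_iff₀ hg).2 (by linarith))
    · beta_reduce
      rw [mul_div_cancel₀ _ hg.ne']; ring
  simp only [comp_apply, ofReal_re, gapEvent]
  rw [hset _ _ hn, hset _ _ hnr]
  refine (ensembleLaw_outlier_max_le n r _ _).trans ?_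
  have := isProbabilityMeasure_ensembleLaw one_pos 0 (0 : Fin n → ℝ)
  refine measureReal_mono (fun v hv j => (hv j).trans ?_)
  -- compare the two windows
  have hn1 : (1 : ℝ) ≤ n := mod_cast le_of_max_le_left hmax
  have hn0 : (0 : ℝ) < n := by linarith
  have hrn : (r : ℝ) ≤ n := mod_cast le_of_max_le_right hmax
  have hNn : N (n + r) ≤ N n + γ n := by
    have h3 : γ n = 1 / (N n * ε n) := by
      rw [eq_div_iff (by have := hs.pos; intro h; rw [mul_assoc, h, mul_zero] at hg; norm_num at hg), ← mul_assoc, hg]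
    have hεn : 0 < ε n := by rw [hε]; positivity
    have h4 : r / N n ≤ γ n := by
      rw [h3, div_le_div_iff₀ hNp (mul_pos hNp hεn)]
      nlinarith
    refine le_trans ?_ (add_le_add_right h4 _)
    refine Real.sqrt_le_iff.2 ⟨by positivity, ?_⟩
    have h5 : N n ^ 2 = 2 * n := sq_sqrt (by positivity)
    have h6 : N n * (r / N n) = r := mul_div_cancel₀ _ hNp.ne'
    push_cast
    nlinarith [sq_nonneg ((r : ℝ) / N n)]
  have hγn : γ n / 2 ≤ γ (n + r) := by
    have h3 : ((n + r : ℕ) : ℝ) ^ (1 / 6 : ℝ) ≤ 2 * (n : ℝ) ^ (1 / 6 : ℝ) := by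
      have h4 : (2 : ℝ) = (64 : ℝ) ^ (1 / 6 : ℝ) := by
        rw [show (64 : ℝ) = 2 ^ (6 : ℝ) by norm_num, ← Real.rpow_mul (by norm_num)]; norm_num
      rw [show 2 * (n : ℝ) ^ (1 / 6 : ℝ) = (64 * n : ℝ) ^ (1 / 6 : ℝ) by
        rw [Real.mul_rpow (by norm_num) hn0.le, ← h4]]
      refine Real.rpow_le_rpow (by positivity) ?_ (by norm_num)
      push_cast
      linarith
    have h5 : (0 : ℝ) < ((n + r : ℕ) : ℝ) := by push_cast; positivity
    rw [hγ]
    beta_reduce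
    rw [div_div]
    refine one_div_le_one_div_of_le (by positivity) ?_
    have := sqrt_nonneg (2 : ℝ)
    nlinarith
  have := mul_le_mul_of_nonpos_right hγn hx
  change N (n + r) + γ (n + r) * x ≤ N n + γ n * (x / 2 + 1)
  nlinarith

theorem airy_tendsto_atBot : Tendsto (fun x =>
    (fredholmSum(shiftKernel airyFun airyFun,Ioi x)).re) atBot (𝓝 0) := by
  obtain ⟨u₀, κ₀, hκ₀, h⟩ := airy_gap_le_exp isEdgeScaling fun n => sqrt_nonneg _
  have hlim := (tendsto_gap_subcritical 0 isEdgeScaling (fun n => sqrt_nonneg _) (β := fun _ => 1 / 2)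
    (β₀ := 1 / 2) (fun _ => by norm_num) tendsto_const_nhds (by norm_num)).2
  have h1 : Tendsto (fun x : ℝ => rexp (-(κ₀ * (u₀ - x)))) atBot (𝓝 0) := by
    refine Real.tendsto_exp_atBot.comp ?_
    have : (fun x : ℝ => -(κ₀ * (u₀ - x))) = fun x => -(κ₀ * u₀) + κ₀ * x := by ext x; ring
    rw [this]
    exact tendsto_atBot_add_const_left _ _ (tendsto_id.const_mul_atBot hκ₀)
  refine squeeze_zero' (.of_forall fun x => ?_) ((eventually_lt_atBot u₀).mono h) h1
  exact ge_of_tendsto ((continuous_re.tendsto _).comp (hlim (Ioi x) measurableSet_Ioi bddBelow_Ioi))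
    (.of_forall fun n => measureReal_nonneg)

/-- Monotonicity is inherited from the gap probabilities, and the limit at `-∞` from the comparison
with the Airy limit. -/
theorem exists_rAiry_distribution (r : ℕ) (τ : ℝ) : ∃ ν : Measure ℝ, IsProbabilityMeasure ν ∧
    ∀ x : ℝ, HasFredholmDet (rAiryKernel r τ) (Ioi x) (ν.real (Iic x)) := by
  rw [rAiryKernel_eq_shiftKernel]
  obtain ⟨h, hlim⟩ := tendsto_gap_critical r τ isEdgeScaling (fun n => sqrt_nonneg _)
  refine h.exists_distribution (fun x => hlim (Ioi x) measurableSet_Ioi bddBelow_Ioi) ?_ ?_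
  · refine .of_forall fun n x y hxy => ?_
    have := isProbabilityMeasure_ensembleLaw one_pos 0
      (outlierTarget n r (√(2 * n) * rexp (τ * (1 / (n : ℝ) ^ (1 / 3 : ℝ)))))
    exact measureReal_mono fun v hv j =>
      Set.image_mono (Set.compl_subset_compl.2 (Set.Ioi_subset_Ioi hxy)) (hv j)
  · have h1 : Tendsto (fun x : ℝ => x / 2 + 1) atBot atBot :=
      tendsto_atBot_add_const_right _ _ (tendsto_id.atBot_div_const two_pos)
    refine squeeze_zero' (.of_forall fun x => ?_)
      ((eventually_le_atBot 0).mono fun x hx => outlier_gap_le_airy r τ hx) (airy_tendsto_atBot.comp h1)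
    exact ge_of_tendsto ((continuous_re.tendsto _).comp (hlim (Ioi x) measurableSet_Ioi bddBelow_Ioi))
      (.of_forall fun n => measureReal_nonneg)

/-! ### The mean empirical measure and the semicircle law -/

theorem tendsto_circleIntegral {ι : Type*} {l : Filter ι} [l.IsCountablyGenerated] {F : ι → ℂ → ℂ}
    {f : ℂ → ℂ} {R M : ℝ} (hR : 0 ≤ R) (hF : ∀ᶠ i in l, ContinuousOn (F i) (sphere 0 R) ∧
      ∀ w ∈ sphere (0 : ℂ) R, ‖F i w‖ ≤ M)
    (h : ∀ w ∈ sphere (0 : ℂ) R, Tendsto (fun i => F i w) l (𝓝 (f w))) :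
    Tendsto (fun i => ∮ w in C(0, R), F i w) l (𝓝 (∮ w in C(0, R), f w)) := by
  have hm := fun α => circleMap_mem_sphere (0 : ℂ) hR α
  refine intervalIntegral.tendsto_integral_filter_of_dominated_convergence (fun _ => R * M) ?_ ?_ ?_ ?_
  · filter_upwards [hF] with i hi
    refine Continuous.aestronglyMeasurable ?_
    have := hi.1.comp_continuous (continuous_circleMap 0 R) hm
    simp only [deriv_circleMap, smul_eq_mul]
    exact ((continuous_circleMap 0 R).mul continuous_const).mul this
  · filter_upwards [hF] with i hi
    refine .of_forall fun α _ => ?_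
    rw [norm_smul, deriv_circleMap]
    simp only [norm_mul, norm_circleMap_zero, norm_I, mul_one, abs_of_nonneg hR]
    exact mul_le_mul_of_nonneg_left (hi.2 _ (hm α)) hR
  · exact intervalIntegrable_const
  · exact .of_forall fun α _ => (h _ (hm α)).const_smul _

theorem circleIntegral_scale (f : ℂ → ℂ) (c R : ℝ) : ∮ w in C(0, c * R), f w = c * ∮ w in C(0, R), f (c * w) := by
  rw [circleIntegral, circleIntegral, ← intervalIntegral.integral_const_mul]
  refine intervalIntegral.integral_congr fun α _ => ?_
  simp only [deriv_circleMap, circleMap, smul_eq_mul, zero_add, Complex.ofReal_mul]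
  ring_nf

/-- The mean is the trace of the biorthogonal matrix. Its `j`-th entry evaluates the Lagrange basis
polynomial at `b j + ξ`, which is the weight of the node times `P(b j + ξ)/ξ`, with P the node
polynomial. The sum is therefore a sum of residues of `P(w + ξ)/P(w) · e^{wξ/2}`. Imaginary `ξ`
keeps the statistic bounded. -/
theorem integral_sum_cexp_of_injective (hn : 0 < n) {b : Fin n → ℝ} (hb : Injective b)
    {ξ : ℂ} (hξ : ξ ≠ 0) (hξ' : ξ.re = 0) {R : ℝ} (hR : 0 < R) (hbR : ∀ i, |b i| < R) :
    ∫ x, ∑ j, cexp (ξ * x j) ∂ensembleLaw 1 0 b = cexp (ξ ^ 2 / 4) / ξ *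
      ((2 * π * I)⁻¹ * ∮ w in C(0, R), (∏ i, (1 + ξ / (w - b i))) * cexp (w * ξ / 2)) := by
  have hmem : ∀ i, (b i : ℂ) ∈ ball (0 : ℂ) R := fun i => by simpa using hbR i
  have h := circleIntegral_div_nodePoly hn hb (c := 0) (hR := hR)
    (F := fun w => (nodePoly b).eval (w + ξ) * cexp (w * ξ / 2))
    (((nodePoly b).differentiable.comp (differentiable_id.add_const ξ)).mul (by fun_prop)) fun i => Or.inl (hmem i)
  have e : ∮ w in C(0, R), (∏ i, (1 + ξ / (w - b i))) * cexp (w * ξ / 2) =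
      ∮ w in C(0, R), (nodePoly b).eval (w + ξ) * cexp (w * ξ / 2) / (nodePoly b).eval w := by
    refine circleIntegral.integral_congr hR.le fun w hw => ?_
    have hne : ∀ i, w - b i ≠ 0 := fun i h0 => by
      rw [sub_eq_zero.1 h0] at hw
      exact (mem_ball.1 (hmem i)).ne hw
    simp only [nodePoly_eval]
    rw [mul_div_right_comm (∏ i, (w + ξ - b i)), ← Finset.prod_div_distrib]
    congr 1
    refine prod_congr rfl fun i _ => ?_
    have := hne i
    field_simp
    ring
  rw [e, h, integral_sum_ensembleLaw hb (f := fun x : ℝ => cexp (ξ * x)) (by fun_prop) (M := 1)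
    fun x => by rw [norm_exp, Complex.mul_re, hξ']; simp, mul_sum]
  refine sum_congr rfl fun j _ => ?_
  rw [if_pos (hmem j)]
  have e1 : ∀ x : ℝ, cexp (ξ * x) * (leftFun b j x * rightFun b j x) =
      cexp (-(b j : ℂ) ^ 2 / 4) * ((gaussTransform (nodeBasis b j)).eval (x : ℂ) *
        cexp (-(x : ℂ) ^ 2) * cexp ((b j + ξ) * x)) := fun x => by
    rw [leftFun_mul_rightFun, add_mul (b j : ℂ), Complex.exp_add (b j * x)]
    ring
  simp_rw [e1]
  rw [integral_const_mul, integral_gaussTransform_exp, nodeBasis,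
    Lagrange.basis_eq_prod_sub_inv_mul_nodal_div (mem_univ j),
    ← Lagrange.nodal_erase_eq_nodal_div (mem_univ j), nodePoly,
    Lagrange.nodal_eq_mul_nodal_erase (mem_univ j), nodeWeight, eval_mul,
    eval_mul, eval_C, Polynomial.eval_sub, eval_X, eval_C]
  have e2 : cexp (-((b j : ℂ) ^ 2 / 4)) * cexp ((b j + ξ) ^ 2 / 4) = cexp (ξ ^ 2 / 4) * cexp (b j * ξ / 2) := by
    rw [← Complex.exp_add, ← Complex.exp_add]; ring_nf
  field_simp
  linear_combination (ξ * Lagrange.nodalWeight Finset.univ (fun i => (b i : ℂ)) j *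
    (Lagrange.nodal (Finset.univ.erase j) fun i => (b i : ℂ)).eval (b j + ξ)) * e2

/-- Both sides are continuous in the nodes, and the right-hand side no longer contains the singular
node weights, so coinciding nodes are reached by separating them with `s · l`. -/
theorem integral_sum_cexp (hn : 0 < n) {b : Fin n → ℝ} (hb : Monotone b)
    {ξ : ℂ} (hξ : ξ ≠ 0) (hξ' : ξ.re = 0) {R : ℝ} (hbR : ∀ i, |b i| < R) :
    ∫ x, ∑ j, cexp (ξ * x j) ∂ensembleLaw 1 0 b = cexp (ξ ^ 2 / 4) / ξ *
      ((2 * π * I)⁻¹ * ∮ w in C(0, R), (∏ i, (1 + ξ / (w - b i))) * cexp (w * ξ / 2)) := by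
  have hR : 0 < R := (abs_nonneg _).trans_lt (hbR ⟨0, hn⟩)
  obtain ⟨B, hB⟩ : ∃ B : ℝ → Fin n → ℝ, B = fun s l => b l + s * (l : ℕ) := ⟨_, rfl⟩
  have hBc : Continuous B := continuous_pi fun l => by simp only [hB]; fun_prop
  have hB0 : B 0 = b := by funext l; simp [hB]
  have hne : ∀ w ∈ sphere (0 : ℂ) R, ∀ x : ℝ, |x| < R → R - |x| ≤ ‖w - x‖ ∧ w - x ≠ 0 := by
    intro w hw x hx
    have h := norm_sub_norm_le w x
    rw [mem_sphere_zero_iff_norm.1 hw, norm_real, norm_eq_abs] at h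
    exact ⟨h, norm_pos_iff.1 (by linarith)⟩
  have hd : ∃ d > 0, ∀ᶠ s in 𝓝 (0 : ℝ), ∀ i, |B s i| < R - d := by
    obtain ⟨i, -, hi⟩ := Finset.exists_max_image Finset.univ (fun i => |b i|) ⟨⟨0, hn⟩, mem_univ _⟩
    refine ⟨(R - |b i|) / 2, by linarith [hbR i], eventually_all.2 fun j => ?_⟩
    refine (((continuous_apply j).comp hBc).abs.tendsto 0).eventually (gt_mem_nhds ?_)
    simp only [comp_apply, hB0]
    linarith [hi j (mem_univ _), hbR i]
  obtain ⟨d, hd0, hd⟩ := hd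
  have h1 : Tendsto (fun s => ∫ x, ∑ j, cexp (ξ * x j) ∂ensembleLaw 1 0 (B s)) (𝓝[>] 0)
      (𝓝 (∫ x, ∑ j, cexp (ξ * x j) ∂ensembleLaw 1 0 (B 0))) := by
    have hc := continuous_integral_ensembleLaw (𝕜 := ℂ) (n := n) one_pos
      (F := fun x => ∑ j, cexp (ξ * x j)) (by fun_prop) (M := n) fun x => by
        refine (norm_sum_le _ _).trans_eq ?_
        simp [norm_exp, Complex.mul_re, hξ']
    exact ((hc.comp (continuous_const.prodMk hBc)).tendsto 0).mono_left nhdsWithin_le_nhds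
  have h2 : Tendsto (fun s => ∮ w in C(0, R), (∏ i, (1 + ξ / (w - B s i))) * cexp (w * ξ / 2))
      (𝓝[>] 0) (𝓝 (∮ w in C(0, R), (∏ i, (1 + ξ / (w - B 0 i))) * cexp (w * ξ / 2))) := by
    refine tendsto_circleIntegral (M := (∏ i : Fin n, (1 + ‖ξ‖ / d)) * rexp (R * ‖ξ‖ / 2)) hR.le ?_ ?_
    · filter_upwards [nhdsWithin_le_nhds hd] with s hs
      have hs' := fun w hw i => hne w hw (B s i) (by linarith [hs i])
      refine ⟨ContinuousOn.mul (continuousOn_finsetProd _ fun i _ => continuousOn_const.add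
        (continuousOn_const.div (by fun_prop) fun w hw => (hs' w hw i).2)) (by fun_prop), fun w hw => ?_⟩
      rw [norm_mul, norm_prod]
      refine mul_le_mul (prod_le_prod (fun _ _ => norm_nonneg _) fun i _ => ?_) ?_ (norm_nonneg _) (by positivity)
      · refine (norm_add_le _ _).trans ?_
        rw [norm_one, norm_div]
        gcongr
        linarith [(hs' w hw i).1, hs i]
      · refine (Complex.norm_exp_le_exp_norm _).trans (exp_le_exp.2 ?_)
        rw [norm_div, norm_mul, mem_sphere_zero_iff_norm.1 hw, Complex.norm_ofNat]
    · intro w hw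
      refine Tendsto.mul_const _ (tendsto_finsetProd _ fun i _ => tendsto_const_nhds.add
        (tendsto_const_nhds.div (tendsto_const_nhds.sub ?_) ?_))
      · exact ((Complex.continuous_ofReal.comp ((continuous_apply i).comp hBc)).tendsto 0).mono_left
          nhdsWithin_le_nhds
      · exact (hne w hw _ (by rw [hB0]; exact hbR i)).2
  rw [hB0] at h1 h2
  refine tendsto_nhds_unique h1 (((h2.const_mul _).const_mul _).congr' ?_)
  filter_upwards [nhdsWithin_le_nhds hd, self_mem_nhdsWithin] with s hs hs0
  refine (integral_sum_cexp_of_injective hn (StrictMono.injective fun i j hij => ?_) hξ hξ' hR fun i => ?_).symm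
  · have h8 : s * ((i : ℕ) : ℝ) < s * ((j : ℕ) : ℝ) := mul_lt_mul_of_pos_left (mod_cast hij) hs0
    simp only [hB]
    linarith [hb hij.le]
  · linarith [hs i]

/-- After scaling by `√n` the product is `(1 + Iκ/(n w))^n` times a correction from the `r`
outliers. The first tends to `exp (Iκ/w)`, the second is an `r`-th power of a ratio tending to `1`.
-/
theorem tendsto_integral_sum_cexp (r : ℕ) {β R κ : ℝ} (hβ : 0 ≤ β) (hR : β < R) (hκ : κ ≠ 0) :
    Tendsto (fun n : ℕ => (∫ x, ∑ j, cexp (I * κ / √n * x j)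
      ∂ensembleLaw 1 0 (outlierTarget n r (√n * β))) / n) atTop
      (𝓝 ((I * κ)⁻¹ * ((2 * π * I)⁻¹ * ∮ w in C(0, R), cexp (I * κ / w) * cexp (w * (I * κ) / 2)))) := by
  have hR0 := hβ.trans_lt hR
  have hIκ : I * (κ : ℂ) ≠ 0 := mul_ne_zero Complex.I_ne_zero (mod_cast hκ)
  have hne : ∀ w ∈ sphere (0 : ℂ) R, ∀ x : ℝ, |x| ≤ β → R - β ≤ ‖w - x‖ ∧ w - x ≠ 0 := by
    intro w hw x hx
    have h := norm_sub_norm_le w x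
    rw [mem_sphere_zero_iff_norm.1 hw, norm_real, norm_eq_abs] at h
    exact ⟨by linarith, norm_pos_iff.1 (by linarith)⟩
  have hT : ∀ n (i : Fin n), |outlierTarget n r β i| ≤ β := fun n i => by
    rw [outlierTarget]; split_ifs <;> simp [hβ, abs_of_nonneg]
  obtain ⟨F, hF⟩ : ∃ F : ℕ → ℂ → ℂ, F = fun n w =>
      (∏ i, (1 + I * κ / n / (w - outlierTarget n r β i))) * cexp (w * (I * κ) / 2) :=
    ⟨_, rfl⟩
  have hlim : Tendsto (fun n => ∮ w in C(0, R), F n w) atTop (𝓝 (∮ w in C(0, R),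
      cexp (I * κ / w) * cexp (w * (I * κ) / 2))) := by
    refine tendsto_circleIntegral (M := rexp (|κ| / (R - β)) * rexp (R * |κ| / 2)) hR0.le ?_ ?_
    · refine .of_forall fun n => ?_
      rw [hF]
      refine ⟨ContinuousOn.mul (continuousOn_finsetProd _ fun i _ => continuousOn_const.add
        (continuousOn_const.div (by fun_prop) fun w hw => (hne w hw _ (hT n i)).2)) (by fun_prop), fun w hw => ?_⟩
      rw [norm_mul, norm_prod]
      refine mul_le_mul ?_ ?_ (norm_nonneg _) (Real.exp_nonneg _)
      · have h1 : ∀ i, ‖1 + I * κ / n / (w - outlierTarget n r β i)‖ ≤ rexp (|κ| / n / (R - β)) := fun i => by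
          refine ((norm_add_le _ _).trans ?_).trans (add_one_le_exp _)
          rw [norm_one, norm_div, norm_div, norm_mul, norm_I, one_mul, norm_real,
            norm_eq_abs, Complex.norm_natCast, add_comm]
          have := (hne w hw _ (hT n i)).1
          have : 0 < R - β := by linarith
          gcongr
        refine (prod_le_prod (fun _ _ => norm_nonneg _) fun i _ => h1 i).trans ?_
        rw [prod_const, Finset.card_univ, Fintype.card_fin, ← exp_nat_mul, exp_le_exp]
        rcases n.eq_zero_or_pos with rfl | hn
        · simp only [Nat.cast_zero, zero_mul]
          exact div_nonneg (abs_nonneg _) (by linarith)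
        · have : (n : ℝ) ≠ 0 := by positivity
          exact le_of_eq (by field_simp)
      · refine (Complex.norm_exp_le_exp_norm _).trans (exp_le_exp.2 ?_)
        simp [mem_sphere_zero_iff_norm.1 hw]
    · intro w hw
      have hw0 : w ≠ 0 := by simpa using (hne w hw 0 (by simpa using hβ)).2
      have hwβ : w - β ≠ 0 := (hne w hw β (abs_of_nonneg hβ).le).2
      have hz : Tendsto (fun n : ℕ => I * κ / n) atTop (𝓝 0) := by
        simpa [div_eq_mul_inv] using (tendsto_inv_atTop_nhds_zero_nat (𝕜 := ℂ)).const_mul (I * κ)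
      have h1 : Tendsto (fun n : ℕ => (1 + I * κ / w / n) ^ n) atTop
          (𝓝 (cexp (I * κ / w))) := Complex.tendsto_one_add_div_pow_exp _
      have h2 : Tendsto (fun n : ℕ => ((w + I * κ / n - β) * w / ((w + I * κ / n) * (w - β))) ^ r) atTop (𝓝 1) := by
        have := ((((hz.const_add w).sub_const (β : ℂ)).mul_const w).div
          ((hz.const_add w).mul_const (w - β)) (by simpa using ⟨hw0, hwβ⟩)).pow r
        rwa [add_zero, mul_comm (w - (β : ℂ)) w, div_self (mul_ne_zero hw0 hwβ), one_pow] at this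
      have h3 := ((h1.mul h2).mul_const (cexp (w * (I * κ) / 2)))
      rw [mul_one] at h3
      refine h3.congr' ?_
      have h4 : ∀ᶠ n : ℕ in atTop, w + I * κ / n ≠ 0 := (hz.const_add w).eventually_ne (by simpa using hw0)
      filter_upwards [h4, eventually_ge_atTop r, eventually_gt_atTop 0] with n hn hnr hn0
      have hn0' : (n : ℂ) ≠ 0 := mod_cast hn0.ne'
      have e : ∏ i, (1 + I * κ / n / (w - outlierTarget n r β i)) =
          (nodePoly (outlierTarget n r β)).eval (w + I * κ / n) / (nodePoly (outlierTarget n r β)).eval w := by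
        rw [nodePoly_eval, nodePoly_eval, ← Finset.prod_div_distrib]
        refine prod_congr rfl fun i _ => ?_
        have := (hne w hw _ (hT n i)).2
        rw [eq_div_iff this, add_mul, div_mul_cancel₀ _ this]
        ring
      rw [hF]
      simp only
      rw [e, nodePoly_outlierTarget hnr, nodePoly_outlierTarget hnr]
      congr 1
      obtain ⟨k, rfl⟩ := Nat.exists_eq_add_of_le' hnr
      rw [Nat.add_sub_cancel]
      have e3 : 1 + I * κ / w / ((k + r : ℕ) : ℂ) = (w + I * κ / ((k + r : ℕ) : ℂ)) / w := by field_simp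
      rw [e3]
      generalize w + I * κ / ((k + r : ℕ) : ℂ) = z at *
      rw [div_pow, div_pow, mul_pow, mul_pow, pow_add, pow_add]
      field_simp
  have hexp : Tendsto (fun n : ℕ => cexp (-((κ : ℂ) ^ 2 / 4) / n) / (I * κ)) atTop (𝓝 (I * κ)⁻¹) := by
    have := ((Complex.continuous_exp.tendsto _).comp
      ((tendsto_inv_atTop_nhds_zero_nat (𝕜 := ℂ)).const_mul (-((κ : ℂ) ^ 2 / 4)))).div_const (I * κ)
    simpa [div_eq_mul_inv, comp_def] using this
  refine (hexp.mul (hlim.const_mul (2 * π * I)⁻¹)).congr' ?_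
  filter_upwards [eventually_gt_atTop 0] with n hn
  have hn' : (0 : ℝ) < n := mod_cast hn
  have hs : 0 < √n := sqrt_pos.2 hn'
  have hs0 : (√n : ℂ) ≠ 0 := mod_cast hs.ne'
  have hss : (√n : ℂ) ^ 2 = n := by rw [← Complex.ofReal_pow, sq_sqrt hn'.le, Complex.ofReal_natCast]
  rw [integral_sum_cexp hn (monotone_outlierTarget n r (by positivity)) (div_ne_zero hIκ hs0)
    (by simp [← Complex.ofReal_div, mul_div_assoc]) (R := √n * R) fun i => ?_, circleIntegral_scale]
  · have e : ∀ w : ℂ, (∏ i, (1 + I * κ / √n / (√n * w - outlierTarget n r (√n * β) i))) *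
          cexp (√n * w * (I * κ / √n) / 2) = F n w := fun w => by
      rw [hF, ← smul_outlierTarget]
      simp only [Pi.smul_apply, smul_eq_mul, Complex.ofReal_mul, ← mul_sub, ← hss]
      congr 2
      · funext i; rw [div_div, div_div, ← mul_assoc, ← sq]
      · field_simp
    simp_rw [e]
    rw [div_pow, mul_pow, I_sq, hss, ← hss]
    have e5 : (-1 * (κ : ℂ) ^ 2 / (√n : ℂ) ^ 2 / 4) = -((κ : ℂ) ^ 2 / 4) / (√n : ℂ) ^ 2 := by ring
    rw [e5]
    field_simp
  · rw [← smul_outlierTarget, Pi.smul_apply, smul_eq_mul, abs_mul, abs_of_pos hs]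
    exact mul_lt_mul_of_pos_left ((hT n i).trans_lt hR) hs

/-- The integrand is singular only at `0`, so the circle may be moved to radius `√2`, where the
exponent `Iκ/w + Iκw/2` becomes `Iκ√2 cos α`. -/
theorem circleIntegral_eq_integral_sin_sq {R κ : ℝ} (hR : √2 ≤ R) (hκ : κ ≠ 0) : (I * κ)⁻¹ * ((2 * π * I)⁻¹ *
      ∮ w in C(0, R), cexp (I * κ / w) * cexp (w * (I * κ) / 2)) =
    ∫ α in (0 : ℝ)..2 * π, ((Real.sin α ^ 2 / π : ℝ) : ℂ) * cexp (κ * (√2 * Real.cos α : ℝ) * I) := by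
  have h2 : 0 < √2 := by positivity
  have h20 : (√2 : ℂ) ≠ 0 := mod_cast h2.ne'
  have hss : (√2 : ℂ) ^ 2 = 2 := by rw [← Complex.ofReal_pow, sq_sqrt (by norm_num), Complex.ofReal_ofNat]
  have hκ' : (κ : ℂ) ≠ 0 := mod_cast hκ
  have hd : ∀ z : ℂ, z ≠ 0 → DifferentiableAt ℂ (fun w =>
      cexp (I * κ / w) * cexp (w * (I * κ) / 2)) z := fun z hz => by
    fun_prop (disch := assumption)
  rw [Complex.circleIntegral_eq_of_differentiable_on_annulus_off_countable h2 hR Set.countable_empty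
    (fun z hz => (hd z fun h => hz.2 (by simp [h, h2])).continuousAt.continuousWithinAt)
    (fun z hz => hd z fun h => hz.1.2 (by simp [h])), circleIntegral]
  obtain ⟨G, hG⟩ : ∃ G : ℝ → ℂ, G = fun α : ℝ => cexp (κ * (√2 * Complex.cos α) * I) := ⟨_, rfl⟩
  have hGc : Continuous G := by rw [hG]; fun_prop
  have e1 : ∀ α : ℝ, deriv (circleMap 0 (√2)) α • (cexp (I * κ / circleMap 0 (√2) α) *
      cexp (circleMap 0 (√2) α * (I * κ) / 2)) =
      I * √2 * ((Complex.cos α + Complex.sin α * I) * G α) := fun α => by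
    have h3 : (I * κ / circleMap 0 (√2) α) + circleMap 0 (√2) α * (I * κ) / 2 = κ * (√2 * Complex.cos α) * I := by
      rw [circleMap, zero_add, Complex.cos, neg_mul, Complex.exp_neg]
      field_simp
      rw [hss]
      ring
    rw [← Complex.exp_add, h3, deriv_circleMap, ← Complex.exp_mul_I, circleMap, zero_add, smul_eq_mul, hG]
    ring
  -- Integration by parts: the integrand is the derivative of the periodic function `(sin α -
  -- 1/(κ√2)) G α`, and the constant `1/(κ√2)` produces the term `I sin α`.
  have e2 : ∫ α in (0 : ℝ)..2 * π, ((Complex.cos α + Complex.sin α * I) * G α -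
      I * κ * √2 * (Complex.sin α ^ 2 * G α)) = 0 := by
    have h3 : ∀ α : ℝ, HasDerivAt (fun α : ℝ => (Complex.sin α - 1 / (κ * √2)) * G α)
        ((Complex.cos α + Complex.sin α * I) * G α - I * κ * √2 * (Complex.sin α ^ 2 * G α)) α := fun α => by
      have h4 : HasDerivAt (fun z : ℂ => (Complex.sin z - 1 / (κ * √2)) *
          cexp (κ * (√2 * Complex.cos z) * I)) _ (α : ℂ) :=
        ((Complex.hasDerivAt_sin (α : ℂ)).sub_const _).mul
          ((((Complex.hasDerivAt_cos (α : ℂ)).const_mul (√2 : ℂ)).const_mul (κ : ℂ)).mul_const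
            I).cexp
      rw [hG]
      refine h4.comp_ofReal.congr_deriv ?_
      field_simp
      ring
    rw [intervalIntegral.integral_eq_sub_of_hasDerivAt (fun α _ => h3 α)
      (Continuous.intervalIntegrable (by fun_prop) _ _), hG]
    simp [Complex.cos_two_pi, Complex.sin_two_pi]
  rw [intervalIntegral.integral_sub (Continuous.intervalIntegrable (by fun_prop) _ _)
    (Continuous.intervalIntegrable (by fun_prop) _ _), intervalIntegral.integral_const_mul, sub_eq_zero] at e2
  have e3 : ∀ α : ℝ, ((Real.sin α ^ 2 / π : ℝ) : ℂ) * cexp (κ * (√2 * Real.cos α : ℝ) * I) =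
      (π : ℂ)⁻¹ * (Complex.sin α ^ 2 * G α) := fun α => by
    rw [hG]; push_cast; ring
  simp_rw [e1, e3]
  rw [intervalIntegral.integral_const_mul, intervalIntegral.integral_const_mul, e2]
  have := Complex.I_ne_zero
  have hpi : (π : ℂ) ≠ 0 := mod_cast Real.pi_ne_zero
  field_simp
  rw [hss]

/-- The semicircle law on `[-c, c]`, as the law of `c * cos α`. -/
noncomputable def semicircleLaw (c : ℝ) : Measure ℝ := ((volume.restrict (Ioc 0 (2 * π))).withDensity fun α =>
    ENNReal.ofReal (Real.sin α ^ 2 / π)).map fun α => c * Real.cos α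

theorem integral_semicircleLaw (c : ℝ) {g : ℝ → ℂ} (hg : Continuous g) :
    ∫ y, g y ∂semicircleLaw c = ∫ α in (0 : ℝ)..2 * π, ((Real.sin α ^ 2 / π : ℝ) : ℂ) * g (c * Real.cos α) := by
  rw [semicircleLaw, integral_map (by fun_prop) hg.aestronglyMeasurable,
    integral_withDensity_eq_integral_toReal_smul (by fun_prop) (by simp),
    intervalIntegral.integral_of_le (by positivity)]
  refine integral_congr_ae (.of_forall fun α => ?_)
  simp only
  rw [ENNReal.toReal_ofReal (by positivity), real_smul]

theorem isProbabilityMeasure_semicircleLaw (c : ℝ) : IsProbabilityMeasure (semicircleLaw c) := by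
  constructor
  rw [semicircleLaw, Measure.map_apply (by fun_prop) MeasurableSet.univ, Set.preimage_univ,
    withDensity_apply _ MeasurableSet.univ, Measure.restrict_univ, ← ofReal_integral_eq_lintegral_ofReal,
    ← intervalIntegral.integral_of_le (by positivity), intervalIntegral.integral_div, integral_sin_sq]
  · simp [Real.pi_ne_zero]
  · exact (Continuous.integrableOn_Icc (by fun_prop)).mono_set Set.Ioc_subset_Icc_self
  · exact .of_forall fun α => by positivity

/-- Every point of the interval is `c cos α` with `α` in the closure of `(0, π)`, and on the open
interval `(0, π)` the density `sin² α / π` is positive. -/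
theorem support_semicircleLaw {c : ℝ} (hc : 0 < c) : (semicircleLaw c).support = Icc (-c) c := by
  have hm : Measurable fun α => c * Real.cos α := by fun_prop
  refine Set.Subset.antisymm (Measure.support_subset_of_isClosed isClosed_Icc ?_) fun x hx => ?_
  · rw [semicircleLaw, mem_ae_map_iff hm.aemeasurable measurableSet_Icc]
    refine Eventually.of_forall fun α => ?_
    simp only
    rw [Set.mem_Icc, ← abs_le, abs_mul, abs_of_pos hc]
    exact mul_le_of_le_one_right hc.le (Real.abs_cos_le_one α)
  · rw [Measure.mem_support_iff_forall]
    intro U hU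
    obtain ⟨V, hVU, hV, hxV⟩ := mem_nhds_iff.1 hU
    refine lt_of_lt_of_le ?_ (measure_mono hVU)
    have hxc : c * Real.cos (Real.arccos (x / c)) = x := by
      rw [Real.cos_arccos (by rw [le_div_iff₀ hc]; linarith [hx.1]) (by rw [div_le_one hc]; exact hx.2)]
      field_simp
    have hW : IsOpen ((fun α => c * Real.cos α) ⁻¹' V) := hV.preimage (by fun_prop)
    have hne : (((fun α => c * Real.cos α) ⁻¹' V) ∩ Ioo 0 π).Nonempty := by
      have : Real.arccos (x / c) ∈ closure (Ioo 0 π) := by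
        rw [closure_Ioo Real.pi_ne_zero.symm]
        exact ⟨Real.arccos_nonneg _, Real.arccos_le_pi _⟩
      exact mem_closure_iff.1 this _ hW (by rw [Set.mem_preimage, hxc]; exact hxV)
    rw [semicircleLaw, Measure.map_apply hm hV.measurableSet, pos_iff_ne_zero, Ne,
      withDensity_apply_eq_zero' (by fun_prop), Measure.restrict_apply' measurableSet_Ioc]
    refine fun h0 => ((hW.inter isOpen_Ioo).measure_pos volume hne).ne' (measure_mono_null ?_ h0)
    rintro α ⟨h1, h2, h3⟩
    have := Real.sin_pos_of_pos_of_lt_pi h2 h3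
    refine ⟨⟨?_, h1⟩, h2, by linarith [pi_pos]⟩
    rw [Set.mem_ofPred_eq, Ne, ENNReal.ofReal_eq_zero, not_le]
    positivity

theorem tendsto_integral_of_tendsto_charFun {M : ℕ → Measure ℝ} {m : Measure ℝ}
    (hM : ∀ᶠ n in atTop, IsProbabilityMeasure (M n)) [IsProbabilityMeasure m]
    (h : ∀ θ, Tendsto (fun n => charFun (M n) θ) atTop (𝓝 (charFun m θ)))
    (f : BoundedContinuousFunction ℝ ℝ) :
    Tendsto (fun n => ∫ y, f y ∂M n) atTop (𝓝 (∫ y, f y ∂m)) := by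
  obtain ⟨k, hk⟩ := eventually_atTop.1 hM
  rw [← tendsto_add_atTop_iff_nat k]
  exact ProbabilityMeasure.tendsto_iff_forall_integral_tendsto.1 ((ProbabilityMeasure.tendsto_iff_tendsto_charFun
      (μ := fun n => ⟨M (n + k), hk _ (Nat.le_add_left _ _)⟩) (μ₀ := ⟨m, inferInstance⟩)).2 fun θ =>
        (tendsto_add_atTop_iff_nat k).2 (h θ)) f

/-- Lévy's continuity theorem for the averaged one-particle marginals. After normalizing the
variance, the outliers sit at a fixed multiple `β` of `√n`, and the limit does not depend on `β`. -/
theorem tendsto_integral_empirical {r : ℕ} {τ₀ : ℝ} {ℙ : (n : ℕ) → ℝ → Measure (Fin n → ℝ)}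
    (hP : ∀ n : ℕ, r ≤ n → ∀ t ∈ Ioo (0 : ℝ) 1, IsOutlierBridgeLaw n r (rexp (-τ₀) * √(n / 2)) t (ℙ n t))
    {t : ℝ} (ht : t ∈ Ioo (0 : ℝ) 1) (f : BoundedContinuousFunction ℝ ℝ) :
    Tendsto (fun n : ℕ => ∫ x, (∑ j, f (x j / √n)) / (n : ℝ) ∂(ℙ n t)) atTop
      (𝓝 (∫ y, f y ∂semicircleLaw (√(2 * t * (1 - t))))) := by
  have hs : 0 < t * (1 - t) := mul_pos ht.1 (sub_pos.2 ht.2)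
  have := isProbabilityMeasure_semicircleLaw (√(2 * t * (1 - t)))
  have hg : ∀ n, Measurable fun x : ℝ => x / √n := fun n => by fun_prop
  obtain ⟨M, hM⟩ : ∃ M : ℕ → Measure ℝ, M = fun n : ℕ => (n : ENNReal)⁻¹ • ∑ j : Fin n,
      (ℙ n t).map (fun x => x j / √n) := ⟨_, rfl⟩
  have hmeas : ∀ n (j : Fin n), Measurable fun x : Fin n → ℝ => x j / √n := fun n j =>
    (hg n).comp (measurable_pi_apply j)
  have hprob : ∀ n, r ≤ n → IsProbabilityMeasure (ℙ n t) := fun n hn => (hP n hn t ht).1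
  have hMp : ∀ᶠ n in atTop, IsProbabilityMeasure (M n) := by
    filter_upwards [eventually_ge_atTop r, eventually_gt_atTop 0] with n hn hn0
    have := hprob n hn
    constructor
    have h1 : ∀ j : Fin n, (ℙ n t).map (fun x => x j / √n) univ = 1 := fun j => by
      rw [Measure.map_apply (hmeas n j) MeasurableSet.univ, Set.preimage_univ, measure_univ]
    rw [hM]
    simp only [Measure.smul_apply, Measure.finsetSum_apply, h1, smul_eq_mul, Finset.sum_const,
      Finset.card_univ, Fintype.card_fin, nsmul_eq_mul, mul_one]
    exact ENNReal.inv_mul_cancel (mod_cast hn0.ne') (by simp)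
  have hint : ∀ {E : Type} [NormedAddCommGroup E] [NormedSpace ℝ E] [CompleteSpace E]
      (g : BoundedContinuousFunction ℝ E) [SecondCountableTopology E] [MeasurableSpace E] [BorelSpace E] (n : ℕ), r ≤ n →
      ∫ y, g y ∂M n = (n : ℝ)⁻¹ • ∫ x, ∑ j, g (x j / √n) ∂ℙ n t := by
    intro E _ _ _ g _ _ _ n hn
    have := hprob n hn
    have hj := fun j => Measure.isProbabilityMeasure_map (μ := ℙ n t) (hmeas n j).aemeasurable
    rw [hM, integral_smul_measure, integral_finsetSum_measure fun j _ => g.integrable _, integral_finsetSum]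
    · simp only [ENNReal.toReal_inv, ENNReal.toReal_natCast]
      congr 1
      exact sum_congr rfl fun j _ => integral_map (hmeas n j).aemeasurable
        g.continuous.aestronglyMeasurable
    · exact fun j _ => (g.integrable _).comp_measurable (hmeas n j)
  refine (tendsto_integral_of_tendsto_charFun hMp (fun θ => ?_) f).congr' ?_
  swap
  · filter_upwards [eventually_ge_atTop r] with n hn
    rw [hint f n hn, integral_div, smul_eq_mul, div_eq_inv_mul]
  -- The contour formula divides by the frequency, so `θ = 0` is separate; there both characteristic
  -- functions equal `1`.
  rcases eq_or_ne θ 0 with rfl | hθ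
  · refine tendsto_const_nhds.congr' ?_
    filter_upwards [hMp] with n hn
    simp
  obtain ⟨β, hβ⟩ : ∃ β, β = √(t * (1 - t)) * (2 / (1 - t) * (rexp (-τ₀) / √2)) := ⟨_, rfl⟩
  have hβ0 : 0 ≤ β := by
    have := sub_pos.2 ht.2
    rw [hβ]; positivity
  have hκ : θ * √(t * (1 - t)) ≠ 0 := mul_ne_zero hθ (sqrt_pos.2 hs).ne'
  have key := tendsto_integral_sum_cexp r (R := β + √2) hβ0 (by simp) hκ
  rw [circleIntegral_eq_integral_sin_sq (by linarith) hκ] at key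
  convert key.congr' ?_ using 2
  · rw [charFun_apply_real, integral_semicircleLaw _ (by fun_prop)]
    refine intervalIntegral.integral_congr fun α _ => ?_
    rw [mul_assoc 2, Real.sqrt_mul (by norm_num)]
    push_cast
    ring_nf
  · filter_upwards [eventually_ge_atTop r] with n hn
    rw [charFun_apply_real]
    have h1 := hint (BoundedContinuousFunction.ofNormedAddCommGroup
      (fun y : ℝ => cexp (θ * y * I)) (by fun_prop) 1 fun y => by
        rw [← Complex.ofReal_mul, norm_exp_ofReal_mul_I]) n hn
    simp only [BoundedContinuousFunction.coe_ofNormedAddCommGroup] at h1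
    rw [h1, bridgeLaw_eq_ensembleLaw hP hn ht, integral_ensembleLaw_scale hs, smul_zero, smul_outlierTarget,
      smul_outlierTarget, Real.sqrt_div (Nat.cast_nonneg n), real_smul, Complex.ofReal_inv,
      Complex.ofReal_natCast, inv_mul_eq_div, hβ]
    congr 1
    have e : √n * (√(t * (1 - t)) * (2 / (1 - t) * (rexp (-τ₀) / √2))) =
        √(t * (1 - t)) * (2 / (1 - t) * (rexp (-τ₀) * (√n / √2))) := by ring
    rw [e]
    refine integral_congr_ae (.of_forall fun x => sum_congr rfl fun j _ => ?_)
    simp only [Pi.smul_apply, smul_eq_mul]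
    push_cast
    ring_nf

/-! ### Assembling the statements -/

theorem theorem0p1 (r : ℕ) (ρ₀ τ₀ : ℝ) (hρ₀ : ρ₀ = Real.exp (-τ₀)) :
    -- the non-intersecting Brownian motions with `r` particles forced to `ρ₀ √(n/2)` exist
    (∀ n : ℕ, r ≤ n → ∀ t ∈ Set.Ioo (0 : ℝ) 1,
      ∃! μ : Measure (Fin n → ℝ), IsOutlierBridgeLaw n r (ρ₀ * Real.sqrt (n / 2)) t μ) ∧
    -- the tangent line to the edge curve through `(ρ₀ √(n/2), 1)` and its point of tangency
    (clock τ₀ = 1 / (1 + ρ₀ ^ 2) ∧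
      ∀ n : ℕ, 1 ≤ n →
        edgeCurve n (clock τ₀) = ρ₀ * Real.sqrt (2 * n) / (1 + ρ₀ ^ 2) ∧
        ∀ t ∈ Set.Ioo (0 : ℝ) 1, ∃ m : ℝ, HasDerivAt (edgeCurve n) m t ∧
          (edgeCurve n t + m * (1 - t) = ρ₀ * Real.sqrt (n / 2) ↔ t = clock τ₀)) ∧
    (∀ ℙ : (n : ℕ) → ℝ → Measure (Fin n → ℝ),
      (∀ n : ℕ, r ≤ n → ∀ t ∈ Set.Ioo (0 : ℝ) 1,
        IsOutlierBridgeLaw n r (ρ₀ * Real.sqrt (n / 2)) t (ℙ n t)) →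
      -- the support of the mean density of particles, for large `n`
      (∀ t ∈ Set.Ioo (0 : ℝ) 1, ∃ m : Measure ℝ, IsProbabilityMeasure m ∧
        (∀ f : BoundedContinuousFunction ℝ ℝ,
          Tendsto (fun n : ℕ => ∫ x, (∑ j, f (x j / Real.sqrt n)) / (n : ℝ) ∂(ℙ n t)) atTop
            (𝓝 (∫ y, f y ∂m))) ∧
        m.support = Set.Icc (-Real.sqrt (2 * t * (1 - t))) (Real.sqrt (2 * t * (1 - t)))) ∧
      -- the limit of the gap probabilities
      (∀ σ τ : ℝ, ∀ E : Set ℝ, MeasurableSet E → BddBelow E →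
        (σ < τ₀ → ∃ d : ℝ, HasFredholmDet airyKernel E d ∧
          Tendsto (fun n : ℕ => (ℙ n (clock (σ + τ / (n : ℝ) ^ (1 / 3 : ℝ)))).real
            {x | ∀ j, x j ∈ edgeWindow n (σ + τ / (n : ℝ) ^ (1 / 3 : ℝ)) Eᶜ}) atTop (𝓝 d)) ∧
        (σ = τ₀ → ∃ d : ℝ, HasFredholmDet (rAiryKernel r τ) E d ∧
          Tendsto (fun n : ℕ => (ℙ n (clock (σ + τ / (n : ℝ) ^ (1 / 3 : ℝ)))).real
            {x | ∀ j, x j ∈ edgeWindow n (σ + τ / (n : ℝ) ^ (1 / 3 : ℝ)) Eᶜ}) atTop (𝓝 d)))) ∧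
    -- the Fredholm determinants are genuine probability distributions
    (∃ ν : Measure ℝ, IsProbabilityMeasure ν ∧
      ∀ x : ℝ, HasFredholmDet airyKernel (Set.Ioi x) (ν.real (Set.Iic x))) ∧
    (∀ τ : ℝ, ∃ ν : Measure ℝ, IsProbabilityMeasure ν ∧
      ∀ x : ℝ, HasFredholmDet (rAiryKernel r τ) (Set.Ioi x) (ν.real (Set.Iic x))) := by

  subst hρ₀
  have hρ := Real.exp_pos (-τ₀)
  refine ⟨fun n _ t ht => ⟨_, isOutlierBridgeLaw_ensembleLaw n r _ ht, fun μ hμ =>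
      hμ.eq (by positivity) (isOutlierBridgeLaw_ensembleLaw n r _ ht)⟩,
    ⟨clock_eq_of_exp rfl, fun n hn => ⟨?_, fun t ht => ?_⟩⟩,
    fun ℙ hP => ⟨fun t ht => ⟨_, isProbabilityMeasure_semicircleLaw _, tendsto_integral_empirical hP ht,
      support_semicircleLaw (Real.sqrt_pos.2 (mul_pos (mul_pos two_pos ht.1) (sub_pos.2 ht.2)))⟩,
      fun σ τ E hE hEb => tendsto_gap_edgeWindow hP σ τ hE hEb⟩,
    -- The Airy case is the r-Airy case with `r = 0` and `τ = 0`.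
    airyKernel_eq_rAiryKernel ▸ exists_rAiry_distribution 0 0, exists_rAiry_distribution r⟩
  · rw [clock_eq_of_exp rfl]
    exact edgeCurve_clock hρ n
  · rw [clock_eq_of_exp rfl]
    exact edgeCurve_tangent hρ hn ht
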